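/- **Conventions.** Let $\mathbb F$ be a field of characteristic $\neq 2$. All graded superalgebras $B$ are finite-dimensional and $(\mathbb N\times\mathbb Z_2)$-graded; $B$-gmod is the category of finitely generated $(\mathbb Z\times\mathbb Z_2)$-graded left $B$-supermodules, with morphisms the $B$-linear maps of degree $(0,0)$, and $B$-gproj is its full subcategory of projective objects. For $n\in\mathbb Z$, $\sigma\in\mathbb Z_2$, $M\{n,\sigma\}$ is $M$ with $M\{n,\sigma\}_{i,\epsilon}=M_{i-n,\epsilon+\sigma}$ and action $b\cdot m=(-1)^{\sigma\bar b}bm$; $\Pi=\{0,1\}$. Tensor products of superalgebras and outer tensor products $\boxtimes$ carry the usual signs. $\mathrm{HOM}_B(P,M)=\bigoplus_d\mathrm{HOM}_B(P,M)_d$ consists of the sums of homogeneous $\mathbb F$-linear maps $f$ with $f(bm)=(-1)^{\bar f\bar b}bf(m)$; if $N$ is a $C\otimes B$-supermodule, $\mathrm{HOM}_B(P,N)$ is a $C$-supermodule by $c\cdot f=(c\otimes1)\circ f$. For a homomorphism $\varphi:B\to A$ of graded superalgebras, possibly not preserving $1$, $\mathrm{Ind}_B^AN=A\varphi(1)\otimes_BN$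 and $\mathrm{Res}^A_BM=\varphi(1)M$. The twist of $M$ by an automorphism $\psi$ is $M$ with the action $b\cdot m=\psi(b)m$. **Grothendieck groups.** Let $\mathbb Z_{q,\pi}=\mathbb Z[q,q^{-1},\pi]/(\pi^2-1)$. $G_0'(B)$ and $K_0'(B)$ are the Grothendieck groups (relations from short exact sequences) of $B$-gmod and $B$-gproj, which are $\mathbb Z_{q,\pi}$-modules by $q^n\pi^\epsilon[M]=[M\{n,\epsilon\}]$ and $q^n\pi^\epsilon[P]=[P\{-n,\epsilon\}]$ respectively. **Towers.** Let $\Lambda\cong\mathbb N^r$ be a commutative monoid. A *tower of graded superalgebras* is a family of graded superalgebras $A_\lambda$ ($\lambda\in\Lambda$) with $A_0\cong\mathbb F$, and homomorphisms $\rho_{\lambda,\mu}:A_\lambda\otimes A_\mu\to A_{\lambda+\mu}$ of graded superalgebras (possibly not preserving $1$), associative and unital, such that (i) $A_{\lambda+\mu}$ is projective on both sides over $A_\lambda\otimes A_\mu$; and (ii), with $\Bbbk=\mathbb Z_{q,\pi}$ if all simple graded supermodules of all $A_\lambda$ are of type $\mathsf M$ and $\Bbbk=\mathbb Z[\frac12,q,q^{-1}]=\mathbb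 Z_{q,\pi}[\frac12]/(\pi-1)$ otherwise (a simple graded supermodule is of type $\mathsf Q$ if it is reducible as an ordinary module, and of type $\mathsf M$ otherwise), and $G_0(A_\lambda)=\Bbbk\otimes_{\mathbb Z_{q,\pi}}G_0'(A_\lambda)$, $K_0(A_\lambda)=\Bbbk\otimes_{\mathbb Z_{q,\pi}}K_0'(A_\lambda)$, the pairing $\langle[P],[M]\rangle=\sum q^n\pi^\epsilon\dim\mathrm{HOM}_{A_\lambda}(P,M)_{n,\epsilon}$ of $K_0(A_\lambda)$ and $G_0(A_\lambda)$ is perfect. Put $\mathcal G=\bigoplus_\lambda G_0(A_\lambda)$, $\mathcal K=\bigoplus_\lambda K_0(A_\lambda)$. Let $\nabla$ be induction from $A_\lambda\otimes A_\mu$ to $A_{\lambda+\mu}$, and $\Delta$ the sum over $\lambda+\mu=\nu$ of the restrictions from $A_\nu$ to $A_\lambda\otimes A_\mu$. On $\mathcal G$ and $\mathcal K$ they induce a multiplication $[M][N]=[\nabla(M\boxtimes N)]$ and a comultiplication $\Delta[M]=[\Delta M]$, where $[M]\otimes[N]$ is identified with $[M\boxtimes N]$. The tower is *strong* if there are biadditive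 $\chi',\chi'',\kappa:\Lambda\times\Lambda\to\mathbb Z$, $d\in\mathbb Z$, $\epsilon\in\mathbb Z_2$, automorphisms $\psi_\lambda$ of $A_\lambda$ (with twist functors $\Psi_\lambda$), $\delta_\lambda\in\mathbb Z$ and $\sigma_\lambda\in\mathbb Z_2$ such that $\delta_{\lambda+\mu}-\delta_\lambda-\delta_\mu=d\kappa(\lambda,\mu)$, $\sigma_{\lambda+\mu}-\sigma_\lambda-\sigma_\mu=\epsilon\kappa(\lambda,\mu)$; $\nabla$ is right adjoint to $\Psi^{\otimes2}\{\delta^{\otimes 2},\sigma^{\otimes 2}\}\Delta\Psi^{-1}\{-\delta,-\sigma\}$; and $\Delta\nabla\cong\nabla^{\otimes2}S_{23}\{\chi\}\Delta^{\otimes2}$, where $S_{23}$ interchanges the second and third tensor factors and $\{\chi\}$ is the shift by the multiple of $(d,\epsilon)$ by $\chi'(\lambda_2,\lambda_3)+\chi''(\lambda_1,\lambda_4)$ on $(A_{\lambda_1}\otimes A_{\lambda_2}\otimes A_{\lambda_3}\otimes A_{\lambda_4})$-gmod. Put $c=q^d\pi^\epsilon\in\Bbbk^\times$. The strong tower is *compatible*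 if $\mathcal K$ and $\mathcal G$ are twisted Hopf algebras, the pairing satisfies $\langle xy,a\rangle=\langle x\otimes y,\Delta a\rangle$, $\langle x,ab\rangle=c^{\kappa(|a|,|b|)}\langle\Delta x,a\otimes b\rangle$, $\langle1,a\rangle=\varepsilon(a)$, $\langle x,1\rangle=\varepsilon(x)$, and $\mathcal G$ is a $(c,(0,\tilde\chi))$-Hopf algebra for some biadditive $\tilde\chi$, which we fix. Here a $(c,(\chi_1,\chi_2))$-Hopf algebra (a twisted Hopf algebra) is a connected $\Lambda$-graded algebra and coalgebra $H$ over $\Bbbk$ ($H_0=\Bbbk1$), with free components of finite rank, such that $\Delta$ is an algebra homomorphism to $H\otimes H$ with the multiplication $(a_1\otimes a_2)(b_1\otimes b_2)=c^{\chi_1(|a_2|,|b_1|)+\chi_2(|a_1|,|b_2|)}a_1b_1\otimes a_2b_2$. For $x\in\mathcal K$ let $R_x^*\in\mathrm{End}\,\mathcal G$ be the adjoint of right multiplication by $x$. The *twisted Heisenberg double* $\mathfrak h(A)$ is $\mathcal G\otimes\mathcal K$ with $$(a\#x)(b\#y)=\sum_{(x)}c^{\kappa(|b|,|x_1'|)+(\tilde\chi-\kappa)(|b|-|x_1|,|x_1'|)}\,aR_{x_1}^*(b)\#x_1'y,\qquad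 \Delta(x)=\sum_{(x)}x_1\otimes x_1',$$ and its *lowest weight Fock space representation* is $\mathcal G$ with $(a\#x)(b)=aR_x^*(b)$. $\mathcal G_{\mathrm{pj}}\subseteq\mathcal G$ is the $\Bbbk$-span of the classes of projectives, and $\mathfrak h_{\mathrm{pj}}(A)=\mathcal G_{\mathrm{pj}}\#\mathcal K$. **Functors.** For $M\in A_\mu$-gmod, $\mathrm{Ind}_M(N)=\mathrm{Ind}_{A_\mu\otimes A_\lambda}^{A_{\mu+\lambda}}(M\boxtimes N)$, $N\in A_\lambda$-gmod. For $P\in A_\nu$-gproj, $\mathrm{Res}_P(N)=\mathrm{HOM}_{A_\nu}(P,\mathrm{Res}^{A_\lambda}_{A_{\lambda-\nu}\otimes A_\nu}N)$, $N\in A_\lambda$-gmod, which is $0$ if $\nu\not\le\lambda$. For $Q\in(A_\alpha\otimes A_\beta)$-gproj, $M\in A_\mu$-gmod, $N\in A_\lambda$-gmod, $$\mathrm{Res}^\dagger_Q(M\boxtimes N)=\mathrm{HOM}_{A_\alpha\otimes A_\beta}\big(Q,S_{23}(\mathrm{Res}^{A_\mu}_{A_{\mu-\alpha}\otimes A_\alpha}M\boxtimes\mathrm{Res}^{A_\lambda}_{A_{\lambda-\beta}\otimes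 A_\beta}N)\big)\{d\,\theta,\epsilon\,\theta\},$$ $$\theta=\kappa(\alpha,\beta)+\chi'(\alpha,\lambda-\beta)+\chi''(\mu-\alpha,\beta).$$ **Theorem.** Let $A$ be a strong compatible tower of graded superalgebras. If some $A_\lambda$ has a simple graded supermodule of type $\mathsf Q$, assume in addition that $\Psi^{\otimes2}\Delta\Psi^{-1}(P)\cong\Delta(P)$ for all $\nu$ and all $P\in A_\nu$-gproj. Then for all graded supermodules $M,N$ and all projective graded supermodules $P,Q$ over members of the tower there are isomorphisms of functors $$\mathrm{Ind}_M\circ\mathrm{Ind}_N\cong\mathrm{Ind}_{\nabla(M\boxtimes N)},\qquad \mathrm{Res}_P\circ\mathrm{Res}_Q\cong\mathrm{Res}_{\nabla(P\boxtimes Q)},\qquad \mathrm{Res}_P\circ\mathrm{Ind}_M\cong\nabla\,\mathrm{Res}^\dagger_{\Delta(P)}(M\boxtimes-)$$ (where $\nabla(P\boxtimes Q)$ is again projective). These isomorphisms categorify the lowest weight Fock space representations of $\mathfrak h(A)$ and $\mathfrak h_{\mathrm{pj}}(A)$, in the following sense. 1. $\mathrm{Ind}_M$ and $\mathrm{Res}_P$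 are exact, and $\mathrm{Ind}_P$, $\mathrm{Res}_P$ preserve projective supermodules. 2. $\mathcal G$ is a representation of $\mathfrak h(A)$ by $(a\#x)(b)=aR_x^*(b)$; $\mathfrak h_{\mathrm{pj}}(A)$ contains $1\#1$ and is closed under the multiplication, and it preserves $\mathcal G_{\mathrm{pj}}$. 3. On classes, $[M][N]=[\mathrm{Ind}_M(N)]$ in $\mathcal G$, $[P][Q]=[\nabla(P\boxtimes Q)]$ in $\mathcal K$, $R_{[P]}^*[N]=[\mathrm{Res}_P(N)]$, and hence $([M]\#[P])([N])=[\mathrm{Ind}_M\circ\mathrm{Res}_P(N)]$, which is $0$ if $P\in A_\nu$-gproj, $N\in A_\lambda$-gmod with $\nu\not\le\lambda$. 4. For $x\in\mathcal K$, $a,b\in\mathcal G$ homogeneous, $R_x^*(ab)=\nabla(\Delta(x)^\dagger(a\otimes b))$, where $$(x\otimes y)^\dagger(a\otimes b)=c^{\kappa(|x|,|y|)+\chi'(|x|,|b|-|y|)+\chi''(|a|-|x|,|y|)}R_x^*(a)\otimes R_y^*(b),$$ and for $x=[P]$, $a=[M]$, $b=[N]$ the right side is the class of $\nabla\,\mathrm{Res}^\dagger_{\Delta(P)}(M\boxtimes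 N)$. -/

import Mathlib

open CategoryTheory
open scoped TensorProduct DirectSum

universe u v w

namespace SuperTower

/-! ### Gradings by `ℤ × ℤ/2` and signs -/

/-- Degrees of graded super objects: an integer degree together with a parity. -/
abbrev Deg := ℤ × ZMod 2

/-- The sign `(-1)^{i j}` attached to two parities. -/
def ksign (i j : ZMod 2) : ℤ := (-1) ^ (i.val * j.val)

theorem ksign_add_left (i i' j : ZMod 2) : ksign (i + i') j = ksign i j * ksign i' j := by
  revert i i' j; decide

theorem ksign_add_right (i j j' : ZMod 2) : ksign i (j + j') = ksign i j * ksign i j' := by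
  revert i j j'; decide

theorem ksign_comm (i j : ZMod 2) : ksign i j = ksign j i := by
  revert i j; decide

theorem ksign_self (i j : ZMod 2) : ksign i j * ksign i j = 1 := by
  revert i j; decide

@[simp] theorem ksign_zero_left (j : ZMod 2) : ksign 0 j = 1 := by
  revert j; decide

@[simp] theorem ksign_zero_right (j : ZMod 2) : ksign j 0 = 1 := by
  revert j; decide

section Grading

variable {F : Type u} [Field F] {V : Type v} [AddCommGroup V] [Module F V]
  {W : Type w} [AddCommGroup W] [Module F W]
  {gr : Deg → Submodule F V} {gw : Deg → Submodule F W}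

/-- The linear map on a graded vector space that is given by `f d` on the piece of degree `d`. -/
noncomputable def dlift (h : DirectSum.IsInternal gr) (f : ∀ d, gr d →ₗ[F] W) : V →ₗ[F] W :=
  DirectSum.toModule F Deg W f ∘ₗ
    (LinearEquiv.ofBijective (DirectSum.coeLinearMap gr) h).symm.toLinearMap

theorem dlift_of_mem (h : DirectSum.IsInternal gr) (f : ∀ d, gr d →ₗ[F] W) {d : Deg} {x : V}
    (hx : x ∈ gr d) : dlift h f x = f d ⟨x, hx⟩ := by
  have : (LinearEquiv.ofBijective (DirectSum.coeLinearMap gr) h).symm x =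
      DirectSum.lof F Deg (fun d => gr d) d ⟨x, hx⟩ := by
    rw [LinearEquiv.symm_apply_eq]
    exact (DirectSum.coeLinearMap_lof gr d ⟨x, hx⟩).symm
  simp [dlift, this]

/-- Induction on homogeneous elements. -/
theorem hom_induction (h : DirectSum.IsInternal gr) {p : V → Prop}
    (hom : ∀ d x, x ∈ gr d → p x) (add : ∀ x y, p x → p y → p (x + y)) (x : V) : p x := by
  have hx : x ∈ ⨆ d, gr d := by
    rw [h.submodule_iSup_eq_top]; trivial
  exact Submodule.iSup_induction gr (motive := p) hx hom (hom 0 0 (zero_mem _)) add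

/-- Criterion for a family of subspaces to be a grading: it spans, and there are projections. -/
theorem isInternal_of_proj (p : Deg → V →ₗ[F] V) (h1 : ∀ d x, x ∈ gr d → p d x = x)
    (h2 : ∀ d e x, x ∈ gr e → e ≠ d → p d x = 0) (h3 : ∀ x, x ∈ ⨆ d, gr d) :
    DirectSum.IsInternal gr := by
  apply DirectSum.isInternal_submodule_of_iSupIndep_of_iSup_eq_top
  · rw [iSupIndep_def]
    intro d
    rw [Submodule.disjoint_def]
    intro x hx hx'
    rw [← h1 d x hx]
    have : (⨆ j, ⨆ (_ : j ≠ d), gr j) ≤ LinearMap.ker (p d) :=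
      iSup₂_le fun e he y hy => h2 d e y hy he
    exact this hx'
  · exact eq_top_iff.2 fun x _ => h3 x

/-- The projection to the piece of degree `d`. -/
noncomputable def prj (h : DirectSum.IsInternal gr) (d : Deg) : V →ₗ[F] V :=
  dlift h fun e => if e = d then (gr e).subtype else 0

theorem prj_same (h : DirectSum.IsInternal gr) {d : Deg} {x : V} (hx : x ∈ gr d) :
    prj h d x = x := by
  simp [prj, dlift_of_mem h _ hx]

theorem prj_ne (h : DirectSum.IsInternal gr) {d e : Deg} {x : V} (hx : x ∈ gr e) (hd : e ≠ d) :
    prj h d x = 0 := by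
  simp [prj, dlift_of_mem h _ hx, hd]

/-- The linear map `v ↦ (-1)^{ε v̄} v`. -/
noncomputable def ptwist (h : DirectSum.IsInternal gr) (ε : ZMod 2) : V →ₗ[F] V :=
  dlift h fun d => ksign ε d.2 • (gr d).subtype

theorem ptwist_of_mem (h : DirectSum.IsInternal gr) (ε : ZMod 2) {d : Deg} {x : V}
    (hx : x ∈ gr d) : ptwist h ε x = ksign ε d.2 • x := by
  simp [ptwist, dlift_of_mem h _ hx]

/-- The projection to the part of parity `ε`. -/
noncomputable def parityPart (h : DirectSum.IsInternal gr) (ε : ZMod 2) : V →ₗ[F] V :=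
  dlift h fun d => if d.2 = ε then (gr d).subtype else 0

theorem parityPart_of_mem (h : DirectSum.IsInternal gr) (ε : ZMod 2) {d : Deg} {x : V}
    (hx : x ∈ gr d) : parityPart h ε x = if d.2 = ε then x else 0 := by
  rw [parityPart, dlift_of_mem h _ hx]
  split_ifs <;> simp

/-- The total grading of a tensor product. -/
def tensorGr (gr : Deg → Submodule F V) (gw : Deg → Submodule F W) (d : Deg) :
    Submodule F (V ⊗[F] W) :=
  Submodule.span F {t | ∃ i j x y, x ∈ gr i ∧ y ∈ gw j ∧ i + j = d ∧ t = x ⊗ₜ[F] y}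

theorem tmul_mem_tensorGr {i j : Deg} {x : V} {y : W} (hx : x ∈ gr i) (hy : y ∈ gw j) :
    x ⊗ₜ[F] y ∈ tensorGr gr gw (i + j) :=
  Submodule.subset_span ⟨i, j, x, y, hx, hy, rfl, rfl⟩

/-- Induction on tensors of homogeneous elements. -/
theorem tensor_hom_induction (h : DirectSum.IsInternal gr) (h' : DirectSum.IsInternal gw)
    {p : V ⊗[F] W → Prop}
    (tmul : ∀ i j x y, x ∈ gr i → y ∈ gw j → p (x ⊗ₜ[F] y))
    (add : ∀ x y, p x → p y → p (x + y)) (t : V ⊗[F] W) : p t := by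
  induction t with
  | zero => simpa using tmul 0 0 0 0 (zero_mem _) (zero_mem _)
  | add x y hx hy => exact add x y hx hy
  | tmul x y =>
    refine hom_induction h (p := fun x => p (x ⊗ₜ[F] y)) (fun i x hx => ?_)
      (fun a b ha hb => by rw [TensorProduct.add_tmul]; exact add _ _ ha hb) x
    exact hom_induction h' (p := fun y => p (x ⊗ₜ[F] y)) (fun j y hy => tmul i j x y hx hy)
      (fun a b ha hb => by rw [TensorProduct.tmul_add]; exact add _ _ ha hb) y

/-- The projection of a tensor product of graded spaces to its piece of degree `d`. -/
noncomputable def tprj (h : DirectSum.IsInternal gr) (h' : DirectSum.IsInternal gw) (d : Deg) :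
    V ⊗[F] W →ₗ[F] V ⊗[F] W :=
  TensorProduct.lift (dlift h fun i =>
    (LinearMap.lcomp F (V ⊗[F] W) (prj h' (d - i))) ∘ₗ (TensorProduct.mk F V W) ∘ₗ (gr i).subtype)

theorem tprj_tmul (h : DirectSum.IsInternal gr) (h' : DirectSum.IsInternal gw) (d : Deg)
    {i j : Deg} {x : V} {y : W} (hx : x ∈ gr i) (hy : y ∈ gw j) :
    tprj h h' d (x ⊗ₜ[F] y) = if i + j = d then x ⊗ₜ[F] y else 0 := by
  have : tprj h h' d (x ⊗ₜ[F] y) = x ⊗ₜ[F] (prj h' (d - i) y) := by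
    simp [tprj, dlift_of_mem h _ hx]
  rw [this]
  split_ifs with hd
  · rw [prj_same]
    rwa [← hd, add_sub_cancel_left]
  · rw [prj_ne h' hy, TensorProduct.tmul_zero]
    rintro rfl
    exact hd (by abel)

theorem tensorGr_internal (h : DirectSum.IsInternal gr) (h' : DirectSum.IsInternal gw) :
    DirectSum.IsInternal (tensorGr gr gw) := by
  refine isInternal_of_proj (tprj h h') ?_ ?_ ?_
  · intro d x hx
    induction hx using Submodule.span_induction with
    | mem x hx =>
      obtain ⟨i, j, a, b, ha, hb, hd, rfl⟩ := hx
      rw [tprj_tmul h h' d ha hb, if_pos hd]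
    | zero => simp
    | add x y _ _ hx hy => rw [map_add, hx, hy]
    | smul c x _ hx => rw [map_smul, hx]
  · intro d e x hx hde
    induction hx using Submodule.span_induction with
    | mem x hx =>
      obtain ⟨i, j, a, b, ha, hb, hd, rfl⟩ := hx
      rw [tprj_tmul h h' d ha hb, if_neg (by rw [hd]; exact hde)]
    | zero => simp
    | add x y _ _ hx hy => rw [map_add, hx, hy, add_zero]
    | smul c x _ hx => rw [map_smul, hx, smul_zero]
  · refine tensor_hom_induction h h' (fun i j x y hx hy => ?_) (fun x y hx hy => add_mem hx hy)
    exact Submodule.mem_iSup_of_mem (i + j) (tmul_mem_tensorGr hx hy)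

end Grading

/-! ### Graded superalgebras and graded supermodules -/

/-- A finite-dimensional `ℕ`-graded superalgebra over `F`: the grading is indexed by `ℤ × ℤ/2`
and vanishes in negative degrees. -/
structure GSAlg (F : Type u) [Field F] where
  carrier : Type u
  [ring : Ring carrier]
  [algebra : Algebra F carrier]
  [finite : Module.Finite F carrier]
  gr : Deg → Submodule F carrier
  internal : DirectSum.IsInternal gr
  nonneg : ∀ d : Deg, d.1 < 0 → gr d = ⊥
  one_mem : 1 ∈ gr 0
  mul_mem : ∀ {i j : Deg} {a b : carrier}, a ∈ gr i → b ∈ gr j → a * b ∈ gr (i + j)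

attribute [instance] GSAlg.ring GSAlg.algebra GSAlg.finite

variable {F : Type u} [Field F]

/-- A finitely generated graded left `B`-supermodule. -/
structure GSMod (B : GSAlg F) where
  carrier : Type u
  [addCommGroup : AddCommGroup carrier]
  [vect : Module F carrier]
  [module : Module B.carrier carrier]
  [tower : IsScalarTower F B.carrier carrier]
  [fg : Module.Finite B.carrier carrier]
  gr : Deg → Submodule F carrier
  internal : DirectSum.IsInternal gr
  smul_mem : ∀ {i j : Deg} {b : B.carrier} {m : carrier},
    b ∈ B.gr i → m ∈ gr j → b • m ∈ gr (i + j)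

attribute [instance] GSMod.addCommGroup GSMod.vect GSMod.module GSMod.tower GSMod.fg

namespace GSMod

variable {B : GSAlg F}

instance finiteDimensional (M : GSMod B) : Module.Finite F M.carrier :=
  Module.Finite.trans B.carrier M.carrier

/-- Morphisms of graded supermodules: `B`-linear maps of degree `(0, 0)`. -/
@[ext] structure Hom (M N : GSMod B) where
  lin : M.carrier →ₗ[B.carrier] N.carrier
  map_mem : ∀ {d : Deg} {m : M.carrier}, m ∈ M.gr d → lin m ∈ N.gr d

/-- The category of finitely generated graded left `B`-supermodules. -/
instance : Category (GSMod B) where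
  Hom := Hom
  id M := ⟨LinearMap.id, fun h => h⟩
  comp f g := ⟨g.lin ∘ₗ f.lin, fun h => g.map_mem (f.map_mem h)⟩

@[ext] theorem hom_ext {M N : GSMod B} {f g : M ⟶ N} (h : ∀ m, f.lin m = g.lin m) : f = g :=
  Hom.ext (LinearMap.ext h)

@[simp] theorem id_lin (M : GSMod B) (m : M.carrier) : Hom.lin (𝟙 M) m = m := rfl

@[simp] theorem comp_lin {M N L : GSMod B} (f : M ⟶ N) (g : N ⟶ L) (m : M.carrier) :
    Hom.lin (f ≫ g) m = g.lin (f.lin m) := rfl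

/-- A morphism as an `F`-linear map. -/
def Hom.linF {M N : GSMod B} (f : M ⟶ N) : M.carrier →ₗ[F] N.carrier := f.lin.restrictScalars F

@[simp] theorem linF_apply {M N : GSMod B} (f : M ⟶ N) (m : M.carrier) :
    Hom.linF f m = f.lin m := rfl

/-- The isomorphism given by a bijective linear map that preserves degrees in both directions. -/
def mkIso {M N : GSMod B} (e : M.carrier ≃ₗ[B.carrier] N.carrier)
    (h : ∀ {d : Deg} {m : M.carrier}, m ∈ M.gr d → e m ∈ N.gr d)
    (h' : ∀ {d : Deg} {m : N.carrier}, m ∈ N.gr d → e.symm m ∈ M.gr d) : M ≅ N where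
  hom := ⟨e.toLinearMap, h⟩
  inv := ⟨e.symm.toLinearMap, h'⟩
  hom_inv_id := by ext m; simp
  inv_hom_id := by ext m; simp

/-- The left action of the algebra as an `F`-bilinear map. -/
def act (M : GSMod B) : B.carrier →ₗ[F] M.carrier →ₗ[F] M.carrier :=
  (Algebra.lsmul F F M.carrier).toLinearMap

@[simp] theorem act_apply (M : GSMod B) (b : B.carrier) (m : M.carrier) : M.act b m = b • m := rfl

/-- Short exact sequences of graded supermodules. -/
def ShortExact {X Y Z : GSMod B} (f : X ⟶ Y) (g : Y ⟶ Z) : Prop :=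
  Function.Injective f.lin ∧ Function.Exact f.lin g.lin ∧ Function.Surjective g.lin

/-- Exact functors: those which preserve short exact sequences. -/
def IsExact {A : GSAlg F} (Φ : GSMod A ⥤ GSMod B) : Prop :=
  ∀ {X Y Z : GSMod A} (f : X ⟶ Y) (g : Y ⟶ Z), ShortExact f g → ShortExact (Φ.map f) (Φ.map g)

/-- Projective graded supermodules (for graded supermodules, projectivity in the graded sense is
the same as projectivity of the underlying module). -/
def IsProjective (M : GSMod B) : Prop := Module.Projective B.carrier M.carrier

/-- The regular supermodule. -/
def regular (B : GSAlg F) : GSMod B where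
  carrier := B.carrier
  gr := B.gr
  internal := B.internal
  smul_mem := B.mul_mem

/-- `M` is a simple graded supermodule: it is nonzero, and it has no graded
subsupermodules besides `0` and `M`. -/
def IsSimpleGraded (M : GSMod B) : Prop :=
  Nontrivial M.carrier ∧ ∀ S : Submodule B.carrier M.carrier,
    (∀ m ∈ S, ∀ d, prj M.internal d m ∈ S) → S = ⊥ ∨ S = ⊤

end GSMod

/-- `B` has a simple graded supermodule of type `Q`, that is, a simple graded supermodule which is
reducible as an ordinary module. (Otherwise all simple graded supermodules are of type `M`.) -/
def GSAlg.HasTypeQ (B : GSAlg F) : Prop :=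
  ∃ V : GSMod B, V.IsSimpleGraded ∧ ¬ IsSimpleModule B.carrier V.carrier

/-! ### Shifts -/

namespace GSAlg

variable (B : GSAlg F)

theorem ptwist_mul (ε : ZMod 2) (a b : B.carrier) :
    ptwist B.internal ε (a * b) = ptwist B.internal ε a * ptwist B.internal ε b := by
  refine hom_induction B.internal (p := fun a => ptwist B.internal ε (a * b) =
    ptwist B.internal ε a * ptwist B.internal ε b) (fun i a ha => ?_) (fun a a' h h' => ?_) a
  · refine hom_induction B.internal (p := fun b => ptwist B.internal ε (a * b) =
      ptwist B.internal ε a * ptwist B.internal ε b) (fun j b hb => ?_) (fun b b' h h' => ?_) b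
    · rw [ptwist_of_mem _ _ ha, ptwist_of_mem _ _ hb, ptwist_of_mem _ _ (B.mul_mem ha hb),
        Prod.snd_add, ksign_add_right, smul_mul_smul_comm]
    · simp only [mul_add, map_add, h, h']
  · simp only [add_mul, map_add, h, h']

/-- The algebra endomorphism `b ↦ (-1)^{ε b̄} b`. -/
noncomputable def parityHom (ε : ZMod 2) : B.carrier →ₐ[F] B.carrier :=
  AlgHom.ofLinearMap (ptwist B.internal ε)
    (by rw [ptwist_of_mem _ _ B.one_mem]; simp) (B.ptwist_mul ε)

theorem parityHom_of_mem (ε : ZMod 2) {d : Deg} {x : B.carrier} (hx : x ∈ B.gr d) :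
    B.parityHom ε x = ksign ε d.2 • x := ptwist_of_mem B.internal ε hx

theorem parityHom_parityHom (ε : ZMod 2) (x : B.carrier) :
    B.parityHom ε (B.parityHom ε x) = x := by
  refine hom_induction B.internal (p := fun x => B.parityHom ε (B.parityHom ε x) = x)
    (fun d x hx => ?_) (fun x y hx hy => by simp only [map_add, hx, hy]) x
  rw [B.parityHom_of_mem ε hx, map_zsmul, B.parityHom_of_mem ε hx, smul_smul, ksign_self,
    one_smul]

end GSAlg

namespace GSMod

variable {B : GSAlg F}

theorem shift_internal (M : GSMod B) (n : ℤ) (σ : ZMod 2) :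
    DirectSum.IsInternal fun d : Deg => M.gr (d - (n, σ)) := by
  refine isInternal_of_proj (fun d => prj M.internal (d - (n, σ))) ?_ ?_ ?_
  · intro d x hx
    exact prj_same _ hx
  · intro d e x hx hde
    exact prj_ne _ hx fun h => hde (by simpa using h)
  · refine hom_induction M.internal (fun d x hx => ?_) (fun x y hx hy => add_mem hx hy)
    exact Submodule.mem_iSup_of_mem (d + (n, σ)) (by simpa using hx)

/-- The space `M` with the action of `B` twisted by `b ↦ (-1)^{σ b̄} b`. -/
def ParityTwist (M : GSMod B) (_σ : ZMod 2) : Type u := M.carrier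

section

variable (M : GSMod B) (σ : ZMod 2)

instance : AddCommGroup (M.ParityTwist σ) := inferInstanceAs (AddCommGroup M.carrier)

instance : Module F (M.ParityTwist σ) := inferInstanceAs (Module F M.carrier)

instance : Module.Finite F (M.ParityTwist σ) := inferInstanceAs (Module.Finite F M.carrier)

noncomputable instance : Module B.carrier (M.ParityTwist σ) :=
  Module.compHom M.carrier (B.parityHom σ).toRingHom

theorem parityTwist_smul (b : B.carrier) (m : M.ParityTwist σ) :
    b • m = (show M.ParityTwist σ from B.parityHom σ b • (show M.carrier from m)) := rfl

instance : IsScalarTower F B.carrier (M.ParityTwist σ) := ⟨fun c b m => by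
  rw [parityTwist_smul, parityTwist_smul, map_smul]
  exact smul_assoc c (B.parityHom σ b) (show M.carrier from m)⟩

end

/-- The shift `M{n, σ} = Π^σ M{n}`: the piece of degree `(i, ε)` is `M_{i - n, ε + σ}`, and an
element `b` acts by `m ↦ (-1)^{σ b̄} b m`. -/
noncomputable def shift (M : GSMod B) (n : ℤ) (σ : ZMod 2) : GSMod B where
  carrier := M.ParityTwist σ
  tower := inferInstance
  fg := Module.Finite.of_restrictScalars_finite F B.carrier (M.ParityTwist σ)
  gr d := M.gr (d - (n, σ))
  internal := M.shift_internal n σ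
  smul_mem {i j b m} hb hm := by
    have h : b • m = ksign σ i.2 • (show M.carrier from b • (show M.carrier from m)) := by
      rw [parityTwist_smul, B.parityHom_of_mem σ hb]
      exact smul_assoc _ b (show M.carrier from m)
    rw [h, add_sub_assoc]
    exact zsmul_mem (M.smul_mem hb hm) _

/-- A `B`-linear map, viewed as a linear map for the twisted actions. -/
noncomputable def parityTwistMap {M N : GSMod B} (f : M.carrier →ₗ[B.carrier] N.carrier)
    (σ : ZMod 2) : M.ParityTwist σ →ₗ[B.carrier] N.ParityTwist σ where
  toFun m := f (show M.carrier from m)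
  map_add' m m' := f.map_add (show M.carrier from m) (show M.carrier from m')
  map_smul' b m := f.map_smul (B.parityHom σ b) (show M.carrier from m)

/-- The shift functor `{n, σ}`; it leaves morphisms unchanged. -/
noncomputable def shiftFunctor (B : GSAlg F) (n : ℤ) (σ : ZMod 2) : GSMod B ⥤ GSMod B where
  obj M := M.shift n σ
  map f := ⟨parityTwistMap f.lin σ, fun h => f.map_mem h⟩
  map_id _ := rfl
  map_comp _ _ := rfl

end GSMod

/-! ### Tensor products of superalgebras, outer tensor products of supermodules -/

section Tensor

variable {A B : GSAlg F}

/-- The signed action `(a ⊗ b) · (m ⊗ n) = (-1)^{b̄ m̄} a m ⊗ b n`, as a bilinear map. -/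
noncomputable def sact (M : GSMod A) (N : GSMod B) :
    A.carrier ⊗[F] B.carrier →ₗ[F] M.carrier ⊗[F] N.carrier →ₗ[F] M.carrier ⊗[F] N.carrier :=
  ∑ ε : ZMod 2, TensorProduct.homTensorHomMap (RingHom.id F) M.carrier N.carrier M.carrier N.carrier ∘ₗ
    TensorProduct.map (LinearMap.lcomp F M.carrier (ptwist M.internal ε) ∘ₗ M.act)
      (N.act ∘ₗ parityPart B.internal ε)

theorem sact_tmul (M : GSMod A) (N : GSMod B) (a : A.carrier) {i j : Deg} {b : B.carrier}
    (hb : b ∈ B.gr i) {m : M.carrier} (hm : m ∈ M.gr j) (n : N.carrier) :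
    sact M N (a ⊗ₜ[F] b) (m ⊗ₜ[F] n) = ksign i.2 j.2 • ((a • m) ⊗ₜ[F] (b • n)) := by
  have key : ∀ ε : ZMod 2, (TensorProduct.homTensorHomMap (RingHom.id F)
        M.carrier N.carrier M.carrier N.carrier ∘ₗ
      TensorProduct.map (LinearMap.lcomp F M.carrier (ptwist M.internal ε) ∘ₗ M.act)
      (N.act ∘ₗ parityPart B.internal ε)) (a ⊗ₜ[F] b) (m ⊗ₜ[F] n) =
      if i.2 = ε then ksign i.2 j.2 • ((a • m) ⊗ₜ[F] (b • n)) else 0 := by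
    intro ε
    rw [LinearMap.comp_apply, TensorProduct.map_tmul, TensorProduct.homTensorHomMap_apply,
      TensorProduct.map_tmul, LinearMap.comp_apply, LinearMap.comp_apply, LinearMap.lcomp_apply,
      ptwist_of_mem _ _ hm, parityPart_of_mem _ _ hb]
    split_ifs with h
    · rw [h, GSMod.act_apply, GSMod.act_apply, smul_comm, TensorProduct.smul_tmul']
    · simp
  rw [sact, LinearMap.sum_apply, LinearMap.sum_apply, Finset.sum_congr rfl fun ε _ => key ε,
    Finset.sum_ite_eq]
  simp

/-- The product `(a₁ ⊗ b₁)(a₂ ⊗ b₂) = (-1)^{b̄₁ ā₂} a₁ a₂ ⊗ b₁ b₂`. -/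
noncomputable def smulTensor (A B : GSAlg F) :
    A.carrier ⊗[F] B.carrier →ₗ[F] A.carrier ⊗[F] B.carrier →ₗ[F] A.carrier ⊗[F] B.carrier :=
  sact (GSMod.regular A) (GSMod.regular B)

theorem smulTensor_tmul (a a' : A.carrier) {i j : Deg} {b : B.carrier}
    (hb : b ∈ B.gr i) (ha' : a' ∈ A.gr j) (b' : B.carrier) :
    smulTensor A B (a ⊗ₜ[F] b) (a' ⊗ₜ[F] b') = ksign i.2 j.2 • ((a * a') ⊗ₜ[F] (b * b')) :=
  sact_tmul (GSMod.regular A) (GSMod.regular B) a hb ha' b'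

theorem sact_smulTensor (M : GSMod A) (N : GSMod B) (x y : A.carrier ⊗[F] B.carrier)
    (t : M.carrier ⊗[F] N.carrier) :
    sact M N (smulTensor A B x y) t = sact M N x (sact M N y t) := by
  refine tensor_hom_induction A.internal B.internal
    (p := fun x => sact M N (smulTensor A B x y) t = sact M N x (sact M N y t))
    (fun i j a b ha hb => ?_) (fun x x' h h' => ?_) x
  · refine tensor_hom_induction A.internal B.internal
      (p := fun y => sact M N (smulTensor A B (a ⊗ₜ b) y) t = sact M N (a ⊗ₜ b) (sact M N y t))
      (fun i' j' a' b' ha' hb' => ?_) (fun y y' h h' => ?_) y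
    · refine tensor_hom_induction M.internal N.internal
        (p := fun t => sact M N (smulTensor A B (a ⊗ₜ b) (a' ⊗ₜ b')) t =
          sact M N (a ⊗ₜ b) (sact M N (a' ⊗ₜ b') t))
        (fun k l m n hm hn => ?_) (fun t t' h h' => ?_) t
      · rw [smulTensor_tmul a a' hb ha', map_zsmul, LinearMap.smul_apply,
          sact_tmul M N _ (B.mul_mem hb hb') hm, sact_tmul M N _ hb' hm, map_zsmul,
          sact_tmul M N _ hb (M.smul_mem ha' hm), smul_smul, smul_smul, mul_smul a a' m, mul_smul b b' n,
          Prod.snd_add, Prod.snd_add, ksign_add_left, ksign_add_right]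
        congr 1
        ring
      · simp only [map_add, h, h']
    · simp only [map_add, LinearMap.add_apply, h, h']
  · simp only [map_add, LinearMap.add_apply, h, h']

theorem sact_one (M : GSMod A) (N : GSMod B) (t : M.carrier ⊗[F] N.carrier) :
    sact M N (1 ⊗ₜ[F] 1) t = t := by
  refine tensor_hom_induction M.internal N.internal
    (p := fun t => sact M N (1 ⊗ₜ[F] 1) t = t)
    (fun k l m n hm hn => ?_) (fun t t' h h' => by rw [map_add, h, h']) t
  rw [sact_tmul M N 1 B.one_mem hm]
  simp

theorem smulTensor_one (x : A.carrier ⊗[F] B.carrier) :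
    smulTensor A B x (1 ⊗ₜ[F] 1) = x := by
  refine tensor_hom_induction A.internal B.internal
    (p := fun x => smulTensor A B x (1 ⊗ₜ[F] 1) = x)
    (fun k l a b ha hb => ?_) (fun t t' h h' => by rw [map_add, LinearMap.add_apply, h, h']) x
  rw [smulTensor_tmul a 1 hb A.one_mem]
  simp

theorem sact_mem (M : GSMod A) (N : GSMod B) {i j : Deg} {x : A.carrier ⊗[F] B.carrier}
    {t : M.carrier ⊗[F] N.carrier} (hx : x ∈ tensorGr A.gr B.gr i)
    (ht : t ∈ tensorGr M.gr N.gr j) : sact M N x t ∈ tensorGr M.gr N.gr (i + j) := by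
  induction hx using Submodule.span_induction with
  | mem x hx =>
    obtain ⟨i₁, i₂, a, b, ha, hb, rfl, rfl⟩ := hx
    induction ht using Submodule.span_induction with
    | mem t ht =>
      obtain ⟨j₁, j₂, m, n, hm, hn, rfl, rfl⟩ := ht
      rw [sact_tmul M N a hb hm, add_add_add_comm]
      exact zsmul_mem (tmul_mem_tensorGr (M.smul_mem ha hm) (N.smul_mem hb hn)) _
    | zero => simp
    | add t t' _ _ h h' => rw [map_add]; exact add_mem h h'
    | smul c t _ h => rw [map_smul]; exact Submodule.smul_mem _ c h
  | zero => simp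
  | add x y _ _ h h' => rw [map_add, LinearMap.add_apply]; exact add_mem h h'
  | smul c x _ h => rw [map_smul, LinearMap.smul_apply]; exact Submodule.smul_mem _ c h

/-- The underlying space of the tensor product superalgebra `A ⊗ B`. -/
def STensor (A B : GSAlg F) : Type u := A.carrier ⊗[F] B.carrier

noncomputable instance : AddCommGroup (STensor A B) :=
  inferInstanceAs (AddCommGroup (A.carrier ⊗[F] B.carrier))

noncomputable instance : Module F (STensor A B) :=
  inferInstanceAs (Module F (A.carrier ⊗[F] B.carrier))

instance : Module.Finite F (STensor A B) :=
  inferInstanceAs (Module.Finite F (A.carrier ⊗[F] B.carrier))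

noncomputable instance : Ring (STensor A B) :=
  { (inferInstance : AddCommGroup (STensor A B)) with
    mul := fun x y => smulTensor A B x y
    one := ((1 : A.carrier) ⊗ₜ[F] (1 : B.carrier) : A.carrier ⊗[F] B.carrier)
    mul_assoc := fun x y z =>
      sact_smulTensor (GSMod.regular A) (GSMod.regular B) x y z
    one_mul := fun x => sact_one (GSMod.regular A) (GSMod.regular B) x
    mul_one := fun x => smulTensor_one x
    left_distrib := fun x y z => (smulTensor A B x).map_add y z
    right_distrib := fun x y z => LinearMap.map_add₂ (smulTensor A B) x y z
    zero_mul := fun x => LinearMap.map_zero₂ (smulTensor A B) x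
    mul_zero := fun x => (smulTensor A B x).map_zero }

noncomputable instance : Algebra F (STensor A B) :=
  Algebra.ofModule (fun c x y => LinearMap.map_smul₂ (smulTensor A B) c x y)
    (fun c x y => (smulTensor A B x).map_smul c y)

/-- The tensor product of graded superalgebras. -/
noncomputable def GSAlg.tensor (A B : GSAlg F) : GSAlg F where
  carrier := STensor A B
  finite := inferInstanceAs (Module.Finite F (A.carrier ⊗[F] B.carrier))
  gr := tensorGr A.gr B.gr
  internal := tensorGr_internal A.internal B.internal
  nonneg d hd := by
    refine eq_bot_iff.2 (Submodule.span_le.2 ?_)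
    rintro _ ⟨i, j, x, y, hx, hy, rfl, rfl⟩
    change _ = _
    rcases lt_or_ge i.1 0 with hi | hi
    · rw [A.nonneg i hi, Submodule.mem_bot] at hx
      rw [hx, TensorProduct.zero_tmul]
      rfl
    · have hj : j.1 < 0 := by
        have : i.1 + j.1 < 0 := hd
        omega
      rw [B.nonneg j hj, Submodule.mem_bot] at hy
      rw [hy, TensorProduct.tmul_zero]
      rfl
  one_mem := by
    have := tmul_mem_tensorGr (F := F) A.one_mem B.one_mem
    rwa [add_zero] at this
  mul_mem hx hy := sact_mem (GSMod.regular A) (GSMod.regular B) hx hy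

/-- The element `a ⊗ b` of `A ⊗ B`. -/
noncomputable def GSAlg.tmul (a : A.carrier) (b : B.carrier) : (A.tensor B).carrier :=
  (a ⊗ₜ[F] b : A.carrier ⊗[F] B.carrier)

theorem GSAlg.tmul_mul_tmul (a a' : A.carrier) {i j : Deg} {b : B.carrier}
    (hb : b ∈ B.gr i) (ha' : a' ∈ A.gr j) (b' : B.carrier) :
    GSAlg.tmul a b * GSAlg.tmul a' b' = ksign i.2 j.2 • GSAlg.tmul (a * a') (b * b') :=
  smulTensor_tmul a a' hb ha' b'

namespace GSMod

/-- The underlying space of the outer tensor product `M ⊠ N`. -/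
def OuterCarrier (M : GSMod A) (N : GSMod B) : Type u := M.carrier ⊗[F] N.carrier

section

variable (M : GSMod A) (N : GSMod B)

noncomputable instance : AddCommGroup (M.OuterCarrier N) :=
  inferInstanceAs (AddCommGroup (M.carrier ⊗[F] N.carrier))

noncomputable instance : Module F (M.OuterCarrier N) :=
  inferInstanceAs (Module F (M.carrier ⊗[F] N.carrier))

instance : Module.Finite F (M.OuterCarrier N) :=
  inferInstanceAs (Module.Finite F (M.carrier ⊗[F] N.carrier))

noncomputable instance : Module (A.tensor B).carrier (M.OuterCarrier N) where
  smul x t := sact M N x t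
  one_smul t := sact_one M N t
  mul_smul x y t := sact_smulTensor M N x y t
  smul_zero x := (sact M N x).map_zero
  smul_add x t t' := (sact M N x).map_add t t'
  add_smul x y t := LinearMap.map_add₂ (sact M N) x y t
  zero_smul t := LinearMap.map_zero₂ (sact M N) t

instance : IsScalarTower F (A.tensor B).carrier (M.OuterCarrier N) :=
  ⟨fun c x t => LinearMap.map_smul₂ (sact M N) c x t⟩

end

/-- The outer tensor product `M ⊠ N`, with the action
`(a ⊗ b) · (m ⊗ n) = (-1)^{b̄ m̄} a m ⊗ b n`. -/
noncomputable def outer (M : GSMod A) (N : GSMod B) : GSMod (A.tensor B) where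
  carrier := M.OuterCarrier N
  tower := inferInstance
  fg := Module.Finite.of_restrictScalars_finite F (A.tensor B).carrier (M.OuterCarrier N)
  gr := tensorGr M.gr N.gr
  internal := tensorGr_internal M.internal N.internal
  smul_mem hx ht := sact_mem M N hx ht

theorem tmul_smul_tmul (M : GSMod A) (N : GSMod B) (a : A.carrier) {i j : Deg} {b : B.carrier}
    (hb : b ∈ B.gr i) {m : M.carrier} (hm : m ∈ M.gr j) (n : N.carrier) :
    GSAlg.tmul a b • (show (M.outer N).carrier from m ⊗ₜ[F] n) =
      ksign i.2 j.2 • (show (M.outer N).carrier from (a • m) ⊗ₜ[F] (b • n)) :=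
  sact_tmul M N a hb hm n

theorem sact_map {M M' : GSMod A} {N N' : GSMod B} (f : M ⟶ M') (g : N ⟶ N')
    (x : A.carrier ⊗[F] B.carrier) (t : M.carrier ⊗[F] N.carrier) :
    TensorProduct.map (Hom.linF f) (Hom.linF g) (sact M N x t) =
      sact M' N' x (TensorProduct.map (Hom.linF f) (Hom.linF g) t) := by
  refine tensor_hom_induction A.internal B.internal
    (p := fun x => TensorProduct.map (Hom.linF f) (Hom.linF g) (sact M N x t) =
      sact M' N' x (TensorProduct.map (Hom.linF f) (Hom.linF g) t))
    (fun i j a b ha hb => ?_) (fun x x' h h' => ?_) x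
  · refine tensor_hom_induction M.internal N.internal
      (p := fun t => TensorProduct.map (Hom.linF f) (Hom.linF g) (sact M N (a ⊗ₜ b) t) =
        sact M' N' (a ⊗ₜ b) (TensorProduct.map (Hom.linF f) (Hom.linF g) t))
      (fun k l m n hm hn => ?_) (fun t t' h h' => by simp only [map_add, h, h']) t
    rw [sact_tmul M N a hb hm, map_zsmul, TensorProduct.map_tmul, TensorProduct.map_tmul,
      linF_apply, linF_apply, linF_apply, linF_apply, sact_tmul M' N' a hb (f.map_mem hm),
      map_smul, map_smul]
  · simp only [map_add, LinearMap.add_apply, h, h']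

theorem map_tensorGr_mem {M M' : GSMod A} {N N' : GSMod B} (f : M ⟶ M') (g : N ⟶ N') {d : Deg}
    {t : M.carrier ⊗[F] N.carrier} (ht : t ∈ tensorGr M.gr N.gr d) :
    TensorProduct.map (Hom.linF f) (Hom.linF g) t ∈ tensorGr M'.gr N'.gr d := by
  induction ht using Submodule.span_induction with
  | mem t ht =>
    obtain ⟨j₁, j₂, m, n, hm, hn, rfl, rfl⟩ := ht
    exact tmul_mem_tensorGr (f.map_mem hm) (g.map_mem hn)
  | zero => simp
  | add t t' _ _ h h' => rw [map_add]; exact add_mem h h'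
  | smul c t _ h => rw [map_smul]; exact Submodule.smul_mem _ c h

/-- The morphism `f ⊠ g`. -/
noncomputable def outerMap {M M' : GSMod A} {N N' : GSMod B} (f : M ⟶ M') (g : N ⟶ N') :
    M.outer N ⟶ M'.outer N' where
  lin :=
    { toFun := fun t => TensorProduct.map (Hom.linF f) (Hom.linF g) t
      map_add' := fun t t' => (TensorProduct.map (Hom.linF f) (Hom.linF g)).map_add t t'
      map_smul' := fun x t => sact_map f g x t }
  map_mem h := map_tensorGr_mem f g h

/-- The functor `M ⊠ -`. -/
noncomputable def outerFunctor (M : GSMod A) (B : GSAlg F) : GSMod B ⥤ GSMod (A.tensor B) where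
  obj N := M.outer N
  map g := outerMap (𝟙 M) g
  map_id N := by
    apply hom_ext
    intro t
    exact LinearMap.congr_fun (TensorProduct.map_id (R := F) (M := M.carrier) (N := N.carrier)) t
  map_comp f g := by
    apply hom_ext
    intro t
    exact LinearMap.congr_fun (TensorProduct.map_comp (R := F) LinearMap.id (Hom.linF g)
      LinearMap.id (Hom.linF f)) t

end GSMod

end Tensor

/-! ### Homomorphisms of superalgebras, restriction and induction -/

/-- A homomorphism of graded superalgebras, not necessarily preserving the identity element. -/
@[ext] structure GSAlg.Hom (B A : GSAlg F) where
  lin : B.carrier →ₗ[F] A.carrier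
  map_mul : ∀ b b', lin (b * b') = lin b * lin b'
  map_mem : ∀ {d : Deg} {b : B.carrier}, b ∈ B.gr d → lin b ∈ A.gr d

namespace GSMod

section Res

variable {A B : GSAlg F} (φ : GSAlg.Hom B A)

/-- The space `φ(1) M`. -/
def ResCarrier (M : GSMod A) : Submodule F M.carrier where
  carrier := {m | φ.lin 1 • m = m}
  add_mem' {m m'} h h' := by
    change _ = _ at h h' ⊢
    rw [smul_add, h, h']
  zero_mem' := smul_zero _
  smul_mem' c m h := by
    change _ = _ at h ⊢
    rw [smul_comm, h]

theorem smul_mem_resCarrier (M : GSMod A) (b : B.carrier) (m : M.carrier) :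
    φ.lin b • m ∈ ResCarrier φ M := by
  change φ.lin 1 • φ.lin b • m = φ.lin b • m
  rw [smul_smul, ← φ.map_mul, one_mul]

instance resModule (M : GSMod A) : Module B.carrier (ResCarrier φ M) where
  smul b m := ⟨φ.lin b • m.1, smul_mem_resCarrier φ M b m.1⟩
  one_smul m := Subtype.ext m.2
  mul_smul b b' m := Subtype.ext (by
    change φ.lin (b * b') • m.1 = φ.lin b • φ.lin b' • m.1
    rw [φ.map_mul, mul_smul])
  smul_zero b := Subtype.ext (smul_zero _)
  smul_add b m m' := Subtype.ext (smul_add _ _ _)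
  add_smul b b' m := Subtype.ext (by
    change φ.lin (b + b') • m.1 = φ.lin b • m.1 + φ.lin b' • m.1
    rw [map_add, add_smul])
  zero_smul m := Subtype.ext (by
    change φ.lin 0 • m.1 = 0
    rw [map_zero, zero_smul])

theorem res_smul_coe (M : GSMod A) (b : B.carrier) (m : ResCarrier φ M) :
    ((b • m : ResCarrier φ M) : M.carrier) = φ.lin b • (m : M.carrier) := rfl

instance resTower (M : GSMod A) : IsScalarTower F B.carrier (ResCarrier φ M) :=
  ⟨fun c b m => Subtype.ext (by
    change φ.lin (c • b) • m.1 = c • φ.lin b • m.1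
    rw [map_smul, smul_assoc])⟩

theorem prj_mem_resCarrier (M : GSMod A) (d : Deg) {m : M.carrier} (hm : m ∈ ResCarrier φ M) :
    prj M.internal d m ∈ ResCarrier φ M := by
  have key : ∀ m : M.carrier, prj M.internal d (φ.lin 1 • m) = φ.lin 1 • prj M.internal d m := by
    refine hom_induction M.internal (fun e x hx => ?_) (fun x y hx hy => ?_)
    · have h := M.smul_mem (φ.map_mem B.one_mem) hx
      rw [zero_add] at h
      by_cases hd : e = d
      · subst hd
        rw [prj_same _ h, prj_same _ hx]
      · rw [prj_ne _ h hd, prj_ne _ hx hd, smul_zero]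
    · rw [smul_add, map_add, map_add, hx, hy, smul_add]
  change φ.lin 1 • prj M.internal d m = prj M.internal d m
  rw [← key, show φ.lin 1 • m = m from hm]

/-- The restriction `φ(1) M` of a graded `A`-supermodule `M` along `φ : B → A`; an element `b` of
`B` acts as `φ(b)`. It is canonically isomorphic to `HOM_A(A φ(1), M)` and to
`φ(1) A ⊗_A M`. -/
def res (M : GSMod A) : GSMod B where
  carrier := ResCarrier φ M
  fg := Module.Finite.of_restrictScalars_finite F B.carrier (ResCarrier φ M)
  gr d := (M.gr d).comap (ResCarrier φ M).subtype
  internal := by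
    refine isInternal_of_proj (fun d => (prj M.internal d).restrict
      (p := ResCarrier φ M) (q := ResCarrier φ M) fun m hm => prj_mem_resCarrier φ M d hm) ?_ ?_ ?_
    · intro d x hx
      exact Subtype.ext (prj_same _ hx)
    · intro d e x hx hd
      exact Subtype.ext (prj_ne _ hx hd)
    · intro x
      have key : ∀ m : M.carrier, (⟨φ.lin 1 • m, smul_mem_resCarrier φ M 1 m⟩ : ResCarrier φ M) ∈
          ⨆ d, (M.gr d).comap (ResCarrier φ M).subtype := by
        refine hom_induction M.internal (fun e x hx => ?_) (fun x y hx hy => ?_)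
        · refine Submodule.mem_iSup_of_mem e ?_
          have h := M.smul_mem (φ.map_mem B.one_mem) hx
          rwa [zero_add] at h
        · convert add_mem hx hy using 1
          exact Subtype.ext (smul_add _ _ _)
      convert key x.1 using 1
      exact Subtype.ext x.2.symm
  smul_mem hb hm := M.smul_mem (φ.map_mem hb) hm

/-- The restriction functor. -/
def resFunctor : GSMod A ⥤ GSMod B where
  obj M := M.res φ
  map {M N} f :=
    { lin :=
        { toFun := fun m => (⟨f.lin m.1, by
            change φ.lin 1 • f.lin m.1 = f.lin m.1
            rw [← map_smul, show φ.lin 1 • m.1 = m.1 from m.2]⟩ : ResCarrier φ N)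
          map_add' := fun m m' => Subtype.ext (f.lin.map_add m.1 m'.1)
          map_smul' := fun b m => Subtype.ext (f.lin.map_smul (φ.lin b) m.1) }
      map_mem := fun h => f.map_mem h }
  map_id _ := rfl
  map_comp _ _ := rfl

end Res

section Ind

variable {A B : GSAlg F} (φ : GSAlg.Hom B A)

/-- The relations `a φ(b) ⊗ n = a ⊗ b n` in `A ⊗ N`. -/
def indRel (N : GSMod B) : Submodule A.carrier (A.carrier ⊗[F] N.carrier) :=
  Submodule.span A.carrier {t | ∃ (a : A.carrier) (b : B.carrier) (n : N.carrier),
    t = (a * φ.lin b) ⊗ₜ[F] n - a ⊗ₜ[F] (b • n)}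

/-- The space `A φ(1) ⊗_B N`, as the quotient of `A ⊗ N` by the relations
`a φ(b) ⊗ n = a ⊗ b n` (which contain `a φ(1) ⊗ n = a ⊗ n`). -/
abbrev IndCarrier (N : GSMod B) : Type u := (A.carrier ⊗[F] N.carrier) ⧸ indRel φ N

theorem tprj_mem_indRel (N : GSMod B) (d : Deg) {t : A.carrier ⊗[F] N.carrier}
    (ht : t ∈ indRel φ N) : tprj A.internal N.internal d t ∈ indRel φ N := by
  have gen : ∀ (x a : A.carrier) (b : B.carrier) (n : N.carrier),
      tprj A.internal N.internal d (x • ((a * φ.lin b) ⊗ₜ[F] n - a ⊗ₜ[F] (b • n))) ∈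
        indRel φ N := by
    intro x a b n
    rw [smul_sub, TensorProduct.smul_tmul', TensorProduct.smul_tmul', smul_eq_mul, smul_eq_mul,
      ← mul_assoc]
    generalize x * a = a
    refine hom_induction A.internal (p := fun a => tprj A.internal N.internal d
      ((a * φ.lin b) ⊗ₜ[F] n - a ⊗ₜ[F] (b • n)) ∈ indRel φ N) (fun i a ha => ?_)
      (fun a a' h h' => ?_) a
    · refine hom_induction B.internal (p := fun b => tprj A.internal N.internal d
        ((a * φ.lin b) ⊗ₜ[F] n - a ⊗ₜ[F] (b • n)) ∈ indRel φ N) (fun j b hb => ?_)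
        (fun b b' h h' => ?_) b
      · refine hom_induction N.internal (p := fun n => tprj A.internal N.internal d
          ((a * φ.lin b) ⊗ₜ[F] n - a ⊗ₜ[F] (b • n)) ∈ indRel φ N) (fun k n hn => ?_)
          (fun n n' h h' => ?_) n
        · rw [map_sub, tprj_tmul _ _ d (A.mul_mem ha (φ.map_mem hb)) hn,
            tprj_tmul _ _ d ha (N.smul_mem hb hn), add_assoc]
          split_ifs
          · exact Submodule.subset_span ⟨a, b, n, rfl⟩
          · simp
        · convert add_mem h h' using 1
          rw [← map_add, TensorProduct.tmul_add, smul_add, TensorProduct.tmul_add]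
          congr 1
          abel
      · convert add_mem h h' using 1
        rw [← map_add, map_add φ.lin, mul_add, add_smul, TensorProduct.tmul_add,
          TensorProduct.add_tmul]
        congr 1
        abel
    · convert add_mem h h' using 1
      rw [← map_add, add_mul, TensorProduct.add_tmul, TensorProduct.add_tmul]
      congr 1
      abel
  induction ht using Submodule.closure_induction with
  | zero => simp
  | add x y _ _ hx hy => rw [map_add]; exact add_mem hx hy
  | smul_mem x t ht =>
    obtain ⟨a, b, n, rfl⟩ := ht
    exact gen x a b n

/-- The quotient map `A ⊗ N → A φ(1) ⊗_B N`. -/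
noncomputable def indMk (N : GSMod B) : A.carrier ⊗[F] N.carrier →ₗ[F] IndCarrier φ N :=
  (indRel φ N).mkQ.restrictScalars F

theorem indMk_surjective (N : GSMod B) : Function.Surjective (indMk φ N) :=
  (indRel φ N).mkQ_surjective

/-- The projection of `A φ(1) ⊗_B N` to its piece of degree `d`. -/
noncomputable def indPrj (N : GSMod B) (d : Deg) : IndCarrier φ N →ₗ[F] IndCarrier φ N :=
  ((indRel φ N).restrictScalars F).liftQ (indMk φ N ∘ₗ tprj A.internal N.internal d)
    (fun t ht => by
      rw [LinearMap.mem_ker, LinearMap.comp_apply]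
      exact (Submodule.Quotient.mk_eq_zero _).2 (tprj_mem_indRel φ N d ht)) ∘ₗ
    (Submodule.Quotient.restrictScalarsEquiv F (indRel φ N)).symm.toLinearMap

theorem indPrj_mk (N : GSMod B) (d : Deg) (t : A.carrier ⊗[F] N.carrier) :
    indPrj φ N d (indMk φ N t) = indMk φ N (tprj A.internal N.internal d t) := rfl

theorem indGr_internal (N : GSMod B) : DirectSum.IsInternal fun d : Deg =>
    (tensorGr A.gr N.gr d).map (indMk φ N) := by
  have hT := tensorGr_internal A.internal N.internal
  have h1 : ∀ d t, t ∈ tensorGr A.gr N.gr d → tprj A.internal N.internal d t = t := by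
    intro d x hx
    induction hx using Submodule.span_induction with
    | mem x hx =>
      obtain ⟨i, j, a, b, ha, hb, hd, rfl⟩ := hx
      rw [tprj_tmul _ _ d ha hb, if_pos hd]
    | zero => simp
    | add x y _ _ hx hy => rw [map_add, hx, hy]
    | smul c x _ hx => rw [map_smul, hx]
  have h2 : ∀ d e t, t ∈ tensorGr A.gr N.gr e → e ≠ d →
      tprj A.internal N.internal d t = 0 := by
    intro d e x hx hde
    induction hx using Submodule.span_induction with
    | mem x hx =>
      obtain ⟨i, j, a, b, ha, hb, hd, rfl⟩ := hx
      rw [tprj_tmul _ _ d ha hb, if_neg (by rw [hd]; exact hde)]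
    | zero => simp
    | add x y _ _ hx hy => rw [map_add, hx, hy, add_zero]
    | smul c x _ hx => rw [map_smul, hx, smul_zero]
  refine isInternal_of_proj (indPrj φ N) ?_ ?_ ?_
  · rintro d _ ⟨t, ht, rfl⟩
    rw [indPrj_mk, h1 d t ht]
  · rintro d e _ ⟨t, ht, rfl⟩ hde
    rw [indPrj_mk, h2 d e t ht hde, map_zero]
  · intro x
    obtain ⟨t, rfl⟩ := indMk_surjective φ N x
    refine hom_induction hT (p := fun t => indMk φ N t ∈ _) (fun d t ht => ?_)
      (fun t t' h h' => by rw [map_add]; exact add_mem h h') t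
    exact Submodule.mem_iSup_of_mem d ⟨t, ht, rfl⟩

/-- The induced supermodule `A φ(1) ⊗_B N`. -/
noncomputable def ind (N : GSMod B) : GSMod A where
  carrier := IndCarrier φ N
  fg :=
    haveI : Module.Finite F (IndCarrier φ N) :=
      Module.Finite.of_surjective (indMk φ N) (indMk_surjective φ N)
    Module.Finite.of_restrictScalars_finite F A.carrier (IndCarrier φ N)
  gr d := (tensorGr A.gr N.gr d).map (indMk φ N)
  internal := indGr_internal φ N
  smul_mem {i j a x} ha hx := by
    obtain ⟨t, ht, rfl⟩ := hx
    refine ⟨a • t, ?_, rfl⟩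
    induction ht using Submodule.span_induction with
    | mem t ht =>
      obtain ⟨j₁, j₂, m, n, hm, hn, rfl, rfl⟩ := ht
      rw [TensorProduct.smul_tmul', ← add_assoc]
      exact tmul_mem_tensorGr (A.mul_mem ha hm) hn
    | zero => rw [smul_zero]; exact zero_mem _
    | add t t' _ _ h h' => rw [smul_add]; exact add_mem h h'
    | smul c t _ h => rw [smul_comm]; exact Submodule.smul_mem _ c h

/-- The map `A ⊗ N → A ⊗ N'` given by a morphism `N → N'`. -/
noncomputable def indMapAux {N N' : GSMod B} (f : N ⟶ N') :
    A.carrier ⊗[F] N.carrier →ₗ[A.carrier] A.carrier ⊗[F] N'.carrier :=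
  TensorProduct.AlgebraTensorModule.map LinearMap.id (Hom.linF f)

theorem indMapAux_mem {N N' : GSMod B} (f : N ⟶ N') :
    indRel φ N ≤ (indRel φ N').comap (indMapAux f) := by
  refine Submodule.span_le.2 ?_
  rintro _ ⟨a, b, n, rfl⟩
  refine Submodule.subset_span ⟨a, b, f.lin n, ?_⟩
  rw [map_sub, indMapAux, TensorProduct.AlgebraTensorModule.map_tmul,
    TensorProduct.AlgebraTensorModule.map_tmul]
  simp

/-- The induction functor. -/
noncomputable def indFunctor : GSMod B ⥤ GSMod A where
  obj N := N.ind φ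
  map {N N'} f :=
    { lin := (indRel φ N).mapQ (indRel φ N') (indMapAux f) (indMapAux_mem φ f)
      map_mem := by
        rintro d _ ⟨t, ht, rfl⟩
        refine ⟨indMapAux f t, ?_, rfl⟩
        induction ht using Submodule.span_induction with
        | mem t ht =>
          obtain ⟨j₁, j₂, m, n, hm, hn, rfl, rfl⟩ := ht
          exact tmul_mem_tensorGr hm (f.map_mem hn)
        | zero => rw [map_zero]; exact zero_mem _
        | add t t' _ _ h h' => rw [map_add]; exact add_mem h h'
        | smul c t _ h =>
          have : indMapAux (A := A) f (c • t) = c • indMapAux f t :=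
            (TensorProduct.map LinearMap.id (Hom.linF f)).map_smul c t
          rw [this]; exact Submodule.smul_mem _ c h }
  map_id N := by
    apply hom_ext
    intro x
    obtain ⟨t, rfl⟩ := indMk_surjective φ N x
    exact congrArg (indMk φ N) (LinearMap.congr_fun
      (TensorProduct.map_id (R := F) (M := A.carrier) (N := N.carrier)) t)
  map_comp {N N' N''} f g := by
    apply hom_ext
    intro x
    obtain ⟨t, rfl⟩ := indMk_surjective φ N x
    exact congrArg (indMk φ N'') (LinearMap.congr_fun (TensorProduct.map_comp (R := F)
      (LinearMap.id (M := A.carrier)) (Hom.linF g) LinearMap.id (Hom.linF f)) t)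

end Ind

end GSMod

namespace GSAlg

section

variable {A B : GSAlg F}

/-- The map `(a, b) ↦ a ⊗ b` as a bilinear map. -/
noncomputable def tmulLin (A B : GSAlg F) :
    A.carrier →ₗ[F] B.carrier →ₗ[F] (A.tensor B).carrier :=
  TensorProduct.mk F A.carrier B.carrier

theorem tmulLin_apply (a : A.carrier) (b : B.carrier) : tmulLin A B a b = tmul a b := rfl

theorem zsmul_tmul (n : ℤ) (a : A.carrier) (b : B.carrier) :
    tmul (n • a) b = n • tmul a b := by
  rw [← tmulLin_apply, ← tmulLin_apply, map_zsmul, LinearMap.smul_apply]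

theorem tmul_zsmul (n : ℤ) (a : A.carrier) (b : B.carrier) :
    tmul a (n • b) = n • tmul a b := by
  rw [← tmulLin_apply, ← tmulLin_apply, map_zsmul]

theorem tmul_mem {i j : Deg} {a : A.carrier} {b : B.carrier} (ha : a ∈ A.gr i) (hb : b ∈ B.gr j) :
    tmul a b ∈ (A.tensor B).gr (i + j) :=
  tmul_mem_tensorGr ha hb

theorem tensor_induction {p : (A.tensor B).carrier → Prop}
    (tmul : ∀ i j a b, a ∈ A.gr i → b ∈ B.gr j → p (GSAlg.tmul a b))
    (add : ∀ x y, p x → p y → p (x + y)) (t : (A.tensor B).carrier) : p t :=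
  tensor_hom_induction A.internal B.internal (p := p) tmul add t

theorem map_mem_of_tmul {X : Type w} [AddCommGroup X] [Module F X]
    (f : (A.tensor B).carrier →ₗ[F] X) (S : Submodule F X) {d : Deg}
    (h : ∀ i j a b, a ∈ A.gr i → b ∈ B.gr j → i + j = d → f (tmul a b) ∈ S)
    {t : (A.tensor B).carrier} (ht : t ∈ (A.tensor B).gr d) : f t ∈ S := by
  have : (A.tensor B).gr d ≤ S.comap f := by
    refine Submodule.span_le.2 ?_
    rintro _ ⟨i, j, a, b, ha, hb, hd, rfl⟩
    exact h i j a b ha hb hd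
  exact this ht

end

section

variable {B A B' A' : GSAlg F}

/-- The linear map `b ⊗ b' ↦ φ(b) ⊗ ψ(b')`. -/
noncomputable def tensorLin (φ : Hom B A) (ψ : Hom B' A') :
    (B.tensor B').carrier →ₗ[F] (A.tensor A').carrier :=
  TensorProduct.map φ.lin ψ.lin

theorem tensorLin_tmul (φ : Hom B A) (ψ : Hom B' A') (b : B.carrier) (b' : B'.carrier) :
    tensorLin φ ψ (tmul b b') = tmul (φ.lin b) (ψ.lin b') := rfl

/-- The tensor product of two homomorphisms. -/
noncomputable def Hom.tensor (φ : Hom B A) (ψ : Hom B' A') :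
    Hom (B.tensor B') (A.tensor A') where
  lin := tensorLin φ ψ
  map_mul x y := by
    refine tensor_induction
      (p := fun x => tensorLin φ ψ (x * y) = tensorLin φ ψ x * tensorLin φ ψ y)
      (fun i j a b ha hb => ?_) (fun x x' h h' => ?_) x
    · refine tensor_induction (p := fun y => tensorLin φ ψ (tmul a b * y) =
          tensorLin φ ψ (tmul a b) * tensorLin φ ψ y)
        (fun k l a' b' ha' hb' => ?_) (fun x x' h h' => ?_) y
      · rw [tmul_mul_tmul a a' hb ha', map_zsmul, tensorLin_tmul, tensorLin_tmul, tensorLin_tmul,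
          tmul_mul_tmul _ _ (ψ.map_mem hb) (φ.map_mem ha'), φ.map_mul, ψ.map_mul]
      · rw [mul_add, map_add, h, h', map_add, mul_add]
    · rw [add_mul, map_add, h, h', map_add, add_mul]
  map_mem {d x} hx := by
    refine map_mem_of_tmul _ _ (fun i j a b ha hb hd => ?_) hx
    rw [tensorLin_tmul, ← hd]
    exact tmul_mem (φ.map_mem ha) (ψ.map_mem hb)

end

section

variable {A₁ A₂ A₃ A₄ : GSAlg F}

/-- The element `(a₁ ⊗ a₂) ⊗ (a₃ ⊗ a₄)`. -/
noncomputable def four (a₁ : A₁.carrier) (a₂ : A₂.carrier) (a₃ : A₃.carrier) (a₄ : A₄.carrier) :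
    ((A₁.tensor A₂).tensor (A₃.tensor A₄)).carrier :=
  tmul (tmul a₁ a₂) (tmul a₃ a₄)

/-- Induction on fourfold tensors of homogeneous elements. -/
theorem four_induction {p : ((A₁.tensor A₂).tensor (A₃.tensor A₄)).carrier → Prop}
    (tmul : ∀ i₁ i₂ i₃ i₄ a₁ a₂ a₃ a₄, a₁ ∈ A₁.gr i₁ → a₂ ∈ A₂.gr i₂ → a₃ ∈ A₃.gr i₃ →
      a₄ ∈ A₄.gr i₄ → p (four a₁ a₂ a₃ a₄))
    (add : ∀ x y, p x → p y → p (x + y))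
    (t : ((A₁.tensor A₂).tensor (A₃.tensor A₄)).carrier) : p t := by
  refine tensor_induction (fun i j x y _ _ => ?_) add t
  refine tensor_induction (p := fun x => p (GSAlg.tmul x y))
    (fun i₁ i₂ a₁ a₂ h₁ h₂ => ?_)
    (fun a b ha hb => by
      rw [← tmulLin_apply, map_add, LinearMap.add_apply]; exact add _ _ ha hb) x
  exact tensor_induction (p := fun y => p (GSAlg.tmul (GSAlg.tmul a₁ a₂) y))
    (fun i₃ i₄ a₃ a₄ h₃ h₄ => tmul _ _ _ _ _ _ _ _ h₁ h₂ h₃ h₄)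
    (fun a b ha hb => by rw [← tmulLin_apply, map_add]; exact add _ _ ha hb) y

theorem four_mul {j₂ j₃ j₄ k₁ k₂ k₃ : Deg}
    (a₁ : A₁.carrier) {a₂ : A₂.carrier} {a₃ : A₃.carrier} {a₄ : A₄.carrier}
    {b₁ : A₁.carrier} {b₂ : A₂.carrier} {b₃ : A₃.carrier} (b₄ : A₄.carrier)
    (h₂ : a₂ ∈ A₂.gr j₂) (h₃ : a₃ ∈ A₃.gr j₃) (h₄ : a₄ ∈ A₄.gr j₄)
    (g₁ : b₁ ∈ A₁.gr k₁) (g₂ : b₂ ∈ A₂.gr k₂) (g₃ : b₃ ∈ A₃.gr k₃) :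
    four a₁ a₂ a₃ a₄ * four b₁ b₂ b₃ b₄ =
      (ksign (j₃.2 + j₄.2) (k₁.2 + k₂.2) * (ksign j₂.2 k₁.2 * ksign j₄.2 k₃.2)) •
        four (a₁ * b₁) (a₂ * b₂) (a₃ * b₃) (a₄ * b₄) := by
  rw [four, four, tmul_mul_tmul _ _ (tmul_mem h₃ h₄) (tmul_mem g₁ g₂), tmul_mul_tmul _ _ h₂ g₁,
    tmul_mul_tmul _ _ h₄ g₃, zsmul_tmul, tmul_zsmul, smul_smul, smul_smul, mul_assoc]
  rfl

/-- The linear map `(a₁ ⊗ a₃) ⊗ (a₂ ⊗ a₄) ↦ (a₁ ⊗ (-1)^{ε ā₂} a₂) ⊗ (a₃' ⊗ a₄)`, where `a₃'` is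
the component of `a₃` of parity `ε`. -/
noncomputable def swapAux (A₁ A₂ A₃ A₄ : GSAlg F) (ε : ZMod 2) :
    ((A₁.tensor A₃).tensor (A₂.tensor A₄)).carrier →ₗ[F]
      ((A₁.tensor A₂).tensor (A₃.tensor A₄)).carrier :=
  (TensorProduct.tensorTensorTensorComm F A₁.carrier A₃.carrier
      A₂.carrier A₄.carrier).toLinearMap ∘ₗ
    TensorProduct.map (TensorProduct.map LinearMap.id (parityPart A₃.internal ε))
      (TensorProduct.map (ptwist A₂.internal ε) LinearMap.id)

theorem swapAux_four (a₁ : A₁.carrier) (a₃ : A₃.carrier) (a₂ : A₂.carrier) (a₄ : A₄.carrier)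
    (ε : ZMod 2) : swapAux A₁ A₂ A₃ A₄ ε (four a₁ a₃ a₂ a₄) =
      four a₁ (ptwist A₂.internal ε a₂) (parityPart A₃.internal ε a₃) a₄ := rfl

/-- The linear map `(a₁ ⊗ a₃) ⊗ (a₂ ⊗ a₄) ↦ (-1)^{ā₃ ā₂} (a₁ ⊗ a₂) ⊗ (a₃ ⊗ a₄)`. -/
noncomputable def swapLin (A₁ A₂ A₃ A₄ : GSAlg F) :
    ((A₁.tensor A₃).tensor (A₂.tensor A₄)).carrier →ₗ[F]
      ((A₁.tensor A₂).tensor (A₃.tensor A₄)).carrier :=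
  ∑ ε : ZMod 2, swapAux A₁ A₂ A₃ A₄ ε

theorem swapLin_four (a₁ : A₁.carrier) {i : Deg} {a₃ : A₃.carrier}
    (h₃ : a₃ ∈ A₃.gr i) {j : Deg} {a₂ : A₂.carrier} (h₂ : a₂ ∈ A₂.gr j) (a₄ : A₄.carrier) :
    swapLin A₁ A₂ A₃ A₄ (four a₁ a₃ a₂ a₄) = ksign i.2 j.2 • four a₁ a₂ a₃ a₄ := by
  have key : ∀ ε : ZMod 2,
      four a₁ (ptwist A₂.internal ε a₂) (parityPart A₃.internal ε a₃) a₄ =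
      if i.2 = ε then ksign i.2 j.2 • four a₁ a₂ a₃ a₄ else 0 := by
    intro ε
    rw [ptwist_of_mem _ _ h₂, parityPart_of_mem _ _ h₃]
    split_ifs with h
    · rw [h, four, tmul_zsmul, zsmul_tmul, four]
    · rw [four, ← tmulLin_apply, ← tmulLin_apply 0 a₄, map_zero, LinearMap.zero_apply, map_zero]
  rw [swapLin, LinearMap.sum_apply,
    Finset.sum_congr rfl fun ε _ => (swapAux_four a₁ a₃ a₂ a₄ ε).trans (key ε), Finset.sum_ite_eq]
  simp

theorem swap_sign (j₂ j₃ j₄ k₁ k₂ k₃ : ZMod 2) :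
    ksign (j₂ + j₄) (k₁ + k₃) * (ksign j₃ k₁ * ksign j₄ k₂) * ksign (j₃ + k₃) (j₂ + k₂) =
      ksign j₃ j₂ * ksign k₃ k₂ *
        (ksign (j₃ + j₄) (k₁ + k₂) * (ksign j₂ k₁ * ksign j₄ k₃)) := by
  revert j₂ j₃ j₄ k₁ k₂ k₃
  decide

/-- The homomorphism `(A₁ ⊗ A₃) ⊗ (A₂ ⊗ A₄) → (A₁ ⊗ A₂) ⊗ (A₃ ⊗ A₄)` that interchanges the second
and third factors. -/
noncomputable def swap23 (A₁ A₂ A₃ A₄ : GSAlg F) :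
    Hom ((A₁.tensor A₃).tensor (A₂.tensor A₄)) ((A₁.tensor A₂).tensor (A₃.tensor A₄)) where
  lin := swapLin A₁ A₂ A₃ A₄
  map_mul x y := by
    refine four_induction (p := fun x => swapLin A₁ A₂ A₃ A₄ (x * y) =
      swapLin A₁ A₂ A₃ A₄ x * swapLin A₁ A₂ A₃ A₄ y)
      (fun j₁ j₃ j₂ j₄ a₁ a₃ a₂ a₄ h₁ h₃ h₂ h₄ => ?_)
      (fun x x' h h' => by rw [add_mul, map_add, h, h', map_add, add_mul]) x
    refine four_induction (p := fun y => swapLin A₁ A₂ A₃ A₄ (four a₁ a₃ a₂ a₄ * y) =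
      swapLin A₁ A₂ A₃ A₄ (four a₁ a₃ a₂ a₄) * swapLin A₁ A₂ A₃ A₄ y)
      (fun k₁ k₃ k₂ k₄ b₁ b₃ b₂ b₄ g₁ g₃ g₂ g₄ => ?_)
      (fun x x' h h' => by rw [mul_add, map_add, h, h', map_add, mul_add]) y
    rw [four_mul _ _ h₃ h₂ h₄ g₁ g₃ g₂, map_zsmul,
      swapLin_four _ (A₃.mul_mem h₃ g₃) (A₂.mul_mem h₂ g₂), swapLin_four _ h₃ h₂,
      swapLin_four _ g₃ g₂, smul_mul_assoc, mul_smul_comm,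
      four_mul _ _ h₂ h₃ h₄ g₁ g₂ g₃, smul_smul, smul_smul, smul_smul]
    congr 1
    exact swap_sign _ _ _ _ _ _
  map_mem {d x} hx := by
    refine map_mem_of_tmul _ _ (fun i j x y hx hy hd => ?_) hx
    refine map_mem_of_tmul (swapLin A₁ A₂ A₃ A₄ ∘ₗ (tmulLin _ _).flip y) _
      (fun i₁ i₃ a₁ a₃ h₁ h₃ hi => ?_) hx
    refine map_mem_of_tmul (swapLin A₁ A₂ A₃ A₄ ∘ₗ tmulLin _ _ (tmul a₁ a₃)) _
      (fun i₂ i₄ a₂ a₄ h₂ h₄ hj => ?_) hy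
    change swapLin A₁ A₂ A₃ A₄ (four a₁ a₃ a₂ a₄) ∈ _
    rw [swapLin_four _ h₃ h₂, ← hd, ← hi, ← hj, add_add_add_comm]
    exact zsmul_mem (tmul_mem (tmul_mem h₁ h₂) (tmul_mem h₃ h₄)) _

end

/-- An automorphism of a graded superalgebra. -/
structure Aut (A : GSAlg F) where
  hom : Hom A A
  inv : Hom A A
  hom_inv : ∀ a, hom.lin (inv.lin a) = a
  inv_hom : ∀ a, inv.lin (hom.lin a) = a

end GSAlg

namespace GSMod

/-- The functor `S₂₃`, obtained by transporting the action along the isomorphism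
`(A₁ ⊗ A₃) ⊗ (A₂ ⊗ A₄) ≅ (A₁ ⊗ A₂) ⊗ (A₃ ⊗ A₄)`. -/
noncomputable def swapFunctor (A₁ A₂ A₃ A₄ : GSAlg F) :
    GSMod ((A₁.tensor A₂).tensor (A₃.tensor A₄)) ⥤
      GSMod ((A₁.tensor A₃).tensor (A₂.tensor A₄)) :=
  resFunctor (GSAlg.swap23 A₁ A₂ A₃ A₄)

end GSMod

/-! ### Homomorphism spaces -/

namespace GSMod

section Hom

variable {B : GSAlg F}

/-- The space of linear maps `f : P → N` of degree `d` with `f(b m) = (-1)^{d̄ b̄} b f(m)`, for a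
graded supermodule `P` and a graded space `N` on which `B` acts through `ρ`. -/
def homPiece (P : GSMod B) {N : Type u} [AddCommGroup N] [Module F N] (gr : Deg → Submodule F N)
    (ρ : B.carrier →ₗ[F] N →ₗ[F] N) (d : Deg) : Submodule F (P.carrier →ₗ[F] N) where
  carrier := {f | (∀ j m, m ∈ P.gr j → f m ∈ gr (d + j)) ∧
    ∀ i b m, b ∈ B.gr i → f (b • m) = ksign d.2 i.2 • ρ b (f m)}
  add_mem' {f g} hf hg := ⟨fun j m hm => add_mem (hf.1 j m hm) (hg.1 j m hm), fun i b m hb => by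
    rw [LinearMap.add_apply, LinearMap.add_apply, hf.2 i b m hb, hg.2 i b m hb, map_add, smul_add]⟩
  zero_mem' := ⟨fun _ _ _ => zero_mem _, fun _ _ _ _ => by simp⟩
  smul_mem' c f hf := ⟨fun j m hm => Submodule.smul_mem _ c (hf.1 j m hm), fun i b m hb => by
    rw [LinearMap.smul_apply, LinearMap.smul_apply, hf.2 i b m hb, map_smul, smul_comm]⟩

/-- The projection of `Hom_F(P, N)` to the maps of degree `d`. -/
noncomputable def hprj (P : GSMod B) {N : Type u} [AddCommGroup N] [Module F N]
    {gr : Deg → Submodule F N} (hN : DirectSum.IsInternal gr) (d : Deg) :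
    (P.carrier →ₗ[F] N) →ₗ[F] (P.carrier →ₗ[F] N) where
  toFun f := dlift P.internal fun i => prj hN (d + i) ∘ₗ f ∘ₗ (P.gr i).subtype
  map_add' f g := by
    ext m
    refine hom_induction P.internal (p := fun m => dlift P.internal (fun i =>
      prj hN (d + i) ∘ₗ (f + g) ∘ₗ (P.gr i).subtype) m = (dlift P.internal (fun i =>
      prj hN (d + i) ∘ₗ f ∘ₗ (P.gr i).subtype) + dlift P.internal (fun i =>
      prj hN (d + i) ∘ₗ g ∘ₗ (P.gr i).subtype)) m) (fun i x hx => ?_)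
      (fun x y hx hy => by rw [map_add, map_add, hx, hy]) m
    rw [LinearMap.add_apply, dlift_of_mem _ _ hx, dlift_of_mem _ _ hx, dlift_of_mem _ _ hx]
    simp
  map_smul' c f := by
    ext m
    refine hom_induction P.internal (p := fun m => dlift P.internal (fun i =>
      prj hN (d + i) ∘ₗ (c • f) ∘ₗ (P.gr i).subtype) m = (c • dlift P.internal (fun i =>
      prj hN (d + i) ∘ₗ f ∘ₗ (P.gr i).subtype)) m) (fun i x hx => ?_)
      (fun x y hx hy => by rw [map_add, map_add, hx, hy]) m
    rw [LinearMap.smul_apply, dlift_of_mem _ _ hx, dlift_of_mem _ _ hx]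
    simp

theorem hprj_of_mem (P : GSMod B) {N : Type u} [AddCommGroup N] [Module F N]
    {gr : Deg → Submodule F N} (hN : DirectSum.IsInternal gr) (d : Deg)
    {ρ : B.carrier →ₗ[F] N →ₗ[F] N} {e : Deg} {f : P.carrier →ₗ[F] N}
    (hf : f ∈ homPiece P gr ρ e) : hprj P hN d f = if e = d then f else 0 := by
  ext m
  refine hom_induction P.internal (p := fun m => hprj P hN d f m = (if e = d then f else 0) m)
    (fun i x hx => ?_) (fun x y hx hy => by rw [map_add, map_add, hx, hy]) m
  have h : hprj P hN d f x = prj hN (d + i) (f x) := dlift_of_mem _ _ hx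
  rw [h]
  split_ifs with hd
  · subst hd
    rw [prj_same hN (hf.1 i x hx)]
  · rw [prj_ne hN (hf.1 i x hx) fun h => hd (add_right_cancel h)]
    rfl

/-- The piece of degree `d` of `HOM_B(P, M)`. -/
def HOM (P M : GSMod B) (d : Deg) : Submodule F (P.carrier →ₗ[F] M.carrier) :=
  homPiece P M.gr M.act d

variable {C : GSAlg F}

/-- The action of `B` on a `C ⊗ B`-supermodule. -/
noncomputable def rightAct (N : GSMod (C.tensor B)) :
    B.carrier →ₗ[F] N.carrier →ₗ[F] N.carrier :=
  N.act ∘ₗ GSAlg.tmulLin C B 1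

/-- The action of `C` on a `C ⊗ B`-supermodule. -/
noncomputable def leftAct (N : GSMod (C.tensor B)) :
    C.carrier →ₗ[F] N.carrier →ₗ[F] N.carrier :=
  N.act ∘ₗ (GSAlg.tmulLin C B).flip 1

theorem leftAct_apply (N : GSMod (C.tensor B)) (c : C.carrier) (n : N.carrier) :
    N.leftAct c n = GSAlg.tmul c (1 : B.carrier) • n := rfl

theorem rightAct_apply (N : GSMod (C.tensor B)) (b : B.carrier) (n : N.carrier) :
    N.rightAct b n = GSAlg.tmul (1 : C.carrier) b • n := rfl

theorem leftAct_mul (N : GSMod (C.tensor B)) (c c' : C.carrier) (n : N.carrier) :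
    N.leftAct (c * c') n = N.leftAct c (N.leftAct c' n) := by
  rw [leftAct_apply, leftAct_apply, leftAct_apply, smul_smul]
  congr 1
  refine hom_induction C.internal (p := fun c' => GSAlg.tmul (c * c') (1 : B.carrier) =
    GSAlg.tmul c 1 * GSAlg.tmul c' 1) (fun d x hx => ?_) (fun x y hx hy => ?_) c'
  · rw [GSAlg.tmul_mul_tmul c x B.one_mem hx]
    simp
  · simp only [← GSAlg.tmulLin_apply, mul_add, map_add, LinearMap.add_apply] at hx hy ⊢
    rw [hx, hy]

theorem leftAct_mem (N : GSMod (C.tensor B)) {i j : Deg} {c : C.carrier} {n : N.carrier}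
    (hc : c ∈ C.gr i) (hn : n ∈ N.gr j) : N.leftAct c n ∈ N.gr (i + j) := by
  have := N.smul_mem (GSAlg.tmul_mem hc B.one_mem) hn
  rwa [add_zero] at this

theorem leftAct_rightAct (N : GSMod (C.tensor B)) {i j : Deg} {c : C.carrier} {b : B.carrier}
    (hc : c ∈ C.gr i) (hb : b ∈ B.gr j) (n : N.carrier) :
    N.leftAct c (N.rightAct b n) = ksign i.2 j.2 • N.rightAct b (N.leftAct c n) := by
  rw [leftAct_apply, leftAct_apply, rightAct_apply, rightAct_apply, smul_smul, smul_smul,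
    GSAlg.tmul_mul_tmul c 1 B.one_mem C.one_mem, GSAlg.tmul_mul_tmul 1 c hb hc]
  simp only [Prod.snd_zero, ksign_zero_left, one_smul, mul_one, one_mul]
  rw [smul_assoc, smul_smul, ksign_comm, ksign_self, one_smul]

variable (P : GSMod B)

/-- The space `HOM_B(P, N)` for a `C ⊗ B`-supermodule `N`. -/
noncomputable def HomCarrier (N : GSMod (C.tensor B)) : Submodule F (P.carrier →ₗ[F] N.carrier) :=
  ⨆ d, homPiece P N.gr N.rightAct d

theorem homPiece_le (N : GSMod (C.tensor B)) (d : Deg) :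
    homPiece P N.gr N.rightAct d ≤ HomCarrier P N :=
  le_iSup (fun d => homPiece P N.gr N.rightAct d) d

theorem leftAct_comp_mem_homPiece (N : GSMod (C.tensor B)) {i d : Deg} {c : C.carrier}
    {f : P.carrier →ₗ[F] N.carrier} (hc : c ∈ C.gr i) (hf : f ∈ homPiece P N.gr N.rightAct d) :
    N.leftAct c ∘ₗ f ∈ homPiece P N.gr N.rightAct (i + d) := by
  refine ⟨fun j m hm => ?_, fun j b m hb => ?_⟩
  · rw [add_assoc]
    exact leftAct_mem N hc (hf.1 j m hm)
  · rw [LinearMap.comp_apply, LinearMap.comp_apply, hf.2 j b m hb, map_zsmul,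
      leftAct_rightAct N hc hb, smul_smul, Prod.snd_add, ksign_add_left, mul_comm]

theorem leftAct_comp_mem (N : GSMod (C.tensor B)) (c : C.carrier)
    {f : P.carrier →ₗ[F] N.carrier} (hf : f ∈ HomCarrier P N) :
    N.leftAct c ∘ₗ f ∈ HomCarrier P N := by
  refine Submodule.iSup_induction (fun d => homPiece P N.gr N.rightAct d)
    (motive := fun f => N.leftAct c ∘ₗ f ∈ HomCarrier P N) hf (fun d f hf => ?_) ?_
    (fun f g hf hg => ?_)
  · refine hom_induction C.internal (p := fun c => N.leftAct c ∘ₗ f ∈ HomCarrier P N)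
      (fun i c hc => homPiece_le P N _ (leftAct_comp_mem_homPiece P N hc hf))
      (fun x y hx hy => ?_) c
    rw [map_add, LinearMap.add_comp]
    exact add_mem hx hy
  · rw [LinearMap.comp_zero]
    exact zero_mem _
  · rw [LinearMap.comp_add]
    exact add_mem hf hg

noncomputable instance homModule (N : GSMod (C.tensor B)) :
    Module C.carrier (HomCarrier P N) where
  smul c f := ⟨N.leftAct c ∘ₗ f.1, leftAct_comp_mem P N c f.2⟩
  one_smul f := Subtype.ext (LinearMap.ext fun m => one_smul _ (f.1 m))
  mul_smul c c' f := Subtype.ext (LinearMap.ext fun m => leftAct_mul N c c' (f.1 m))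
  smul_zero c := Subtype.ext (LinearMap.comp_zero _)
  smul_add c f g := Subtype.ext (LinearMap.comp_add _ _ _)
  add_smul c c' f := Subtype.ext (by
    change N.leftAct (c + c') ∘ₗ f.1 = N.leftAct c ∘ₗ f.1 + N.leftAct c' ∘ₗ f.1
    rw [map_add, LinearMap.add_comp])
  zero_smul f := Subtype.ext (by
    change N.leftAct 0 ∘ₗ f.1 = 0
    rw [map_zero, LinearMap.zero_comp])

theorem hom_smul_apply (N : GSMod (C.tensor B)) (c : C.carrier) (f : HomCarrier P N)
    (m : P.carrier) :
    ((c • f : HomCarrier P N) : P.carrier →ₗ[F] N.carrier) m =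
      GSAlg.tmul c (1 : B.carrier) • (f : P.carrier →ₗ[F] N.carrier) m := rfl

instance homTower (N : GSMod (C.tensor B)) : IsScalarTower F C.carrier (HomCarrier P N) :=
  ⟨fun r c f => Subtype.ext (by
    change N.leftAct (r • c) ∘ₗ f.1 = r • (N.leftAct c ∘ₗ f.1)
    rw [map_smul, LinearMap.smul_comp])⟩

theorem hprj_mem (N : GSMod (C.tensor B)) (d : Deg) {f : P.carrier →ₗ[F] N.carrier}
    (hf : f ∈ HomCarrier P N) : hprj P N.internal d f ∈ HomCarrier P N := by
  refine Submodule.iSup_induction (fun d => homPiece P N.gr N.rightAct d)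
    (motive := fun f => hprj P N.internal d f ∈ HomCarrier P N) hf (fun e f hf => ?_) ?_
    (fun f g hf hg => ?_)
  · rw [hprj_of_mem P N.internal d hf]
    split_ifs
    · exact homPiece_le P N e hf
    · exact zero_mem _
  · rw [map_zero]; exact zero_mem _
  · rw [map_add]; exact add_mem hf hg

/-- The graded supermodule `HOM_B(P, N)` over `C`, for a `C ⊗ B`-supermodule `N`, with the action
`c · f = (c ⊗ 1) ∘ f`. -/
noncomputable def hom (N : GSMod (C.tensor B)) : GSMod C where
  carrier := HomCarrier P N
  fg := Module.Finite.of_restrictScalars_finite F C.carrier (HomCarrier P N)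
  gr d := (homPiece P N.gr N.rightAct d).comap (HomCarrier P N).subtype
  internal := by
    refine isInternal_of_proj (fun d => (hprj P N.internal d).restrict
      (p := HomCarrier P N) (q := HomCarrier P N) fun f hf => hprj_mem P N d hf) ?_ ?_ ?_
    · intro d x hx
      refine Subtype.ext ((hprj_of_mem P N.internal d hx).trans ?_)
      rw [if_pos rfl]
      rfl
    · intro d e x hx hd
      refine Subtype.ext ((hprj_of_mem P N.internal d hx).trans ?_)
      rw [if_neg hd]
      rfl
    · rintro ⟨f, hf⟩
      have key : HomCarrier P N ≤ (⨆ d, (homPiece P N.gr N.rightAct d).comap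
          (HomCarrier P N).subtype).map (HomCarrier P N).subtype := by
        rw [Submodule.map_iSup]
        exact iSup_mono fun d f hf => ⟨⟨f, homPiece_le P N d hf⟩, hf, rfl⟩
      obtain ⟨g, hg, hgf⟩ := key hf
      have : g = ⟨f, hf⟩ := Subtype.ext hgf
      rwa [← this]
  smul_mem hc hf := leftAct_comp_mem_homPiece P N hc hf

theorem comp_mem_homPiece {N N' : GSMod (C.tensor B)} (g : N ⟶ N') {d : Deg}
    {f : P.carrier →ₗ[F] N.carrier} (hf : f ∈ homPiece P N.gr N.rightAct d) :
    Hom.linF g ∘ₗ f ∈ homPiece P N'.gr N'.rightAct d := by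
  refine ⟨fun j m hm => g.map_mem (hf.1 j m hm), fun i b m hb => ?_⟩
  rw [LinearMap.comp_apply, LinearMap.comp_apply, hf.2 i b m hb, map_zsmul, linF_apply,
    linF_apply, rightAct_apply, rightAct_apply, map_smul]

theorem comp_mem_homCarrier {N N' : GSMod (C.tensor B)} (g : N ⟶ N')
    {f : P.carrier →ₗ[F] N.carrier} (hf : f ∈ HomCarrier P N) :
    Hom.linF g ∘ₗ f ∈ HomCarrier P N' := by
  refine Submodule.iSup_induction (fun d => homPiece P N.gr N.rightAct d)
    (motive := fun f => Hom.linF g ∘ₗ f ∈ HomCarrier P N') hf (fun e f hf => ?_) ?_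
    (fun f f' hf hf' => ?_)
  · exact homPiece_le P N' e (comp_mem_homPiece P g hf)
  · rw [LinearMap.comp_zero]; exact zero_mem _
  · rw [LinearMap.comp_add]; exact add_mem hf hf'

/-- The functor `HOM_B(P, -)` from `C ⊗ B`-supermodules to `C`-supermodules. -/
noncomputable def homFunctor (C : GSAlg F) : GSMod (C.tensor B) ⥤ GSMod C where
  obj N := hom P N
  map {N N'} g :=
    { lin :=
        { toFun := fun f => (⟨Hom.linF g ∘ₗ f.1, comp_mem_homCarrier P g f.2⟩ : HomCarrier P N')
          map_add' := fun f f' => Subtype.ext (LinearMap.comp_add _ _ _)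
          map_smul' := fun c f => Subtype.ext (LinearMap.ext fun m =>
            g.lin.map_smul (GSAlg.tmul c (1 : B.carrier)) (f.1 m)) }
      map_mem := fun hf => comp_mem_homPiece P g hf }
  map_id _ := rfl
  map_comp _ _ := rfl

end Hom

/-! ### Finite direct sums -/

section Pi

variable {B : GSAlg F} {ι : Type} [Finite ι]

/-- The direct sum of finitely many graded supermodules. -/
def pi (M : ι → GSMod B) : GSMod B where
  carrier := ∀ i, (M i).carrier
  gr d := Submodule.pi Set.univ fun i => (M i).gr d
  internal := by
    refine isInternal_of_proj (fun d => LinearMap.pi fun i => prj (M i).internal d ∘ₗ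
      LinearMap.proj i) ?_ ?_ ?_
    · intro d x hx
      funext i
      exact prj_same _ (hx i trivial)
    · intro d e x hx hd
      funext i
      exact prj_ne _ (hx i trivial) hd
    · intro x
      classical
      cases nonempty_fintype ι
      rw [show x = ∑ i, Pi.single i (x i) from (Finset.univ_sum_single x).symm]
      refine sum_mem fun i _ => ?_
      refine hom_induction (M i).internal (p := fun m => (Pi.single i m : ∀ i, (M i).carrier) ∈
        ⨆ d, Submodule.pi Set.univ fun i => (M i).gr d) (fun d m hm => ?_) (fun a b ha hb => ?_)
        (x i)
      · refine Submodule.mem_iSup_of_mem d fun j _ => ?_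
        by_cases h : j = i
        · subst h
          rwa [Pi.single_eq_same]
        · rw [Pi.single_eq_of_ne h]
          exact zero_mem _
      · rw [Pi.single_add]
        exact add_mem ha hb
  smul_mem hb hm := fun i hi => (M i).smul_mem hb (hm i hi)

/-- The direct sum of finitely many functors. -/
def piFunctor {D : Type v} [Category.{w} D] (G : ι → D ⥤ GSMod B) : D ⥤ GSMod B where
  obj X := pi fun i => (G i).obj X
  map f :=
    { lin := LinearMap.pi fun i => ((G i).map f).lin ∘ₗ LinearMap.proj i
      map_mem := fun hm i hi => ((G i).map f).map_mem (hm i hi) }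
  map_id X := by
    apply hom_ext
    intro m
    funext i
    change ((G i).map (𝟙 X)).lin (m i) = m i
    rw [(G i).map_id]
    rfl
  map_comp f g := by
    apply hom_ext
    intro m
    funext i
    change ((G i).map (f ≫ g)).lin (m i) = ((G i).map g).lin (((G i).map f).lin (m i))
    rw [(G i).map_comp]
    rfl

end Pi

end GSMod

/-! ### Two-sided projectivity -/

section TwoSided

variable {A B : GSAlg F} (φ : GSAlg.Hom B A)

/-- The space `A φ(1)`. -/
def RightCarrier : Submodule F A.carrier where
  carrier := {a | a * φ.lin 1 = a}
  add_mem' {a b} h h' := by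
    change _ = _ at h h' ⊢
    rw [add_mul, h, h']
  zero_mem' := zero_mul _
  smul_mem' c a h := by
    change _ = _ at h ⊢
    rw [smul_mul_assoc, h]

/-- The right action of `B` on `A φ(1)`. -/
instance : Module B.carrierᵐᵒᵖ (RightCarrier φ) where
  smul b a := ⟨a.1 * φ.lin b.unop, by
    change a.1 * φ.lin b.unop * φ.lin 1 = a.1 * φ.lin b.unop
    rw [mul_assoc, ← φ.map_mul, mul_one]⟩
  one_smul a := Subtype.ext a.2
  mul_smul b b' a := Subtype.ext (by
    change a.1 * φ.lin (b'.unop * b.unop) = a.1 * φ.lin b'.unop * φ.lin b.unop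
    rw [φ.map_mul, mul_assoc])
  smul_zero b := Subtype.ext (zero_mul _)
  smul_add b a a' := Subtype.ext (add_mul _ _ _)
  add_smul b b' a := Subtype.ext (by
    change a.1 * φ.lin (b.unop + b'.unop) = a.1 * φ.lin b.unop + a.1 * φ.lin b'.unop
    rw [map_add, mul_add])
  zero_smul a := Subtype.ext (by
    change a.1 * φ.lin 0 = 0
    rw [map_zero, mul_zero])

/-- `A` is a two-sided projective `B`-supermodule through `φ`: the left module `φ(1) A` and the
right module `A φ(1)` are projective. (When `φ(1) = 1` these are both `A`; in general they are the
summands of `A` on which the identity of `B` acts as the identity, and `B` acts by zero on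
the complementary summands.) -/
def IsTwoSidedProjective : Prop :=
  (GSMod.res φ (GSMod.regular A)).IsProjective ∧
    Module.Projective B.carrierᵐᵒᵖ (RightCarrier φ)

end TwoSided

/-! ### Grothendieck groups -/

namespace GSMod

variable {B : GSAlg F}

/-- The zero supermodule. -/
def zeroMod (B : GSAlg F) : GSMod B := pi (ι := Empty) fun i => i.elim

instance : Subsingleton (zeroMod B).carrier :=
  inferInstanceAs (Subsingleton (∀ i : Empty, (i.elim : GSMod B).carrier))

theorem shift_zero_iso (M : GSMod B) : Nonempty (M ≅ M.shift 0 0) :=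
  ⟨mkIso (N := M.shift 0 0)
    { toFun := fun m => (m : M.ParityTwist 0)
      invFun := fun m => (m : M.carrier)
      map_add' := fun _ _ => rfl
      map_smul' := fun b m => by
        have h : B.parityHom 0 b = b := by
          refine hom_induction B.internal (p := fun b => B.parityHom 0 b = b)
            (fun d x hx => ?_) (fun x y hx hy => by rw [map_add, hx, hy]) b
          rw [B.parityHom_of_mem 0 hx, ksign_zero_left, one_smul]
        change b • m = B.parityHom 0 b • m
        rw [h]
      left_inv := fun _ => rfl
      right_inv := fun _ => rfl }
    (fun {d m} h => by
      change m ∈ M.gr (d - (0, 0))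
      rwa [Prod.mk_zero_zero, sub_zero])
    (fun {d m} h => by
      change m ∈ M.gr (d - (0, 0)) at h
      rwa [Prod.mk_zero_zero, sub_zero] at h)⟩

theorem shift_shift_iso (M : GSMod B) (n n' : ℤ) (σ σ' : ZMod 2) :
    Nonempty ((M.shift n σ).shift n' σ' ≅ M.shift (n + n') (σ + σ')) :=
  ⟨mkIso (M := (M.shift n σ).shift n' σ') (N := M.shift (n + n') (σ + σ'))
    { toFun := fun m => (m : M.ParityTwist (σ + σ'))
      invFun := fun m => (m : M.carrier)
      map_add' := fun _ _ => rfl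
      map_smul' := fun b m => by
        have h : B.parityHom (σ + σ') b = B.parityHom σ (B.parityHom σ' b) := by
          refine hom_induction B.internal
            (p := fun b => B.parityHom (σ + σ') b = B.parityHom σ (B.parityHom σ' b))
            (fun d x hx => ?_) (fun x y hx hy => by simp only [map_add, hx, hy]) b
          rw [B.parityHom_of_mem _ hx, B.parityHom_of_mem _ hx, map_zsmul,
            B.parityHom_of_mem _ hx, smul_smul, ksign_add_left, mul_comm]
        change B.parityHom σ (B.parityHom σ' b) • (show M.carrier from m) =
          B.parityHom (σ + σ') b • (show M.carrier from m)
        rw [h]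
      left_inv := fun _ => rfl
      right_inv := fun _ => rfl }
    (fun {d m} h => by
      change m ∈ M.gr (d - (n', σ') - (n, σ)) at h
      change m ∈ M.gr (d - (n + n', σ + σ'))
      rwa [sub_sub, add_comm, Prod.mk_add_mk] at h)
    (fun {d m} h => by
      change m ∈ M.gr (d - (n', σ') - (n, σ))
      change m ∈ M.gr (d - (n + n', σ + σ')) at h
      rwa [sub_sub, add_comm (n', σ'), Prod.mk_add_mk])⟩

theorem IsProjective.shift {P : GSMod B} (hP : P.IsProjective) (n : ℤ) (σ : ZMod 2) :
    (P.shift n σ).IsProjective := by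
  let e : B.carrier ≃+* B.carrier :=
    { toFun := B.parityHom σ
      invFun := B.parityHom σ
      left_inv := B.parityHom_parityHom σ
      right_inv := B.parityHom_parityHom σ
      map_mul' := map_mul _
      map_add' := map_add _ }
  have : Module.Projective B.carrier P.carrier := hP
  have : RingHomInvPair (e : B.carrier →+* B.carrier) (e : B.carrier →+* B.carrier) :=
    ⟨RingHom.ext (B.parityHom_parityHom σ), RingHom.ext (B.parityHom_parityHom σ)⟩
  let f : P.carrier ≃ₛₗ[(e : B.carrier →+* B.carrier)] P.ParityTwist σ :=
    { toFun := fun m => (m : P.ParityTwist σ)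
      invFun := fun m => (m : P.carrier)
      map_add' := fun _ _ => rfl
      map_smul' := fun b m => by
        change b • m = B.parityHom σ (B.parityHom σ b) • m
        rw [B.parityHom_parityHom]
      left_inv := fun _ => rfl
      right_inv := fun _ => rfl }
  exact Module.Projective.of_equiv f

theorem IsProjective.zeroMod : (zeroMod B).IsProjective := by
  change Module.Projective B.carrier (GSMod.zeroMod B).carrier
  infer_instance

end GSMod

section Groth

/-- The ring `ℤ[q, q⁻¹, π] / (π² - 1)`, as the group ring of `ℤ × ℤ/2`: the monomial `q ^ n π ^ ε`
is the element `(n, ε)` of the group. -/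
abbrev Zqπ : Type := AddMonoidAlgebra ℤ Deg

/-- The monomial `q ^ n π ^ ε`. -/
noncomputable def qmon (n : ℤ) (ε : ZMod 2) : Zqπ := AddMonoidAlgebra.single (n, ε) 1

/-- The monomial `q ^ n π ^ ε` as a unit. -/
noncomputable def qunit (n : ℤ) (ε : ZMod 2) : Zqπˣ :=
  Units.map (AddMonoidAlgebra.of ℤ Deg) (toUnits (Multiplicative.ofAdd ((n, ε) : Deg)))

theorem qunit_val (n : ℤ) (ε : ZMod 2) : (qunit n ε : Zqπ) = qmon n ε := rfl

/-- The relations `[M₁] - [M₂] + [M₃] = 0` for short exact sequences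
`0 → M₁ → M₂ → M₃ → 0` of supermodules with the property `S`. -/
def grothRel (B : GSAlg F) (S : GSMod B → Prop) : AddSubgroup (FreeAbelianGroup {M // S M}) :=
  AddSubgroup.closure {t | ∃ (X Y Z : {M // S M}) (f : X.1 ⟶ Y.1) (g : Y.1 ⟶ Z.1),
    GSMod.ShortExact f g ∧
      t = FreeAbelianGroup.of X - FreeAbelianGroup.of Y + FreeAbelianGroup.of Z}

/-- The Grothendieck group of the category of supermodules with the property `S`. -/
def Groth (B : GSAlg F) (S : GSMod B → Prop) : Type (u + 1) :=
  FreeAbelianGroup {M // S M} ⧸ grothRel B S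

instance (B : GSAlg F) (S : GSMod B → Prop) : AddCommGroup (Groth B S) :=
  inferInstanceAs (AddCommGroup (FreeAbelianGroup {M // S M} ⧸ grothRel B S))

namespace Groth

variable {B : GSAlg F} {S : GSMod B → Prop}

/-- The class of a supermodule. -/
def cls (M : {M // S M}) : Groth B S :=
  QuotientAddGroup.mk' (grothRel B S) (FreeAbelianGroup.of M)

theorem cls_exact {X Y Z : {M // S M}} {f : X.1 ⟶ Y.1} {g : Y.1 ⟶ Z.1}
    (h : GSMod.ShortExact f g) : (cls X - cls Y + cls Z : Groth B S) = 0 := by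
  have := (QuotientAddGroup.eq_zero_iff (N := grothRel B S) _).2
    (AddSubgroup.subset_closure ⟨X, Y, Z, f, g, h, rfl⟩)
  exact this

/-- A map that is additive on short exact sequences extends to the Grothendieck group. -/
def lift {X : Type w} [AddCommGroup X] (v : {M // S M} → X)
    (h : ∀ (X Y Z : {M // S M}) (f : X.1 ⟶ Y.1) (g : Y.1 ⟶ Z.1), GSMod.ShortExact f g →
      v X - v Y + v Z = 0) : Groth B S →+ X :=
  QuotientAddGroup.lift (grothRel B S) (FreeAbelianGroup.lift v) (by
    refine (AddSubgroup.closure_le _).2 ?_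
    rintro _ ⟨X, Y, Z, f, g, hfg, rfl⟩
    change FreeAbelianGroup.lift v _ = 0
    rw [map_add, map_sub, FreeAbelianGroup.lift_apply_of, FreeAbelianGroup.lift_apply_of,
      FreeAbelianGroup.lift_apply_of]
    exact h X Y Z f g hfg)

theorem lift_cls {X : Type w} [AddCommGroup X] (v : {M // S M} → X) (h) (M : {M // S M}) :
    lift v h (cls M) = v M :=
  FreeAbelianGroup.lift_apply_of v M

theorem addHom_ext {X : Type w} [AddCommGroup X] {f g : Groth B S →+ X}
    (h : ∀ M, f (cls M) = g (cls M)) : f = g := by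
  refine QuotientAddGroup.addMonoidHom_ext _ ?_
  ext M
  exact h M

theorem cls_zero (h : S (GSMod.zeroMod B)) : (cls ⟨GSMod.zeroMod B, h⟩ : Groth B S) = 0 := by
  have := cls_exact (S := S) (X := ⟨GSMod.zeroMod B, h⟩) (Y := ⟨GSMod.zeroMod B, h⟩)
    (Z := ⟨GSMod.zeroMod B, h⟩) (f := 𝟙 _) (g := 𝟙 _)
    ⟨fun _ _ _ => Subsingleton.elim _ _, fun x => ⟨fun _ => ⟨x, rfl⟩, fun _ =>
      Subsingleton.elim _ _⟩, fun x => ⟨x, rfl⟩⟩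
  simpa using this

theorem cls_iso (h : S (GSMod.zeroMod B)) {M N : {M // S M}} (e : M.1 ≅ N.1) :
    (cls M : Groth B S) = cls N := by
  have h1 : ∀ m, e.inv.lin (e.hom.lin m) = m := fun m => by
    rw [← GSMod.comp_lin, e.hom_inv_id, GSMod.id_lin]
  have h2 : ∀ m, e.hom.lin (e.inv.lin m) = m := fun m => by
    rw [← GSMod.comp_lin, e.inv_hom_id, GSMod.id_lin]
  have := cls_exact (S := S) (X := M) (Y := N) (Z := ⟨GSMod.zeroMod B, h⟩) (f := e.hom)
    (g := ⟨0, fun _ => zero_mem _⟩)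
    ⟨Function.LeftInverse.injective h1, fun x => ⟨fun _ => ⟨e.inv.lin x, h2 x⟩, fun _ => rfl⟩,
      fun x => ⟨0, Subsingleton.elim _ _⟩⟩
  rw [cls_zero, add_zero, sub_eq_zero] at this
  exact this

/-- Properties of supermodules that hold for zero and are stable under shifts. -/
structure ShiftStable (S : GSMod B → Prop) : Prop where
  zero : S (GSMod.zeroMod B)
  shift : ∀ {M : GSMod B}, S M → ∀ n σ, S (M.shift n σ)

/-- The endomorphism `[M] ↦ [M{n, σ}]` of a Grothendieck group. -/
noncomputable def shiftEnd (hS : ShiftStable S) (d : Deg) : Module.End ℤ (Groth B S) :=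
  (lift (fun M => cls ⟨M.1.shift d.1 d.2, hS.shift M.2 d.1 d.2⟩)
    fun X Y Z f g h => cls_exact
      (X := ⟨X.1.shift d.1 d.2, hS.shift X.2 d.1 d.2⟩)
      (Y := ⟨Y.1.shift d.1 d.2, hS.shift Y.2 d.1 d.2⟩)
      (Z := ⟨Z.1.shift d.1 d.2, hS.shift Z.2 d.1 d.2⟩)
      (f := (GSMod.shiftFunctor B d.1 d.2).map f) (g := (GSMod.shiftFunctor B d.1 d.2).map g)
      h).toIntLinearMap

theorem shiftEnd_cls (hS : ShiftStable S) (d : Deg) (M : {M // S M}) :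
    shiftEnd hS d (cls M) = cls ⟨M.1.shift d.1 d.2, hS.shift M.2 d.1 d.2⟩ :=
  lift_cls (fun M => (cls ⟨M.1.shift d.1 d.2, hS.shift M.2 d.1 d.2⟩ : Groth B S))
    (fun X Y Z f g h => cls_exact
      (X := ⟨X.1.shift d.1 d.2, hS.shift X.2 d.1 d.2⟩)
      (Y := ⟨Y.1.shift d.1 d.2, hS.shift Y.2 d.1 d.2⟩)
      (Z := ⟨Z.1.shift d.1 d.2, hS.shift Z.2 d.1 d.2⟩)
      (f := (GSMod.shiftFunctor B d.1 d.2).map f) (g := (GSMod.shiftFunctor B d.1 d.2).map g)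
      h) M

theorem end_ext {f g : Module.End ℤ (Groth B S)} (h : ∀ M, f (cls M) = g (cls M)) : f = g := by
  have := addHom_ext (f := f.toAddMonoidHom) (g := g.toAddMonoidHom) h
  exact LinearMap.ext fun x => DFunLike.congr_fun this x

/-- The action of the group of degrees on a Grothendieck group by shifts. -/
noncomputable def shiftHom (hS : ShiftStable S) :
    Multiplicative Deg →* Module.End ℤ (Groth B S) where
  toFun d := shiftEnd hS d.toAdd
  map_one' := end_ext fun M => by
    rw [shiftEnd_cls]
    exact cls_iso hS.zero (GSMod.shift_zero_iso M.1).some.symm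
  map_mul' d e := end_ext fun M => by
    rw [Module.End.mul_apply, shiftEnd_cls, shiftEnd_cls, shiftEnd_cls]
    refine (cls_iso hS.zero ?_).symm
    rw [mul_comm d e]
    exact (GSMod.shift_shift_iso M.1 _ _ _ _).some

/-- The action of `ℤ[q, q⁻¹, π] / (π² - 1)` on a Grothendieck group for which the monomial of
degree `d` acts as the shift by `s d`. -/
noncomputable def monHom (hS : ShiftStable S) (s : Deg →+ Deg) :
    Zqπ →+* Module.End ℤ (Groth B S) :=
  (AddMonoidAlgebra.lift ℤ (Module.End ℤ (Groth B S)) Deg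
    ((shiftHom hS).comp s.toMultiplicative)).toRingHom

theorem monHom_qmon (hS : ShiftStable S) (s : Deg →+ Deg) (n : ℤ) (ε : ZMod 2) :
    monHom hS s (qmon n ε) = shiftEnd hS (s (n, ε)) :=
  (AddMonoidAlgebra.lift_single _ _ _).trans (one_smul _ _)

end Groth

theorem shiftStable_true (B : GSAlg F) : Groth.ShiftStable (fun _ : GSMod B => True) :=
  ⟨trivial, fun _ _ _ => trivial⟩

theorem shiftStable_isProjective (B : GSAlg F) :
    Groth.ShiftStable (fun M : GSMod B => M.IsProjective) :=
  ⟨GSMod.IsProjective.zeroMod, fun h n σ => h.shift n σ⟩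

/-- The Grothendieck group of all finitely generated graded supermodules. -/
def GPrime (B : GSAlg F) : Type (u + 1) := Groth B fun _ => True

/-- The Grothendieck group of finitely generated graded projective supermodules. -/
def KPrime (B : GSAlg F) : Type (u + 1) := Groth B fun M => M.IsProjective

instance (B : GSAlg F) : AddCommGroup (GPrime B) :=
  inferInstanceAs (AddCommGroup (Groth B fun _ => True))

instance (B : GSAlg F) : AddCommGroup (KPrime B) :=
  inferInstanceAs (AddCommGroup (Groth B fun M => M.IsProjective))

/-- The action of `ℤ[q, q⁻¹, π] / (π² - 1)` on `G₀'(B)`: `q ^ n π ^ ε [M] = [M{n, ε}]`. -/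
noncomputable instance (B : GSAlg F) : Module Zqπ (GPrime B) :=
  Module.compHom (Groth B fun _ => True)
    (Groth.monHom (shiftStable_true B) (AddMonoidHom.id Deg))

/-- The map `q ^ n π ^ ε ↦ q ^ (-n) π ^ ε`, on degrees. -/
def negDeg : Deg →+ Deg := AddMonoidHom.prodMap (-AddMonoidHom.id ℤ) (AddMonoidHom.id (ZMod 2))

/-- The action of `ℤ[q, q⁻¹, π] / (π² - 1)` on `K₀'(B)`: `q ^ n π ^ ε [P] = [P{-n, ε}]`. -/
noncomputable instance (B : GSAlg F) : Module Zqπ (KPrime B) :=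
  Module.compHom (Groth B fun M => M.IsProjective)
    (Groth.monHom (shiftStable_isProjective B) negDeg)

/-- The class `[M]` of a supermodule. -/
def gcls {B : GSAlg F} (M : GSMod B) : GPrime B := Groth.cls (S := fun _ => True) ⟨M, trivial⟩

/-- The class `[P]` of a projective supermodule. -/
def kcls {B : GSAlg F} (P : {P : GSMod B // P.IsProjective}) : KPrime B :=
  Groth.cls (S := fun M => M.IsProjective) P

theorem qmon_smul_gcls {B : GSAlg F} (n : ℤ) (ε : ZMod 2) (M : GSMod B) :
    qmon n ε • gcls M = gcls (M.shift n ε) := by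
  change Groth.monHom (shiftStable_true B) (AddMonoidHom.id Deg) (qmon n ε) (gcls M) = _
  rw [Groth.monHom_qmon]
  exact Groth.shiftEnd_cls (shiftStable_true B) (n, ε) ⟨M, trivial⟩

theorem qmon_smul_kcls {B : GSAlg F} (n : ℤ) (ε : ZMod 2)
    (P : {P : GSMod B // P.IsProjective}) :
    qmon n ε • kcls P = kcls ⟨P.1.shift (-n) ε, P.2.shift (-n) ε⟩ := by
  change Groth.monHom (shiftStable_isProjective B) negDeg (qmon n ε) (kcls P) = _
  rw [Groth.monHom_qmon]
  exact Groth.shiftEnd_cls (shiftStable_isProjective B) (-n, ε) P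

/-- The graded dimension of `HOM_B(P, M)`, an element of `ℤ[q, q⁻¹, π] / (π² - 1)`. -/
noncomputable def grdimHom {B : GSAlg F} (P M : GSMod B) : Zqπ :=
  ∑ᶠ d : Deg, (Module.finrank F (GSMod.HOM P M d) : ℤ) • qmon d.1 d.2

/-- The ideal generated by `2 X - 1` and `π - 1` if `Q` holds, and by `X` otherwise. -/
noncomputable def groundIdeal (Q : Prop) : Ideal (Polynomial Zqπ) :=
  Ideal.span {p | (¬ Q ∧ p = Polynomial.X) ∨ (Q ∧ p = 2 * Polynomial.X - 1) ∨
    (Q ∧ p = Polynomial.C (qmon 0 1) - 1)}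

/-- The ground ring `𝕜`: it is `ℤ[1/2, q, q⁻¹] = ℤ[q, q⁻¹, π][1/2] / (π - 1)` if `Q` holds, and
`ℤ[q, q⁻¹, π] / (π² - 1)` otherwise. -/
def GroundRing (Q : Prop) : Type := Polynomial Zqπ ⧸ groundIdeal Q

noncomputable instance (Q : Prop) : CommRing (GroundRing Q) :=
  inferInstanceAs (CommRing (Polynomial Zqπ ⧸ groundIdeal Q))

noncomputable instance (Q : Prop) : Algebra Zqπ (GroundRing Q) :=
  inferInstanceAs (Algebra Zqπ (Polynomial Zqπ ⧸ groundIdeal Q))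

variable (k : Type) [CommRing k] [Algebra Zqπ k]

/-- `G₀(B) = 𝕜 ⊗ G₀'(B)`. -/
def G₀ (B : GSAlg F) : Type (u + 1) := k ⊗[Zqπ] GPrime B

/-- `K₀(B) = 𝕜 ⊗ K₀'(B)`. -/
def K₀ (B : GSAlg F) : Type (u + 1) := k ⊗[Zqπ] KPrime B

noncomputable instance (B : GSAlg F) : AddCommGroup (G₀ k B) :=
  inferInstanceAs (AddCommGroup (k ⊗[Zqπ] GPrime B))

noncomputable instance (B : GSAlg F) : AddCommGroup (K₀ k B) :=
  inferInstanceAs (AddCommGroup (k ⊗[Zqπ] KPrime B))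

noncomputable instance (B : GSAlg F) : Module k (G₀ k B) :=
  inferInstanceAs (Module k (k ⊗[Zqπ] GPrime B))

noncomputable instance (B : GSAlg F) : Module k (K₀ k B) :=
  inferInstanceAs (Module k (k ⊗[Zqπ] KPrime B))

variable {B : GSAlg F}

/-- The class of `M` in `G₀(B)`. -/
noncomputable def clsG (M : GSMod B) : G₀ k B :=
  (1 ⊗ₜ[Zqπ] gcls M : k ⊗[Zqπ] GPrime B)

/-- The class of a projective supermodule `P` in `K₀(B)`. -/
noncomputable def clsK (P : {P : GSMod B // P.IsProjective}) : K₀ k B :=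
  (1 ⊗ₜ[Zqπ] kcls P : k ⊗[Zqπ] KPrime B)

/-- The bilinear map with prescribed values on two families of vectors (when these span, it is
unique). -/
noncomputable def bilinOf {k : Type*} [CommRing k] {I J X Y Z : Type*} [AddCommGroup X] [Module k X]
    [AddCommGroup Y] [Module k Y] [AddCommGroup Z] [Module k Z] (x : I → X) (y : J → Y)
    (v : I → J → Z) : X →ₗ[k] Y →ₗ[k] Z :=
  open Classical in
  if h : ∃ f : X →ₗ[k] Y →ₗ[k] Z, ∀ i j, f (x i) (y j) = v i j then h.choose else 0

/-- The pairing `K₀(B) × G₀(B) → 𝕜` with `⟨[P], [M]⟩ = grdim HOM_B(P, M)`. -/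
noncomputable def pairing (B : GSAlg F) : K₀ k B →ₗ[k] G₀ k B →ₗ[k] k :=
  bilinOf (clsK k) (clsG k) fun P M => algebraMap Zqπ k (grdimHom P.1 M)

end Groth

/-! ### Twisted Hopf algebras and the twisted Heisenberg double -/

section Hopf

/-- The quadruples `(a, b, c, d)` with `a + b = l₁`, `c + d = l₂`, `a + c = m₁`, `b + d = m₂`. -/
@[ext] structure Quad {Λ : Type} [AddCommMonoid Λ] (l₁ l₂ m₁ m₂ : Λ) where
  a : Λ
  b : Λ
  c : Λ
  d : Λ
  hl₁ : a + b = l₁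
  hl₂ : c + d = l₂
  hm₁ : a + c = m₁
  hm₂ : b + d = m₂

instance {Λ : Type} [AddCommMonoid Λ] [Finset.HasAntidiagonal Λ] (l₁ l₂ m₁ m₂ : Λ) :
    Finite (Quad l₁ l₂ m₁ m₂) := by
  refine Finite.of_injective (β := Finset.HasAntidiagonal.antidiagonal l₁ × Finset.HasAntidiagonal.antidiagonal l₂)
    (fun x => (⟨(x.a, x.b), Finset.HasAntidiagonal.mem_antidiagonal.2 x.hl₁⟩,
      ⟨(x.c, x.d), Finset.HasAntidiagonal.mem_antidiagonal.2 x.hl₂⟩)) ?_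
  intro x y h
  simp only [Prod.mk.injEq, Subtype.mk.injEq] at h
  exact Quad.ext h.1.1 h.1.2 h.2.1 h.2.2

noncomputable instance {Λ : Type} [AddCommMonoid Λ] [Finset.HasAntidiagonal Λ]
    (l₁ l₂ m₁ m₂ : Λ) : Fintype (Quad l₁ l₂ m₁ m₂) := Fintype.ofFinite _

/-- A `Λ`-graded `k`-module `H = ⨁ H_l` together with graded linear maps: a multiplication and a
comultiplication (given by their components `H_l ⊗ H_m → H_n` and `H_n → H_l ⊗ H_m` for
`l + m = n`), a unit `1 ∈ H_0` and a counit (given by its component `H_0 → k`, the other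
components being zero). -/
structure HopfData (k : Type) [CommRing k] (Λ : Type) [AddCommMonoid Λ] where
  carrier : Λ → Type w
  [addCommGroup : ∀ l, AddCommGroup (carrier l)]
  [module : ∀ l, Module k (carrier l)]
  mul : ∀ {l m n : Λ}, l + m = n → carrier l →ₗ[k] carrier m →ₗ[k] carrier n
  one : carrier 0
  comul : ∀ {l m n : Λ}, l + m = n → carrier n →ₗ[k] carrier l ⊗[k] carrier m
  counit : carrier 0 →ₗ[k] k

attribute [instance] HopfData.addCommGroup HopfData.module

variable {k : Type} [CommRing k] {Λ : Type} [AddCommMonoid Λ]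

namespace HopfData

variable (H : HopfData.{w} k Λ)

/-- The map `(a₁ ⊗ a₂) ⊗ (b₁ ⊗ b₂) ↦ a₁ b₁ ⊗ a₂ b₂`. -/
noncomputable def mulTensor {a b c d m n : Λ} (h : a + c = m) (h' : b + d = n) :
    (H.carrier a ⊗[k] H.carrier b) ⊗[k] (H.carrier c ⊗[k] H.carrier d) →ₗ[k]
      H.carrier m ⊗[k] H.carrier n :=
  TensorProduct.map (TensorProduct.lift (H.mul h)) (TensorProduct.lift (H.mul h')) ∘ₗ
    (TensorProduct.tensorTensorTensorComm k (H.carrier a) (H.carrier b) (H.carrier c)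
      (H.carrier d)).toLinearMap

/-- `H` is a `(c, χ)`-Hopf algebra with `χ = (χ', χ'')`: the graded pieces are free of finite rank,
`H` is an algebra and a coalgebra, it is connected, and the comultiplication is a homomorphism of
algebras to `H ⊗ H` with the multiplication
`(a₁ ⊗ a₂) (b₁ ⊗ b₂) = c ^ (χ'(|a₂|, |b₁|) + χ''(|a₁|, |b₂|)) a₁ b₁ ⊗ a₂ b₂`. -/
structure IsTwistedHopf [Finset.HasAntidiagonal Λ] (c : kˣ) (χ' χ'' : Λ →+ Λ →+ ℤ) : Prop where
  free : ∀ l, Module.Free k (H.carrier l)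
  finite : ∀ l, Module.Finite k (H.carrier l)
  /-- `H_0 = k 1`. -/
  connected : ∀ x : H.carrier 0, ∃ r : k, x = r • H.one
  mul_assoc : ∀ {l m n p q r : Λ} (h₁ : l + m = p) (h₂ : p + n = r) (h₃ : m + n = q)
    (h₄ : l + q = r) (x : H.carrier l) (y : H.carrier m) (z : H.carrier n),
    H.mul h₂ (H.mul h₁ x y) z = H.mul h₄ x (H.mul h₃ y z)
  one_mul : ∀ {l : Λ} (h : 0 + l = l) (x : H.carrier l), H.mul h H.one x = x
  mul_one : ∀ {l : Λ} (h : l + 0 = l) (x : H.carrier l), H.mul h x H.one = x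
  comul_coassoc : ∀ {l m n p q r : Λ} (h₁ : l + m = p) (h₂ : p + n = r) (h₃ : m + n = q)
    (h₄ : l + q = r) (x : H.carrier r),
    TensorProduct.assoc k (H.carrier l) (H.carrier m) (H.carrier n)
      ((H.comul h₁).rTensor (H.carrier n) (H.comul h₂ x)) =
      (H.comul h₃).lTensor (H.carrier l) (H.comul h₄ x)
  counit_comul : ∀ {l : Λ} (h : 0 + l = l) (x : H.carrier l),
    TensorProduct.lid k (H.carrier l) (H.counit.rTensor (H.carrier l) (H.comul h x)) = x
  comul_counit : ∀ {l : Λ} (h : l + 0 = l) (x : H.carrier l),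
    TensorProduct.rid k (H.carrier l) (H.counit.lTensor (H.carrier l) (H.comul h x)) = x
  counit_one : H.counit H.one = 1
  comul_one : H.comul (add_zero 0) H.one = H.one ⊗ₜ[k] H.one
  comul_mul : ∀ {l₁ l₂ m₁ m₂ n : Λ} (hl : l₁ + l₂ = n) (hm : m₁ + m₂ = n)
    (x : H.carrier l₁) (y : H.carrier l₂),
    H.comul hm (H.mul hl x y) = ∑ s : Quad l₁ l₂ m₁ m₂,
      (c ^ (χ' s.b s.c + χ'' s.a s.d) : kˣ) •
        H.mulTensor s.hm₁ s.hm₂ (H.comul s.hl₁ x ⊗ₜ[k] H.comul s.hl₂ y)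

end HopfData

/-- The pairing `⟨x ⊗ y, a ⊗ b⟩ = ⟨x, a⟩ ⟨y, b⟩`. -/
noncomputable def tensorPairing {X Y A B : Type w} [AddCommGroup X] [Module k X] [AddCommGroup Y]
    [Module k Y] [AddCommGroup A] [Module k A] [AddCommGroup B] [Module k B]
    (p : X →ₗ[k] A →ₗ[k] k) (q : Y →ₗ[k] B →ₗ[k] k) : X ⊗[k] Y →ₗ[k] A ⊗[k] B →ₗ[k] k :=
  TensorProduct.lift (LinearMap.mk₂ k
    (fun x y => LinearMap.mul' k k ∘ₗ TensorProduct.map (p x) (q y))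
    (fun x x' y => by rw [map_add, TensorProduct.map_add_left, LinearMap.comp_add])
    (fun r x y => by rw [map_smul, TensorProduct.map_smul_left, LinearMap.comp_smul])
    (fun x y y' => by rw [map_add, TensorProduct.map_add_right, LinearMap.comp_add])
    (fun r x y => by rw [map_smul, TensorProduct.map_smul_right, LinearMap.comp_smul]))

theorem tensorPairing_tmul {X Y A B : Type w} [AddCommGroup X] [Module k X] [AddCommGroup Y]
    [Module k Y] [AddCommGroup A] [Module k A] [AddCommGroup B] [Module k B]
    (p : X →ₗ[k] A →ₗ[k] k) (q : Y →ₗ[k] B →ₗ[k] k) (x : X) (y : Y) (a : A) (b : B) :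
    tensorPairing p q (x ⊗ₜ y) (a ⊗ₜ b) = p x a * q y b := rfl

/-- The pairing `p` makes `(H⁺, H⁻)` a `(c, γ)`-dual pair with `γ = (γ', γ'')`: it is a
`(c, γ)`-twisted Hopf pairing `H⁻ × H⁺ → k` which is perfect in each degree (and it vanishes on
elements of distinct degrees). -/
structure IsDualPairing (c : kˣ) (γ' γ'' : Λ →+ Λ →+ ℤ) (G K : HopfData.{w} k Λ)
    (p : ∀ l, K.carrier l →ₗ[k] G.carrier l →ₗ[k] k) : Prop where
  perfect : ∀ l, (p l).IsPerfPair
  mul_left : ∀ {l m n : Λ} (h : l + m = n) (x : K.carrier l) (y : K.carrier m) (a : G.carrier n),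
    p n (K.mul h x y) a =
      (c ^ γ' l m : kˣ) • tensorPairing (p l) (p m) (x ⊗ₜ[k] y) (G.comul h a)
  mul_right : ∀ {l m n : Λ} (h : l + m = n) (x : K.carrier n) (a : G.carrier l) (b : G.carrier m),
    p n x (G.mul h a b) =
      (c ^ γ'' l m : kˣ) • tensorPairing (p l) (p m) (K.comul h x) (a ⊗ₜ[k] b)
  one_left : ∀ a : G.carrier 0, p 0 K.one a = G.counit a
  one_right : ∀ x : K.carrier 0, p 0 x G.one = K.counit x

/-- A pair of `Λ`-graded modules with operations and a pairing that is perfect in each degree. -/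
structure DualPair (k : Type) [CommRing k] (Λ : Type) [AddCommMonoid Λ] where
  pos : HopfData.{w} k Λ
  neg : HopfData.{w} k Λ
  pair : ∀ l, neg.carrier l →ₗ[k] pos.carrier l →ₗ[k] k
  [perfect : ∀ l, (pair l).IsPerfPair]

attribute [instance] DualPair.perfect

namespace DualPair

variable (D : DualPair.{w} k Λ)

/-- The component `H⁺_n → H⁺_l` of the adjoint `R_x^*` of right multiplication by `x ∈ H⁻_m`, where
`l + m = n`: it is determined by `⟨y, R_x^*(a)⟩ = ⟨y x, a⟩`. -/
noncomputable def rStar {l m n : Λ} (h : l + m = n) :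
    D.neg.carrier m →ₗ[k] D.pos.carrier n →ₗ[k] D.pos.carrier l :=
  LinearMap.mk₂ k
    (fun x a => (D.pair l).flip.toPerfPair.symm ((D.pair n).flip a ∘ₗ (D.neg.mul h).flip x))
    (fun x x' a => by rw [map_add, LinearMap.comp_add, map_add])
    (fun r x a => by rw [map_smul, LinearMap.comp_smul, map_smul])
    (fun x a a' => by rw [map_add, LinearMap.add_comp, map_add])
    (fun r x a => by rw [map_smul, LinearMap.smul_comp, map_smul])

theorem pair_rStar {l m n : Λ} (h : l + m = n) (y : D.neg.carrier l) (x : D.neg.carrier m)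
    (a : D.pos.carrier n) : D.pair l y (D.rStar h x a) = D.pair n (D.neg.mul h y x) a := by
  have := LinearMap.congr_fun ((D.pair l).flip.toPerfPair.apply_symm_apply
    ((D.pair n).flip a ∘ₗ (D.neg.mul h).flip x)) y
  exact this

variable [Finset.HasAntidiagonal Λ] [DecidableEq Λ]

/-- The underlying module `H⁺ ⊗ H⁻` of the twisted Heisenberg double, as the direct sum of its
bihomogeneous pieces. -/
abbrev Double : Type w := ⨁ i : Λ × Λ, D.pos.carrier i.1 ⊗[k] D.neg.carrier i.2

/-- The Fock space `H⁺`. -/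
abbrev Fock : Type w := ⨁ l : Λ, D.pos.carrier l

/-- The element `a # x` for homogeneous `a` and `x`. -/
noncomputable def sharp {l m : Λ} (a : D.pos.carrier l) (x : D.neg.carrier m) : D.Double :=
  DirectSum.lof k (Λ × Λ) (fun i => D.pos.carrier i.1 ⊗[k] D.neg.carrier i.2) (l, m) (a ⊗ₜ[k] x)

/-- A homogeneous element of the Fock space. -/
noncomputable def ofPos {l : Λ} (a : D.pos.carrier l) : D.Fock :=
  DirectSum.lof k Λ D.pos.carrier l a

/-- The map `(a ⊗ x) ⊗ (b ⊗ y) ↦ ∑ a R_{x₁}^*(b) ⊗ x₂ y`, the sum over the component of `Δ(x)`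
with `|x₁| = m₁`, `|x₂| = m₂`. -/
noncomputable def smashPiece {l m m₁ m₂ n n₁ p l' p' : Λ} (hm : m₁ + m₂ = m) (hn : n₁ + m₁ = n)
    (hl : l + n₁ = l') (hp : m₂ + p = p') :
    (D.pos.carrier l ⊗[k] D.neg.carrier m) ⊗[k] (D.pos.carrier n ⊗[k] D.neg.carrier p) →ₗ[k]
      D.pos.carrier l' ⊗[k] D.neg.carrier p' :=
  TensorProduct.map
      (TensorProduct.lift (D.pos.mul hl) ∘ₗ
        (TensorProduct.lift (D.rStar hn)).lTensor (D.pos.carrier l) ∘ₗ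
        (TensorProduct.assoc k (D.pos.carrier l) (D.neg.carrier m₁)
          (D.pos.carrier n)).toLinearMap)
      (TensorProduct.lift (D.neg.mul hp)) ∘ₗ
    (TensorProduct.tensorTensorTensorComm k (D.pos.carrier l ⊗[k] D.neg.carrier m₁)
      (D.neg.carrier m₂) (D.pos.carrier n) (D.neg.carrier p)).toLinearMap ∘ₗ
    ((TensorProduct.assoc k (D.pos.carrier l) (D.neg.carrier m₁)
        (D.neg.carrier m₂)).symm.toLinearMap ∘ₗ
      (D.neg.comul hm).lTensor (D.pos.carrier l)).rTensor
        (D.pos.carrier n ⊗[k] D.neg.carrier p)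

/-- The multiplication of the twisted Heisenberg double of a compatible `(c, γ)`-dual pair, where
`γ = (γ', γ'')` and `H⁻` is a `(c, ξ)`-Hopf algebra with `ξ = (ξ', ξ'')`:
`(a # x) (b # y) = ∑ c ^ (γ''(|b|, |x₂|) + ξ''(|b| - |x₁|, |x₂|)) a R_{x₁}^*(b) # x₂ y`.
The sum is over the components of `Δ(x)` with `|x₁| = s.1`, `|x₂| = s.2`, and over the degrees
`|b| - |x₁| = t.1`; the terms with `|x₁| ≰ |b|` vanish. -/
noncomputable def smash (c : kˣ) (γ'' ξ'' : Λ →+ Λ →+ ℤ) : D.Double →ₗ[k] D.Double →ₗ[k] D.Double :=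
  DirectSum.toModule k (Λ × Λ) (D.Double →ₗ[k] D.Double) fun i => LinearMap.flip <|
    DirectSum.toModule k (Λ × Λ)
      (D.pos.carrier i.1 ⊗[k] D.neg.carrier i.2 →ₗ[k] D.Double) fun j => LinearMap.flip <|
      TensorProduct.curry <|
        ∑ s : Finset.HasAntidiagonal.antidiagonal i.2, ∑ t : Finset.HasAntidiagonal.antidiagonal j.1,
          if h : t.1.2 = s.1.1 then
            (c ^ (γ'' j.1 s.1.2 + ξ'' t.1.1 s.1.2) : kˣ) •
              (DirectSum.lof k (Λ × Λ) (fun i => D.pos.carrier i.1 ⊗[k] D.neg.carrier i.2)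
                  (i.1 + t.1.1, s.1.2 + j.2) ∘ₗ
                D.smashPiece (Finset.HasAntidiagonal.mem_antidiagonal.1 s.2)
                  (h ▸ Finset.HasAntidiagonal.mem_antidiagonal.1 t.2) rfl rfl)
          else 0

/-- The action of the twisted Heisenberg double on the Fock space,
`(a # x) (b) = a R_x^*(b)`. -/
noncomputable def fock : D.Double →ₗ[k] D.Fock →ₗ[k] D.Fock :=
  DirectSum.toModule k (Λ × Λ) (D.Fock →ₗ[k] D.Fock) fun i => LinearMap.flip <|
    DirectSum.toModule k Λ (D.pos.carrier i.1 ⊗[k] D.neg.carrier i.2 →ₗ[k] D.Fock) fun n =>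
      LinearMap.flip <| TensorProduct.curry <|
        ∑ t : Finset.HasAntidiagonal.antidiagonal n,
          if h : t.1.2 = i.2 then
            DirectSum.lof k Λ D.pos.carrier (i.1 + t.1.1) ∘ₗ
              TensorProduct.lift (D.pos.mul rfl) ∘ₗ
              (TensorProduct.lift (D.rStar (h ▸ Finset.HasAntidiagonal.mem_antidiagonal.1 t.2))).lTensor
                (D.pos.carrier i.1) ∘ₗ
              (TensorProduct.assoc k (D.pos.carrier i.1) (D.neg.carrier i.2)
                (D.pos.carrier n)).toLinearMap
          else 0

end DualPair

end Hopf

/-! ### Towers of graded superalgebras -/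

theorem GSMod.regular_isProjective (B : GSAlg F) : (GSMod.regular B).IsProjective := by
  change Module.Projective B.carrier B.carrier
  infer_instance

section Classes

variable (k : Type) [CommRing k] [Algebra Zqπ k] {B : GSAlg F}

open Classical in
/-- The class in `K₀(B)` of a supermodule that is projective (and `0` for all others). -/
noncomputable def clsKOf (M : GSMod B) : K₀ k B :=
  if h : M.IsProjective then clsK k ⟨M, h⟩ else 0

/-- The linear map with prescribed values on a family of vectors (when these span, it is
unique). -/
noncomputable def linOf {k : Type*} [CommRing k] {I X Z : Type*} [AddCommGroup X] [Module k X]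
    [AddCommGroup Z] [Module k Z] (x : I → X) (v : I → Z) : X →ₗ[k] Z :=
  open Classical in
  if h : ∃ f : X →ₗ[k] Z, ∀ i, f (x i) = v i then h.choose else 0

/-- The graded dimension `∑ q ^ n π ^ ε dim M_{n, ε}`. -/
noncomputable def grdim (M : GSMod B) : Zqπ :=
  ∑ᶠ d : Deg, (Module.finrank F (M.gr d) : ℤ) • qmon d.1 d.2

/-- The sum `∑ q ^ (-n) π ^ ε dim M_{n, ε}`. -/
noncomputable def grdimInv (M : GSMod B) : Zqπ :=
  ∑ᶠ d : Deg, (Module.finrank F (M.gr d) : ℤ) • qmon (-d.1) d.2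

end Classes

/-- A tower of graded superalgebras, indexed by `Λ`. The external multiplication is given by its
components `A_l ⊗ A_m → A_n` for `l + m = n`; it is associative and unital, and it is a homomorphism
of graded superalgebras (not necessarily preserving the identity element). -/
structure Tower (F : Type u) [Field F] (Λ : Type) [AddCommMonoid Λ] where
  A : Λ → GSAlg F
  ρ : ∀ {l m n : Λ}, l + m = n → GSAlg.Hom ((A l).tensor (A m)) (A n)
  assoc : ∀ {l m n p q r : Λ} (h₁ : l + m = p) (h₂ : p + n = r) (h₃ : m + n = q) (h₄ : l + q = r)
    (x : (A l).carrier) (y : (A m).carrier) (z : (A n).carrier),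
    (ρ h₂).lin (GSAlg.tmul ((ρ h₁).lin (GSAlg.tmul x y)) z) =
      (ρ h₄).lin (GSAlg.tmul x ((ρ h₃).lin (GSAlg.tmul y z)))
  one_mul : ∀ {l : Λ} (h : 0 + l = l) (x : (A l).carrier), (ρ h).lin (GSAlg.tmul 1 x) = x
  mul_one : ∀ {l : Λ} (h : l + 0 = l) (x : (A l).carrier), (ρ h).lin (GSAlg.tmul x 1) = x
  /-- `A_0` is the ground field. -/
  zero : Function.Bijective (algebraMap F (A 0).carrier)
  projective : ∀ {l m n : Λ} (h : l + m = n), IsTwoSidedProjective (ρ h)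
  /-- The pairing on `K₀(A_l) × G₀(A_l)` is perfect. -/
  perfect : ∀ l, (pairing (GroundRing (∃ l, (A l).HasTypeQ)) (A l)).IsPerfPair

namespace Tower

variable {Λ : Type} [AddCommMonoid Λ] (T : Tower F Λ)

/-- The ground ring `𝕜` of a tower: `ℤ[1/2, q, q⁻¹]` if some `A_l` has a simple graded supermodule
of type `Q`, and `ℤ[q, q⁻¹, π] / (π² - 1)` otherwise. -/
abbrev kk : Type := GroundRing (∃ l, (T.A l).HasTypeQ)

/-- The unit `q ^ d π ^ ε` of the ground ring. -/
noncomputable def unit (d : ℤ) (ε : ZMod 2) : T.kkˣ :=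
  Units.map (algebraMap Zqπ T.kk).toMonoidHom (qunit d ε)

/-- The class `[M]` in `G₀(A_l)`. -/
noncomputable def G {l : Λ} (M : GSMod (T.A l)) : G₀ T.kk (T.A l) := clsG T.kk M

/-- The class `[P]` in `K₀(A_l)` of a projective supermodule `P`. -/
noncomputable def K {l : Λ} (P : GSMod (T.A l)) : K₀ T.kk (T.A l) := clsKOf T.kk P

/-- The product `∇(M ⊠ N)`. -/
noncomputable def nabla {l m n : Λ} (h : l + m = n) (M : GSMod (T.A l)) (N : GSMod (T.A m)) :
    GSMod (T.A n) := (M.outer N).ind (T.ρ h)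

/-- The functor `Ind_M`. -/
noncomputable def Ind {l m n : Λ} (h : l + m = n) (M : GSMod (T.A l)) :
    GSMod (T.A m) ⥤ GSMod (T.A n) :=
  GSMod.outerFunctor M (T.A m) ⋙ GSMod.indFunctor (T.ρ h)

/-- The functor `Res_P = HOM(P, Res -)`. -/
noncomputable def Res {l m n : Λ} (h : l + m = n) (P : GSMod (T.A m)) :
    GSMod (T.A n) ⥤ GSMod (T.A l) :=
  GSMod.resFunctor (T.ρ h) ⋙ GSMod.homFunctor P (T.A l)

/-- The multiplication of `⨁ G₀(A_l)`, `[M] [N] = [∇(M ⊠ N)]`. -/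
noncomputable def mulG {l m n : Λ} (h : l + m = n) :
    G₀ T.kk (T.A l) →ₗ[T.kk] G₀ T.kk (T.A m) →ₗ[T.kk] G₀ T.kk (T.A n) :=
  bilinOf T.G T.G fun M N => T.G (T.nabla h M N)

/-- The multiplication of `⨁ K₀(A_l)`, `[P] [Q] = [∇(P ⊠ Q)]`. -/
noncomputable def mulK {l m n : Λ} (h : l + m = n) :
    K₀ T.kk (T.A l) →ₗ[T.kk] K₀ T.kk (T.A m) →ₗ[T.kk] K₀ T.kk (T.A n) :=
  bilinOf (fun P : {P : GSMod (T.A l) // P.IsProjective} => T.K P.1)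
    (fun Q : {Q : GSMod (T.A m) // Q.IsProjective} => T.K Q.1)
    fun P Q => T.K (T.nabla h P.1 Q.1)

/-- The map `G₀(A_l) ⊗ G₀(A_m) → G₀(A_l ⊗ A_m)`, `[M] ⊗ [N] ↦ [M ⊠ N]`. -/
noncomputable def boxG (l m : Λ) :
    G₀ T.kk (T.A l) ⊗[T.kk] G₀ T.kk (T.A m) →ₗ[T.kk] G₀ T.kk ((T.A l).tensor (T.A m)) :=
  TensorProduct.lift (bilinOf T.G T.G fun M N => clsG T.kk (GSMod.outer M N))

/-- The map `K₀(A_l) ⊗ K₀(A_m) → K₀(A_l ⊗ A_m)`, `[P] ⊗ [Q] ↦ [P ⊠ Q]`. -/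
noncomputable def boxK (l m : Λ) :
    K₀ T.kk (T.A l) ⊗[T.kk] K₀ T.kk (T.A m) →ₗ[T.kk] K₀ T.kk ((T.A l).tensor (T.A m)) :=
  TensorProduct.lift (bilinOf (fun P : {P : GSMod (T.A l) // P.IsProjective} => T.K P.1)
    (fun Q : {Q : GSMod (T.A m) // Q.IsProjective} => T.K Q.1)
    fun P Q => clsKOf T.kk (GSMod.outer P.1 Q.1))

/-- The tower is strong: `χ`, `d`, `ε` are the twist, `ψ` is the conjugation, `δ`, `σ` are the
shifts. The two axioms on functors are stated for each component of the direct sums of categories. -/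
structure Strong [Finset.HasAntidiagonal Λ] where
  χ' : Λ →+ Λ →+ ℤ
  χ'' : Λ →+ Λ →+ ℤ
  κ : Λ →+ Λ →+ ℤ
  d : ℤ
  ε : ZMod 2
  ψ : ∀ l, GSAlg.Aut (T.A l)
  δ : Λ → ℤ
  σ : Λ → ZMod 2
  δ_add : ∀ l m, δ (l + m) - δ l - δ m = d * κ l m
  σ_add : ∀ l m, σ (l + m) - σ l - σ m = ε * (κ l m : ZMod 2)
  /-- `∇` is right adjoint to `Ψ^{⊗2} {δ^{⊗2}, σ^{⊗2}} Δ Ψ⁻¹ {-δ, -σ}`. -/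
  adj : ∀ {l m n : Λ} (h : l + m = n), Nonempty
    ((GSMod.shiftFunctor (T.A n) (-δ n) (-σ n) ⋙ GSMod.resFunctor (ψ n).inv ⋙
      GSMod.resFunctor (T.ρ h) ⋙ GSMod.shiftFunctor _ (δ l + δ m) (σ l + σ m) ⋙
      GSMod.resFunctor ((ψ l).hom.tensor (ψ m).hom)) ⊣ GSMod.indFunctor (T.ρ h))
  /-- `Δ ∇ ≅ ∇^{⊗2} S₂₃ {χ} Δ^{⊗2}`. -/
  mackey : ∀ {l₁ l₂ m₁ m₂ n : Λ} (hl : l₁ + l₂ = n) (hm : m₁ + m₂ = n), Nonempty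
    (GSMod.indFunctor (T.ρ hl) ⋙ GSMod.resFunctor (T.ρ hm) ≅
      GSMod.piFunctor fun s : Quad l₁ l₂ m₁ m₂ =>
        GSMod.resFunctor ((T.ρ s.hl₁).tensor (T.ρ s.hl₂)) ⋙
        GSMod.shiftFunctor _ (d * χ' s.b s.c + d * χ'' s.a s.d)
          (ε * (χ' s.b s.c : ZMod 2) + ε * (χ'' s.a s.d : ZMod 2)) ⋙
        GSMod.swapFunctor (T.A s.a) (T.A s.b) (T.A s.c) (T.A s.d) ⋙
        GSMod.indFunctor ((T.ρ s.hm₁).tensor (T.ρ s.hm₂)))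

/-- The module `⨁ G₀(A_l)` with the operations induced by induction and restriction; the
comultiplication is a parameter. -/
noncomputable def hopfG (comul : ∀ {l m n : Λ}, l + m = n →
    G₀ T.kk (T.A n) →ₗ[T.kk] G₀ T.kk (T.A l) ⊗[T.kk] G₀ T.kk (T.A m)) :
    HopfData.{u + 1} T.kk Λ where
  carrier l := G₀ T.kk (T.A l)
  mul h := T.mulG h
  one := T.G (GSMod.regular (T.A 0))
  comul h := comul h
  counit := linOf T.G fun V => algebraMap Zqπ T.kk (grdim V)

/-- The module `⨁ K₀(A_l)` with the operations induced by induction and restriction; the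
comultiplication is a parameter. -/
noncomputable def hopfK (comul : ∀ {l m n : Λ}, l + m = n →
    K₀ T.kk (T.A n) →ₗ[T.kk] K₀ T.kk (T.A l) ⊗[T.kk] K₀ T.kk (T.A m)) :
    HopfData.{u + 1} T.kk Λ where
  carrier l := K₀ T.kk (T.A l)
  mul h := T.mulK h
  one := T.K (GSMod.regular (T.A 0))
  comul h := comul h
  counit := linOf (fun V : {V : GSMod (T.A 0) // V.IsProjective} => T.K V.1)
    fun V => algebraMap Zqπ T.kk (grdimInv V.1)

/-- The tower is dualizing, with a `(q ^ d π ^ ε, (0, κ))`-twisted Hopf pairing, and compatible. The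
comultiplications on `⨁ G₀(A_l)` and `⨁ K₀(A_l)` are the maps induced by restriction:
`Δ[M] = ∑ [Res M]`, where `G₀(A_l) ⊗ G₀(A_m)` is compared with `G₀(A_l ⊗ A_m)` through
`[M] ⊗ [N] ↦ [M ⊠ N]`, and similarly for `K₀`. Compatibility is the condition `χ' = -(γ')ᵀ`
on a choice of `χ = (χ', χ'')` for which `⨁ G₀(A_l)` is a `(q ^ d π ^ ε, χ)`-Hopf algebra; as
`γ' = 0`, it says `χ' = 0`. This `χ''` is the field `twist`. -/
structure Compatible [Finset.HasAntidiagonal Λ] (d : ℤ) (ε : ZMod 2) (κ : Λ →+ Λ →+ ℤ) where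
  comulG : ∀ {l m n : Λ}, l + m = n →
    G₀ T.kk (T.A n) →ₗ[T.kk] G₀ T.kk (T.A l) ⊗[T.kk] G₀ T.kk (T.A m)
  comulK : ∀ {l m n : Λ}, l + m = n →
    K₀ T.kk (T.A n) →ₗ[T.kk] K₀ T.kk (T.A l) ⊗[T.kk] K₀ T.kk (T.A m)
  comulG_cls : ∀ {l m n : Λ} (h : l + m = n) (M : GSMod (T.A n)),
    T.boxG l m (comulG h (T.G M)) = clsG T.kk (M.res (T.ρ h))
  comulK_cls : ∀ {l m n : Λ} (h : l + m = n) (P : GSMod (T.A n)), P.IsProjective →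
    T.boxK l m (comulK h (T.K P)) = clsKOf T.kk (P.res (T.ρ h))
  isDualPairing : IsDualPairing (T.unit d ε) 0 κ (T.hopfG comulG) (T.hopfK comulK)
    fun l => pairing T.kk (T.A l)
  isTwistedHopfK : ∃ ξ' ξ'' : Λ →+ Λ →+ ℤ, (T.hopfK comulK).IsTwistedHopf (T.unit d ε) ξ' ξ''
  twist : Λ →+ Λ →+ ℤ
  isTwistedHopfG : (T.hopfG comulG).IsTwistedHopf (T.unit d ε) 0 twist

variable [Finset.HasAntidiagonal Λ]

/-- The dual pair `(⨁ G₀(A_l), ⨁ K₀(A_l))` of a compatible tower. -/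
noncomputable def Compatible.dualPair {T : Tower F Λ} {d : ℤ} {ε : ZMod 2} {κ : Λ →+ Λ →+ ℤ}
    (C : T.Compatible d ε κ) : DualPair.{u + 1} T.kk Λ where
  pos := T.hopfG C.comulG
  neg := T.hopfK C.comulK
  pair l := pairing T.kk (T.A l)
  perfect l := T.perfect l

namespace Strong

variable {T} (S : T.Strong)

/-- The functor `Ψ^{⊗2} Δ Ψ⁻¹`, in components. -/
noncomputable def conjRes {l m n : Λ} (h : l + m = n) :
    GSMod (T.A n) ⥤ GSMod ((T.A l).tensor (T.A m)) :=
  GSMod.resFunctor (S.ψ n).inv ⋙ GSMod.resFunctor (T.ρ h) ⋙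
    GSMod.resFunctor ((S.ψ l).hom.tensor (S.ψ m).hom)

/-- The functor `∇ Res†_{Δ(P)}(M ⊠ -)` from `A_{l₂}`-supermodules to `A_{m₁}`-supermodules, for `M` an
`A_{l₁}`-supermodule and `P` an `A_{m₂}`-supermodule: it is the direct sum over the quadruples
`(a, b, c, d)` with `a + b = l₁`, `c + d = l₂`, `a + c = m₁`, `b + d = m₂` of the functors
`Ind HOM(Res P, S₂₃(Res M ⊠ Res -))`, shifted by the multiple of `(d, ε)` by
`κ(b, d) + χ'(b, c) + χ''(a, d)`. -/
noncomputable def cross {l₁ l₂ m₁ m₂ : Λ} (M : GSMod (T.A l₁)) (P : GSMod (T.A m₂)) :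
    GSMod (T.A l₂) ⥤ GSMod (T.A m₁) :=
  GSMod.piFunctor fun s : Quad l₁ l₂ m₁ m₂ =>
    GSMod.resFunctor (T.ρ s.hl₂) ⋙
    GSMod.outerFunctor (M.res (T.ρ s.hl₁)) ((T.A s.c).tensor (T.A s.d)) ⋙
    GSMod.swapFunctor (T.A s.a) (T.A s.b) (T.A s.c) (T.A s.d) ⋙
    GSMod.homFunctor (P.res (T.ρ s.hm₂)) ((T.A s.a).tensor (T.A s.c)) ⋙
    GSMod.shiftFunctor _ (S.d * S.κ s.b s.d + S.d * S.χ' s.b s.c + S.d * S.χ'' s.a s.d)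
      (S.ε * (S.κ s.b s.d : ZMod 2) + S.ε * (S.χ' s.b s.c : ZMod 2) +
        S.ε * (S.χ'' s.a s.d : ZMod 2)) ⋙
    GSMod.indFunctor (T.ρ s.hm₁)

variable (C : T.Compatible S.d S.ε S.κ)

/-- The element `∇(Δ(x)† (a ⊗ b))`, where
`(x₁ ⊗ x₂)† (a ⊗ b) = (q ^ d π ^ ε) ^ (κ(|x₁|, |x₂|) + χ'(|x₁|, |b| - |x₂|) + χ''(|a| - |x₁|, |x₂|))
R_{x₁}^*(a) ⊗ R_{x₂}^*(b)`, for `|a| = l₁`, `|b| = l₂`, `|x| = m₂`. -/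
noncomputable def dagger {l₁ l₂ m₂ : Λ} (m₁ : Λ) (x : K₀ T.kk (T.A m₂)) (a : G₀ T.kk (T.A l₁))
    (b : G₀ T.kk (T.A l₂)) : G₀ T.kk (T.A m₁) :=
  ∑ s : Quad l₁ l₂ m₁ m₂,
    (T.unit S.d S.ε ^ (S.κ s.b s.d + S.χ' s.b s.c + S.χ'' s.a s.d) : T.kkˣ) •
      TensorProduct.lift ((C.dualPair.pos.mul s.hm₁).compl₁₂
        ((C.dualPair.rStar s.hl₁).flip a) ((C.dualPair.rStar s.hl₂).flip b))
        (C.dualPair.neg.comul s.hm₂ x)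

end Strong

namespace Compatible

variable {T} {d : ℤ} {ε : ZMod 2} {κ : Λ →+ Λ →+ ℤ} (C : T.Compatible d ε κ) [DecidableEq Λ]

/-- The multiplication of the twisted Heisenberg double `𝔥(A)`; here `γ'' = κ` and
`ξ'' = χ'' + γ' - γ'' = χ'' - κ`. -/
noncomputable def smash :
    C.dualPair.Double →ₗ[T.kk] C.dualPair.Double →ₗ[T.kk] C.dualPair.Double :=
  C.dualPair.smash (T.unit d ε) κ (C.twist - κ)

/-- The image `𝒢_pj(A_l)` of the Cartan map. -/
noncomputable def Gpj (l : Λ) : Submodule T.kk (C.dualPair.pos.carrier l) :=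
  Submodule.span T.kk {a | ∃ P : GSMod (T.A l), P.IsProjective ∧ a = T.G P}

/-- The projective twisted Heisenberg double `𝔥_pj(A) = 𝒢_pj(A) # 𝒦(A)`. -/
noncomputable def doublePj : Submodule T.kk C.dualPair.Double :=
  Submodule.span T.kk {X | ∃ (l m : Λ) (a : C.dualPair.pos.carrier l)
    (x : C.dualPair.neg.carrier m), a ∈ C.Gpj l ∧ X = C.dualPair.sharp a x}

/-- The Fock space `𝒢_pj(A)` of the projective twisted Heisenberg double. -/
noncomputable def fockPj : Submodule T.kk C.dualPair.Fock :=
  Submodule.span T.kk {v | ∃ (l : Λ) (a : C.dualPair.pos.carrier l),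
    a ∈ C.Gpj l ∧ v = C.dualPair.ofPos a}

end Compatible

end Tower

end SuperTower

open SuperTower

namespace SuperTower

section GradedLinear

variable {F : Type u} [Field F] {V : Type v} [AddCommGroup V] [Module F V]
  {W : Type w} [AddCommGroup W] [Module F W]
  {gr : Deg → Submodule F V} {gw : Deg → Submodule F W}

theorem lin_ext_hom {X : Type*} [AddCommGroup X] [Module F X] (h : DirectSum.IsInternal gr)
    {f g : V →ₗ[F] X} (H : ∀ d x, x ∈ gr d → f x = g x) : f = g :=
  LinearMap.ext fun x => hom_induction h (p := fun x => f x = g x) H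
    (fun x y hx hy => by rw [map_add, map_add, hx, hy]) x

theorem prj_mem (h : DirectSum.IsInternal gr) (d : Deg) (x : V) : prj h d x ∈ gr d := by
  refine hom_induction h (p := fun x => prj h d x ∈ gr d) (fun e x hx => ?_)
    (fun x y hx hy => by rw [map_add]; exact add_mem hx hy) x
  by_cases hd : e = d
  · subst hd; rwa [prj_same h hx]
  · rw [prj_ne h hx hd]; exact zero_mem _

theorem coe_symm_eq_prj (h : DirectSum.IsInternal gr) (d : Deg) (x : V) :
    (((LinearEquiv.ofBijective (DirectSum.coeLinearMap gr) h).symm x) d : V) = prj h d x := by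
  classical
  refine hom_induction h (p := fun x =>
    (((LinearEquiv.ofBijective (DirectSum.coeLinearMap gr) h).symm x) d : V) = prj h d x)
    (fun e x hx => ?_) (fun x y hx hy => by rw [map_add, map_add, DirectSum.add_apply,
      Submodule.coe_add, hx, hy]) x
  have : (LinearEquiv.ofBijective (DirectSum.coeLinearMap gr) h).symm x =
      DirectSum.lof F Deg (fun d => gr d) e ⟨x, hx⟩ := by
    rw [LinearEquiv.symm_apply_eq]
    exact (DirectSum.coeLinearMap_lof gr e ⟨x, hx⟩).symm
  rw [this]
  by_cases hd : e = d
  · subst hd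
    rw [DirectSum.lof_apply, prj_same h hx]
  · rw [prj_ne h hx hd, DirectSum.lof_eq_of, DirectSum.of_eq_of_ne _ _ _ (Ne.symm hd)]
    rfl

theorem eq_zero_of_prj (h : DirectSum.IsInternal gr) {x : V} (hx : ∀ d, prj h d x = 0) :
    x = 0 := by
  have : (LinearEquiv.ofBijective (DirectSum.coeLinearMap gr) h).symm x = 0 := by
    refine DFinsupp.ext fun d => Subtype.ext ?_
    exact (coe_symm_eq_prj h d x).trans (hx d)
  simpa using this

theorem prj_map (h : DirectSum.IsInternal gr) (h' : DirectSum.IsInternal gw) (f : V →ₗ[F] W)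
    (hf : ∀ d x, x ∈ gr d → f x ∈ gw d) (d : Deg) (x : V) :
    prj h' d (f x) = f (prj h d x) := by
  refine hom_induction h (p := fun x => prj h' d (f x) = f (prj h d x)) (fun e x hx => ?_)
    (fun x y hx hy => by simp only [map_add, hx, hy]) x
  by_cases hd : e = d
  · subst hd; rw [prj_same h hx, prj_same h' (hf _ _ hx)]
  · rw [prj_ne h hx hd, prj_ne h' (hf _ _ hx) hd, map_zero]

theorem mem_of_map_mem (h : DirectSum.IsInternal gr) (h' : DirectSum.IsInternal gw)
    (f : V →ₗ[F] W) (hf : ∀ d x, x ∈ gr d → f x ∈ gw d) (hi : Function.Injective f)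
    {d : Deg} {x : V} (hx : f x ∈ gw d) : x ∈ gr d := by
  have := prj_map h h' f hf d x
  rw [prj_same h' hx] at this
  rw [hi this]
  exact prj_mem h d x

theorem injective_of_pieces (h : DirectSum.IsInternal gr) (h' : DirectSum.IsInternal gw)
    (f : V →ₗ[F] W) (hf : ∀ d x, x ∈ gr d → f x ∈ gw d)
    (hi : ∀ d x, x ∈ gr d → f x = 0 → x = 0) : Function.Injective f := by
  rw [injective_iff_map_eq_zero]
  intro x hx
  refine eq_zero_of_prj h fun d => hi d _ (prj_mem h d x) ?_
  rw [← prj_map h h' f hf, hx, map_zero]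

theorem surjective_of_pieces (h' : DirectSum.IsInternal gw)
    (f : V →ₗ[F] W) (hs : ∀ d y, y ∈ gw d → ∃ x, f x = y) : Function.Surjective f := by
  refine hom_induction h' (p := fun y => ∃ x, f x = y) hs ?_
  rintro _ _ ⟨x, rfl⟩ ⟨y, rfl⟩
  exact ⟨x + y, map_add _ _ _⟩

theorem exists_mem_of_surjective (h : DirectSum.IsInternal gr) (h' : DirectSum.IsInternal gw)
    (f : V →ₗ[F] W) (hf : ∀ d x, x ∈ gr d → f x ∈ gw d) (hs : Function.Surjective f)
    {d : Deg} {y : W} (hy : y ∈ gw d) : ∃ x ∈ gr d, f x = y := by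
  obtain ⟨x, rfl⟩ := hs y
  exact ⟨prj h d x, prj_mem h d x, by rw [← prj_map h h' f hf, prj_same h' hy]⟩

theorem exists_homBasis [Module.Finite F V] (h : DirectSum.IsInternal gr) :
    ∃ (ι : Type) (_ : Fintype ι) (d : ι → Deg) (b : Module.Basis ι F V), ∀ i, b i ∈ gr (d i) := by
  let v : ∀ d, Module.Basis (Fin (Module.finrank F (gr d))) F (gr d) :=
    fun d => Module.finBasis F (gr d)
  let b := h.collectedBasis v
  have : Finite (Σ d : Deg, Fin (Module.finrank F (gr d))) := Module.Finite.finite_basis b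
  exact ⟨_, Fintype.ofFinite _, fun i => i.1, b, h.collectedBasis_mem v⟩

theorem ptwist_mem (h : DirectSum.IsInternal gr) (ε : ZMod 2) {d : Deg} {x : V} (hx : x ∈ gr d) :
    ptwist h ε x ∈ gr d := by
  rw [ptwist_of_mem h ε hx]; exact zsmul_mem hx _

theorem ptwist_ptwist (h : DirectSum.IsInternal gr) (ε : ZMod 2) (x : V) :
    ptwist h ε (ptwist h ε x) = x := by
  refine hom_induction h (p := fun x => ptwist h ε (ptwist h ε x) = x) (fun d x hx => ?_)
    (fun x y hx hy => by simp only [map_add, hx, hy]) x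
  rw [ptwist_of_mem h ε hx, map_zsmul, ptwist_of_mem h ε hx, smul_smul, ksign_self, one_smul]

theorem tensor_lin_ext {X : Type*} [AddCommGroup X] [Module F X] (h : DirectSum.IsInternal gr)
    (h' : DirectSum.IsInternal gw) {f g : V ⊗[F] W →ₗ[F] X}
    (H : ∀ i j x y, x ∈ gr i → y ∈ gw j → f (x ⊗ₜ y) = g (x ⊗ₜ y)) : f = g :=
  LinearMap.ext fun t => tensor_hom_induction h h' (p := fun t => f t = g t) H
    (fun x y hx hy => by rw [map_add, map_add, hx, hy]) t

/-- A linear map that sends tensors of homogeneous elements to a subspace. -/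
theorem map_tensorGr_of_tmul {X : Type*} [AddCommGroup X] [Module F X] (f : V ⊗[F] W →ₗ[F] X)
    (S : Submodule F X) {d : Deg}
    (H : ∀ i j x y, x ∈ gr i → y ∈ gw j → i + j = d → f (x ⊗ₜ y) ∈ S)
    {t : V ⊗[F] W} (ht : t ∈ tensorGr gr gw d) : f t ∈ S := by
  have : tensorGr gr gw d ≤ S.comap f := by
    refine Submodule.span_le.2 ?_
    rintro _ ⟨i, j, x, y, hx, hy, hd, rfl⟩
    exact H i j x y hx hy hd
  exact this ht

end GradedLinear

variable {F : Type u} [Field F]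

theorem deg_neg (i : ZMod 2) : -i = i := by revert i; decide

/-- A bilinear identity may be checked on homogeneous elements. -/
theorem bilin_ext_hom {V W X : Type*} [AddCommGroup V] [Module F V] [AddCommGroup W] [Module F W]
    [AddCommGroup X] [Module F X] {gr : Deg → Submodule F V} {gw : Deg → Submodule F W}
    (h : DirectSum.IsInternal gr)
    (h' : DirectSum.IsInternal gw) {f g : V →ₗ[F] W →ₗ[F] X}
    (H : ∀ i j x y, x ∈ gr i → y ∈ gw j → f x y = g x y) : f = g :=
  lin_ext_hom h fun i x hx => lin_ext_hom h' fun j y hy => H i j x y hx hy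

namespace GSMod

variable {A B C : GSAlg F}

/-- A morphism from an `F`-linear map whose `B`-linearity is checked on homogeneous elements. -/
def homOfF {M N : GSMod B} (f : M.carrier →ₗ[F] N.carrier)
    (hmem : ∀ d m, m ∈ M.gr d → f m ∈ N.gr d)
    (hsmul : ∀ i j b m, b ∈ B.gr i → m ∈ M.gr j → f (b • m) = b • f m) : M ⟶ N where
  lin :=
    { toFun := f
      map_add' := f.map_add
      map_smul' := fun b m => by
        exact LinearMap.congr_fun₂ (f := M.act.compr₂ f) (g := N.act.compl₂ f)
          (bilin_ext_hom B.internal M.internal fun i j b m hb hm => hsmul i j b m hb hm) b m }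
  map_mem := fun h => hmem _ _ h

/-- A bijective morphism is an isomorphism. -/
noncomputable def isoOfBij {M N : GSMod B} (f : M ⟶ N) (h : Function.Bijective f.lin) : M ≅ N :=
  mkIso (LinearEquiv.ofBijective f.lin h) (fun hm => f.map_mem hm) (fun {d m} hm => by
    refine mem_of_map_mem M.internal N.internal (Hom.linF f) (fun _ _ h => f.map_mem h) h.1 ?_
    have : Hom.linF f ((LinearEquiv.ofBijective f.lin h).symm m) = m :=
      (LinearEquiv.ofBijective f.lin h).apply_symm_apply m
    rwa [this])

theorem iso_bijective {M N : GSMod B} (e : M ≅ N) : Function.Bijective e.hom.lin :=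
  ⟨Function.LeftInverse.injective (g := e.inv.lin) fun m => by
    rw [← comp_lin, e.hom_inv_id, id_lin], Function.RightInverse.surjective (g := e.inv.lin) fun m => by
    rw [← comp_lin, e.inv_hom_id, id_lin]⟩

/-- A natural transformation with bijective components is an isomorphism. -/
noncomputable def natIsoOfBij' {D : Type*} [Category* D] {G H : D ⥤ GSMod B}
    (f : ∀ X, G.obj X ⟶ H.obj X) (hf : ∀ X, Function.Bijective (f X).lin)
    (nat : ∀ {X Y} (g : X ⟶ Y), G.map g ≫ f Y = f X ≫ H.map g) : G ≅ H :=
  NatIso.ofComponents (fun X => isoOfBij (f X) (hf X)) fun g => nat g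

theorem IsExact.comp {Φ : GSMod A ⥤ GSMod B} {Ψ : GSMod B ⥤ GSMod C} (h : IsExact Φ)
    (h' : IsExact Ψ) : IsExact (Φ ⋙ Ψ) := fun f g hfg => h' _ _ (h f g hfg)

theorem IsProjective.of_iso {M N : GSMod B} (e : M ≅ N) (h : M.IsProjective) : N.IsProjective := by
  have : Module.Projective B.carrier M.carrier := h
  exact Module.Projective.of_equiv (LinearEquiv.ofBijective e.hom.lin (iso_bijective e))

/-- A module through which the identity of `P` factors additively is projective if the
intermediate modules are. -/
theorem projective_of_sum {R : Type*} [Ring R] {P : Type*} [AddCommGroup P] [Module R P]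
    {ι : Type*} [Fintype ι] {M : ι → Type*} [∀ i, AddCommGroup (M i)] [∀ i, Module R (M i)]
    (hM : ∀ i, Module.Projective R (M i)) (s : ∀ i, P →ₗ[R] M i) (r : ∀ i, M i →ₗ[R] P)
    (h : ∀ p, ∑ i, r i (s i p) = p) : Module.Projective R P := by
  classical
  refine Module.Projective.of_lifting_property'' fun f hf => ?_
  choose k hk using fun i => Module.projective_lifting_property f (r i) hf
  refine ⟨∑ i, k i ∘ₗ s i, LinearMap.ext fun p => ?_⟩
  rw [LinearMap.comp_apply, LinearMap.sum_apply, map_sum, LinearMap.id_apply]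
  conv_rhs => rw [← h p]
  exact Finset.sum_congr rfl fun i _ => LinearMap.congr_fun (hk i) (s i p)

/-- Graded lifting property. -/
theorem IsProjective.exists_lift {P X Y : GSMod B} (hP : P.IsProjective) (g : X ⟶ Y)
    (hg : Function.Surjective g.lin) (f : P ⟶ Y) : ∃ k : P ⟶ X, k ≫ g = f := by
  have : Module.Projective B.carrier P.carrier := hP
  obtain ⟨k, hk⟩ := Module.projective_lifting_property g.lin f.lin hg
  let k' : P.carrier →ₗ[F] X.carrier := dlift P.internal fun d =>
    prj X.internal d ∘ₗ k.restrictScalars F ∘ₗ (P.gr d).subtype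
  have hk' : ∀ d p, p ∈ P.gr d → k' p = prj X.internal d (k p) :=
    fun d p hp => dlift_of_mem P.internal _ hp
  refine ⟨homOfF k' (fun d p hp => ?_) (fun i j b p hb hp => ?_), hom_ext fun p => ?_⟩
  · rw [hk' d p hp]; exact prj_mem _ _ _
  · rw [hk' _ _ (P.smul_mem hb hp), hk' _ _ hp, map_smul]
    generalize k p = x
    refine hom_induction X.internal (p := fun x => prj X.internal (i + j) (b • x) =
      b • prj X.internal j x) (fun e x hx => ?_) (fun x y hx hy => by
        rw [smul_add, map_add, map_add, hx, hy, smul_add]) x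
    by_cases he : e = j
    · subst he; rw [prj_same _ hx, prj_same _ (X.smul_mem hb hx)]
    · rw [prj_ne _ hx he, prj_ne _ (X.smul_mem hb hx) (fun h => he (add_left_cancel h)), smul_zero]
  · refine LinearMap.congr_fun (f := Hom.linF g ∘ₗ k') (g := Hom.linF f)
      (lin_ext_hom P.internal fun d p hp => ?_) p
    rw [LinearMap.comp_apply, hk' d p hp, ← prj_map X.internal Y.internal (Hom.linF g)
      (fun _ _ h => g.map_mem h)]
    have : Hom.linF g (k p) = Hom.linF f p := LinearMap.congr_fun hk p
    rw [this]
    exact prj_same _ (f.map_mem hp)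

/-- The morphism `B{d} → M` with `b ↦ b m` (up to the sign of the twisted action). -/
noncomputable def fromShift (M : GSMod B) {d : Deg} {m : M.carrier} (hm : m ∈ M.gr d) :
    (regular B).shift d.1 d.2 ⟶ M :=
  homOfF (M := (regular B).shift d.1 d.2) (N := M)
    ((M.act.flip m) ∘ₗ (B.parityHom d.2).toLinearMap)
    (fun e b hb => by
      have hb' : b ∈ B.gr (e - d) := hb
      have := M.smul_mem (B.gr (e - d) |> fun _ => ptwist_mem B.internal d.2 hb') hm
      rwa [sub_add_cancel] at this)
    (fun i j b x hb hx => by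
      change B.parityHom d.2 (B.parityHom d.2 b * (show B.carrier from x)) • m =
        b • (B.parityHom d.2 (show B.carrier from x) • m)
      rw [map_mul, B.parityHom_parityHom, mul_smul])

theorem fromShift_lin (M : GSMod B) {d : Deg} {m : M.carrier} (hm : m ∈ M.gr d)
    (b : B.carrier) : (fromShift M hm).lin b = B.parityHom d.2 b • m := rfl

/-- The free cover of a graded supermodule. -/
theorem exists_free_cover (M : GSMod B) : ∃ (ι : Type) (_ : Fintype ι) (d : ι → Deg)
    (r : ∀ i, (regular B).shift (d i).1 (d i).2 ⟶ M),
    ∀ m, ∃ x : ∀ i, ((regular B).shift (d i).1 (d i).2).carrier, ∑ i, (r i).lin (x i) = m := by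
  obtain ⟨ι, hι, d, b, hb⟩ := exists_homBasis M.internal
  refine ⟨ι, hι, d, fun i => fromShift M (hb i), fun m =>
    ⟨fun i => B.parityHom (d i).2 (algebraMap F B.carrier (b.repr m i)), ?_⟩⟩
  conv_rhs => rw [← b.sum_repr m]
  refine Finset.sum_congr rfl fun i _ => ?_
  rw [fromShift_lin, B.parityHom_parityHom, algebraMap_smul]

/-- The morphism from a finite direct sum given by its components. -/
def piDesc {ι : Type} [Fintype ι] {M : ι → GSMod B} {N : GSMod B} (r : ∀ i, M i ⟶ N) :
    pi M ⟶ N where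
  lin := ∑ i, (r i).lin ∘ₗ LinearMap.proj i
  map_mem {d m} hm := by
    rw [LinearMap.sum_apply]
    exact sum_mem fun i _ => (r i).map_mem (hm i trivial)

theorem piDesc_lin {ι : Type} [Fintype ι] {M : ι → GSMod B} {N : GSMod B} (r : ∀ i, M i ⟶ N)
    (m : (pi M).carrier) : (piDesc r).lin m = ∑ i, (r i).lin (m i) := by
  change (∑ i, (r i).lin ∘ₗ LinearMap.proj i : (∀ i, (M i).carrier) →ₗ[B.carrier] _) m = _
  exact LinearMap.sum_apply _ _ _

/-- The projections of a finite direct sum. -/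
def piProj {ι : Type} [Finite ι] (M : ι → GSMod B) (i : ι) : pi M ⟶ M i where
  lin := LinearMap.proj i
  map_mem hm := hm i trivial

/-- A finite graded dual basis of a projective graded supermodule. -/
theorem IsProjective.exists_dualBasis {P : GSMod B} (hP : P.IsProjective) :
    ∃ (ι : Type) (_ : Fintype ι) (d : ι → Deg) (s : ∀ i, P ⟶ (regular B).shift (d i).1 (d i).2)
      (r : ∀ i, (regular B).shift (d i).1 (d i).2 ⟶ P),
      ∀ p, ∑ i, (r i).lin ((s i).lin p) = p := by
  obtain ⟨ι, hι, d, r, hr⟩ := exists_free_cover P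
  obtain ⟨k, hk⟩ := hP.exists_lift (piDesc r) (fun m => by
    obtain ⟨x, hx⟩ := hr m
    exact ⟨x, (piDesc_lin r x).trans hx⟩) (𝟙 P)
  refine ⟨ι, hι, d, fun i => k ≫ piProj _ i, r, fun p => ?_⟩
  have := congrArg (fun f : P ⟶ P => f.lin p) hk
  exact (piDesc_lin r _).symm.trans this

end GSMod

end SuperTower

namespace SuperTower

variable {F : Type u} [Field F]

namespace GSAlg

/-- The identity homomorphism. -/
def Hom.id (A : GSAlg F) : Hom A A := ⟨LinearMap.id, fun _ _ => rfl, fun h => h⟩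

/-- The composition of homomorphisms, `φ` after `χ`. -/
def Hom.comp {A B C : GSAlg F} (φ : Hom B C) (χ : Hom A B) : Hom A C :=
  ⟨φ.lin ∘ₗ χ.lin, fun b b' => by simp [χ.map_mul, φ.map_mul], fun h => φ.map_mem (χ.map_mem h)⟩

@[simp] theorem Hom.id_lin (A : GSAlg F) (a : A.carrier) : (Hom.id A).lin a = a := rfl

@[simp] theorem Hom.comp_lin {A B C : GSAlg F} (φ : Hom B C) (χ : Hom A B) (a : A.carrier) :
    (φ.comp χ).lin a = φ.lin (χ.lin a) := rfl

@[simp] theorem Hom.tensor_tmul {A B A' B' : GSAlg F} (φ : Hom B A) (ψ : Hom B' A')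
    (b : B.carrier) (b' : B'.carrier) :
    (φ.tensor ψ).lin (tmul b b') = tmul (φ.lin b) (ψ.lin b') := rfl

theorem tensor_one (A B : GSAlg F) : (1 : (A.tensor B).carrier) = tmul 1 1 := rfl

theorem tmul_mul_one (A B : GSAlg F) (a : A.carrier) (a' : A.carrier) (b' : B.carrier) :
    tmul a (1 : B.carrier) * tmul a' b' = tmul (a * a') b' := by
  refine hom_induction A.internal (p := fun a' => tmul a (1 : B.carrier) * tmul a' b' =
    tmul (a * a') b') (fun d x hx => ?_) (fun x y hx hy => ?_) a'
  · rw [tmul_mul_tmul a x B.one_mem hx]; simp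
  · simp only [← tmulLin_apply, mul_add, map_add, LinearMap.add_apply] at hx hy ⊢
    rw [hx, hy]

theorem one_mul_tmul (A B : GSAlg F) (a : A.carrier) (b b' : B.carrier) :
    tmul a b * tmul (1 : A.carrier) b' = tmul a (b * b') := by
  refine hom_induction B.internal (p := fun b => tmul a b * tmul (1 : A.carrier) b' =
    tmul a (b * b')) (fun d x hx => ?_) (fun x y hx hy => ?_) b
  · rw [tmul_mul_tmul a 1 hx A.one_mem]; simp
  · simp only [← tmulLin_apply, add_mul, map_add] at hx hy ⊢
    rw [hx, hy]

theorem Hom.ext_tmul {A B C : GSAlg F} {φ χ : Hom (A.tensor B) C}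
    (h : ∀ a b, φ.lin (tmul a b) = χ.lin (tmul a b)) : φ = χ :=
  Hom.ext (TensorProduct.ext' h)

/-- The associativity isomorphism `(A ⊗ B) ⊗ C → A ⊗ (B ⊗ C)`. -/
noncomputable def assocLin (A B C : GSAlg F) :
    ((A.tensor B).tensor C).carrier ≃ₗ[F] (A.tensor (B.tensor C)).carrier :=
  TensorProduct.assoc F A.carrier B.carrier C.carrier

theorem assocLin_tmul {A B C : GSAlg F} (a : A.carrier) (b : B.carrier) (c : C.carrier) :
    assocLin A B C (tmul (tmul a b) c) = tmul a (tmul b c) := rfl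

theorem three_induction {A B C : GSAlg F} {p : ((A.tensor B).tensor C).carrier → Prop}
    (h : ∀ i j k a b c, a ∈ A.gr i → b ∈ B.gr j → c ∈ C.gr k → p (tmul (tmul a b) c))
    (add : ∀ x y, p x → p y → p (x + y)) (t) : p t := by
  refine tensor_induction (fun _ k x c _ hc => ?_) add t
  refine tensor_induction (p := fun x => p (tmul x c)) (fun i j a b ha hb => h i j k a b c ha hb hc)
    (fun x y hx hy => ?_) x
  rw [← tmulLin_apply, map_add, LinearMap.add_apply]
  exact add _ _ hx hy

theorem assocLin_mul {A B C : GSAlg F} (x y : ((A.tensor B).tensor C).carrier) :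
    assocLin A B C (x * y) = assocLin A B C x * assocLin A B C y := by
  refine three_induction (p := fun x => assocLin A B C (x * y) =
    assocLin A B C x * assocLin A B C y) (fun i j k a b c ha hb hc => ?_)
    (fun x x' h h' => by simp only [add_mul, map_add, h, h']) x
  refine three_induction (p := fun y => assocLin A B C (tmul (tmul a b) c * y) =
    assocLin A B C (tmul (tmul a b) c) * assocLin A B C y) (fun i' j' k' a' b' c' ha' hb' hc' => ?_)
    (fun x x' h h' => by simp only [mul_add, map_add, h, h']) y
  rw [tmul_mul_tmul _ _ hc (tmul_mem ha' hb'), tmul_mul_tmul a a' hb ha', assocLin_tmul,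
    assocLin_tmul, tmul_mul_tmul _ _ (tmul_mem hb hc) ha', tmul_mul_tmul _ _ hc hb', zsmul_tmul,
    map_zsmul, map_zsmul, assocLin_tmul, tmul_zsmul, smul_smul, smul_smul, Prod.snd_add,
    Prod.snd_add, ksign_add_right, ksign_add_left]
  congr 1
  ring

theorem assocLin_mem {A B C : GSAlg F} {d : Deg} {x : ((A.tensor B).tensor C).carrier}
    (hx : x ∈ ((A.tensor B).tensor C).gr d) : assocLin A B C x ∈ (A.tensor (B.tensor C)).gr d := by
  refine map_mem_of_tmul (assocLin A B C).toLinearMap _ (fun i k x c hx hc hd => ?_) hx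
  refine map_mem_of_tmul ((assocLin A B C).toLinearMap ∘ₗ (tmulLin _ _).flip c) _
    (fun i' j a b ha hb hi => ?_) hx
  rw [← hd, ← hi, add_assoc]
  exact tmul_mem ha (tmul_mem hb hc)

/-- The associativity homomorphism. -/
noncomputable def assocHom (A B C : GSAlg F) :
    Hom ((A.tensor B).tensor C) (A.tensor (B.tensor C)) where
  lin := (assocLin A B C).toLinearMap
  map_mul := assocLin_mul
  map_mem := assocLin_mem

/-- The inverse of the associativity homomorphism. -/
noncomputable def assocInv (A B C : GSAlg F) :
    Hom (A.tensor (B.tensor C)) ((A.tensor B).tensor C) where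
  lin := (assocLin A B C).symm.toLinearMap
  map_mul x y := (assocLin A B C).injective (by
    rw [assocLin_mul]; simp)
  map_mem {d x} hx := mem_of_map_mem ((A.tensor B).tensor C).internal
    (A.tensor (B.tensor C)).internal (assocLin A B C).toLinearMap (fun _ _ h => assocLin_mem h)
    (assocLin A B C).injective (by simpa using hx)

theorem assocInv_tmul {A B C : GSAlg F} (a : A.carrier) (b : B.carrier) (c : C.carrier) :
    (assocInv A B C).lin (tmul a (tmul b c)) = tmul (tmul a b) c :=
  (assocLin A B C).symm_apply_apply (GSAlg.tmul (GSAlg.tmul a b) c)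

end GSAlg

namespace GSMod

section Res

variable {A B C : GSAlg F}

/-- The inclusion of a restriction. -/
def resι (φ : GSAlg.Hom B A) (M : GSMod A) : (M.res φ).carrier →ₗ[F] M.carrier :=
  (ResCarrier φ M).subtype

theorem resι_injective (φ : GSAlg.Hom B A) (M : GSMod A) : Function.Injective (resι φ M) :=
  Subtype.val_injective

/-- An element of a restriction. -/
def resMk (φ : GSAlg.Hom B A) (M : GSMod A) (m : M.carrier) (h : φ.lin 1 • m = m) :
    (M.res φ).carrier := (⟨m, h⟩ : ResCarrier φ M)

@[simp] theorem resι_resMk (φ : GSAlg.Hom B A) (M : GSMod A) (m : M.carrier) (h) :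
    resι φ M (resMk φ M m h) = m := rfl

theorem one_smul_resι (φ : GSAlg.Hom B A) (M : GSMod A) (m : (M.res φ).carrier) :
    φ.lin 1 • resι φ M m = resι φ M m := m.2

@[simp] theorem resι_smul (φ : GSAlg.Hom B A) (M : GSMod A) (b : B.carrier)
    (m : (M.res φ).carrier) : resι φ M (b • m) = φ.lin b • resι φ M m := rfl

theorem resι_mem (φ : GSAlg.Hom B A) (M : GSMod A) {d : Deg} {m : (M.res φ).carrier} :
    resι φ M m ∈ M.gr d ↔ m ∈ (M.res φ).gr d := Iff.rfl

/-- The morphism to a restriction given by a semilinear map with values in it. -/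
def resLift (φ : GSAlg.Hom B A) {N : GSMod B} {M : GSMod A} (f : N.carrier →ₗ[F] M.carrier)
    (hmem : ∀ d n, n ∈ N.gr d → f n ∈ M.gr d)
    (hsmul : ∀ i j b n, b ∈ B.gr i → n ∈ N.gr j → f (b • n) = φ.lin b • f n)
    (h1 : ∀ d n, n ∈ N.gr d → φ.lin 1 • f n = f n) : N ⟶ M.res φ :=
  homOfF (N := M.res φ) (f.codRestrict (ResCarrier φ M) fun n =>
      hom_induction N.internal (p := fun n => φ.lin 1 • f n = f n) h1
        (fun x y hx hy => by rw [map_add, smul_add, hx, hy]) n)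
    (fun d n hn => hmem d n hn) (fun i j b n hb hn => Subtype.ext (hsmul i j b n hb hn))

/-- Restriction along a composition. -/
noncomputable def resComp (φ : GSAlg.Hom B C) (χ : GSAlg.Hom A B) :
    resFunctor φ ⋙ resFunctor χ ≅ resFunctor (φ.comp χ) :=
  natIsoOfBij' (G := resFunctor φ ⋙ resFunctor χ) (H := resFunctor (φ.comp χ))
    (fun M => resLift (φ.comp χ) (N := (M.res φ).res χ) (resι φ M ∘ₗ resι χ (M.res φ))
      (fun _ _ h => h) (fun _ _ _ _ _ _ => rfl)
      (fun _ n _ => congrArg (resι φ M) (one_smul_resι χ (M.res φ) n)))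
    (fun M => ⟨fun x y h => resι_injective χ _ (resι_injective φ _
      (congrArg (resι (φ.comp χ) M) h)), fun y => by
      have h : φ.lin (χ.lin 1) • resι _ _ y = resι _ _ y := one_smul_resι _ _ y
      have h' : φ.lin 1 • resι _ _ y = resι _ _ y := by
        conv_lhs => rw [← h]
        rw [smul_smul, ← φ.map_mul, one_mul, h]
      exact ⟨resMk χ _ (resMk φ _ _ h') (resι_injective φ M h), rfl⟩⟩)
    (fun _ => rfl)

theorem resFunctor_exact (φ : GSAlg.Hom B A) : IsExact (resFunctor φ) := by
  rintro X Y Z f g ⟨hi, he, hs⟩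
  refine ⟨fun x y h => resι_injective φ _ (hi (congrArg (resι φ Y) h)), fun y => ⟨fun h => ?_, ?_⟩,
    fun z => ?_⟩
  · obtain ⟨x, hx⟩ := (he (resι φ Y y)).1 (congrArg (resι φ Z) h)
    refine ⟨resMk φ X x (hi ?_), resι_injective φ Y hx⟩
    rw [map_smul, hx]
    exact one_smul_resι φ Y y
  · rintro ⟨x, rfl⟩
    exact resι_injective φ Z (he.apply_apply_eq_zero (resι φ X x))
  · obtain ⟨y, hy⟩ := hs (resι φ Z z)
    refine ⟨resMk φ Y (φ.lin 1 • y) (smul_mem_resCarrier φ Y 1 y), resι_injective φ Z ?_⟩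
    change g.lin (φ.lin 1 • y) = resι φ Z z
    rw [map_smul, hy]
    exact one_smul_resι φ Z z

end Res

section Ind

variable {A B C : GSAlg F} (φ : GSAlg.Hom B A)

/-- The quotient map to an induced module. -/
noncomputable def imk (N : GSMod B) : A.carrier ⊗[F] N.carrier →ₗ[F] (N.ind φ).carrier :=
  indMk φ N

theorem imk_mul (N : GSMod B) (a : A.carrier) (b : B.carrier) (n : N.carrier) :
    imk φ N ((a * φ.lin b) ⊗ₜ n) = imk φ N (a ⊗ₜ (b • n)) :=
  (Submodule.Quotient.eq _).2 (Submodule.subset_span ⟨a, b, n, rfl⟩)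

theorem imk_mul_one (N : GSMod B) (a : A.carrier) (n : N.carrier) :
    imk φ N ((a * φ.lin 1) ⊗ₜ n) = imk φ N (a ⊗ₜ n) := by
  rw [imk_mul, one_smul]

theorem smul_imk (N : GSMod B) (a a' : A.carrier) (n : N.carrier) :
    a • imk φ N (a' ⊗ₜ n) = imk φ N ((a * a') ⊗ₜ n) := rfl

theorem imk_eq_smul (N : GSMod B) (a : A.carrier) (n : N.carrier) :
    imk φ N (a ⊗ₜ n) = a • imk φ N ((1 : A.carrier) ⊗ₜ n) := by
  rw [smul_imk, mul_one]

theorem imk_mem (N : GSMod B) {i j : Deg} {a : A.carrier} {n : N.carrier} (ha : a ∈ A.gr i)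
    (hn : n ∈ N.gr j) : imk φ N (a ⊗ₜ n) ∈ (N.ind φ).gr (i + j) :=
  ⟨_, tmul_mem_tensorGr ha hn, rfl⟩

theorem imk_surjective (N : GSMod B) : Function.Surjective (imk φ N) := indMk_surjective φ N

theorem ind_induction {N : GSMod B} {p : (N.ind φ).carrier → Prop}
    (h : ∀ i j a n, a ∈ A.gr i → n ∈ N.gr j → p (imk φ N (a ⊗ₜ n)))
    (add : ∀ x y, p x → p y → p (x + y)) (x : (N.ind φ).carrier) : p x := by
  obtain ⟨t, rfl⟩ := imk_surjective φ N x
  exact tensor_hom_induction A.internal N.internal (p := fun t => p (imk φ N t)) h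
    (fun x y hx hy => by rw [map_add]; exact add _ _ hx hy) t

theorem map_ind_mem {N : GSMod B} {X : Type*} [AddCommGroup X] [Module F X]
    (f : (N.ind φ).carrier →ₗ[F] X) (S : Submodule F X) {d : Deg}
    (h : ∀ i j a n, a ∈ A.gr i → n ∈ N.gr j → i + j = d → f (imk φ N (a ⊗ₜ n)) ∈ S)
    {x : (N.ind φ).carrier} (hx : x ∈ (N.ind φ).gr d) : f x ∈ S := by
  obtain ⟨t, ht, rfl⟩ := hx
  exact map_tensorGr_of_tmul (f ∘ₗ imk φ N) S h ht

/-- Linear maps out of an induced module. -/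
noncomputable def indLiftF {X : Type*} [AddCommGroup X] [Module F X] {N : GSMod B}
    (f : A.carrier ⊗[F] N.carrier →ₗ[F] X)
    (h : ∀ i j k a b n, a ∈ A.gr i → b ∈ B.gr j → n ∈ N.gr k →
      f ((a * φ.lin b) ⊗ₜ n) = f (a ⊗ₜ (b • n))) : (N.ind φ).carrier →ₗ[F] X :=
  ((indRel φ N).restrictScalars F).liftQ f (fun t ht => by
    have h' : ∀ a b n, f ((a * φ.lin b) ⊗ₜ n) = f (a ⊗ₜ (b • n)) := by
      intro a b n
      refine hom_induction A.internal (p := fun a => f ((a * φ.lin b) ⊗ₜ n) = f (a ⊗ₜ (b • n)))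
        (fun i a ha => ?_) (fun x y hx hy => by
          simp only [add_mul, TensorProduct.add_tmul, map_add, hx, hy]) a
      refine hom_induction B.internal (p := fun b => f ((a * φ.lin b) ⊗ₜ n) = f (a ⊗ₜ (b • n)))
        (fun j b hb => ?_) (fun x y hx hy => by
          simp only [map_add, mul_add, add_smul, TensorProduct.add_tmul, TensorProduct.tmul_add,
            hx, hy]) b
      exact hom_induction N.internal (p := fun n => f ((a * φ.lin b) ⊗ₜ n) = f (a ⊗ₜ (b • n)))
        (fun k n hn => h i j k a b n ha hb hn) (fun x y hx hy => by
          simp only [smul_add, TensorProduct.tmul_add, map_add, hx, hy]) n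
    change t ∈ indRel φ N at ht
    rw [LinearMap.mem_ker]
    induction ht using Submodule.closure_induction with
    | zero => exact map_zero _
    | add x y _ _ hx hy => rw [map_add, hx, hy, add_zero]
    | smul_mem x t ht =>
      obtain ⟨a, b, n, rfl⟩ := ht
      rw [smul_sub, TensorProduct.smul_tmul', TensorProduct.smul_tmul', smul_eq_mul, smul_eq_mul,
        ← mul_assoc, map_sub, h', sub_self]) ∘ₗ
    (Submodule.Quotient.restrictScalarsEquiv F (indRel φ N)).symm.toLinearMap

theorem indLiftF_mk {X : Type*} [AddCommGroup X] [Module F X] {N : GSMod B}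
    (f : A.carrier ⊗[F] N.carrier →ₗ[F] X) (h) (t : A.carrier ⊗[F] N.carrier) :
    indLiftF φ f h (imk φ N t) = f t := rfl

/-- The morphism out of an induced module given by a semilinear map. -/
noncomputable def indLift {N : GSMod B} {X : GSMod A} (g : N.carrier →ₗ[F] X.carrier)
    (hmem : ∀ d n, n ∈ N.gr d → g n ∈ X.gr d)
    (hsmul : ∀ i j b n, b ∈ B.gr i → n ∈ N.gr j → g (b • n) = φ.lin b • g n) : N.ind φ ⟶ X :=
  homOfF (M := N.ind φ) (indLiftF φ (TensorProduct.lift (X.act.compl₂ g)) (fun i j k a b n _ hb hn => by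
      rw [TensorProduct.lift.tmul, TensorProduct.lift.tmul, LinearMap.compl₂_apply,
        LinearMap.compl₂_apply, act_apply, act_apply, hsmul j k b n hb hn, mul_smul]))
    (fun d x hx => by
      refine map_ind_mem φ _ _ (fun i j a n ha hn hd => ?_) hx
      rw [indLiftF_mk, TensorProduct.lift.tmul, ← hd]
      exact X.smul_mem ha (hmem _ _ hn))
    (fun i j a x _ _ => by
      refine ind_induction φ (p := fun x => indLiftF φ (TensorProduct.lift (X.act.compl₂ g)) _
        (a • x) = a • indLiftF φ (TensorProduct.lift (X.act.compl₂ g)) _ x)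
        (fun _ _ a' n _ _ => ?_) (fun x y hx hy => by rw [smul_add, map_add, hx, hy, map_add, smul_add]) x
      rw [smul_imk, indLiftF_mk, indLiftF_mk, TensorProduct.lift.tmul, TensorProduct.lift.tmul]
      exact mul_smul a a' (g n))

theorem indLift_mk {N : GSMod B} {X : GSMod A} (g : N.carrier →ₗ[F] X.carrier) (hmem) (hsmul)
    (a : A.carrier) (n : N.carrier) :
    (indLift φ (X := X) g hmem hsmul).lin (imk φ N (a ⊗ₜ n)) = a • g n := rfl

/-- The canonical map `N → A φ(1) ⊗ N`. -/
noncomputable def indUnit (N : GSMod B) : N.carrier →ₗ[F] (N.ind φ).carrier :=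
  imk φ N ∘ₗ TensorProduct.mk F A.carrier N.carrier 1

theorem indUnit_apply (N : GSMod B) (n : N.carrier) :
    indUnit φ N n = imk φ N ((1 : A.carrier) ⊗ₜ n) := rfl

theorem imk_eq (N : GSMod B) (a : A.carrier) (n : N.carrier) :
    imk φ N (a ⊗ₜ n) = a • indUnit φ N n := imk_eq_smul φ N a n

theorem indUnit_mem (N : GSMod B) {d : Deg} {n : N.carrier} (hn : n ∈ N.gr d) :
    indUnit φ N n ∈ (N.ind φ).gr d := by
  have := imk_mem φ N A.one_mem hn
  rwa [zero_add] at this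

theorem indUnit_smul (N : GSMod B) (b : B.carrier) (n : N.carrier) :
    indUnit φ N (b • n) = φ.lin b • indUnit φ N n := by
  rw [indUnit_apply, indUnit_apply, smul_imk, mul_one, ← imk_mul, one_mul]

theorem one_smul_indUnit (N : GSMod B) (n : N.carrier) :
    φ.lin 1 • indUnit φ N n = indUnit φ N n := by
  rw [← indUnit_smul, one_smul]

theorem indLift_unit {N : GSMod B} {X : GSMod A} (g : N.carrier →ₗ[F] X.carrier) (hmem) (hsmul)
    (n : N.carrier) : (indLift φ (X := X) g hmem hsmul).lin (indUnit φ N n) = g n := by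
  rw [indUnit_apply, indLift_mk, one_smul]

theorem indMap_unit {N N' : GSMod B} (f : N ⟶ N') (n : N.carrier) :
    ((indFunctor φ).map f).lin (indUnit φ N n) = indUnit φ N' (f.lin n) := rfl

theorem ind_hom_ext {N : GSMod B} {X : GSMod A} {f g : N.ind φ ⟶ X}
    (h : ∀ d n, n ∈ N.gr d → f.lin (indUnit φ N n) = g.lin (indUnit φ N n)) : f = g :=
  hom_ext fun x => by
  refine ind_induction φ (p := fun x => f.lin x = g.lin x) (fun i j a n ha hn => ?_)
    (fun x y hx hy => by rw [map_add, map_add, hx, hy]) x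
  rw [imk_eq, map_smul, map_smul, h j n hn]

theorem bij_of_inverse {X Y : Type*} {f : X → Y} (g : Y → X) (h₁ : ∀ x, g (f x) = x)
    (h₂ : ∀ y, f (g y) = y) : Function.Bijective f :=
  ⟨Function.LeftInverse.injective h₁, Function.RightInverse.surjective h₂⟩

theorem bij_of_comp_eq_id {M N : GSMod B} {f : M ⟶ N} (g : N ⟶ M) (h₁ : f ≫ g = 𝟙 M)
    (h₂ : g ≫ f = 𝟙 N) : Function.Bijective f.lin :=
  iso_bijective ⟨f, g, h₁, h₂⟩

/-- The comparison `C φχ(1) ⊗_A X → C φ(1) ⊗_B (B χ(1) ⊗_A X)`. -/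
noncomputable def indCompHom (φ : GSAlg.Hom B C) (χ : GSAlg.Hom A B) (X : GSMod A) :
    X.ind (φ.comp χ) ⟶ (X.ind χ).ind φ :=
  indLift (φ.comp χ) (indUnit φ (X.ind χ) ∘ₗ indUnit χ X)
    (fun d n hn => indUnit_mem φ _ (indUnit_mem χ _ hn)) (fun i j b n _ _ => by
      rw [LinearMap.comp_apply, indUnit_smul, indUnit_smul]; rfl)

/-- The map `b ⊗ x ↦ φ(b) ⊗ x`. -/
noncomputable def indCompAux (φ : GSAlg.Hom B C) (χ : GSAlg.Hom A B) (X : GSMod A) :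
    (X.ind χ).carrier →ₗ[F] (X.ind (φ.comp χ)).carrier :=
  indLiftF χ (imk (φ.comp χ) X ∘ₗ TensorProduct.map φ.lin LinearMap.id)
    (fun i j k a b n _ _ _ => by
      rw [LinearMap.comp_apply, LinearMap.comp_apply, TensorProduct.map_tmul, φ.map_mul,
        TensorProduct.map_tmul]
      exact imk_mul (φ.comp χ) X _ _ _)

theorem indCompAux_mk (φ : GSAlg.Hom B C) (χ : GSAlg.Hom A B) (X : GSMod A) (b : B.carrier)
    (x : X.carrier) : indCompAux φ χ X (imk χ X (b ⊗ₜ x)) = imk (φ.comp χ) X (φ.lin b ⊗ₜ x) := rfl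

/-- The inverse of `indCompHom`. -/
noncomputable def indCompInv (φ : GSAlg.Hom B C) (χ : GSAlg.Hom A B) (X : GSMod A) :
    (X.ind χ).ind φ ⟶ X.ind (φ.comp χ) :=
  indLift φ (indCompAux φ χ X)
    (fun d n hn => by
      refine map_ind_mem χ _ _ (fun i j a n ha hn hd => ?_) hn
      rw [indCompAux_mk, ← hd]
      exact imk_mem (φ.comp χ) X (φ.map_mem ha) hn)
    (fun i j b n _ _ => by
      refine ind_induction χ (N := X) (p := fun n => indCompAux φ χ X (b • n) =
        φ.lin b • indCompAux φ χ X n) (fun _ _ a x _ _ => ?_) (fun x y hx hy => ?_) n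
      · rw [smul_imk, indCompAux_mk, indCompAux_mk, smul_imk, φ.map_mul]
      · rw [smul_add, map_add, hx, hy, map_add, smul_add])

theorem indCompHom_bijective (φ : GSAlg.Hom B C) (χ : GSAlg.Hom A B) (X : GSMod A) :
    Function.Bijective (indCompHom φ χ X).lin := by
  refine bij_of_comp_eq_id (indCompInv φ χ X) ?_ ?_
  · refine ind_hom_ext (φ.comp χ) fun d n _ => ?_
    rw [comp_lin, indCompHom, indLift_unit, LinearMap.comp_apply, indCompInv, indLift_unit,
      indUnit_apply, indCompAux_mk, id_lin, imk_eq, ← one_smul A.carrier n]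
    rw [indUnit_smul, smul_smul, GSAlg.Hom.comp_lin, ← φ.map_mul, one_mul]
  · refine ind_hom_ext φ fun d n _ => ?_
    rw [comp_lin, indCompInv, indLift_unit, id_lin]
    refine ind_induction χ (N := X) (p := fun n => (indCompHom φ χ X).lin (indCompAux φ χ X n) =
      indUnit φ (X.ind χ) n) (fun i j b x _ _ => ?_) (fun x y hx hy => by simp only [map_add, hx, hy]) n
    rw [indCompAux_mk, imk_eq, map_smul, indCompHom, indLift_unit, LinearMap.comp_apply,
      ← indUnit_smul, ← imk_eq]

/-- Induction in stages. -/
noncomputable def indComp (φ : GSAlg.Hom B C) (χ : GSAlg.Hom A B) :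
    indFunctor (φ.comp χ) ≅ indFunctor χ ⋙ indFunctor φ :=
  natIsoOfBij' (G := indFunctor (φ.comp χ)) (H := indFunctor χ ⋙ indFunctor φ)
    (indCompHom φ χ) (indCompHom_bijective φ χ)
    (fun {X Y} g => ind_hom_ext (φ.comp χ) (N := X) (X := (Y.ind χ).ind φ) fun d n hn => by
      change (indCompHom φ χ Y).lin (((indFunctor (φ.comp χ)).map g).lin (indUnit (φ.comp χ) X n)) =
        ((indFunctor φ).map ((indFunctor χ).map g)).lin
          ((indCompHom φ χ X).lin (indUnit (φ.comp χ) X n))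
      rw [indMap_unit, indCompHom, indCompHom, indLift_unit, indLift_unit]
      rfl)

/-- The comparison of inductions along homomorphisms that correspond under an isomorphism. -/
noncomputable def indTransport {B' : GSAlg F} (θ : GSAlg.Hom B B')
    (Φ : GSAlg.Hom B' A) (X : GSMod B) (X' : GSMod B') (u : X.carrier →ₗ[F] X'.carrier)
    (hu : ∀ d x, x ∈ X.gr d → u x ∈ X'.gr d)
    (hs : ∀ i j b x, b ∈ B.gr i → x ∈ X.gr j → u (b • x) = θ.lin b • u x) :
    X.ind (Φ.comp θ) ⟶ X'.ind Φ :=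
  indLift (Φ.comp θ) (X := X'.ind Φ) (indUnit Φ X' ∘ₗ u)
      (fun d n hn => indUnit_mem Φ _ (hu d n hn)) (fun i j b n hb hn => by
        rw [LinearMap.comp_apply, hs i j b n hb hn, indUnit_smul]; rfl)

theorem indTransport_bijective {B' : GSAlg F} (θ : GSAlg.Hom B B') (θ' : GSAlg.Hom B' B)
    (hθ : ∀ b, θ.lin (θ'.lin b) = b)
    (Φ : GSAlg.Hom B' A) (X : GSMod B) (X' : GSMod B') (u : X.carrier ≃ₗ[F] X'.carrier)
    (hu : ∀ d x, x ∈ X.gr d → u.toLinearMap x ∈ X'.gr d)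
    (hs : ∀ i j b x, b ∈ B.gr i → x ∈ X.gr j → u.toLinearMap (b • x) = θ.lin b • u.toLinearMap x) :
    Function.Bijective (indTransport θ Φ X X' u.toLinearMap hu hs).lin := by
  have hu' : ∀ d x, x ∈ X'.gr d → u.symm x ∈ X.gr d := fun d x hx =>
    mem_of_map_mem X.internal X'.internal u.toLinearMap hu u.injective (by simpa using hx)
  let T : X'.ind Φ ⟶ X.ind (Φ.comp θ) := indLift Φ (indUnit (Φ.comp θ) X ∘ₗ u.symm.toLinearMap)
    (fun d n hn => indUnit_mem _ _ (hu' d n hn)) (fun i j b n hb hn => by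
      have : u.symm (b • n) = θ'.lin b • u.symm n := by
        rw [LinearEquiv.symm_apply_eq, ← LinearEquiv.coe_coe, hs i j _ _ (θ'.map_mem hb) (hu' _ _ hn), hθ,
          LinearEquiv.coe_coe, LinearEquiv.apply_symm_apply]
      rw [LinearMap.comp_apply, LinearEquiv.coe_coe, this, indUnit_smul, GSAlg.Hom.comp_lin, hθ]
      rfl)
  refine bij_of_comp_eq_id T (ind_hom_ext _ fun d n hn => ?_) (ind_hom_ext _ fun d n hn => ?_)
  · rw [comp_lin, indTransport, indLift_unit, LinearMap.comp_apply, indLift_unit, id_lin]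
    simp
  · rw [comp_lin, indLift_unit, LinearMap.comp_apply, indTransport, indLift_unit, id_lin]
    simp

end Ind

end GSMod

end SuperTower

namespace SuperTower

variable {F : Type u} [Field F]

section Signed

variable {V : Type*} [AddCommGroup V] [Module F V] {W : Type*} [AddCommGroup W] [Module F W]
  {X : Type*} [AddCommGroup X] [Module F X]
  {gr : Deg → Submodule F V} {gw : Deg → Submodule F W}

/-- The bilinear map `(v, w) ↦ (-1)^{v̄ w̄} f(v, w)`. -/
noncomputable def signed (h : DirectSum.IsInternal gr) (h' : DirectSum.IsInternal gw)
    (f : V →ₗ[F] W →ₗ[F] X) : V →ₗ[F] W →ₗ[F] X :=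
  ∑ ε : ZMod 2, f.compl₁₂ (ptwist h ε) (parityPart h' ε)

theorem signed_apply (h : DirectSum.IsInternal gr) (h' : DirectSum.IsInternal gw)
    (f : V →ₗ[F] W →ₗ[F] X) {i j : Deg} {x : V} {y : W} (hx : x ∈ gr i) (hy : y ∈ gw j) :
    signed h h' f x y = ksign i.2 j.2 • f x y := by
  have key : ∀ ε : ZMod 2, f (ptwist h ε x) (parityPart h' ε y) =
      if j.2 = ε then ksign i.2 j.2 • f x y else 0 := by
    intro ε
    rw [ptwist_of_mem h ε hx, parityPart_of_mem h' ε hy]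
    split_ifs with he
    · rw [← he, map_zsmul, LinearMap.smul_apply, ksign_comm]
    · rw [map_zero]
  simp [signed, key]

end Signed

theorem ksign_smul_ksign_smul {X : Type*} [AddCommGroup X] (i j : ZMod 2) (x : X) :
    ksign i j • ksign i j • x = x := by
  rw [smul_smul, ksign_self, one_smul]

namespace GSMod

variable {A B C D : GSAlg F}

section Outer

/-- The bilinear map `(m, n) ↦ m ⊗ n`. -/
noncomputable def otm (M : GSMod A) (N : GSMod B) :
    M.carrier →ₗ[F] N.carrier →ₗ[F] (M.outer N).carrier :=
  TensorProduct.mk F M.carrier N.carrier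

variable {M : GSMod A} {N : GSMod B}

theorem smul_otm (a : A.carrier) {i j : Deg} {b : B.carrier} (hb : b ∈ B.gr i) {m : M.carrier}
    (hm : m ∈ M.gr j) (n : N.carrier) :
    GSAlg.tmul a b • otm M N m n = ksign i.2 j.2 • otm M N (a • m) (b • n) :=
  tmul_smul_tmul M N a hb hm n

theorem smul_otm_left (a : A.carrier) (m : M.carrier) (n : N.carrier) :
    GSAlg.tmul a (1 : B.carrier) • otm M N m n = otm M N (a • m) n := by
  refine hom_induction M.internal (p := fun m => GSAlg.tmul a (1 : B.carrier) • otm M N m n =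
    otm M N (a • m) n) (fun d m hm => ?_) (fun x y hx hy => ?_) m
  · rw [smul_otm a B.one_mem hm, Prod.snd_zero, ksign_zero_left, one_smul, one_smul]
  · rw [map_add, LinearMap.add_apply, smul_add, hx, hy, smul_add, map_add, LinearMap.add_apply]

theorem smul_otm_right {i j : Deg} {b : B.carrier} (hb : b ∈ B.gr i) {m : M.carrier}
    (hm : m ∈ M.gr j) (n : N.carrier) :
    GSAlg.tmul (1 : A.carrier) b • otm M N m n = ksign i.2 j.2 • otm M N m (b • n) := by
  rw [smul_otm 1 hb hm, one_smul]

theorem otm_mem {i j : Deg} {m : M.carrier} {n : N.carrier} (hm : m ∈ M.gr i) (hn : n ∈ N.gr j) :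
    otm M N m n ∈ (M.outer N).gr (i + j) :=
  tmul_mem_tensorGr hm hn

theorem outer_induction {p : (M.outer N).carrier → Prop}
    (tmul : ∀ i j m n, m ∈ M.gr i → n ∈ N.gr j → p (otm M N m n))
    (add : ∀ x y, p x → p y → p (x + y)) (t : (M.outer N).carrier) : p t :=
  tensor_hom_induction M.internal N.internal (p := p) tmul add t

/-- Linear maps out of an outer tensor product. -/
noncomputable def outerLiftF {X : Type*} [AddCommGroup X] [Module F X]
    (f : M.carrier →ₗ[F] N.carrier →ₗ[F] X) : (M.outer N).carrier →ₗ[F] X :=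
  TensorProduct.lift f

@[simp] theorem outerLiftF_otm {X : Type*} [AddCommGroup X] [Module F X]
    (f : M.carrier →ₗ[F] N.carrier →ₗ[F] X) (m : M.carrier) (n : N.carrier) :
    outerLiftF f (otm M N m n) = f m n := rfl

theorem outer_lin_ext {X : Type*} [AddCommGroup X] [Module F X]
    {f g : (M.outer N).carrier →ₗ[F] X}
    (h : ∀ i j m n, m ∈ M.gr i → n ∈ N.gr j → f (otm M N m n) = g (otm M N m n)) : f = g :=
  tensor_lin_ext M.internal N.internal h

theorem outer_hom_ext {X : GSMod (A.tensor B)} {f g : M.outer N ⟶ X}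
    (h : ∀ i j m n, m ∈ M.gr i → n ∈ N.gr j → f.lin (otm M N m n) = g.lin (otm M N m n)) :
    f = g :=
  hom_ext (outer_induction h fun x y hx hy => by rw [map_add, map_add, hx, hy])

theorem map_outer_mem {X : Type*} [AddCommGroup X] [Module F X]
    (f : (M.outer N).carrier →ₗ[F] X) (S : Submodule F X) {d : Deg}
    (h : ∀ i j m n, m ∈ M.gr i → n ∈ N.gr j → i + j = d → f (otm M N m n) ∈ S)
    {x : (M.outer N).carrier} (hx : x ∈ (M.outer N).gr d) : f x ∈ S :=
  map_tensorGr_of_tmul f S h hx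

@[simp] theorem outerMap_otm {M' : GSMod A} {N' : GSMod B} (f : M ⟶ M') (g : N ⟶ N')
    (m : M.carrier) (n : N.carrier) :
    (outerMap f g).lin (otm M N m n) = otm M' N' (f.lin m) (g.lin n) := rfl

/-- A semilinearity condition for maps out of an outer tensor product may be checked on tensors
of homogeneous elements. -/
theorem outer_semilinear {X : GSMod C}
    (θ : (A.tensor B).carrier →ₗ[F] C.carrier) (f : (M.outer N).carrier →ₗ[F] X.carrier)
    (h : ∀ i j k l a b m n, a ∈ A.gr i → b ∈ B.gr j → m ∈ M.gr k → n ∈ N.gr l →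
      f (GSAlg.tmul a b • otm M N m n) = θ (GSAlg.tmul a b) • f (otm M N m n))
    (x : (A.tensor B).carrier) (t : (M.outer N).carrier) : f (x • t) = θ x • f t := by
  refine GSAlg.tensor_induction (p := fun x => f (x • t) = θ x • f t)
    (fun i j a b ha hb => ?_) (fun x y hx hy => by simp only [add_smul, map_add, hx, hy]) x
  exact outer_induction (p := fun t => f (GSAlg.tmul a b • t) = θ (GSAlg.tmul a b) • f t)
    (fun k l m n hm hn => h i j k l a b m n ha hb hm hn)
    (fun x y hx hy => by simp only [smul_add, map_add, hx, hy]) t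

/-- Morphisms out of an outer tensor product. -/
noncomputable def outerLift {X : GSMod (A.tensor B)} (f : M.carrier →ₗ[F] N.carrier →ₗ[F] X.carrier)
    (hmem : ∀ i j m n, m ∈ M.gr i → n ∈ N.gr j → f m n ∈ X.gr (i + j))
    (hsmul : ∀ i j k l a b m n, a ∈ A.gr i → b ∈ B.gr j → m ∈ M.gr k → n ∈ N.gr l →
      ksign j.2 k.2 • f (a • m) (b • n) = GSAlg.tmul a b • f m n) : M.outer N ⟶ X :=
  homOfF (M := M.outer N) (outerLiftF f)
    (fun d x hx => map_outer_mem _ _ (fun i j m n hm hn hd => hd ▸ hmem i j m n hm hn) hx)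
    (fun _ _ x t _ _ => outer_semilinear LinearMap.id (outerLiftF f)
      (fun i j k l a b m n ha hb hm hn => by
        rw [smul_otm a hb hm, map_zsmul, outerLiftF_otm, outerLiftF_otm]
        exact hsmul i j k l a b m n ha hb hm hn) x t)

@[simp] theorem outerLift_otm {X : GSMod (A.tensor B)}
    (f : M.carrier →ₗ[F] N.carrier →ₗ[F] X.carrier) (hmem) (hsmul) (m : M.carrier)
    (n : N.carrier) : (outerLift (X := X) f hmem hsmul).lin (otm M N m n) = f m n := rfl

end Outer

section IndOuter

/-- Bilinear maps out of an induced module. -/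
noncomputable def indLift₂ (φ : GSAlg.Hom B A) {N : GSMod B} {V : Type*} [AddCommGroup V]
    [Module F V] {gr : Deg → Submodule F V} (hV : DirectSum.IsInternal gr) {X : Type*}
    [AddCommGroup X] [Module F X] (f : V →ₗ[F] A.carrier →ₗ[F] N.carrier →ₗ[F] X)
    (h : ∀ l i j k v a b n, v ∈ gr l → a ∈ A.gr i → b ∈ B.gr j → n ∈ N.gr k →
      f v (a * φ.lin b) n = f v a (b • n)) : V →ₗ[F] (N.ind φ).carrier →ₗ[F] X :=
  have h' : ∀ v i j k a b n, a ∈ A.gr i → b ∈ B.gr j → n ∈ N.gr k →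
      TensorProduct.lift (f v) ((a * φ.lin b) ⊗ₜ[F] n) =
        TensorProduct.lift (f v) (a ⊗ₜ[F] (b • n)) := fun v i j k a b n ha hb hn => by
    refine hom_induction hV (p := fun v => TensorProduct.lift (f v) ((a * φ.lin b) ⊗ₜ[F] n) =
        TensorProduct.lift (f v) (a ⊗ₜ[F] (b • n))) (fun l v hv => h l i j k v a b n hv ha hb hn)
      (fun x y hx hy => by
        simp only [TensorProduct.lift.tmul, map_add, LinearMap.add_apply] at hx hy ⊢
        rw [hx, hy]) v
  { toFun := fun v => indLiftF φ (TensorProduct.lift (f v)) (h' v)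
    map_add' := fun v v' => LinearMap.ext fun x => by
      obtain ⟨t, rfl⟩ := imk_surjective φ N x
      rw [LinearMap.add_apply, indLiftF_mk, indLiftF_mk, indLiftF_mk, ← LinearMap.add_apply]
      congr 1
      exact TensorProduct.ext' fun a n => by simp
    map_smul' := fun c v => LinearMap.ext fun x => by
      obtain ⟨t, rfl⟩ := imk_surjective φ N x
      rw [LinearMap.smul_apply, indLiftF_mk, indLiftF_mk, ← LinearMap.smul_apply]
      congr 1
      exact TensorProduct.ext' fun a n => by simp }

theorem indLift₂_mk (φ : GSAlg.Hom B A) {N : GSMod B} {V : Type*} [AddCommGroup V]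
    [Module F V] {gr : Deg → Submodule F V} (hV : DirectSum.IsInternal gr) {X : Type*}
    [AddCommGroup X] [Module F X] (f : V →ₗ[F] A.carrier →ₗ[F] N.carrier →ₗ[F] X) (h)
    (v : V) (a : A.carrier) (n : N.carrier) :
    indLift₂ φ hV f h v (imk φ N (a ⊗ₜ n)) = f v a n := rfl

/-- The morphism of induced modules given by a morphism. -/
noncomputable def indMap (φ : GSAlg.Hom B A) {N N' : GSMod B} (f : N ⟶ N') :
    N.ind φ ⟶ N'.ind φ := (indFunctor φ).map f

theorem indMap_lin_unit (φ : GSAlg.Hom B A) {N N' : GSMod B} (f : N ⟶ N') (n : N.carrier) :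
    (indMap φ f).lin (indUnit φ N n) = indUnit φ N' (f.lin n) := rfl

theorem ind_outer_hom_ext (φ : GSAlg.Hom (B.tensor C) A) {M : GSMod B} {N : GSMod C} {X : GSMod A}
    {f g : (M.outer N).ind φ ⟶ X} (h : ∀ i j m n, m ∈ M.gr i → n ∈ N.gr j →
      f.lin (indUnit φ _ (otm M N m n)) = g.lin (indUnit φ _ (otm M N m n))) : f = g :=
  ind_hom_ext φ fun _ x _ => outer_induction
    (p := fun x => f.lin (indUnit φ _ x) = g.lin (indUnit φ _ x)) h
    (fun x y hx hy => by simp only [map_add, hx, hy]) x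

/-- The comparison `(C ⊗ A) ⊗_{C ⊗ B} (M ⊠ Y) → M ⊠ (A ⊗_B Y)`. -/
noncomputable def indOuterHom (M : GSMod C) (ψ : GSAlg.Hom B A) (Y : GSMod B) :
    (M.outer Y).ind ((GSAlg.Hom.id C).tensor ψ) ⟶ M.outer (Y.ind ψ) :=
  indLift _ (X := M.outer (Y.ind ψ)) (outerLiftF ((otm M (Y.ind ψ)).compl₂ (indUnit ψ Y)))
    (fun d x hx => map_outer_mem _ _ (fun i j m n hm hn hd =>
      hd ▸ otm_mem hm (indUnit_mem ψ Y hn)) hx)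
    (fun _ _ x t _ _ => outer_semilinear _ _
      (fun i j k l a b m n ha hb hm hn => by
        rw [smul_otm a hb hm, map_zsmul, outerLiftF_otm, outerLiftF_otm, LinearMap.compl₂_apply,
          LinearMap.compl₂_apply, GSAlg.Hom.tensor_tmul, indUnit_smul,
          smul_otm _ (ψ.map_mem hb) hm, GSAlg.Hom.id_lin]) x t)

theorem indOuterHom_unit (M : GSMod C) (ψ : GSAlg.Hom B A) (Y : GSMod B) (m : M.carrier)
    (y : Y.carrier) : (indOuterHom M ψ Y).lin (indUnit _ (M.outer Y) (otm M Y m y)) =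
      otm M (Y.ind ψ) m (indUnit ψ Y y) := by
  rw [indOuterHom, indLift_unit]; rfl

/-- The map `m ⊗ (a ⊗ y) ↦ (-1)^{ā m̄} (1 ⊗ a) ⊗ (m ⊗ y)`. -/
noncomputable def indOuterInv (M : GSMod C) (ψ : GSAlg.Hom B A) (Y : GSMod B) :
    (M.outer (Y.ind ψ)).carrier →ₗ[F]
      ((M.outer Y).ind ((GSAlg.Hom.id C).tensor ψ)).carrier :=
  outerLiftF (indLift₂ ψ M.internal (signed M.internal A.internal (LinearMap.mk₂ F
      (fun m a => rightAct ((M.outer Y).ind ((GSAlg.Hom.id C).tensor ψ)) a ∘ₗ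
        indUnit ((GSAlg.Hom.id C).tensor ψ) (M.outer Y) ∘ₗ otm M Y m)
      (fun m m' a => by ext; simp) (fun c m a => by ext; simp)
      (fun m a a' => by ext; simp) (fun c m a => by ext; simp)))
    (fun l i j k v a b n hv ha hb hn => by
      rw [signed_apply _ _ _ hv (A.mul_mem ha (ψ.map_mem hb)), signed_apply _ _ _ hv ha]
      simp only [LinearMap.smul_apply, LinearMap.mk₂_apply, LinearMap.comp_apply, rightAct_apply]
      rw [← GSAlg.one_mul_tmul, mul_smul, show GSAlg.tmul (1 : C.carrier) (ψ.lin b) =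
        ((GSAlg.Hom.id C).tensor ψ).lin (GSAlg.tmul 1 b) from rfl, ← indUnit_smul,
        smul_otm_right hb hv, map_zsmul, smul_comm (GSAlg.tmul (1 : C.carrier) a), smul_smul, Prod.snd_add, ksign_add_right,
        mul_assoc, ksign_comm j.2, ksign_self, mul_one]))

theorem indOuterInv_mk (M : GSMod C) (ψ : GSAlg.Hom B A) (Y : GSMod B) {i j : Deg} {m : M.carrier}
    (hm : m ∈ M.gr i) {a : A.carrier} (ha : a ∈ A.gr j) (y : Y.carrier) :
    indOuterInv M ψ Y (otm M (Y.ind ψ) m (imk ψ Y (a ⊗ₜ y))) =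
      ksign i.2 j.2 • GSAlg.tmul (1 : C.carrier) a • indUnit _ (M.outer Y) (otm M Y m y) := by
  rw [indOuterInv, outerLiftF_otm, indLift₂_mk, signed_apply _ _ _ hm ha]
  rfl

theorem indOuterHom_bijective (M : GSMod C) (ψ : GSAlg.Hom B A) (Y : GSMod B) :
    Function.Bijective (indOuterHom M ψ Y).lin := by
  have hu : ∀ x, ((GSAlg.Hom.id C).tensor ψ).lin 1 • indUnit _ (M.outer Y) x =
      indUnit ((GSAlg.Hom.id C).tensor ψ) (M.outer Y) x := one_smul_indUnit _ _
  refine bij_of_inverse (indOuterInv M ψ Y) (fun x => ?_) (fun x => ?_)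
  · refine ind_induction _ (p := fun x => indOuterInv M ψ Y ((indOuterHom M ψ Y).lin x) = x)
      (fun i j c x hc hx => ?_) (fun x y hx hy => by rw [map_add, map_add, hx, hy]) x
    rw [imk_eq]
    refine GSAlg.tensor_induction (p := fun c => indOuterInv M ψ Y ((indOuterHom M ψ Y).lin
      (c • indUnit _ (M.outer Y) x)) = c • indUnit _ (M.outer Y) x)
      (fun i j c a hc ha => ?_) (fun x y hx hy => by rw [add_smul, map_add, map_add, hx, hy]) c
    refine outer_induction (p := fun x => indOuterInv M ψ Y ((indOuterHom M ψ Y).lin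
      (GSAlg.tmul c a • indUnit _ (M.outer Y) x)) = GSAlg.tmul c a • indUnit _ (M.outer Y) x)
      (fun k l m y hm hy => ?_)
      (fun x y hx hy => by rw [map_add, smul_add, map_add, map_add, hx, hy]) x
    rw [map_smul, indOuterHom_unit, smul_otm c ha hm, map_zsmul, ← imk_eq,
      indOuterInv_mk M ψ Y (M.smul_mem hc hm) ha, smul_smul, ← smul_otm_left, indUnit_smul,
      GSAlg.Hom.tensor_tmul, GSAlg.Hom.id_lin, smul_smul, GSAlg.tmul_mul_tmul _ _ ha hc,
      smul_assoc, smul_smul, Prod.snd_add, ksign_add_left, one_mul, ← hu, GSAlg.tensor_one,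
      GSAlg.Hom.tensor_tmul, GSAlg.Hom.id_lin, smul_smul, smul_smul,
      GSAlg.tmul_mul_tmul _ _ (A.mul_mem ha (ψ.map_mem B.one_mem)) C.one_mem,
      GSAlg.tmul_mul_tmul _ _ ha C.one_mem, mul_assoc, mul_assoc, mul_assoc, ← ψ.map_mul]
    have : ksign j.2 k.2 * (ksign i.2 j.2 * (ksign k.2 j.2 * ksign j.2 i.2)) = 1 := by
      generalize i.2 = i; generalize j.2 = j; generalize k.2 = k
      revert i j k; decide
    simp [this]
  · refine outer_induction (p := fun x => (indOuterHom M ψ Y).lin (indOuterInv M ψ Y x) = x)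
      (fun i j m n hm hn => ?_) (fun x y hx hy => by rw [map_add, map_add, hx, hy]) x
    refine ind_induction ψ (p := fun n => (indOuterHom M ψ Y).lin (indOuterInv M ψ Y
      (otm M (Y.ind ψ) m n)) = otm M (Y.ind ψ) m n) (fun i j a y ha hy => ?_)
      (fun x y hx hy => by simp only [map_add, hx, hy]) n
    rw [indOuterInv_mk M ψ Y hm ha, map_zsmul, map_smul, indOuterHom_unit, smul_otm_right ha hm,
      ← imk_eq, ksign_comm, ksign_smul_ksign_smul]

theorem indOuterHom_natural (M : GSMod C) (ψ : GSAlg.Hom B A) {X Y : GSMod B} (g : X ⟶ Y) :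
    indMap ((GSAlg.Hom.id C).tensor ψ) (outerMap (𝟙 M) g) ≫ indOuterHom M ψ Y =
      indOuterHom M ψ X ≫ outerMap (𝟙 M) (indMap ψ g) :=
  ind_outer_hom_ext _ fun i j m n _ _ => by
    rw [comp_lin, comp_lin, indMap_lin_unit, outerMap_otm, indOuterHom_unit, indOuterHom_unit,
      outerMap_otm, indMap_lin_unit]

/-- `M ⊠ -` commutes with induction. -/
noncomputable def indOuter (M : GSMod C) (ψ : GSAlg.Hom B A) :
    outerFunctor M B ⋙ indFunctor ((GSAlg.Hom.id C).tensor ψ) ≅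
      indFunctor ψ ⋙ outerFunctor M A :=
  natIsoOfBij' (G := outerFunctor M B ⋙ indFunctor ((GSAlg.Hom.id C).tensor ψ))
    (H := indFunctor ψ ⋙ outerFunctor M A) (indOuterHom M ψ) (indOuterHom_bijective M ψ)
    (indOuterHom_natural M ψ)

/-- The comparison `(A ⊗ C) ⊗_{B ⊗ C} (X ⊠ L) → (A ⊗_B X) ⊠ L`. -/
noncomputable def outerIndHom (φ : GSAlg.Hom B A) (X : GSMod B) (L : GSMod C) :
    (X.outer L).ind (φ.tensor (GSAlg.Hom.id C)) ⟶ (X.ind φ).outer L :=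
  indLift _ (X := (X.ind φ).outer L) (outerLiftF ((otm (X.ind φ) L) ∘ₗ (indUnit φ X)))
    (fun d x hx => map_outer_mem _ _ (fun i j m n hm hn hd =>
      hd ▸ otm_mem (indUnit_mem φ X hm) hn) hx)
    (fun _ _ x t _ _ => outer_semilinear _ _
      (fun i j k l a b m n ha hb hm hn => by
        rw [smul_otm a hb hm, map_zsmul, outerLiftF_otm, outerLiftF_otm, LinearMap.comp_apply,
          LinearMap.comp_apply, GSAlg.Hom.tensor_tmul, indUnit_smul,
          GSAlg.Hom.id_lin, smul_otm _ hb (indUnit_mem φ X hm)]) x t)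

theorem outerIndHom_unit (φ : GSAlg.Hom B A) (X : GSMod B) (L : GSMod C) (x : X.carrier)
    (l : L.carrier) : (outerIndHom φ X L).lin (indUnit _ (X.outer L) (otm X L x l)) =
      otm (X.ind φ) L (indUnit φ X x) l := by
  rw [outerIndHom, indLift_unit]; rfl

/-- The map `(a ⊗ x) ⊗ l ↦ (a ⊗ 1) ⊗ (x ⊗ l)`. -/
noncomputable def outerIndInv (φ : GSAlg.Hom B A) (X : GSMod B) (L : GSMod C) :
    ((X.ind φ).outer L).carrier →ₗ[F]
      ((X.outer L).ind (φ.tensor (GSAlg.Hom.id C))).carrier :=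
  outerLiftF (indLift₂ φ L.internal (LinearMap.mk₂ F
      (fun l a => leftAct ((X.outer L).ind (φ.tensor (GSAlg.Hom.id C))) a ∘ₗ
        indUnit (φ.tensor (GSAlg.Hom.id C)) (X.outer L) ∘ₗ (otm X L).flip l)
      (fun m m' a => by ext; simp) (fun c m a => by ext; simp)
      (fun m a a' => by ext; simp) (fun c m a => by ext; simp))
    (fun l i j k v a b n hv ha hb hn => by
      simp only [LinearMap.mk₂_apply, LinearMap.comp_apply, leftAct_mul]
      congr 1
      rw [leftAct_apply, LinearMap.flip_apply, LinearMap.flip_apply,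
        show GSAlg.tmul (φ.lin b) (1 : C.carrier) =
        (φ.tensor (GSAlg.Hom.id C)).lin (GSAlg.tmul b 1) from rfl, ← indUnit_smul,
        smul_otm_left])).flip

theorem outerIndInv_mk (φ : GSAlg.Hom B A) (X : GSMod B) (L : GSMod C) (a : A.carrier)
    (x : X.carrier) (l : L.carrier) :
    outerIndInv φ X L (otm (X.ind φ) L (imk φ X (a ⊗ₜ x)) l) =
      GSAlg.tmul a (1 : C.carrier) • indUnit _ (X.outer L) (otm X L x l) := rfl

theorem outerIndHom_bijective (φ : GSAlg.Hom B A) (X : GSMod B) (L : GSMod C) :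
    Function.Bijective (outerIndHom φ X L).lin := by
  have hu : ∀ x, (φ.tensor (GSAlg.Hom.id C)).lin 1 • indUnit _ (X.outer L) x =
      indUnit (φ.tensor (GSAlg.Hom.id C)) (X.outer L) x := one_smul_indUnit _ _
  refine bij_of_inverse (outerIndInv φ X L) (fun x => ?_) (fun x => ?_)
  · refine ind_induction _ (p := fun x => outerIndInv φ X L ((outerIndHom φ X L).lin x) = x)
      (fun i j c x hc hx => ?_) (fun x y hx hy => by rw [map_add, map_add, hx, hy]) x
    rw [imk_eq]
    refine GSAlg.tensor_induction (p := fun c => outerIndInv φ X L ((outerIndHom φ X L).lin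
      (c • indUnit _ (X.outer L) x)) = c • indUnit _ (X.outer L) x)
      (fun i j a c ha hc => ?_) (fun x y hx hy => by rw [add_smul, map_add, map_add, hx, hy]) c
    refine outer_induction (p := fun x => outerIndInv φ X L ((outerIndHom φ X L).lin
      (GSAlg.tmul a c • indUnit _ (X.outer L) x)) = GSAlg.tmul a c • indUnit _ (X.outer L) x)
      (fun k l x y hx hy => ?_)
      (fun x y hx hy => by rw [map_add, smul_add, map_add, map_add, hx, hy]) x
    have h1 : otm X L x (c • y) = ksign j.2 k.2 • GSAlg.tmul (1 : B.carrier) c • otm X L x y := by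
      rw [smul_otm_right hc hx, ksign_smul_ksign_smul]
    rw [map_smul, outerIndHom_unit, smul_otm a hc (indUnit_mem φ X hx), map_zsmul, ← imk_eq,
      outerIndInv_mk, h1, map_zsmul, smul_comm (GSAlg.tmul a (1 : C.carrier)),
      ksign_smul_ksign_smul, indUnit_smul, GSAlg.Hom.tensor_tmul, smul_smul,
      GSAlg.tmul_mul_one, ← hu, smul_smul, smul_smul, GSAlg.tensor_one, GSAlg.Hom.tensor_tmul,
      GSAlg.Hom.id_lin, GSAlg.Hom.id_lin, GSAlg.tmul_mul_tmul _ _ hc (φ.map_mem B.one_mem),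
      GSAlg.tmul_mul_tmul _ _ hc (φ.map_mem B.one_mem), mul_assoc, ← φ.map_mul, mul_one]
  · refine outer_induction (p := fun x => (outerIndHom φ X L).lin (outerIndInv φ X L x) = x)
      (fun i j x l hx hl => ?_) (fun x y hx hy => by rw [map_add, map_add, hx, hy]) x
    refine ind_induction φ (p := fun x => (outerIndHom φ X L).lin (outerIndInv φ X L
      (otm (X.ind φ) L x l)) = otm (X.ind φ) L x l) (fun i j a y ha hy => ?_)
      (fun x y hx hy => by simp only [map_add, LinearMap.add_apply, hx, hy]) x
    rw [outerIndInv_mk, map_smul, outerIndHom_unit, smul_otm_left, ← imk_eq]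

theorem outerIndHom_natural (φ : GSAlg.Hom B A) (X : GSMod B) {L L' : GSMod C} (g : L ⟶ L') :
    indMap (φ.tensor (GSAlg.Hom.id C)) (outerMap (𝟙 X) g) ≫ outerIndHom φ X L' =
      outerIndHom φ X L ≫ outerMap (𝟙 (X.ind φ)) g :=
  ind_outer_hom_ext _ fun i j m n _ _ => by
    rw [comp_lin, comp_lin, indMap_lin_unit, outerMap_otm, outerIndHom_unit, outerIndHom_unit,
      outerMap_otm]
    rfl

/-- The outer tensor product with an induced module. -/
noncomputable def outerInd (φ : GSAlg.Hom B A) (X : GSMod B) (C : GSAlg F) :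
    outerFunctor X C ⋙ indFunctor (φ.tensor (GSAlg.Hom.id C)) ≅ outerFunctor (X.ind φ) C :=
  natIsoOfBij' (G := outerFunctor X C ⋙ indFunctor (φ.tensor (GSAlg.Hom.id C)))
    (H := outerFunctor (X.ind φ) C) (outerIndHom φ X) (outerIndHom_bijective φ X)
    (outerIndHom_natural φ X)

/-- The associativity of outer tensor products. -/
noncomputable def outerAssoc (M : GSMod A) (N : GSMod B) (L : GSMod C) :
    ((M.outer N).outer L).carrier ≃ₗ[F] (M.outer (N.outer L)).carrier :=
  TensorProduct.assoc F M.carrier N.carrier L.carrier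

theorem outerAssoc_otm (M : GSMod A) (N : GSMod B) (L : GSMod C) (m : M.carrier) (n : N.carrier)
    (l : L.carrier) : outerAssoc M N L (otm (M.outer N) L (otm M N m n) l) =
      otm M (N.outer L) m (otm N L n l) := rfl

theorem outerAssoc_mem (M : GSMod A) (N : GSMod B) (L : GSMod C) (d : Deg) (x)
    (hx : x ∈ ((M.outer N).outer L).gr d) :
    (outerAssoc M N L).toLinearMap x ∈ (M.outer (N.outer L)).gr d := by
  refine map_outer_mem _ _ (fun i j x l hx hl hd => ?_) hx
  refine map_outer_mem ((outerAssoc M N L).toLinearMap ∘ₗ (otm (M.outer N) L).flip l) _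
    (fun i' j' m n hm hn hi => ?_) hx
  rw [← hd, ← hi, add_assoc]
  exact otm_mem hm (otm_mem hn hl)

theorem outerAssoc_smul (M : GSMod A) (N : GSMod B) (L : GSMod C)
    (x : ((A.tensor B).tensor C).carrier) (t : ((M.outer N).outer L).carrier) :
    (outerAssoc M N L).toLinearMap (x • t) =
      (GSAlg.assocHom A B C).lin x • (outerAssoc M N L).toLinearMap t := by
  refine GSAlg.three_induction (p := fun x => (outerAssoc M N L).toLinearMap (x • t) =
      (GSAlg.assocHom A B C).lin x • (outerAssoc M N L).toLinearMap t)
      (fun i j k a b c ha hb hc => ?_) (fun x y hx hy => by simp only [add_smul, map_add, hx, hy]) x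
  refine outer_induction (p := fun t => (outerAssoc M N L).toLinearMap
    (GSAlg.tmul (GSAlg.tmul a b) c • t) = (GSAlg.assocHom A B C).lin
      (GSAlg.tmul (GSAlg.tmul a b) c) • (outerAssoc M N L).toLinearMap t)
      (fun _ k' s l _ hl => ?_) (fun x y hx hy => by simp only [smul_add, map_add, hx, hy]) t
  refine outer_induction (p := fun s => (outerAssoc M N L).toLinearMap
    (GSAlg.tmul (GSAlg.tmul a b) c • otm (M.outer N) L s l) = (GSAlg.assocHom A B C).lin
      (GSAlg.tmul (GSAlg.tmul a b) c) • (outerAssoc M N L).toLinearMap (otm (M.outer N) L s l))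
      (fun i' j' m n hm hn => ?_)
      (fun x y hx hy => by simp only [smul_add, map_add, LinearMap.add_apply, hx, hy]) s
  change outerAssoc M N L _ = GSAlg.tmul a (GSAlg.tmul b c) • outerAssoc M N L _
  rw [smul_otm _ hc (otm_mem hm hn), smul_otm _ hb hm, outerAssoc_otm,
    smul_otm a (GSAlg.tmul_mem hb hc) hm, smul_otm b hc hn, map_zsmul, map_zsmul,
    LinearMap.smul_apply, map_zsmul, map_zsmul, outerAssoc_otm, smul_smul, smul_smul, Prod.snd_add, Prod.snd_add,
    ksign_add_left, ksign_add_right]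
  congr 1
  ring

/-- The comparison of the inductions of `(M ⊠ N) ⊠ L` and `M ⊠ (N ⊠ L)`. -/
noncomputable def indAssocHom (M : GSMod A) (N : GSMod B)
    (Φ : GSAlg.Hom (A.tensor (B.tensor C)) D) (L : GSMod C) :
    ((M.outer N).outer L).ind (Φ.comp (GSAlg.assocHom A B C)) ⟶ (M.outer (N.outer L)).ind Φ :=
  indTransport (GSAlg.assocHom A B C) Φ ((M.outer N).outer L) (M.outer (N.outer L))
      (outerAssoc M N L).toLinearMap (outerAssoc_mem M N L)
      (fun _ _ x t _ _ => outerAssoc_smul M N L x t)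

theorem indAssocHom_unit (M : GSMod A) (N : GSMod B)
    (Φ : GSAlg.Hom (A.tensor (B.tensor C)) D) (L : GSMod C) (x) :
    (indAssocHom M N Φ L).lin (indUnit (Φ.comp (GSAlg.assocHom A B C)) ((M.outer N).outer L) x) =
      indUnit Φ (M.outer (N.outer L)) (outerAssoc M N L x) := by
  rw [indAssocHom, indTransport, indLift_unit]
  rfl

theorem indAssoc_natural (M : GSMod A) (N : GSMod B)
    (Φ : GSAlg.Hom (A.tensor (B.tensor C)) D) {L L' : GSMod C} (g : L ⟶ L') :
    indMap (Φ.comp (GSAlg.assocHom A B C)) (outerMap (𝟙 (M.outer N)) g) ≫ indAssocHom M N Φ L' =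
      indAssocHom M N Φ L ≫ indMap Φ (outerMap (𝟙 M) (outerMap (𝟙 N) g)) :=
  ind_outer_hom_ext _ fun i j x l _ _ => by
    rw [comp_lin, comp_lin, indMap_lin_unit, indAssocHom_unit, indAssocHom_unit, indMap_lin_unit]
    refine outer_induction (p := fun x => indUnit Φ (M.outer (N.outer L')) (outerAssoc M N L'
      ((outerMap (𝟙 (M.outer N)) g).lin (otm (M.outer N) L x l))) =
      indUnit Φ (M.outer (N.outer L')) ((outerMap (𝟙 M) (outerMap (𝟙 N) g)).lin
        (outerAssoc M N L (otm (M.outer N) L x l)))) (fun _ _ m n _ _ => rfl)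
      (fun x y hx hy => by simp only [map_add, LinearMap.add_apply, hx, hy]) x

/-- Induction of triple outer tensor products. -/
noncomputable def indAssoc (M : GSMod A) (N : GSMod B) (Φ : GSAlg.Hom (A.tensor (B.tensor C)) D) :
    outerFunctor (M.outer N) C ⋙ indFunctor (Φ.comp (GSAlg.assocHom A B C)) ≅
      outerFunctor N C ⋙ outerFunctor M (B.tensor C) ⋙ indFunctor Φ :=
  natIsoOfBij' (G := outerFunctor (M.outer N) C ⋙ indFunctor (Φ.comp (GSAlg.assocHom A B C)))
    (H := outerFunctor N C ⋙ outerFunctor M (B.tensor C) ⋙ indFunctor Φ)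
    (indAssocHom M N Φ)
    (fun L => indTransport_bijective (GSAlg.assocHom A B C) (GSAlg.assocInv A B C)
      (fun b => (GSAlg.assocLin A B C).apply_symm_apply b) Φ ((M.outer N).outer L)
      (M.outer (N.outer L)) (outerAssoc M N L) (outerAssoc_mem M N L)
      (fun _ _ x t _ _ => outerAssoc_smul M N L x t))
    (fun g => indAssoc_natural M N Φ g)

end IndOuter

end GSMod

namespace Tower

variable {Λ : Type} [AddCommMonoid Λ] (T : Tower F Λ)

theorem rho_comp {l m n p q s : Λ} (h₁ : m + n = p) (h₂ : l + p = q) (h₃ : l + m = s)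
    (h₄ : s + n = q) : (T.ρ h₄).comp ((T.ρ h₃).tensor (GSAlg.Hom.id _)) =
      ((T.ρ h₂).comp ((GSAlg.Hom.id _).tensor (T.ρ h₁))).comp
        (GSAlg.assocHom (T.A l) (T.A m) (T.A n)) := by
  refine GSAlg.Hom.ext (LinearMap.ext fun x => ?_)
  refine GSAlg.three_induction (p := fun x =>
    ((T.ρ h₄).comp ((T.ρ h₃).tensor (GSAlg.Hom.id _))).lin x =
      (((T.ρ h₂).comp ((GSAlg.Hom.id _).tensor (T.ρ h₁))).comp (GSAlg.assocHom _ _ _)).lin x)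
    (fun _ _ _ a b c _ _ _ => ?_) (fun x y hx hy => ?_) x
  · exact T.assoc h₃ h₄ h₁ h₂ a b c
  · rw [map_add, map_add, hx, hy]

/-- `Ind_M ∘ Ind_N ≅ Ind_{∇(M ⊠ N)}`. -/
theorem ind_comp_ind {l m n p q s : Λ} (h₁ : m + n = p) (h₂ : l + p = q) (h₃ : l + m = s)
    (h₄ : s + n = q) (M : GSMod (T.A l)) (N : GSMod (T.A m)) :
    Nonempty (T.Ind h₁ N ⋙ T.Ind h₂ M ≅ T.Ind h₄ (T.nabla h₃ M N)) := by
  refine ⟨?_⟩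
  refine Functor.isoWhiskerLeft (GSMod.outerFunctor N _)
    (Functor.isoWhiskerRight (GSMod.indOuter M (T.ρ h₁)).symm (GSMod.indFunctor (T.ρ h₂))) ≪≫ ?_
  refine Functor.isoWhiskerLeft (GSMod.outerFunctor N _ ⋙ GSMod.outerFunctor M _)
    (GSMod.indComp (T.ρ h₂) ((GSAlg.Hom.id _).tensor (T.ρ h₁))).symm ≪≫ ?_
  refine (GSMod.indAssoc M N _).symm ≪≫ ?_
  rw [← T.rho_comp h₁ h₂ h₃ h₄]
  exact Functor.isoWhiskerLeft _ (GSMod.indComp (T.ρ h₄) ((T.ρ h₃).tensor (GSAlg.Hom.id _))) ≪≫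
    Functor.isoWhiskerRight (GSMod.outerInd (T.ρ h₃) (M.outer N) _) (GSMod.indFunctor (T.ρ h₄))

end Tower

end SuperTower

namespace SuperTower

variable {F : Type u} [Field F]

namespace GSMod

variable {A B C D B' C' : GSAlg F}

section HomBasics

/-- The inclusion of `HOM_B(P, N)` into the space of all linear maps. -/
noncomputable def homι (P : GSMod B) (N : GSMod (C.tensor B)) :
    (hom P N).carrier →ₗ[F] P.carrier →ₗ[F] N.carrier :=
  (HomCarrier P N).subtype

/-- A homogeneous element of `HOM_B(P, N)`. -/
noncomputable def homMk {P : GSMod B} {N : GSMod (C.tensor B)} {d : Deg}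
    (f : P.carrier →ₗ[F] N.carrier) (hf : f ∈ homPiece P N.gr N.rightAct d) :
    (hom P N).carrier :=
  (⟨f, homPiece_le P N d hf⟩ : HomCarrier P N)

variable {P : GSMod B} {N : GSMod (C.tensor B)}

theorem homι_injective : Function.Injective (homι P N) := Subtype.val_injective

@[simp] theorem homι_homMk {d : Deg} (f : P.carrier →ₗ[F] N.carrier)
    (hf : f ∈ homPiece P N.gr N.rightAct d) : homι P N (homMk f hf) = f := rfl

theorem homι_mem {d : Deg} {f : (hom P N).carrier} :
    homι P N f ∈ homPiece P N.gr N.rightAct d ↔ f ∈ (hom P N).gr d := Iff.rfl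

theorem homMk_mem {d : Deg} (f : P.carrier →ₗ[F] N.carrier)
    (hf : f ∈ homPiece P N.gr N.rightAct d) : homMk f hf ∈ (hom P N).gr d := hf

theorem homι_smul (c : C.carrier) (f : (hom P N).carrier) :
    homι P N (c • f) = N.leftAct c ∘ₗ homι P N f := rfl

theorem homι_smul_apply (c : C.carrier) (f : (hom P N).carrier) (p : P.carrier) :
    homι P N (c • f) p = GSAlg.tmul c (1 : B.carrier) • homι P N f p := rfl

@[simp] theorem homι_map {N' : GSMod (C.tensor B)} (g : N ⟶ N') (f : (hom P N).carrier)
    (p : P.carrier) : homι P N' (((homFunctor P C).map g).lin f) p = g.lin (homι P N f p) := rfl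

/-- The map between spaces of homomorphisms induced by a linear map that preserves the homogeneous
homomorphisms. -/
noncomputable def homLin {P' : GSMod B'} {N' : GSMod (C'.tensor B')}
    (T : (P.carrier →ₗ[F] N.carrier) →ₗ[F] (P'.carrier →ₗ[F] N'.carrier))
    (hT : ∀ d f, f ∈ homPiece P N.gr N.rightAct d → T f ∈ HomCarrier P' N') :
    (hom P N).carrier →ₗ[F] (hom P' N').carrier :=
  (T ∘ₗ homι P N).codRestrict (HomCarrier P' N') fun f =>
    hom_induction (hom P N).internal (p := fun f => T (homι P N f) ∈ HomCarrier P' N')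
      (fun d _ hf => hT d _ hf)
      (fun x y hx hy => by rw [map_add, map_add]; exact add_mem hx hy) f

/-- A map between spaces of homomorphisms as a morphism. -/
noncomputable def homHom {P' : GSMod B'} {N' : GSMod (C.tensor B')}
    (T : (P.carrier →ₗ[F] N.carrier) →ₗ[F] (P'.carrier →ₗ[F] N'.carrier))
    (hT : ∀ d f, f ∈ homPiece P N.gr N.rightAct d → T f ∈ homPiece P' N'.gr N'.rightAct d)
    (hC : ∀ i d c f, c ∈ C.gr i → f ∈ homPiece P N.gr N.rightAct d →
      T (N.leftAct c ∘ₗ f) = N'.leftAct c ∘ₗ T f) : hom P N ⟶ hom P' N' :=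
  homOfF (homLin T fun d f hf => homPiece_le P' N' d (hT d f hf)) (fun d _ hf => hT d _ hf)
    (fun i d c _ hc hf => homι_injective (hC i d c _ hc hf))

theorem hom_bijective_of_pieces {M : GSMod C} {M' : GSMod C'} (f : M.carrier →ₗ[F] M'.carrier)
    (hmem : ∀ d m, m ∈ M.gr d → f m ∈ M'.gr d)
    (hi : ∀ d m, m ∈ M.gr d → f m = 0 → m = 0)
    (hs : ∀ d m, m ∈ M'.gr d → ∃ x, f x = m) : Function.Bijective f :=
  ⟨injective_of_pieces M.internal M'.internal f hmem hi, surjective_of_pieces M'.internal f hs⟩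

/-- Precomposition with a morphism. -/
noncomputable def homPre {P' : GSMod B} (u : P' ⟶ P) (N : GSMod (C.tensor B)) :
    hom P N ⟶ hom P' N :=
  homHom (LinearMap.lcomp F N.carrier (Hom.linF u))
    (fun d f hf => ⟨fun j m hm => hf.1 j _ (u.map_mem hm), fun i b m hb => by
      rw [LinearMap.lcomp_apply, LinearMap.lcomp_apply, linF_apply, linF_apply, map_smul]
      exact hf.2 i b _ hb⟩) (fun _ _ _ _ _ _ => rfl)

theorem homPre_natural {P' : GSMod B} (u : P' ⟶ P) {N N' : GSMod (C.tensor B)} (g : N ⟶ N') :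
    (homFunctor P C).map g ≫ homPre u N' = homPre u N ≫ (homFunctor P' C).map g := rfl

/-- Isomorphic modules have isomorphic functors of homomorphisms. -/
noncomputable def homFunctorIso {P' : GSMod B} (e : P ≅ P') (C : GSAlg F) :
    homFunctor P' C ≅ homFunctor P C :=
  natIsoOfBij' (G := homFunctor P' C) (H := homFunctor P C) (homPre e.hom)
    (fun N => bij_of_comp_eq_id (homPre e.inv N)
      (hom_ext fun f => homι_injective (LinearMap.ext fun p => by
        change homι P' N f (e.hom.lin (e.inv.lin p)) = homι P' N f p
        rw [← comp_lin, e.inv_hom_id, id_lin]))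
      (hom_ext fun f => homι_injective (LinearMap.ext fun p => by
        change homι P N f (e.inv.lin (e.hom.lin p)) = homι P N f p
        rw [← comp_lin, e.hom_inv_id, id_lin])))
    (fun g => homPre_natural e.hom g)

end HomBasics

section Pieces

variable {X : Type u} [AddCommGroup X] [Module F X] {gr : Deg → Submodule F X}

/-- Homomorphisms out of an induced module are determined by their restrictions. -/
theorem comp_indUnit_mem (φ : GSAlg.Hom B A) (N : GSMod B) (ρ : A.carrier →ₗ[F] X →ₗ[F] X)
    {d : Deg} {f : (N.ind φ).carrier →ₗ[F] X} (hf : f ∈ homPiece (N.ind φ) gr ρ d) :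
    f ∘ₗ indUnit φ N ∈ homPiece N gr (ρ ∘ₗ φ.lin) d :=
  ⟨fun j m hm => hf.1 j _ (indUnit_mem φ N hm), fun i b m hb => by
    rw [LinearMap.comp_apply, LinearMap.comp_apply, indUnit_smul, hf.2 i _ _ (φ.map_mem hb)]
    rfl⟩

theorem homPiece_ind_ext (φ : GSAlg.Hom B A) (N : GSMod B) (ρ : A.carrier →ₗ[F] X →ₗ[F] X)
    {d : Deg} {f : (N.ind φ).carrier →ₗ[F] X} (hf : f ∈ homPiece (N.ind φ) gr ρ d)
    (h : f ∘ₗ indUnit φ N = 0) : f = 0 :=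
  LinearMap.ext fun x => ind_induction φ (p := fun x => f x = (0 : _ →ₗ[F] X) x)
    (fun i j a n ha hn => by
      rw [imk_eq, hf.2 i a _ ha, show f (indUnit φ N n) = 0 from LinearMap.congr_fun h n, map_zero,
        smul_zero, LinearMap.zero_apply])
    (fun x y hx hy => by rw [map_add, hx, hy, map_add]) x

theorem exists_homPiece_ind (φ : GSAlg.Hom B A) (N : GSMod B) (ρ : A.carrier →ₗ[F] X →ₗ[F] X)
    (hρ : ∀ a a' x, ρ (a * a') x = ρ a (ρ a' x)) (hρ1 : ∀ x, ρ 1 x = x)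
    (hgr : ∀ i j a x, a ∈ A.gr i → x ∈ gr j → ρ a x ∈ gr (i + j))
    {d : Deg} {g : N.carrier →ₗ[F] X} (hg : g ∈ homPiece N gr (ρ ∘ₗ φ.lin) d) :
    ∃ f ∈ homPiece (N.ind φ) gr ρ d, f ∘ₗ indUnit φ N = g := by
  let f : (N.ind φ).carrier →ₗ[F] X :=
    indLiftF φ (TensorProduct.lift ((ρ.compl₂ g) ∘ₗ (A.parityHom d.2).toLinearMap))
    (fun i j k a b n ha hb hn => by
      simp only [TensorProduct.lift.tmul, LinearMap.comp_apply, LinearMap.compl₂_apply,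
        AlgHom.toLinearMap_apply]
      rw [map_mul, hρ, hg.2 j b n hb, A.parityHom_of_mem _ (φ.map_mem hb), map_zsmul,
        LinearMap.smul_apply]
      rfl)
  have hf : ∀ a n, f (imk φ N (a ⊗ₜ n)) = ρ (A.parityHom d.2 a) (g n) := fun a n => rfl
  refine ⟨f, ⟨fun j m hm => ?_, fun i a m ha => ?_⟩, LinearMap.ext fun n => ?_⟩
  · refine map_ind_mem φ f (gr (d + j)) (fun i k a n ha hn hik => ?_) hm
    rw [hf, A.parityHom_of_mem _ ha, map_zsmul, LinearMap.smul_apply, ← hik,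
      show d + (i + k) = i + (d + k) by abel]
    exact zsmul_mem (hgr _ _ _ _ ha (hg.1 k n hn)) _
  · refine ind_induction φ (p := fun m => f (a • m) = ksign d.2 i.2 • ρ a (f m))
      (fun _ _ a' n _ _ => ?_) (fun x y hx hy => by simp only [smul_add, map_add, hx, hy]) m
    rw [smul_imk, hf, hf, map_mul, hρ, A.parityHom_of_mem _ ha, map_zsmul, LinearMap.smul_apply]
  · rw [LinearMap.comp_apply, indUnit_apply, hf, map_one, hρ1]

/-- Currying of homogeneous homomorphisms. -/
theorem outerLiftF_mem_homPiece {P : GSMod B} {Q : GSMod D} (ρB : B.carrier →ₗ[F] X →ₗ[F] X)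
    (ρD : D.carrier →ₗ[F] X →ₗ[F] X) (ρ : (B.tensor D).carrier →ₗ[F] X →ₗ[F] X)
    (hρ : ∀ b c x, ρ (GSAlg.tmul b c) x = ρB b (ρD c x))
    (hcomm : ∀ i j b c x, b ∈ B.gr i → c ∈ D.gr j →
      ρB b (ρD c x) = ksign i.2 j.2 • ρD c (ρB b x))
    {d : Deg} {f : P.carrier →ₗ[F] Q.carrier →ₗ[F] X}
    (h₁ : ∀ j p, p ∈ P.gr j → f p ∈ homPiece Q gr ρD (d + j))
    (h₂ : ∀ i b p q, b ∈ B.gr i → f (b • p) q = ksign d.2 i.2 • ρB b (f p q)) :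
    outerLiftF f ∈ homPiece (P.outer Q) gr ρ d := by
  refine ⟨fun j m hm => map_outer_mem _ _ (fun i j p q hp hq hd => ?_) hm, fun i x m hx => ?_⟩
  · rw [outerLiftF_otm, ← hd, ← add_assoc]
    exact (h₁ i p hp).1 j q hq
  · have key : ∀ i j k b c p q, b ∈ B.gr i → c ∈ D.gr j → p ∈ P.gr k →
        outerLiftF f (GSAlg.tmul b c • otm P Q p q) =
          ksign d.2 (i + j).2 • ρ (GSAlg.tmul b c) (outerLiftF f (otm P Q p q)) := by
      intro i j k b c p q hb hc hp
      rw [smul_otm b hc hp, map_zsmul, outerLiftF_otm, outerLiftF_otm,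
        (h₁ _ _ (P.smul_mem hb hp)).2 j c q hc, h₂ i b p q hb, hρ, map_zsmul, hcomm i j b c _ hb hc,
        smul_smul, smul_smul, smul_smul, Prod.snd_add, Prod.snd_add, Prod.snd_add]
      congr 1
      generalize i.2 = i; generalize j.2 = j; generalize k.2 = k; generalize d.2 = d
      revert i j k d; decide
    refine outer_induction (p := fun m => outerLiftF f (x • m) =
      ksign d.2 i.2 • ρ x (outerLiftF f m)) (fun k _ p q hp _ => ?_)
      (fun x y hx hy => by simp only [smul_add, map_add, hx, hy]) m
    have := GSAlg.map_mem_of_tmul (A := B) (B := D) (d := i) (outerLiftF f ∘ₗ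
      (P.outer Q).act.flip (otm P Q p q) - ksign d.2 i.2 • ρ.flip (outerLiftF f (otm P Q p q))) ⊥
      (fun i' j' b c hb hc hij => by
        have := key i' j' k b c p q hb hc hp
        rw [hij] at this
        rw [Submodule.mem_bot, LinearMap.sub_apply, sub_eq_zero]
        exact this) hx
    rw [Submodule.mem_bot, LinearMap.sub_apply, sub_eq_zero] at this
    exact this

theorem homPiece_outer_curry {P : GSMod B} {Q : GSMod D} (ρB : B.carrier →ₗ[F] X →ₗ[F] X)
    (ρD : D.carrier →ₗ[F] X →ₗ[F] X) (ρ : (B.tensor D).carrier →ₗ[F] X →ₗ[F] X)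
    (hρ : ∀ b c x, ρ (GSAlg.tmul b c) x = ρB b (ρD c x))
    (hB : ∀ x, ρB 1 x = x) (hD : ∀ x, ρD 1 x = x)
    {d : Deg} {g : (P.outer Q).carrier →ₗ[F] X} (hg : g ∈ homPiece (P.outer Q) gr ρ d) :
    (∀ j p, p ∈ P.gr j → g ∘ₗ otm P Q p ∈ homPiece Q gr ρD (d + j)) ∧
      ∀ i b p q, b ∈ B.gr i → g (otm P Q (b • p) q) = ksign d.2 i.2 • ρB b (g (otm P Q p q)) := by
  refine ⟨fun j p hp => ⟨fun k q hq => ?_, fun i c q hc => ?_⟩, fun i b p q hb => ?_⟩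
  · rw [add_assoc]
    exact hg.1 _ _ (otm_mem hp hq)
  · have h : otm P Q p (c • q) = ksign i.2 j.2 • GSAlg.tmul (1 : B.carrier) c • otm P Q p q := by
      rw [smul_otm_right hc hp, ksign_smul_ksign_smul]
    rw [LinearMap.comp_apply, LinearMap.comp_apply, h, map_zsmul,
      hg.2 (0 + i) _ _ (GSAlg.tmul_mem B.one_mem hc), hρ, hB, smul_smul, zero_add, Prod.snd_add,
      ksign_add_left, mul_comm, ksign_comm j.2]
  · rw [← smul_otm_left, hg.2 (i + 0) _ _ (GSAlg.tmul_mem hb D.one_mem), hρ, hD, add_zero]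

end Pieces

section Curry

theorem rightAct_mul (N : GSMod (C.tensor B)) (b b' : B.carrier) (n : N.carrier) :
    N.rightAct (b * b') n = N.rightAct b (N.rightAct b' n) := by
  rw [rightAct_apply, rightAct_apply, rightAct_apply, smul_smul, GSAlg.one_mul_tmul]

theorem rightAct_one (N : GSMod (C.tensor B)) (n : N.carrier) : N.rightAct 1 n = n :=
  one_smul _ n

theorem leftAct_one (N : GSMod (C.tensor B)) (n : N.carrier) : N.leftAct 1 n = n :=
  one_smul _ n

theorem rightAct_mem (N : GSMod (C.tensor B)) {i j : Deg} {b : B.carrier} {n : N.carrier}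
    (hb : b ∈ B.gr i) (hn : n ∈ N.gr j) : N.rightAct b n ∈ N.gr (i + j) := by
  have := N.smul_mem (GSAlg.tmul_mem C.one_mem hb) hn
  rwa [zero_add] at this

/-- The projection to a restriction. -/
def resPr (φ : GSAlg.Hom B A) (M : GSMod A) : M.carrier →ₗ[F] (M.res φ).carrier :=
  (M.act (φ.lin 1)).codRestrict (ResCarrier φ M) fun m => smul_mem_resCarrier φ M 1 m

theorem resι_resPr (φ : GSAlg.Hom B A) (M : GSMod A) (m : M.carrier) :
    resι φ M (resPr φ M m) = φ.lin 1 • m := rfl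

theorem resι_comp_mem (φ : GSAlg.Hom B A) (M : GSMod A) {N : GSMod D}
    {ρ : D.carrier →ₗ[F] M.carrier →ₗ[F] M.carrier}
    {ρ' : D.carrier →ₗ[F] (M.res φ).carrier →ₗ[F] (M.res φ).carrier}
    (h : ∀ b x, resι φ M (ρ' b x) = ρ b (resι φ M x)) {d : Deg}
    {f : N.carrier →ₗ[F] (M.res φ).carrier} :
    resι φ M ∘ₗ f ∈ homPiece N M.gr ρ d ↔ f ∈ homPiece N (M.res φ).gr ρ' d := by
  refine and_congr Iff.rfl (forall_congr' fun i => forall_congr' fun b => forall_congr' fun m =>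
    imp_congr_right fun hb => ?_)
  rw [LinearMap.comp_apply, LinearMap.comp_apply, ← h, ← map_zsmul,
    (resι_injective φ M).eq_iff]

/-- Homomorphisms that are compatible with the identity have values in the restriction. -/
theorem resι_comp_resPr_comp (φ : GSAlg.Hom B A) (M : GSMod A) {N : GSMod D}
    {ρ : D.carrier →ₗ[F] M.carrier →ₗ[F] M.carrier} (hρ : ∀ x, ρ 1 x = φ.lin 1 • x) {d : Deg}
    {f : N.carrier →ₗ[F] M.carrier} (hf : f ∈ homPiece N M.gr ρ d) :
    resι φ M ∘ₗ resPr φ M ∘ₗ f = f :=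
  LinearMap.ext fun n => by
    have := hf.2 0 1 n D.one_mem
    rw [one_smul, Prod.snd_zero, ksign_zero_right, one_smul, hρ] at this
    exact this.symm

theorem finrank_homPiece_eq {P : GSMod B} {P' : GSMod B'} {X X' : Type u} [AddCommGroup X]
    [Module F X] [AddCommGroup X'] [Module F X'] {gr : Deg → Submodule F X}
    {gr' : Deg → Submodule F X'} {ρ : B.carrier →ₗ[F] X →ₗ[F] X}
    {ρ' : B'.carrier →ₗ[F] X' →ₗ[F] X'} {d d' : Deg}
    (T : (P.carrier →ₗ[F] X) →ₗ[F] (P'.carrier →ₗ[F] X'))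
    (hT : ∀ f, f ∈ homPiece P gr ρ d → T f ∈ homPiece P' gr' ρ' d')
    (hi : ∀ f, f ∈ homPiece P gr ρ d → T f = 0 → f = 0)
    (hs : ∀ g, g ∈ homPiece P' gr' ρ' d' → ∃ f ∈ homPiece P gr ρ d, T f = g) :
    Module.finrank F (homPiece P gr ρ d) = Module.finrank F (homPiece P' gr' ρ' d') :=
  (LinearEquiv.ofBijective (T.restrict hT) ⟨by
    rw [← LinearMap.ker_eq_bot, LinearMap.ker_eq_bot']
    exact fun f hf => Subtype.ext (hi f.1 f.2 (congrArg Subtype.val hf)), fun g => by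
    obtain ⟨f, hf, h⟩ := hs g.1 g.2
    exact ⟨⟨f, hf⟩, Subtype.ext h⟩⟩).finrank_eq

theorem grdimHom_congr {P M : GSMod B} {P' M' : GSMod B'}
    (h : ∀ d, Module.finrank F (HOM P M d) = Module.finrank F (HOM P' M' d)) :
    grdimHom P M = grdimHom P' M' := by
  rw [grdimHom, grdimHom]
  exact finsum_congr fun d => by rw [h d]

theorem finrank_HOM_ind (φ : GSAlg.Hom B A) (Y : GSMod B) (M : GSMod A) (d : Deg) :
    Module.finrank F (HOM (Y.ind φ) M d) = Module.finrank F (HOM Y (M.res φ) d) := by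
  have hρ : ∀ x, (M.act ∘ₗ φ.lin) 1 x = φ.lin 1 • x := fun _ => rfl
  have hr : ∀ (b : B.carrier) (x), resι φ M ((M.res φ).act b x) =
      (M.act ∘ₗ φ.lin) b (resι φ M x) := fun _ _ => rfl
  refine finrank_homPiece_eq ((LinearMap.lcomp F _ (indUnit φ Y)) ∘ₗ
    LinearMap.compRight F (resPr φ M)) (fun f hf => ?_) (fun f hf h0 => ?_) (fun g hg => ?_)
  · have h := comp_indUnit_mem φ Y _ hf
    rw [← resι_comp_resPr_comp φ M hρ h] at h
    exact (resι_comp_mem φ M hr).1 h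
  · refine homPiece_ind_ext φ Y _ hf ?_
    rw [← resι_comp_resPr_comp φ M hρ (comp_indUnit_mem φ Y _ hf)]
    change resι φ M ∘ₗ ((resPr φ M ∘ₗ f) ∘ₗ indUnit φ Y) = 0
    rw [show (resPr φ M ∘ₗ f) ∘ₗ indUnit φ Y = 0 from h0, LinearMap.comp_zero]
  · obtain ⟨f, hf, h⟩ := exists_homPiece_ind φ Y M.act (fun a a' x => mul_smul a a' x)
      (fun x => one_smul _ x) (fun _ _ _ _ ha hx => M.smul_mem ha hx)
      ((resι_comp_mem φ M hr).2 hg)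
    refine ⟨f, hf, LinearMap.ext fun y => resι_injective φ M ?_⟩
    have := LinearMap.congr_fun (resι_comp_resPr_comp φ M hρ (comp_indUnit_mem φ Y _ hf)) y
    exact this.trans (LinearMap.congr_fun h y)

theorem grdimHom_ind (φ : GSAlg.Hom B A) (Y : GSMod B) (M : GSMod A) :
    grdimHom (Y.ind φ) M = grdimHom Y (M.res φ) :=
  grdimHom_congr (finrank_HOM_ind φ Y M)

theorem rightAct_res (φ : GSAlg.Hom B A) (M : GSMod (C.tensor A)) (b : B.carrier)
    (x : (M.res ((GSAlg.Hom.id C).tensor φ)).carrier) :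
    resι _ M ((M.res ((GSAlg.Hom.id C).tensor φ)).rightAct b x) =
      (M.rightAct ∘ₗ φ.lin) b (resι _ M x) := rfl

/-- Frobenius reciprocity: the restriction of homomorphisms along the unit of induction. -/
noncomputable def homIndHom (φ : GSAlg.Hom B A) (Y : GSMod B) (M : GSMod (C.tensor A)) :
    hom (Y.ind φ) M ⟶ hom Y (M.res ((GSAlg.Hom.id C).tensor φ)) :=
  homHom (N' := M.res ((GSAlg.Hom.id C).tensor φ)) ((LinearMap.lcomp F _ (indUnit φ Y)) ∘ₗ
    LinearMap.compRight F (resPr ((GSAlg.Hom.id C).tensor φ) M))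
    (fun d f hf => by
      have h := comp_indUnit_mem φ Y _ hf
      rw [← resι_comp_resPr_comp ((GSAlg.Hom.id C).tensor φ) M (fun _ => rfl) h] at h
      exact (resι_comp_mem _ M (rightAct_res φ M)).1 h)
    (fun i d c f hc hf => LinearMap.ext fun y => resι_injective _ M (by
      change GSAlg.tmul (1 : C.carrier) (φ.lin 1) • GSAlg.tmul c (1 : A.carrier) •
          f (indUnit φ Y y) = GSAlg.tmul c (φ.lin 1) • GSAlg.tmul (1 : C.carrier) (φ.lin 1) •
          f (indUnit φ Y y)
      rw [smul_smul, smul_smul, GSAlg.one_mul_tmul, ← φ.map_mul, mul_one,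
        GSAlg.tmul_mul_tmul _ _ (φ.map_mem B.one_mem) hc]
      simp))

theorem resι_homIndHom (φ : GSAlg.Hom B A) (Y : GSMod B) (M : GSMod (C.tensor A))
    (f : (hom (Y.ind φ) M).carrier) (y : Y.carrier) :
    resι _ M (homι Y _ ((homIndHom φ Y M).lin f) y) = homι _ M f (indUnit φ Y y) := by
  refine hom_induction (hom (Y.ind φ) M).internal (p := fun f => resι _ M (homι Y _
    ((homIndHom φ Y M).lin f) y) = homι _ M f (indUnit φ Y y)) (fun d f hf => ?_)
    (fun x y hx hy => by simp only [map_add, LinearMap.add_apply, hx, hy]) f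
  exact LinearMap.congr_fun (resι_comp_resPr_comp ((GSAlg.Hom.id C).tensor φ) M (fun _ => rfl)
    (comp_indUnit_mem φ Y _ hf)) y

theorem homIndHom_bijective (φ : GSAlg.Hom B A) (Y : GSMod B) (M : GSMod (C.tensor A)) :
    Function.Bijective (homIndHom φ Y M).lin := by
  refine hom_bijective_of_pieces (Hom.linF (homIndHom φ Y M)) (fun _ _ h => Hom.map_mem _ h)
    (fun d f hf h0 => homι_injective ?_) (fun d g hg => ?_)
  · refine homPiece_ind_ext φ Y _ hf (LinearMap.ext fun y => ?_)
    rw [LinearMap.comp_apply, ← resι_homIndHom, show (homIndHom φ Y M).lin f = 0 from h0]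
    simp
  · obtain ⟨f, hf, h⟩ := exists_homPiece_ind φ Y M.rightAct (rightAct_mul M) (rightAct_one M)
      (fun _ _ _ _ ha hx => rightAct_mem M ha hx)
      ((resι_comp_mem _ M (rightAct_res φ M)).2 hg)
    refine ⟨homMk f hf, homι_injective (LinearMap.ext fun y => resι_injective _ M ?_)⟩
    exact (resι_homIndHom φ Y M _ y).trans (LinearMap.congr_fun h y)

/-- Frobenius reciprocity. -/
noncomputable def homInd (φ : GSAlg.Hom B A) (Y : GSMod B) (C : GSAlg F) :
    homFunctor (Y.ind φ) C ≅ resFunctor ((GSAlg.Hom.id C).tensor φ) ⋙ homFunctor Y C :=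
  natIsoOfBij' (G := homFunctor (Y.ind φ) C)
    (H := resFunctor ((GSAlg.Hom.id C).tensor φ) ⋙ homFunctor Y C)
    (homIndHom φ Y) (homIndHom_bijective φ Y)
    (fun {M M'} g => hom_ext fun f => homι_injective (LinearMap.ext fun y => resι_injective _ M'
      ((resι_homIndHom φ Y M' (((homFunctor (Y.ind φ) C).map g).lin f) y).trans
        (congrArg g.lin (resι_homIndHom φ Y M f y)).symm)))

theorem rightAct_resMk (φ : GSAlg.Hom B A) (Y : GSMod (A.tensor D)) (b : D.carrier)
    (x : (Y.res (φ.tensor (GSAlg.Hom.id D))).carrier) :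
    resι _ Y ((Y.res (φ.tensor (GSAlg.Hom.id D))).rightAct b x) = Y.rightAct b (resι _ Y x) := by
  rw [rightAct_apply, rightAct_apply, resι_smul, GSAlg.Hom.tensor_tmul]
  conv_rhs => rw [← one_smul_resι, GSAlg.tensor_one, GSAlg.Hom.tensor_tmul, smul_smul,
    GSAlg.Hom.id_lin]
  refine congrArg (· • _) ?_
  refine hom_induction D.internal (p := fun b => GSAlg.tmul (φ.lin 1) ((GSAlg.Hom.id D).lin b) =
    GSAlg.tmul 1 b * GSAlg.tmul (φ.lin 1) 1) (fun i b hb => ?_) (fun x y hx hy => ?_) b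
  · rw [GSAlg.tmul_mul_tmul _ _ hb (φ.map_mem B.one_mem)]
    simp
  · simp only [← GSAlg.tmulLin_apply, map_add, add_mul] at hx hy ⊢
    rw [hx, hy]

/-- The comparison of homomorphisms to a restriction with the restriction of homomorphisms. -/
noncomputable def homResHom (φ : GSAlg.Hom B A) (Q : GSMod D) (Y : GSMod (A.tensor D)) :
    hom Q (Y.res (φ.tensor (GSAlg.Hom.id D))) ⟶ (hom Q Y).res φ :=
  resLift φ (M := hom Q Y) (homLin (N' := Y) (LinearMap.compRight F (resι (φ.tensor (GSAlg.Hom.id D)) Y))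
      (fun _ _ hf => homPiece_le Q Y _ ((resι_comp_mem _ Y (rightAct_resMk φ Y)).2 hf)))
    (fun _ _ hf => (resι_comp_mem _ Y (rightAct_resMk φ Y)).2 hf)
    (fun _ _ _ _ _ _ => rfl)
    (fun _ f _ => homι_injective (LinearMap.ext fun q =>
      one_smul_resι (φ.tensor (GSAlg.Hom.id D)) Y (homι Q _ f q)))

theorem resι_homResHom (φ : GSAlg.Hom B A) (Q : GSMod D) (Y : GSMod (A.tensor D))
    (f : (hom Q (Y.res (φ.tensor (GSAlg.Hom.id D)))).carrier) (q : Q.carrier) :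
    homι Q Y (resι φ (hom Q Y) ((homResHom φ Q Y).lin f)) q =
      resι _ Y (homι Q _ f q) := rfl

theorem homResHom_bijective (φ : GSAlg.Hom B A) (Q : GSMod D) (Y : GSMod (A.tensor D)) :
    Function.Bijective (homResHom φ Q Y).lin := by
  refine ⟨fun f f' h => homι_injective (LinearMap.ext fun q => resι_injective _ Y ?_), ?_⟩
  · rw [← resι_homResHom, ← resι_homResHom, h]
  · refine surjective_of_pieces ((hom Q Y).res φ).internal (Hom.linF (homResHom φ Q Y))
      fun d g hg => ?_
    have h1 : ∀ q, homι Q Y (resι φ _ g) q ∈ ResCarrier (φ.tensor (GSAlg.Hom.id D)) Y := fun q =>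
      LinearMap.congr_fun (congrArg (homι Q Y) (one_smul_resι φ (hom Q Y) g)) q
    exact ⟨homMk (N := Y.res (φ.tensor (GSAlg.Hom.id D)))
      ((homι Q Y (resι φ _ g)).codRestrict _ h1)
      ((resι_comp_mem _ Y (rightAct_resMk φ Y)).1 hg), rfl⟩

/-- Homomorphisms commute with restriction in the other factor. -/
noncomputable def homRes (φ : GSAlg.Hom B A) (Q : GSMod D) :
    resFunctor (φ.tensor (GSAlg.Hom.id D)) ⋙ homFunctor Q B ≅ homFunctor Q A ⋙ resFunctor φ :=
  natIsoOfBij' (G := resFunctor (φ.tensor (GSAlg.Hom.id D)) ⋙ homFunctor Q B)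
    (H := homFunctor Q A ⋙ resFunctor φ) (homResHom φ Q) (homResHom_bijective φ Q)
    (fun _ => rfl)

theorem assocInv_one : (GSAlg.assocInv A B C).lin 1 = 1 := GSAlg.assocInv_tmul 1 1 1

theorem curry_comm (X : GSMod ((C.tensor B).tensor D)) {i j : Deg} {b : B.carrier} {c : D.carrier}
    (hb : b ∈ B.gr i) (hc : c ∈ D.gr j) (x : X.carrier) :
    (X.leftAct ∘ₗ GSAlg.tmulLin C B 1) b (X.rightAct c x) =
      ksign i.2 j.2 • X.rightAct c ((X.leftAct ∘ₗ GSAlg.tmulLin C B 1) b x) := by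
  have := leftAct_rightAct X (GSAlg.tmul_mem C.one_mem hb) hc x
  rwa [zero_add] at this

/-- The currying `HOM(P, HOM(Q, X)) → HOM(P ⊠ Q, X)` on all linear maps. -/
noncomputable def curryLin (P : GSMod B) (Q : GSMod D) (X : GSMod ((C.tensor B).tensor D)) :
    (P.carrier →ₗ[F] (hom Q X).carrier) →ₗ[F]
      ((P.outer Q).carrier →ₗ[F] (X.res (GSAlg.assocInv C B D)).carrier) where
  toFun f := resPr (GSAlg.assocInv C B D) X ∘ₗ outerLiftF (homι Q X ∘ₗ f)
  map_add' f f' := outer_lin_ext fun _ _ p q _ _ => by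
    change resPr _ X (homι Q X (f p + f' p) q) =
      resPr _ X (homι Q X (f p) q) + resPr _ X (homι Q X (f' p) q)
    rw [map_add, LinearMap.add_apply, map_add]
  map_smul' c f := outer_lin_ext fun _ _ p q _ _ => by
    change resPr _ X (homι Q X (c • f p) q) = c • resPr _ X (homι Q X (f p) q)
    rw [map_smul, LinearMap.smul_apply, map_smul]

theorem resι_curryLin (P : GSMod B) (Q : GSMod D) (X : GSMod ((C.tensor B).tensor D))
    (f : P.carrier →ₗ[F] (hom Q X).carrier) :
    resι (GSAlg.assocInv C B D) X ∘ₗ curryLin P Q X f = outerLiftF (homι Q X ∘ₗ f) :=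
  LinearMap.ext fun x => by
    change (GSAlg.assocInv C B D).lin 1 • outerLiftF (homι Q X ∘ₗ f) x = _
    rw [assocInv_one, one_smul]

theorem resι_curryLin_otm (P : GSMod B) (Q : GSMod D) (X : GSMod ((C.tensor B).tensor D))
    (f : P.carrier →ₗ[F] (hom Q X).carrier) (p : P.carrier) (q : Q.carrier) :
    resι (GSAlg.assocInv C B D) X (curryLin P Q X f (otm P Q p q)) = homι Q X (f p) q :=
  LinearMap.congr_fun (resι_curryLin P Q X f) (otm P Q p q)

theorem curryLin_mem (P : GSMod B) (Q : GSMod D) (X : GSMod ((C.tensor B).tensor D)) (d : Deg)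
    (f : P.carrier →ₗ[F] (hom Q X).carrier)
    (hf : f ∈ homPiece P (hom Q X).gr (hom Q X).rightAct d) :
    curryLin P Q X f ∈ homPiece (P.outer Q) (X.res (GSAlg.assocInv C B D)).gr
      (X.res (GSAlg.assocInv C B D)).rightAct d := by
  refine (resι_comp_mem (ρ := X.act ∘ₗ (GSAlg.assocInv C B D).lin ∘ₗ
        GSAlg.tmulLin C (B.tensor D) 1) _ X (fun _ _ => rfl)).1 ?_
  rw [resι_curryLin]
  refine outerLiftF_mem_homPiece (X.leftAct ∘ₗ GSAlg.tmulLin C B 1) X.rightAct _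
    (fun b c x => ?_) (fun i j b c x hb hc => curry_comm X hb hc x)
    (fun j p hp => hf.1 j p hp) (fun i b p q hb => ?_)
  · change (GSAlg.assocInv C B D).lin (GSAlg.tmul 1 (GSAlg.tmul b c)) • x =
      GSAlg.tmul (GSAlg.tmul (1 : C.carrier) b) (1 : D.carrier) •
        GSAlg.tmul (1 : (C.tensor B).carrier) c • x
    rw [GSAlg.assocInv_tmul, smul_smul, GSAlg.tmul_mul_one, mul_one]
  · rw [LinearMap.comp_apply, LinearMap.comp_apply, hf.2 i b p hb, map_zsmul]
    rfl

/-- The currying `HOM(P, HOM(Q, X)) → HOM(P ⊠ Q, X)`. -/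
noncomputable def homCurryHom (P : GSMod B) (Q : GSMod D) (X : GSMod ((C.tensor B).tensor D)) :
    hom P (hom Q X) ⟶ hom (P.outer Q) (X.res (GSAlg.assocInv C B D)) :=
  homHom (N' := X.res (GSAlg.assocInv C B D)) (curryLin P Q X) (curryLin_mem P Q X)
    (fun i d c f hc hf => outer_lin_ext fun _ _ p q _ _ => resι_injective _ X (by
      rw [resι_curryLin_otm]
      change GSAlg.tmul (GSAlg.tmul c (1 : B.carrier)) (1 : D.carrier) • homι Q X (f p) q =
        (GSAlg.assocInv C B D).lin (GSAlg.tmul c (GSAlg.tmul 1 1)) •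
          resι _ X (curryLin P Q X f (otm P Q p q))
      rw [resι_curryLin_otm, GSAlg.assocInv_tmul]))

theorem resι_homCurryHom (P : GSMod B) (Q : GSMod D) (X : GSMod ((C.tensor B).tensor D))
    (f : (hom P (hom Q X)).carrier) (p : P.carrier) (q : Q.carrier) :
    resι _ X (homι _ _ ((homCurryHom P Q X).lin f) (otm P Q p q)) =
      homι Q X (homι P _ f p) q :=
  resι_curryLin_otm P Q X (homι P _ f) p q

theorem homCurryHom_bijective (P : GSMod B) (Q : GSMod D) (X : GSMod ((C.tensor B).tensor D)) :
    Function.Bijective (homCurryHom P Q X).lin := by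
  refine ⟨fun f f' h => homι_injective (LinearMap.ext fun p => homι_injective
    (LinearMap.ext fun q => ?_)), ?_⟩
  · rw [← resι_homCurryHom, ← resι_homCurryHom, h]
  · refine surjective_of_pieces (hom (P.outer Q) (X.res (GSAlg.assocInv C B D))).internal
      (Hom.linF (homCurryHom P Q X)) fun d g hg => ?_
    obtain ⟨h₁, h₂⟩ := homPiece_outer_curry (X.leftAct ∘ₗ GSAlg.tmulLin C B 1) X.rightAct
      (X.act ∘ₗ (GSAlg.assocInv C B D).lin ∘ₗ GSAlg.tmulLin C (B.tensor D) 1) (fun b c x => by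
        change (GSAlg.assocInv C B D).lin (GSAlg.tmul 1 (GSAlg.tmul b c)) • x =
          GSAlg.tmul (GSAlg.tmul (1 : C.carrier) b) (1 : D.carrier) •
            GSAlg.tmul (1 : (C.tensor B).carrier) c • x
        rw [GSAlg.assocInv_tmul, smul_smul, GSAlg.tmul_mul_one, mul_one])
      (fun x => one_smul _ x) (rightAct_one X)
      ((resι_comp_mem (ρ := X.act ∘ₗ (GSAlg.assocInv C B D).lin ∘ₗ
        GSAlg.tmulLin C (B.tensor D) 1) _ X (fun _ _ => rfl)).2 hg)
    have hm : ∀ p, (resι _ X ∘ₗ homι _ _ g) ∘ₗ otm P Q p ∈ HomCarrier Q X := fun p =>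
      hom_induction P.internal (p := fun p => (resι _ X ∘ₗ homι _ _ g) ∘ₗ otm P Q p ∈ HomCarrier Q X)
        (fun j p hp => homPiece_le Q X _ (h₁ j p hp))
        (fun x y hx hy => by rw [map_add, LinearMap.comp_add]; exact add_mem hx hy) p
    let k : P.carrier →ₗ[F] (hom Q X).carrier :=
      (LinearMap.compRight F (resι _ X ∘ₗ homι _ _ g) ∘ₗ otm P Q).codRestrict (HomCarrier Q X) hm
    refine ⟨homMk k ⟨fun j p hp => h₁ j p hp, fun i b p hb => homι_injective
      (LinearMap.ext fun q => ?_)⟩, homι_injective (outer_lin_ext fun _ _ p q _ _ =>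
        resι_injective _ X ?_)⟩
    · rw [map_zsmul]
      exact h₂ i b p q hb
    · exact resι_homCurryHom P Q X _ p q

/-- Currying. -/
noncomputable def homCurry (P : GSMod B) (Q : GSMod D) (C : GSAlg F) :
    homFunctor Q (C.tensor B) ⋙ homFunctor P C ≅
      resFunctor (GSAlg.assocInv C B D) ⋙ homFunctor (P.outer Q) C :=
  natIsoOfBij' (G := homFunctor Q (C.tensor B) ⋙ homFunctor P C)
    (H := resFunctor (GSAlg.assocInv C B D) ⋙ homFunctor (P.outer Q) C)
    (homCurryHom P Q) (homCurryHom_bijective P Q)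
    (fun {X X'} g => hom_ext fun f => homι_injective (outer_lin_ext fun _ _ p q _ _ =>
      resι_injective _ X' ((resι_homCurryHom P Q X' _ p q).trans
        (congrArg g.lin (resι_homCurryHom P Q X f p q)).symm)))

theorem finrank_HOM_outer (P : GSMod B) (Q : GSMod D) (Y : GSMod (B.tensor D)) (d : Deg) :
    Module.finrank F (HOM (P.outer Q) Y d) = Module.finrank F (HOM P (hom Q Y) d) := by
  symm
  have hρ : ∀ (b : B.carrier) (c : D.carrier) (x : Y.carrier),
      Y.act (GSAlg.tmul b c) x = Y.leftAct b (Y.rightAct c x) := fun b c x => by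
    rw [act_apply, leftAct_apply, rightAct_apply, smul_smul, GSAlg.tmul_mul_one, mul_one]
  refine finrank_homPiece_eq
    { toFun := fun f => outerLiftF (homι Q Y ∘ₗ f)
      map_add' := fun f f' => outer_lin_ext fun _ _ _ _ _ _ => by
        simp only [LinearMap.comp_apply, LinearMap.add_apply, outerLiftF_otm, map_add]
      map_smul' := fun c f => outer_lin_ext fun _ _ _ _ _ _ => by
        simp only [LinearMap.comp_apply, LinearMap.smul_apply, outerLiftF_otm, map_smul,
          RingHom.id_apply] } (fun f hf => ?_) (fun f hf h0 => ?_) (fun g hg => ?_)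
  · refine outerLiftF_mem_homPiece Y.leftAct Y.rightAct _ hρ
      (fun i j b c x hb hc => leftAct_rightAct Y hb hc x)
        (fun j p hp => hf.1 j p hp) (fun i b p q hb => ?_)
    rw [LinearMap.comp_apply, LinearMap.comp_apply, hf.2 i b p hb, map_zsmul]
    rfl
  · refine LinearMap.ext fun p => homι_injective (LinearMap.ext fun q => ?_)
    exact LinearMap.congr_fun h0 (otm P Q p q)
  · obtain ⟨h₁, h₂⟩ := homPiece_outer_curry Y.leftAct Y.rightAct _ hρ (leftAct_one Y)
      (rightAct_one Y) hg
    have hm : ∀ p, g ∘ₗ otm P Q p ∈ HomCarrier Q Y := fun p =>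
      hom_induction P.internal (p := fun p => g ∘ₗ otm P Q p ∈ HomCarrier Q Y)
        (fun j p hp => homPiece_le Q Y _ (h₁ j p hp))
        (fun x y hx hy => by rw [map_add, LinearMap.comp_add]; exact add_mem hx hy) p
    refine ⟨(LinearMap.compRight F g ∘ₗ otm P Q).codRestrict (HomCarrier Q Y) hm,
      ⟨fun j p hp => h₁ j p hp, fun i b p hb => homι_injective
      (LinearMap.ext fun q => ?_)⟩, outer_lin_ext fun _ _ p q _ _ => rfl⟩
    rw [map_zsmul]
    exact h₂ i b p q hb

theorem grdimHom_outer (P : GSMod B) (Q : GSMod D) (Y : GSMod (B.tensor D)) :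
    grdimHom (P.outer Q) Y = grdimHom P (hom Q Y) :=
  grdimHom_congr (finrank_HOM_outer P Q Y)

end Curry

end GSMod

namespace Tower

variable {Λ : Type} [AddCommMonoid Λ] (T : Tower F Λ)

theorem rho_comp_inv {l m n p q s : Λ} (h₁ : p + n = q) (h₂ : l + m = p) (h₃ : m + n = s)
    (h₄ : l + s = q) : ((T.ρ h₁).comp ((T.ρ h₂).tensor (GSAlg.Hom.id _))).comp
        (GSAlg.assocInv (T.A l) (T.A m) (T.A n)) =
      (T.ρ h₄).comp ((GSAlg.Hom.id _).tensor (T.ρ h₃)) := by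
  rw [T.rho_comp h₃ h₄ h₂ h₁]
  exact GSAlg.Hom.ext (LinearMap.ext fun x => congrArg
    ((T.ρ h₄).comp ((GSAlg.Hom.id _).tensor (T.ρ h₃))).lin
      ((GSAlg.assocLin _ _ _).apply_symm_apply x))

/-- `Res_P ∘ Res_Q ≅ Res_{∇(P ⊠ Q)}`. -/
theorem res_comp_res {l m n p q s : Λ} (h₁ : p + n = q) (h₂ : l + m = p) (h₃ : m + n = s)
    (h₄ : l + s = q) (P : GSMod (T.A m)) (Q : GSMod (T.A n)) :
    Nonempty (T.Res h₁ Q ⋙ T.Res h₂ P ≅ T.Res h₄ (T.nabla h₃ P Q)) := by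
  refine ⟨?_⟩
  refine Functor.isoWhiskerLeft (GSMod.resFunctor (T.ρ h₁))
    (Functor.isoWhiskerRight (GSMod.homRes (T.ρ h₂) Q).symm (GSMod.homFunctor P _)) ≪≫ ?_
  refine Functor.isoWhiskerLeft (GSMod.resFunctor (T.ρ h₁) ⋙
    GSMod.resFunctor ((T.ρ h₂).tensor (GSAlg.Hom.id _))) (GSMod.homCurry P Q (T.A l)) ≪≫ ?_
  refine Functor.isoWhiskerRight (Functor.isoWhiskerRight (GSMod.resComp _ _)
    (GSMod.resFunctor _) ≪≫ GSMod.resComp _ _) (GSMod.homFunctor (P.outer Q) _) ≪≫ ?_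
  rw [T.rho_comp_inv h₁ h₂ h₃ h₄]
  exact Functor.isoWhiskerRight (GSMod.resComp _ _).symm (GSMod.homFunctor (P.outer Q) _) ≪≫
    Functor.isoWhiskerLeft (GSMod.resFunctor (T.ρ h₄)) (GSMod.homInd (T.ρ h₃) (P.outer Q) _).symm

end Tower

end SuperTower

namespace SuperTower

variable {F : Type u} [Field F]

namespace GSMod

variable {A B C D A' B' : GSAlg F}

section Shift

/-- The identity map to a shift. -/
def shiftEquiv (M : GSMod B) (n : ℤ) (σ : ZMod 2) : M.carrier ≃ₗ[F] (M.shift n σ).carrier :=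
  { toFun := fun m => (m : M.ParityTwist σ)
    invFun := fun m => (m : M.ParityTwist σ)
    map_add' := fun _ _ => rfl
    map_smul' := fun _ _ => rfl
    left_inv := fun _ => rfl
    right_inv := fun _ => rfl }

variable (M : GSMod B) (n : ℤ) (σ : ZMod 2)

theorem smul_shiftEquiv (b : B.carrier) (m : M.carrier) :
    b • shiftEquiv M n σ m = shiftEquiv M n σ (B.parityHom σ b • m) := rfl

theorem smul_shiftEquiv_of_mem {i : Deg} {b : B.carrier} (hb : b ∈ B.gr i) (m : M.carrier) :
    b • shiftEquiv M n σ m = ksign σ i.2 • shiftEquiv M n σ (b • m) := by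
  rw [smul_shiftEquiv, B.parityHom_of_mem σ hb, smul_assoc, map_zsmul]

theorem shiftEquiv_smul_of_mem {i : Deg} {b : B.carrier} (hb : b ∈ B.gr i) (m : M.carrier) :
    shiftEquiv M n σ (b • m) = ksign σ i.2 • b • shiftEquiv M n σ m := by
  rw [smul_shiftEquiv_of_mem M n σ hb, ksign_smul_ksign_smul]

theorem symm_shiftEquiv_smul_of_mem {i : Deg} {b : B.carrier} (hb : b ∈ B.gr i)
    (m : (M.shift n σ).carrier) :
    (shiftEquiv M n σ).symm (b • m) = ksign σ i.2 • b • (shiftEquiv M n σ).symm m := by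
  obtain ⟨m, rfl⟩ := (shiftEquiv M n σ).surjective m
  rw [smul_shiftEquiv_of_mem M n σ hb, map_zsmul, LinearEquiv.symm_apply_apply,
    LinearEquiv.symm_apply_apply]

theorem shiftEquiv_mem {d : Deg} {m : M.carrier} :
    shiftEquiv M n σ m ∈ (M.shift n σ).gr d ↔ m ∈ M.gr (d - (n, σ)) := Iff.rfl

theorem shiftEquiv_mem_add {d : Deg} {m : M.carrier} (hm : m ∈ M.gr d) :
    shiftEquiv M n σ m ∈ (M.shift n σ).gr (d + (n, σ)) := by
  rw [shiftEquiv_mem, add_sub_cancel_right]; exact hm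

theorem symm_shiftEquiv_mem {d : Deg} {m : (M.shift n σ).carrier} :
    (shiftEquiv M n σ).symm m ∈ M.gr (d - (n, σ)) ↔ m ∈ (M.shift n σ).gr d := Iff.rfl

/-- Restriction commutes with shifts. -/
noncomputable def resShiftHom (φ : GSAlg.Hom B A) (M : GSMod A) (n : ℤ) (σ : ZMod 2) :
    (M.shift n σ).res φ ⟶ (M.res φ).shift n σ :=
  homOfF (N := (M.res φ).shift n σ) ((shiftEquiv (M.res φ) n σ).toLinearMap ∘ₗ resPr φ M ∘ₗ
      (shiftEquiv M n σ).symm.toLinearMap ∘ₗ resι φ (M.shift n σ))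
    (fun d m hm => by
      have := M.smul_mem (φ.map_mem B.one_mem) (show (shiftEquiv M n σ).symm (resι φ _ m) ∈
        M.gr (d - (n, σ)) from hm)
      rw [zero_add] at this
      exact this)
    (fun i j b m hb hm => by
      simp only [LinearMap.comp_apply, LinearEquiv.coe_coe, resι_smul]
      rw [symm_shiftEquiv_smul_of_mem M n σ (φ.map_mem hb), map_zsmul, map_zsmul,
        smul_shiftEquiv_of_mem _ n σ hb]
      congr 2
      refine resι_injective φ M ?_
      rw [resι_smul, resι_resPr, resι_resPr, smul_smul, smul_smul, ← φ.map_mul, ← φ.map_mul,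
        one_mul, mul_one])

theorem resShiftHom_lin (φ : GSAlg.Hom B A) (M : GSMod A) (n : ℤ) (σ : ZMod 2)
    (m : ((M.shift n σ).res φ).carrier) :
    resι φ M ((shiftEquiv (M.res φ) n σ).symm ((resShiftHom φ M n σ).lin m)) =
      (shiftEquiv M n σ).symm (resι φ _ m) := by
  change φ.lin 1 • (shiftEquiv M n σ).symm (resι φ _ m) = _
  conv_rhs => rw [← one_smul_resι φ, symm_shiftEquiv_smul_of_mem M n σ (φ.map_mem B.one_mem)]
  simp

theorem resShiftHom_bijective (φ : GSAlg.Hom B A) (M : GSMod A) (n : ℤ) (σ : ZMod 2) :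
    Function.Bijective (resShiftHom φ M n σ).lin := by
  refine ⟨fun x y h => ?_, fun y => ?_⟩
  · refine resι_injective φ _ ((shiftEquiv M n σ).symm.injective ?_)
    rw [← resShiftHom_lin, ← resShiftHom_lin, h]
  · refine ⟨resMk φ (M.shift n σ) (shiftEquiv M n σ (resι φ M ((shiftEquiv _ n σ).symm y))) ?_,
      (shiftEquiv _ n σ).symm.injective (resι_injective φ M ?_)⟩
    · rw [smul_shiftEquiv_of_mem _ _ _ (φ.map_mem B.one_mem), one_smul_resι]
      simp
    · rw [resShiftHom_lin, resι_resMk, LinearEquiv.symm_apply_apply]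

/-- Restriction commutes with shifts. -/
noncomputable def resShift (φ : GSAlg.Hom B A) (n : ℤ) (σ : ZMod 2) :
    shiftFunctor A n σ ⋙ resFunctor φ ≅ resFunctor φ ⋙ shiftFunctor B n σ :=
  natIsoOfBij' (G := shiftFunctor A n σ ⋙ resFunctor φ) (H := resFunctor φ ⋙ shiftFunctor B n σ)
    (fun M => resShiftHom φ M n σ) (fun M => resShiftHom_bijective φ M n σ)
    (fun {M M'} g => hom_ext fun m => (shiftEquiv (M'.res φ) n σ).symm.injective
      (resι_injective φ M' ((resShiftHom_lin φ M' n σ _).trans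
        (congrArg g.lin (resShiftHom_lin φ M n σ m)).symm)))

/-- The composition of two shifts. -/
noncomputable def shiftShiftHom (M : GSMod B) (n n' : ℤ) (σ σ' : ZMod 2) :
    (M.shift n σ).shift n' σ' ⟶ M.shift (n + n') (σ + σ') :=
  homOfF (N := M.shift (n + n') (σ + σ')) ((shiftEquiv M (n + n') (σ + σ')).toLinearMap ∘ₗ
      (shiftEquiv M n σ).symm.toLinearMap ∘ₗ (shiftEquiv (M.shift n σ) n' σ').symm.toLinearMap)
    (fun d m hm => by
      change m ∈ M.gr (d - (n', σ') - (n, σ)) at hm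
      change m ∈ M.gr (d - (n + n', σ + σ'))
      rwa [sub_sub, add_comm, Prod.mk_add_mk] at hm)
    (fun i j b m hb hm => by
      simp only [LinearMap.comp_apply, LinearEquiv.coe_coe]
      rw [symm_shiftEquiv_smul_of_mem _ n' σ' hb, map_zsmul, symm_shiftEquiv_smul_of_mem _ n σ hb,
        map_zsmul, map_zsmul, shiftEquiv_smul_of_mem _ _ _ hb, ksign_add_left]
      simp only [smul_smul]
      rw [show ksign σ' i.2 * (ksign σ i.2 * (ksign σ i.2 * ksign σ' i.2)) = 1 by
        rw [← mul_assoc (ksign σ i.2), ksign_self, one_mul, ksign_self], one_smul])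

/-- The composition of two shifts. -/
noncomputable def shiftShift (B : GSAlg F) (n n' : ℤ) (σ σ' : ZMod 2) :
    shiftFunctor B n σ ⋙ shiftFunctor B n' σ' ≅ shiftFunctor B (n + n') (σ + σ') :=
  natIsoOfBij' (G := shiftFunctor B n σ ⋙ shiftFunctor B n' σ')
    (H := shiftFunctor B (n + n') (σ + σ')) (fun M => shiftShiftHom M n n' σ σ')
    (fun M => ((shiftEquiv (M.shift n σ) n' σ').symm.trans ((shiftEquiv M n σ).symm.trans
      (shiftEquiv M (n + n') (σ + σ')))).bijective) (fun _ => rfl)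

theorem rightAct_shiftEquiv (Y : GSMod (C.tensor B)) (n : ℤ) (σ : ZMod 2) {i : Deg} {b : B.carrier}
    (hb : b ∈ B.gr i) (y : Y.carrier) : (Y.shift n σ).rightAct b (shiftEquiv Y n σ y) =
      ksign σ i.2 • shiftEquiv Y n σ (Y.rightAct b y) := by
  have := smul_shiftEquiv_of_mem Y n σ (GSAlg.tmul_mem C.one_mem hb) y
  rwa [zero_add] at this

theorem leftAct_shiftEquiv (Y : GSMod (C.tensor B)) (n : ℤ) (σ : ZMod 2) {i : Deg} {b : C.carrier}
    (hb : b ∈ C.gr i) (y : Y.carrier) : (Y.shift n σ).leftAct b (shiftEquiv Y n σ y) =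
      ksign σ i.2 • shiftEquiv Y n σ (Y.leftAct b y) := by
  have := smul_shiftEquiv_of_mem Y n σ (GSAlg.tmul_mem hb B.one_mem) y
  rwa [add_zero] at this

theorem shiftEquiv_comp_mem (P : GSMod B) (Y : GSMod (C.tensor B)) (n : ℤ) (σ : ZMod 2) {d : Deg}
    {f : P.carrier →ₗ[F] Y.carrier} :
    (shiftEquiv Y n σ).toLinearMap ∘ₗ f ∈ homPiece P (Y.shift n σ).gr (Y.shift n σ).rightAct d ↔
      f ∈ homPiece P Y.gr Y.rightAct (d - (n, σ)) := by
  refine and_congr (forall_congr' fun j => forall_congr' fun m => imp_congr_right fun hm => ?_)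
    (forall_congr' fun i => forall_congr' fun b => forall_congr' fun m =>
    imp_congr_right fun hb => ?_)
  · rw [LinearMap.comp_apply, LinearEquiv.coe_coe, shiftEquiv_mem, add_sub_right_comm]
  · rw [LinearMap.comp_apply, LinearMap.comp_apply, LinearEquiv.coe_coe,
      rightAct_shiftEquiv Y n σ hb, ← map_zsmul, ← map_zsmul, (shiftEquiv Y n σ).injective.eq_iff,
      smul_smul, ← ksign_add_left]
    have : d.2 + σ = (d - (n, σ)).2 := by rw [Prod.snd_sub, sub_eq_add_neg, deg_neg]
    rw [this]

/-- Homomorphisms to a shift. -/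
noncomputable def homShiftHom (P : GSMod B) (Y : GSMod (C.tensor B)) (n : ℤ) (σ : ZMod 2) :
    (hom P Y).shift n σ ⟶ hom P (Y.shift n σ) :=
  homOfF (M := (hom P Y).shift n σ) ((homLin (N' := Y.shift n σ)
      (LinearMap.compRight F (shiftEquiv Y n σ).toLinearMap)
      (fun d f hf => homPiece_le P _ (d + (n, σ)) ((shiftEquiv_comp_mem P Y n σ).2
        (by rwa [add_sub_cancel_right])))) ∘ₗ (shiftEquiv (hom P Y) n σ).symm.toLinearMap)
    (fun d f hf => (shiftEquiv_comp_mem P Y n σ).2 hf)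
    (fun i j c f hc hf => homι_injective (LinearMap.ext fun p => by
      obtain ⟨f, rfl⟩ := (shiftEquiv (hom P Y) n σ).surjective f
      rw [smul_shiftEquiv_of_mem _ n σ hc]
      change shiftEquiv Y n σ (homι P Y (ksign σ i.2 • c • f) p) =
        (Y.shift n σ).leftAct c (shiftEquiv Y n σ (homι P Y f p))
      rw [leftAct_shiftEquiv Y n σ hc, map_zsmul, LinearMap.smul_apply, map_zsmul]
      rfl))

theorem homShiftHom_lin (P : GSMod B) (Y : GSMod (C.tensor B)) (n : ℤ) (σ : ZMod 2)
    (f : (hom P Y).carrier) (p : P.carrier) :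
    homι P _ ((homShiftHom P Y n σ).lin (shiftEquiv (hom P Y) n σ f)) p =
      shiftEquiv Y n σ (homι P Y f p) := rfl

theorem homShiftHom_bijective (P : GSMod B) (Y : GSMod (C.tensor B)) (n : ℤ) (σ : ZMod 2) :
    Function.Bijective (homShiftHom P Y n σ).lin := by
  refine ⟨fun f f' h => ?_, surjective_of_pieces (hom P (Y.shift n σ)).internal
    (Hom.linF (homShiftHom P Y n σ)) fun d g hg => ?_⟩
  · obtain ⟨f, rfl⟩ := (shiftEquiv (hom P Y) n σ).surjective f
    obtain ⟨f', rfl⟩ := (shiftEquiv (hom P Y) n σ).surjective f'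
    refine congrArg _ (homι_injective (LinearMap.ext fun p => (shiftEquiv Y n σ).injective ?_))
    rw [← homShiftHom_lin, ← homShiftHom_lin, h]
  · exact ⟨shiftEquiv (hom P Y) n σ (homMk ((shiftEquiv Y n σ).symm.toLinearMap ∘ₗ homι P _ g)
      ((shiftEquiv_comp_mem P Y n σ).1 hg)), rfl⟩

/-- Homomorphisms to a shift. -/
noncomputable def homShift (P : GSMod B) (C : GSAlg F) (n : ℤ) (σ : ZMod 2) :
    homFunctor P C ⋙ shiftFunctor C n σ ≅ shiftFunctor (C.tensor B) n σ ⋙ homFunctor P C :=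
  natIsoOfBij' (G := homFunctor P C ⋙ shiftFunctor C n σ)
    (H := shiftFunctor (C.tensor B) n σ ⋙ homFunctor P C) (fun Y => homShiftHom P Y n σ)
    (fun Y => homShiftHom_bijective P Y n σ) (fun _ => rfl)

theorem comp_shiftEquiv_mem (P : GSMod B) {X : Type u} [AddCommGroup X] [Module F X]
    {gr : Deg → Submodule F X} {ρ : B.carrier →ₗ[F] X →ₗ[F] X} (n : ℤ) (σ : ZMod 2) {d : Deg}
    {f : (P.shift n σ).carrier →ₗ[F] X} (hf : f ∈ homPiece (P.shift n σ) gr ρ d) :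
    f ∘ₗ (shiftEquiv P n σ).toLinearMap ∈ homPiece P gr ρ (d + (n, σ)) := by
  refine ⟨fun j m hm => ?_, fun i b m hb => ?_⟩
  · rw [add_assoc, add_comm (n, σ)]
    exact hf.1 _ _ (shiftEquiv_mem_add P n σ hm)
  · rw [LinearMap.comp_apply, LinearMap.comp_apply, LinearEquiv.coe_coe,
      shiftEquiv_smul_of_mem P n σ hb, map_zsmul, hf.2 i b _ hb, smul_smul, Prod.snd_add,
      ksign_add_left, mul_comm]

theorem comp_symm_shiftEquiv_mem (P : GSMod B) {X : Type u} [AddCommGroup X] [Module F X]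
    {gr : Deg → Submodule F X} {ρ : B.carrier →ₗ[F] X →ₗ[F] X} (n : ℤ) (σ : ZMod 2) {d : Deg}
    {f : P.carrier →ₗ[F] X} (hf : f ∈ homPiece P gr ρ (d + (n, σ))) :
    f ∘ₗ (shiftEquiv P n σ).symm.toLinearMap ∈ homPiece (P.shift n σ) gr ρ d := by
  refine ⟨fun j m hm => ?_, fun i b m hb => ?_⟩
  · have := hf.1 _ _ hm
    rwa [show d + (n, σ) + (j - (n, σ)) = d + j by abel] at this
  · rw [LinearMap.comp_apply, LinearMap.comp_apply, LinearEquiv.coe_coe,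
      symm_shiftEquiv_smul_of_mem P n σ hb, map_zsmul, hf.2 i b _ hb, smul_smul, Prod.snd_add,
      ksign_add_left, mul_left_comm, ksign_self, mul_one]

/-- Homomorphisms from a shift, as a map of vector spaces. -/
noncomputable def homShiftPre (P : GSMod B) (Y : GSMod (C.tensor B)) (n : ℤ) (σ : ZMod 2) :
    (hom (P.shift n σ) Y).carrier →ₗ[F] (hom P Y).carrier :=
  homLin (N' := Y) (LinearMap.lcomp F _ (shiftEquiv P n σ).toLinearMap)
    (fun d _ hf => homPiece_le P Y (d + (n, σ)) (comp_shiftEquiv_mem P n σ hf))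

theorem homShiftPre_mem (P : GSMod B) (Y : GSMod (C.tensor B)) (n : ℤ) (σ : ZMod 2) {d : Deg}
    {f : (hom (P.shift n σ) Y).carrier} (hf : f ∈ (hom (P.shift n σ) Y).gr d) :
    homShiftPre P Y n σ f ∈ (hom P Y).gr (d + (n, σ)) := comp_shiftEquiv_mem P n σ hf

theorem homShiftPre_smul (P : GSMod B) (Y : GSMod (C.tensor B)) (n : ℤ) (σ : ZMod 2)
    (c : C.carrier) (f : (hom (P.shift n σ) Y).carrier) :
    homShiftPre P Y n σ (c • f) = c • homShiftPre P Y n σ f := rfl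

/-- Homomorphisms from a shift, as a map of vector spaces. -/
noncomputable def shiftHomLin (P : GSMod B) (Y : GSMod (C.tensor B)) (n : ℤ) (σ : ZMod 2) :
    (hom (P.shift n σ) Y).carrier →ₗ[F] ((hom P Y).shift (-n) σ).carrier :=
  (shiftEquiv (hom P Y) (-n) σ).toLinearMap ∘ₗ ptwist (hom P Y).internal σ ∘ₗ homShiftPre P Y n σ

theorem shiftHomLin_of_mem (P : GSMod B) (Y : GSMod (C.tensor B)) (n : ℤ) (σ : ZMod 2) {d : Deg}
    {f : (hom (P.shift n σ) Y).carrier} (hf : f ∈ (hom (P.shift n σ) Y).gr d) :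
    shiftHomLin P Y n σ f =
      ksign σ (d + (n, σ)).2 • shiftEquiv (hom P Y) (-n) σ (homShiftPre P Y n σ f) := by
  change shiftEquiv (hom P Y) (-n) σ (ptwist (hom P Y).internal σ (homShiftPre P Y n σ f)) = _
  rw [ptwist_of_mem _ _ (homShiftPre_mem P Y n σ hf), map_zsmul]

theorem deg_sub_shift (d : Deg) (n : ℤ) (σ : ZMod 2) : d - (-n, σ) = d + (n, σ) := by
  rw [sub_eq_add_neg, Prod.neg_mk, neg_neg, deg_neg]

theorem shiftHomLin_mem (P : GSMod B) (Y : GSMod (C.tensor B)) (n : ℤ) (σ : ZMod 2) (d : Deg)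
    (f : (hom (P.shift n σ) Y).carrier) (hf : f ∈ (hom (P.shift n σ) Y).gr d) :
    shiftHomLin P Y n σ f ∈ ((hom P Y).shift (-n) σ).gr d := by
  rw [shiftHomLin_of_mem P Y n σ hf]
  refine zsmul_mem ((shiftEquiv_mem (hom P Y) (-n) σ).2 ?_) _
  rw [deg_sub_shift]
  exact homShiftPre_mem P Y n σ hf

theorem shiftHomLin_smul (P : GSMod B) (Y : GSMod (C.tensor B)) (n : ℤ) (σ : ZMod 2) (i j : Deg)
    (c : C.carrier) (f : (hom (P.shift n σ) Y).carrier) (hc : c ∈ C.gr i)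
    (hf : f ∈ (hom (P.shift n σ) Y).gr j) :
    shiftHomLin P Y n σ (c • f) = c • shiftHomLin P Y n σ f := by
  rw [shiftHomLin_of_mem P Y n σ hf, shiftHomLin_of_mem P Y n σ (GSMod.smul_mem _ hc hf),
    homShiftPre_smul, shiftEquiv_smul_of_mem _ _ _ hc, smul_smul, smul_comm c, add_assoc,
    Prod.snd_add i, ksign_add_right, mul_comm (ksign σ i.2), mul_assoc, ksign_self, mul_one]

/-- Homomorphisms from a shift. -/
noncomputable def shiftHomHom (P : GSMod B) (Y : GSMod (C.tensor B)) (n : ℤ) (σ : ZMod 2) :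
    hom (P.shift n σ) Y ⟶ (hom P Y).shift (-n) σ :=
  homOfF (shiftHomLin P Y n σ) (shiftHomLin_mem P Y n σ) (shiftHomLin_smul P Y n σ)

theorem shiftHomHom_bijective (P : GSMod B) (Y : GSMod (C.tensor B)) (n : ℤ) (σ : ZMod 2) :
    Function.Bijective (shiftHomHom P Y n σ).lin := by
  have h1 : Function.Bijective (ptwist (hom P Y).internal σ) :=
    bij_of_inverse _ (ptwist_ptwist _ σ) (ptwist_ptwist _ σ)
  refine (shiftEquiv (hom P Y) (-n) σ).bijective.comp (h1.comp ⟨fun f f' h => ?_,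
    surjective_of_pieces (hom P Y).internal _ fun d g hg => ?_⟩)
  · refine homι_injective (LinearMap.ext fun p => ?_)
    obtain ⟨p, rfl⟩ := (shiftEquiv P n σ).surjective p
    exact LinearMap.congr_fun (congrArg (homι P Y) h) p
  · exact ⟨homMk (d := d - (n, σ)) (homι P Y g ∘ₗ (shiftEquiv P n σ).symm.toLinearMap)
      (comp_symm_shiftEquiv_mem P n σ (by rwa [sub_add_cancel])), rfl⟩

/-- Postcomposition with a morphism. -/
noncomputable def homMap (P : GSMod B) {Y Y' : GSMod (C.tensor B)} (g : Y ⟶ Y') :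
    hom P Y ⟶ hom P Y' := (homFunctor P C).map g

/-- The shift of a morphism. -/
noncomputable def shiftMap {M N : GSMod B} (g : M ⟶ N) (n : ℤ) (σ : ZMod 2) :
    M.shift n σ ⟶ N.shift n σ := (shiftFunctor B n σ).map g

theorem shiftHomLin_natural (P : GSMod B) {Y Y' : GSMod (C.tensor B)} (g : Y ⟶ Y') (n : ℤ)
    (σ : ZMod 2) : shiftHomLin P Y' n σ ∘ₗ Hom.linF (homMap (P.shift n σ) g) =
      Hom.linF (shiftMap (homMap P g) (-n) σ) ∘ₗ shiftHomLin P Y n σ := by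
  refine lin_ext_hom (hom (P.shift n σ) Y).internal fun d x hx => ?_
  rw [LinearMap.comp_apply, LinearMap.comp_apply, shiftHomLin_of_mem P Y n σ hx, map_zsmul]
  exact shiftHomLin_of_mem P Y' n σ ((homMap (P.shift n σ) g).map_mem hx)

/-- Homomorphisms from a shift. -/
noncomputable def shiftHom (P : GSMod B) (C : GSAlg F) (n : ℤ) (σ : ZMod 2) :
    homFunctor (P.shift n σ) C ≅ homFunctor P C ⋙ shiftFunctor C (-n) σ :=
  natIsoOfBij' (G := homFunctor (P.shift n σ) C) (H := homFunctor P C ⋙ shiftFunctor C (-n) σ)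
    (fun Y => shiftHomHom P Y n σ) (fun Y => shiftHomHom_bijective P Y n σ)
    (fun g => hom_ext fun f => LinearMap.congr_fun (shiftHomLin_natural P g n σ) f)

end Shift

section OuterRes

/-- The comparison `φ(1) M ⊠ ψ(1) N → (φ ⊗ ψ)(1) (M ⊠ N)`. -/
noncomputable def outerResHom (φ : GSAlg.Hom B A) (ψ : GSAlg.Hom B' A') (M : GSMod A)
    (N : GSMod A') : (M.res φ).outer (N.res ψ) ⟶ (M.outer N).res (φ.tensor ψ) :=
  resLift (φ.tensor ψ) (M := M.outer N) (outerLiftF ((otm M N).compl₁₂ (resι φ M) (resι ψ N)))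
    (fun d x hx => map_outer_mem _ _ (fun i j m n hm hn hd => hd ▸ otm_mem (M := M) (N := N) hm hn) hx)
    (fun _ _ x t _ _ => outer_semilinear _ _ (fun i j k l a b m n ha hb hm hn => by
        rw [smul_otm a hb hm, map_zsmul, outerLiftF_otm, outerLiftF_otm, LinearMap.compl₁₂_apply,
          LinearMap.compl₁₂_apply, resι_smul, resι_smul, GSAlg.Hom.tensor_tmul,
          smul_otm _ (ψ.map_mem hb) ((resι_mem φ M).2 hm)]) x t)
    (fun _ x _ => outer_induction (p := fun x => (φ.tensor ψ).lin 1 • outerLiftF _ x =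
      outerLiftF _ x) (fun i j m n hm hn => by
        rw [outerLiftF_otm, LinearMap.compl₁₂_apply, GSAlg.tensor_one, GSAlg.Hom.tensor_tmul,
          smul_otm _ (ψ.map_mem B'.one_mem) ((resι_mem φ M).2 hm), one_smul_resι, one_smul_resι]
        simp) (fun x y hx hy => by rw [map_add, smul_add, hx, hy]) x)

theorem resι_outerResHom (φ : GSAlg.Hom B A) (ψ : GSAlg.Hom B' A') (M : GSMod A) (N : GSMod A')
    (m : (M.res φ).carrier) (n : (N.res ψ).carrier) :
    resι _ (M.outer N) ((outerResHom φ ψ M N).lin (otm _ _ m n)) =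
      otm M N (resι φ M m) (resι ψ N n) := rfl

/-- The projection `m ⊗ n ↦ φ(1) m ⊗ ψ(1) n`. -/
noncomputable def outerResPr (φ : GSAlg.Hom B A) (ψ : GSAlg.Hom B' A') (M : GSMod A) (N : GSMod A') :
    (M.outer N).carrier →ₗ[F] ((M.res φ).outer (N.res ψ)).carrier :=
  outerLiftF ((otm _ _).compl₁₂ (resPr φ M) (resPr ψ N))

theorem resPr_resι (φ : GSAlg.Hom B A) (M : GSMod A) (m : (M.res φ).carrier) :
    resPr φ M (resι φ M m) = m := resι_injective φ M (one_smul_resι φ M m)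

theorem outerResHom_bijective (φ : GSAlg.Hom B A) (ψ : GSAlg.Hom B' A') (M : GSMod A)
    (N : GSMod A') : Function.Bijective (outerResHom φ ψ M N).lin := by
  refine bij_of_inverse (fun t => outerResPr φ ψ M N (resι _ _ t)) (fun x => ?_) (fun t => ?_)
  · refine outer_induction (p := fun x => outerResPr φ ψ M N (resι _ _
      ((outerResHom φ ψ M N).lin x)) = x) (fun i j m n _ _ => ?_)
      (fun x y hx hy => by simp only [map_add, hx, hy]) x
    rw [resι_outerResHom, outerResPr, outerLiftF_otm, LinearMap.compl₁₂_apply, resPr_resι,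
      resPr_resι]
  · refine resι_injective _ _ ?_
    have : ∀ x : (M.outer N).carrier, resι _ _ ((outerResHom φ ψ M N).lin (outerResPr φ ψ M N x)) =
        (φ.tensor ψ).lin 1 • x := fun x => outer_induction (p := fun x => resι _ _
        ((outerResHom φ ψ M N).lin (outerResPr φ ψ M N x)) = (φ.tensor ψ).lin 1 • x)
      (fun i j m n hm hn => by
        rw [outerResPr, outerLiftF_otm, LinearMap.compl₁₂_apply, resι_outerResHom, resι_resPr,
          resι_resPr, GSAlg.tensor_one, GSAlg.Hom.tensor_tmul,
          smul_otm _ (ψ.map_mem B'.one_mem) hm]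
        simp) (fun x y hx hy => by simp only [map_add, smul_add, hx, hy]) x
    rw [this, one_smul_resι]

/-- Restriction of outer tensor products. -/
noncomputable def outerRes (φ : GSAlg.Hom B A) (ψ : GSAlg.Hom B' A') (M : GSMod A) :
    resFunctor ψ ⋙ outerFunctor (M.res φ) B' ≅ outerFunctor M A' ⋙ resFunctor (φ.tensor ψ) :=
  natIsoOfBij' (G := resFunctor ψ ⋙ outerFunctor (M.res φ) B')
    (H := outerFunctor M A' ⋙ resFunctor (φ.tensor ψ)) (outerResHom φ ψ M)
    (outerResHom_bijective φ ψ M)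
    (fun {N N'} _ => outer_hom_ext (M := M.res φ) (N := N.res ψ)
      (X := (M.outer N').res (φ.tensor ψ)) fun _ _ _ _ _ _ => rfl)

end OuterRes

section Pi

variable {ι : Type} [Finite ι]

/-- Isomorphic families of functors have isomorphic sums. -/
noncomputable def piIso {𝒟 : Type v} [Category.{w} 𝒟] {G H : ι → 𝒟 ⥤ GSMod B}
    (e : ∀ i, G i ≅ H i) : piFunctor G ≅ piFunctor H :=
  natIsoOfBij' (G := piFunctor G) (H := piFunctor H)
    (fun X => ⟨LinearMap.pi fun i => ((e i).hom.app X).lin ∘ₗ LinearMap.proj i,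
      fun hm i hi => ((e i).hom.app X).map_mem (hm i hi)⟩)
    (fun X => ⟨fun x y h => funext fun i => (iso_bijective ((e i).app X)).1 (congrFun h i),
      fun y => ⟨fun i => ((e i).inv.app X).lin (y i), funext fun i => by
        change (((e i).inv.app X) ≫ ((e i).hom.app X)).lin (y i) = y i
        rw [Iso.inv_hom_id_app]; rfl⟩⟩)
    (fun {X Y} g => hom_ext fun m => funext fun i =>
      congrArg (fun f => Hom.lin f (m i)) ((e i).hom.naturality g))

theorem homPi_bijective (P : GSMod B) (N : ι → GSMod (C.tensor B)) :
    Function.Bijective (LinearMap.pi fun i => ((homFunctor P C).map (piProj N i)).lin :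
      (hom P (pi N)).carrier →ₗ[C.carrier] ∀ i, (hom P (N i)).carrier) := by
  refine ⟨fun f f' h => homι_injective (LinearMap.ext fun p => funext fun i => ?_), ?_⟩
  · exact LinearMap.congr_fun (congrArg (homι P (N i)) (congrFun h i)) p
  · refine surjective_of_pieces (pi fun i => hom P (N i)).internal ((LinearMap.pi fun i =>
      ((homFunctor P C).map (piProj N i)).lin).restrictScalars F) fun d g hg => ?_
    exact ⟨homMk (N := pi N) (d := d) (LinearMap.pi fun i => homι P (N i) (g i))
      ⟨fun j m hm i hi => (hg i hi).1 j m hm, fun k b m hb => funext fun i =>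
        (hg i trivial).2 k b m hb⟩, rfl⟩

/-- Homomorphisms to a finite direct sum. -/
noncomputable def homPi {𝒟 : Type v} [Category.{w} 𝒟] (P : GSMod B)
    (G : ι → 𝒟 ⥤ GSMod (C.tensor B)) :
    piFunctor G ⋙ homFunctor P C ≅ piFunctor fun i => G i ⋙ homFunctor P C :=
  natIsoOfBij' (G := piFunctor G ⋙ homFunctor P C) (H := piFunctor fun i => G i ⋙ homFunctor P C)
    (fun X => ⟨LinearMap.pi fun i => ((homFunctor P C).map (piProj (fun i => (G i).obj X) i)).lin,
      fun hm i _ => ((homFunctor P C).map (piProj (fun i => (G i).obj X) i)).map_mem hm⟩)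
    (fun X => homPi_bijective P fun i => (G i).obj X) (fun _ => rfl)

end Pi

end GSMod

end SuperTower

namespace SuperTower

variable {F : Type u} [Field F]

namespace GSMod

variable {A B C D A' B' : GSAlg F}

/-- The identity map from a superalgebra to a shift of its regular supermodule. -/
def regShift (B : GSAlg F) (d : Deg) : B.carrier ≃ₗ[F] ((regular B).shift d.1 d.2).carrier :=
  shiftEquiv (regular B) d.1 d.2

theorem smul_regShift (B : GSAlg F) (d : Deg) (b z : B.carrier) :
    b • regShift B d z = regShift B d (B.parityHom d.2 b * z) := rfl

theorem regShift_mem (B : GSAlg F) (d : Deg) {j : Deg} {z : B.carrier} :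
    regShift B d z ∈ ((regular B).shift d.1 d.2).gr j ↔ z ∈ B.gr (j - d) := Iff.rfl

theorem regShift_symm_smul (B : GSAlg F) (d : Deg) (b : B.carrier)
    (z : ((regular B).shift d.1 d.2).carrier) :
    (regShift B d).symm (b • z) = B.parityHom d.2 b * (regShift B d).symm z := rfl

/-- The linear form given by a morphism to a shift of the regular supermodule. -/
noncomputable def formOf {P : GSMod B} {d : Deg} (s : P ⟶ (regular B).shift d.1 d.2) :
    P.carrier →ₗ[B.carrier] B.carrier where
  toFun p := B.parityHom d.2 ((regShift B d).symm (s.lin p))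
  map_add' p q := by rw [map_add, map_add, map_add]
  map_smul' b p := by
    rw [map_smul, regShift_symm_smul, map_mul, B.parityHom_parityHom]
    rfl

theorem formOf_apply {P : GSMod B} {d : Deg} (s : P ⟶ (regular B).shift d.1 d.2) (p : P.carrier) :
    formOf s p = B.parityHom d.2 ((regShift B d).symm (s.lin p)) := rfl

theorem formOf_smul {P : GSMod B} {d : Deg} (s : P ⟶ (regular B).shift d.1 d.2)
    (r : (regular B).shift d.1 d.2 ⟶ P) (p : P.carrier) :
    formOf s p • r.lin (regShift B d 1) = r.lin (s.lin p) := by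
  rw [← map_smul, smul_regShift, formOf_apply, B.parityHom_parityHom, mul_one,
    LinearEquiv.apply_symm_apply]

/-- A finite dual basis of a projective graded supermodule consisting of homogeneous elements and
homogeneous linear forms. -/
theorem IsProjective.exists_homogeneous_dualBasis {P : GSMod B} (hP : P.IsProjective) :
    ∃ (ι : Type) (_ : Fintype ι) (d : ι → Deg) (x : ι → P.carrier)
      (t : ι → (P.carrier →ₗ[B.carrier] B.carrier)), (∀ i, x i ∈ P.gr (d i)) ∧
      (∀ i j p, p ∈ P.gr j → t i p ∈ B.gr (j - d i)) ∧ ∀ p, ∑ i, t i p • x i = p := by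
  obtain ⟨ι, hι, d, s, r, h⟩ := hP.exists_dualBasis
  refine ⟨ι, hι, d, fun i => (r i).lin (regShift B (d i) 1), fun i => formOf (s i),
    fun i => (r i).map_mem ((regShift_mem B (d i)).2 ?_), fun i j p hp => ?_, fun p => ?_⟩
  · rw [sub_self]; exact B.one_mem
  · exact ptwist_mem B.internal (d i).2 ((s i).map_mem hp)
  · simp only [formOf_smul, h]

section Coefficients

variable {P : GSMod B} (Y : GSMod (C.tensor B)) (t : P.carrier →ₗ[B.carrier] B.carrier) (d : Deg)

/-- The map `y ↦ (p ↦ ± t(p) y)` for a linear form `t`. -/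
noncomputable def formSmul : Y.carrier →ₗ[F] (P.carrier →ₗ[F] Y.carrier) :=
  dlift Y.internal fun k =>
    (LinearMap.lcomp F Y.carrier (ptwist B.internal (k - d).2 ∘ₗ t.restrictScalars F)) ∘ₗ
      Y.rightAct.flip ∘ₗ (Y.gr k).subtype

theorem formSmul_apply {k : Deg} {y : Y.carrier} (hy : y ∈ Y.gr k) (p : P.carrier) :
    formSmul Y t d y p = Y.rightAct (ptwist B.internal (k - d).2 (t p)) y := by
  rw [formSmul, dlift_of_mem _ _ hy]
  rfl

variable (ht : ∀ j p, p ∈ P.gr j → t p ∈ B.gr (j - d))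
include ht

theorem formSmul_mem {k : Deg} {y : Y.carrier} (hy : y ∈ Y.gr k) :
    formSmul Y t d y ∈ homPiece P Y.gr Y.rightAct (k - d) := by
  refine ⟨fun j p hp => ?_, fun i b p hb => ?_⟩
  · rw [formSmul_apply Y t d hy, show k - d + j = (j - d) + k by abel]
    exact rightAct_mem Y (ptwist_mem _ _ (ht j p hp)) hy
  · rw [formSmul_apply Y t d hy, formSmul_apply Y t d hy, map_smul, smul_eq_mul, B.ptwist_mul,
      ptwist_of_mem _ _ hb, smul_mul_assoc, map_zsmul, LinearMap.smul_apply, rightAct_mul]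

theorem formSmul_leftAct {i k : Deg} {c : C.carrier} (hc : c ∈ C.gr i) {y : Y.carrier}
    (hy : y ∈ Y.gr k) : formSmul Y t d (Y.leftAct c y) = Y.leftAct c ∘ₗ formSmul Y t d y :=
  lin_ext_hom P.internal fun j p hp => by
    rw [LinearMap.comp_apply, formSmul_apply Y t d hy, formSmul_apply Y t d (leftAct_mem Y hc hy),
      ptwist_of_mem _ _ (ht j p hp), ptwist_of_mem _ _ (ht j p hp), map_zsmul, map_zsmul,
      LinearMap.smul_apply, LinearMap.smul_apply, map_zsmul, leftAct_rightAct Y hc (ht j p hp),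
      smul_smul, add_sub_assoc, Prod.snd_add, ksign_add_left, mul_comm]

/-- The map `y ↦ (p ↦ ± t(p) y)` to the space of homomorphisms. -/
noncomputable def formHom : Y.carrier →ₗ[F] (hom P Y).carrier :=
  (formSmul Y t d).codRestrict (HomCarrier P Y) fun y =>
    hom_induction Y.internal (p := fun y => formSmul Y t d y ∈ HomCarrier P Y)
      (fun k _ hy => homPiece_le P Y (k - d) (formSmul_mem Y t d ht hy))
      (fun x y hx hy => by rw [map_add]; exact add_mem hx hy) y

theorem homι_formHom (y : Y.carrier) : homι P Y (formHom Y t d ht y) = formSmul Y t d y := rfl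

theorem formHom_mem {k : Deg} {y : Y.carrier} (hy : y ∈ Y.gr k) :
    formHom Y t d ht y ∈ (hom P Y).gr (k - d) := formSmul_mem Y t d ht hy

theorem formHom_leftAct (c : C.carrier) (y : Y.carrier) :
    formHom Y t d ht (Y.leftAct c y) = c • formHom Y t d ht y := by
  refine hom_induction C.internal (p := fun c => formHom Y t d ht (Y.leftAct c y) =
    c • formHom Y t d ht y) (fun i c hc => ?_)
    (fun x y hx hy => by simp only [map_add, LinearMap.add_apply, add_smul, hx, hy]) c
  refine hom_induction Y.internal (p := fun y => formHom Y t d ht (Y.leftAct c y) =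
    c • formHom Y t d ht y) (fun k y hy => ?_)
    (fun x y hx hy => by simp only [map_add, smul_add, hx, hy]) y
  exact homι_injective (formSmul_leftAct Y t d ht hc hy)

end Coefficients

theorem sum_formSmul {ι : Type} [Fintype ι] {P : GSMod B} (Y : GSMod (C.tensor B)) {d : ι → Deg}
    {x : ι → P.carrier} {t : ι → (P.carrier →ₗ[B.carrier] B.carrier)} (hx : ∀ i, x i ∈ P.gr (d i))
    (ht : ∀ i j p, p ∈ P.gr j → t i p ∈ B.gr (j - d i)) (h : ∀ p, ∑ i, t i p • x i = p) {e : Deg}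
    {f : P.carrier →ₗ[F] Y.carrier} (hf : f ∈ homPiece P Y.gr Y.rightAct e) :
    ∑ i, formSmul Y (t i) (d i) (f (x i)) = f :=
  lin_ext_hom P.internal fun j p hp => by
    rw [LinearMap.sum_apply]
    conv_rhs => rw [← h p, map_sum]
    refine Finset.sum_congr rfl fun i _ => ?_
    rw [formSmul_apply Y _ _ (hf.1 _ _ (hx i)), add_sub_cancel_right,
      ptwist_of_mem _ _ (ht i j p hp), map_zsmul, hf.2 _ _ _ (ht i j p hp), LinearMap.smul_apply]

theorem sum_formHom {ι : Type} [Fintype ι] {P : GSMod B} (Y : GSMod (C.tensor B)) {d : ι → Deg}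
    {x : ι → P.carrier} {t : ι → (P.carrier →ₗ[B.carrier] B.carrier)} (hx : ∀ i, x i ∈ P.gr (d i))
    (ht : ∀ i j p, p ∈ P.gr j → t i p ∈ B.gr (j - d i)) (h : ∀ p, ∑ i, t i p • x i = p)
    (f : (hom P Y).carrier) :
    ∑ i, formHom Y (t i) (d i) (ht i) (homι P Y f (x i)) = f := by
  refine hom_induction (hom P Y).internal (p := fun f => ∑ i, formHom Y (t i) (d i) (ht i)
    (homι P Y f (x i)) = f) (fun e f hf => homι_injective ?_)
    (fun f g hf hg => by
      simp only [map_add, LinearMap.add_apply, Finset.sum_add_distrib]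
      rw [hf, hg]) f
  rw [map_sum]
  exact sum_formSmul Y hx ht h hf

section IndTensor

variable {A₁ A₂ B₁ B₂ : GSAlg F}

/-- The linear map out of a tensor product of superalgebras given by a bilinear map. -/
noncomputable def tensorLift {X : Type*} [AddCommGroup X] [Module F X]
    (g : A₁.carrier →ₗ[F] A₂.carrier →ₗ[F] X) : (A₁.tensor A₂).carrier →ₗ[F] X :=
  TensorProduct.lift g

theorem tensorLift_tmul {X : Type*} [AddCommGroup X] [Module F X]
    (g : A₁.carrier →ₗ[F] A₂.carrier →ₗ[F] X) (a : A₁.carrier) (a' : A₂.carrier) :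
    tensorLift g (GSAlg.tmul a a') = g a a' := rfl

/-- Linear maps out of a module induced along a tensor product of homomorphisms. -/
noncomputable def indLiftT (φ : GSAlg.Hom B₁ A₁) (ψ : GSAlg.Hom B₂ A₂) {Y : GSMod (B₁.tensor B₂)}
    {X : Type*} [AddCommGroup X] [Module F X]
    (f : (A₁.tensor A₂).carrier →ₗ[F] Y.carrier →ₗ[F] X)
    (h : ∀ i j k l m a₁ a₂ b₁ b₂ y, a₁ ∈ A₁.gr i → a₂ ∈ A₂.gr j → b₁ ∈ B₁.gr k → b₂ ∈ B₂.gr l →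
      y ∈ Y.gr m → ksign j.2 k.2 • f (GSAlg.tmul (a₁ * φ.lin b₁) (a₂ * ψ.lin b₂)) y =
        f (GSAlg.tmul a₁ a₂) (GSAlg.tmul b₁ b₂ • y)) :
    (Y.ind (φ.tensor ψ)).carrier →ₗ[F] X :=
  indLiftF (φ.tensor ψ) (TensorProduct.lift f) (fun _ _ m a b y _ _ hy => by
    simp only [TensorProduct.lift.tmul]
    refine GSAlg.tensor_induction (p := fun a => f (a * (φ.tensor ψ).lin b) y = f a (b • y))
      (fun i j a₁ a₂ h₁ h₂ => ?_) (fun a a' ha ha' => by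
        simp only [add_mul, map_add, LinearMap.add_apply, ha, ha']) a
    refine GSAlg.tensor_induction (p := fun b => f (GSAlg.tmul a₁ a₂ * (φ.tensor ψ).lin b) y =
      f (GSAlg.tmul a₁ a₂) (b • y)) (fun k l b₁ b₂ g₁ g₂ => ?_) (fun a a' ha ha' => by
        simp only [map_add, mul_add, add_smul, LinearMap.add_apply, ha, ha']) b
    rw [GSAlg.Hom.tensor_tmul, GSAlg.tmul_mul_tmul _ _ h₂ (φ.map_mem g₁), map_zsmul,
      LinearMap.smul_apply]
    exact h i j k l m a₁ a₂ b₁ b₂ y h₁ h₂ g₁ g₂ hy)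

theorem indLiftT_mk (φ : GSAlg.Hom B₁ A₁) (ψ : GSAlg.Hom B₂ A₂) {Y : GSMod (B₁.tensor B₂)}
    {X : Type*} [AddCommGroup X] [Module F X]
    (f : (A₁.tensor A₂).carrier →ₗ[F] Y.carrier →ₗ[F] X) (h) (a : (A₁.tensor A₂).carrier)
    (y : Y.carrier) : indLiftT φ ψ f h (imk (φ.tensor ψ) Y (a ⊗ₜ y)) = f a y := rfl

theorem ind_tensor_induction (φ : GSAlg.Hom B₁ A₁) (ψ : GSAlg.Hom B₂ A₂) {Y : GSMod (B₁.tensor B₂)}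
    {p : (Y.ind (φ.tensor ψ)).carrier → Prop}
    (h : ∀ i j k a₁ a₂ y, a₁ ∈ A₁.gr i → a₂ ∈ A₂.gr j → y ∈ Y.gr k →
      p (imk (φ.tensor ψ) Y (GSAlg.tmul a₁ a₂ ⊗ₜ y)))
    (add : ∀ x y, p x → p y → p (x + y)) (x : (Y.ind (φ.tensor ψ)).carrier) : p x :=
  ind_induction (φ.tensor ψ) (p := p) (fun _ k a y _ hy =>
    GSAlg.tensor_induction (p := fun a => p (imk (φ.tensor ψ) Y (a ⊗ₜ y)))
      (fun i j a₁ a₂ h₁ h₂ => h i j k a₁ a₂ y h₁ h₂ hy)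
      (fun a a' ha ha' => by
        rw [TensorProduct.add_tmul, map_add]; exact add _ _ ha ha') a) add x

end IndTensor

theorem tmul_smul_eq (Y : GSMod (C.tensor B)) (c : C.carrier) (b : B.carrier) (y : Y.carrier) :
    GSAlg.tmul c b • y = Y.leftAct c (Y.rightAct b y) := by
  rw [leftAct_apply, rightAct_apply, smul_smul, GSAlg.tmul_mul_one, mul_one]

section IndHom

variable (φ : GSAlg.Hom B A) (P : GSMod D) (Y : GSMod (B.tensor D))

/-- The extension of `φ : B → A` to `B ⊗ D → A ⊗ D`. -/
noncomputable abbrev extHom (φ : GSAlg.Hom B A) (D : GSAlg F) :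
    GSAlg.Hom (B.tensor D) (A.tensor D) := φ.tensor (GSAlg.Hom.id D)

theorem rightAct_indUnit (b : D.carrier) (y : Y.carrier) :
    (Y.ind (extHom φ D)).rightAct b (indUnit (extHom φ D) Y y) =
      indUnit (extHom φ D) Y (Y.rightAct b y) := by
  rw [rightAct_apply, rightAct_apply, indUnit_smul, ← one_smul_indUnit (extHom φ D), smul_smul,
    smul_smul, GSAlg.tensor_one, GSAlg.Hom.tensor_tmul, GSAlg.Hom.tensor_tmul,
    GSAlg.Hom.id_lin, GSAlg.Hom.id_lin]
  congr 1
  refine hom_induction D.internal (p := fun b => GSAlg.tmul 1 b * GSAlg.tmul (φ.lin 1) 1 =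
    GSAlg.tmul (φ.lin 1) b * GSAlg.tmul (φ.lin 1) 1) (fun i b hb => ?_) (fun x y hx hy => ?_) b
  · rw [GSAlg.tmul_mul_tmul _ _ hb (φ.map_mem B.one_mem),
      GSAlg.tmul_mul_tmul _ _ hb (φ.map_mem B.one_mem), ← φ.map_mul, one_mul, one_mul]
  · simp only [← GSAlg.tmulLin_apply, map_add, add_mul] at hx hy ⊢
    rw [hx, hy]

theorem imk_rightAct {i j : Deg} (a : A.carrier) {b b' : D.carrier} (hb : b ∈ D.gr i)
    (hb' : b' ∈ D.gr j) (y : Y.carrier) : imk (extHom φ D) Y (GSAlg.tmul a b ⊗ₜ Y.rightAct b' y) =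
      imk (extHom φ D) Y (GSAlg.tmul a (b * b') ⊗ₜ y) := by
  rw [rightAct_apply, ← imk_mul, ← imk_mul_one (extHom φ D) Y (GSAlg.tmul a (b * b')),
    GSAlg.tensor_one, GSAlg.Hom.tensor_tmul, GSAlg.Hom.tensor_tmul, GSAlg.Hom.id_lin,
    GSAlg.Hom.id_lin, GSAlg.tmul_mul_tmul _ _ hb (φ.map_mem B.one_mem),
    GSAlg.tmul_mul_tmul _ _ (D.mul_mem hb hb') (φ.map_mem B.one_mem), mul_one]
  simp

theorem comp_indUnit_mem_homPiece {d : Deg} {f : P.carrier →ₗ[F] Y.carrier}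
    (hf : f ∈ homPiece P Y.gr Y.rightAct d) : indUnit (extHom φ D) Y ∘ₗ f ∈
      homPiece P (Y.ind (extHom φ D)).gr (Y.ind (extHom φ D)).rightAct d :=
  ⟨fun j p hp => indUnit_mem _ Y (hf.1 j p hp), fun i b p hb => by
    rw [LinearMap.comp_apply, LinearMap.comp_apply, hf.2 i b p hb, map_zsmul, rightAct_indUnit]⟩

/-- Composition with the unit of induction. -/
noncomputable def homUnit : (hom P Y).carrier →ₗ[F] (hom P (Y.ind (extHom φ D))).carrier :=
  homLin (N' := Y.ind (extHom φ D)) (LinearMap.compRight F (indUnit (extHom φ D) Y))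
    (fun d _ hf => homPiece_le _ _ d (comp_indUnit_mem_homPiece φ P Y hf))

theorem homι_homUnit (f : (hom P Y).carrier) : homι P (Y.ind (extHom φ D)) (homUnit φ P Y f) =
    indUnit (extHom φ D) Y ∘ₗ homι P Y f := rfl

theorem homUnit_mem {d : Deg} {f : (hom P Y).carrier} (hf : f ∈ (hom P Y).gr d) :
    homUnit φ P Y f ∈ (hom P (Y.ind (extHom φ D))).gr d := comp_indUnit_mem_homPiece φ P Y hf

theorem homUnit_smul (b : B.carrier) (f : (hom P Y).carrier) :
    homUnit φ P Y (b • f) = φ.lin b • homUnit φ P Y f :=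
  homι_injective (LinearMap.ext fun p => by
    rw [homι_smul_apply, homι_homUnit, homι_homUnit, LinearMap.comp_apply, LinearMap.comp_apply,
      homι_smul_apply, indUnit_smul]
    rfl)

/-- The comparison `A φ(1) ⊗_B HOM_D(P, Y) → HOM_D(P, (A ⊗ D) ⊗_{B ⊗ D} Y)`. -/
noncomputable def indHomHom : (hom P Y).ind φ ⟶ hom P (Y.ind (extHom φ D)) :=
  indLift φ (X := hom P (Y.ind (extHom φ D))) (homUnit φ P Y)
    (fun _ _ hf => homUnit_mem φ P Y hf) (fun _ _ b f _ _ => homUnit_smul φ P Y b f)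

theorem homι_indHomHom_mk (a : A.carrier) (f : (hom P Y).carrier) (p : P.carrier) :
    homι P _ ((indHomHom φ P Y).lin (imk φ (hom P Y) (a ⊗ₜ f))) p =
      imk (extHom φ D) Y (GSAlg.tmul a 1 ⊗ₜ homι P Y f p) := by
  rw [imk_eq, imk_eq, map_smul, indHomHom, indLift_unit, homι_smul_apply]
  rfl

section

variable {P} (t : P.carrier →ₗ[D.carrier] D.carrier) (d : Deg)
  (ht : ∀ j p, p ∈ P.gr j → t p ∈ D.gr (j - d))

/-- The map `(a ⊗ b) ⊗ y ↦ a ⊗ (p ↦ ± t(p) b y)`. -/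
noncomputable def indFormHom : (Y.ind (extHom φ D)).carrier →ₗ[F] ((hom P Y).ind φ).carrier :=
  indLiftT φ (GSAlg.Hom.id D) (tensorLift (LinearMap.mk₂ F
      (fun a b => imk φ (hom P Y) ∘ₗ TensorProduct.mk F A.carrier (hom P Y).carrier a ∘ₗ
        formHom Y t d ht ∘ₗ Y.rightAct b)
      (fun a a' b => by ext; simp) (fun c a b => by ext; simp)
      (fun a b b' => by ext; simp [TensorProduct.tmul_add]) (fun c a b => by ext; simp)))
    (fun i j k l m a₁ a₂ b₁ b₂ y _ h₂ g₁ g₂ _ => by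
      simp only [tensorLift_tmul, LinearMap.mk₂_apply, LinearMap.comp_apply,
        TensorProduct.mk_apply, GSAlg.Hom.id_lin]
      rw [imk_mul, ← formHom_leftAct, ← map_zsmul, ← TensorProduct.tmul_smul, ← map_zsmul]
      congr 3
      rw [rightAct_mul, tmul_smul_eq, leftAct_rightAct Y g₁ h₂, smul_smul, ksign_comm, ksign_self,
        one_smul])

theorem indFormHom_mk (a : A.carrier) (b : D.carrier) (y : Y.carrier) :
    indFormHom φ Y t d ht (imk (extHom φ D) Y (GSAlg.tmul a b ⊗ₜ y)) =
      imk φ (hom P Y) (a ⊗ₜ formHom Y t d ht (Y.rightAct b y)) := rfl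

end

theorem indHomHom_bijective (hP : P.IsProjective) : Function.Bijective (indHomHom φ P Y).lin := by
  obtain ⟨ι, hι, d, x, t, hx, ht, h⟩ := hP.exists_homogeneous_dualBasis
  have h₁ : ∀ z, ∑ i, indFormHom φ Y (t i) (d i) (ht i)
      (homι P _ ((indHomHom φ P Y).lin z) (x i)) = z := by
    intro z
    refine ind_induction φ (p := fun z => ∑ i, indFormHom φ Y (t i) (d i) (ht i)
      (homι P _ ((indHomHom φ P Y).lin z) (x i)) = z) (fun i j a f _ _ => ?_)
      (fun z z' hz hz' => by
        simp only [map_add, LinearMap.add_apply, Finset.sum_add_distrib, hz, hz']) z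
    simp only [homι_indHomHom_mk, indFormHom_mk, rightAct_one]
    rw [← map_sum, ← TensorProduct.tmul_sum, sum_formHom Y hx ht h]
  have h₂ : ∀ i k (z : (Y.ind (extHom φ D)).carrier), z ∈ (Y.ind (extHom φ D)).gr k →
      (indHomHom φ P Y).lin (indFormHom φ Y (t i) (d i) (ht i) z) =
        formHom (Y.ind (extHom φ D)) (t i) (d i) (ht i) z := by
    intro i _ z _
    refine ind_tensor_induction φ (GSAlg.Hom.id D) (p := fun z => (indHomHom φ P Y).lin
      (indFormHom φ Y (t i) (d i) (ht i) z) = formHom (Y.ind (extHom φ D)) (t i) (d i) (ht i) z)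
      (fun j k l a b y ha hb hy => homι_injective (lin_ext_hom P.internal fun m p hp => ?_))
      (fun z z' hz hz' => by simp only [map_add, hz, hz']) z
    have hz := imk_mem (extHom φ D) Y (GSAlg.tmul_mem ha hb) hy
    rw [indFormHom_mk, homι_indHomHom_mk, homι_formHom, homι_formHom, formSmul_apply _ _ _ hz,
      formSmul_apply _ _ _ (rightAct_mem Y hb hy), ptwist_of_mem _ _ (ht i m p hp),
      ptwist_of_mem _ _ (ht i m p hp), map_zsmul, map_zsmul, LinearMap.smul_apply,
      LinearMap.smul_apply, ← rightAct_mul]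
    rw [TensorProduct.tmul_smul, map_zsmul, imk_rightAct φ Y a D.one_mem
      (D.mul_mem (ht i m p hp) hb), one_mul, rightAct_apply, smul_imk,
      GSAlg.tmul_mul_tmul _ _ (ht i m p hp) ha, one_mul, ← TensorProduct.smul_tmul', map_zsmul, smul_smul]
    congr 1
    rw [show j + k + l - d i = j + (k + l - d i) by abel, Prod.snd_add j, ksign_add_left, ksign_comm _ j.2,
      mul_right_comm, ksign_self, one_mul]
  refine ⟨fun z z' hz => by rw [← h₁ z, ← h₁ z', hz], surjective_of_pieces
    (hom P (Y.ind (extHom φ D))).internal (Hom.linF (indHomHom φ P Y)) fun e g hg => ?_⟩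
  refine ⟨∑ i, indFormHom φ Y (t i) (d i) (ht i) (homι P _ g (x i)), ?_⟩
  rw [map_sum]
  refine (Finset.sum_congr rfl fun i _ => h₂ i _ _ (hg.1 _ _ (hx i))).trans ?_
  exact sum_formHom (Y.ind (extHom φ D)) hx ht h g

theorem indHomHom_natural {Y' : GSMod (B.tensor D)} (g : Y ⟶ Y') :
    indMap φ (homMap P g) ≫ indHomHom φ P Y' = indHomHom φ P Y ≫ homMap P (indMap (extHom φ D) g) :=
  ind_hom_ext φ (N := hom P Y) fun _ f _ => by
    rw [comp_lin, comp_lin, indMap_lin_unit, indHomHom, indHomHom, indLift_unit, indLift_unit]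
    rfl

/-- Induction commutes with homomorphisms from a projective supermodule over the other factor. -/
noncomputable def indHom (hP : P.IsProjective) :
    homFunctor P B ⋙ indFunctor φ ≅ indFunctor (extHom φ D) ⋙ homFunctor P A :=
  natIsoOfBij' (G := homFunctor P B ⋙ indFunctor φ)
    (H := indFunctor (extHom φ D) ⋙ homFunctor P A) (indHomHom φ P)
    (fun Y => indHomHom_bijective φ P Y hP) (fun {Y _} g => indHomHom_natural φ P Y g)

end IndHom

end GSMod

end SuperTower

namespace SuperTower

variable {F : Type u} [Field F]

namespace GSMod

variable {A B C D : GSAlg F}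

/-- The homomorphism `b ↦ 1 ⊗ b`. -/
noncomputable def _root_.SuperTower.GSAlg.inclR (C B : GSAlg F) : GSAlg.Hom B (C.tensor B) where
  lin := GSAlg.tmulLin C B 1
  map_mul b b' := (GSAlg.one_mul_tmul C B 1 b b').symm
  map_mem hb := by
    have := GSAlg.tmul_mem C.one_mem hb
    rwa [zero_add] at this

section Slice

variable (Y : GSMod (C.tensor B)) (e : Deg)

/-- The supermodule over `B` for which a homomorphism of degree `e` to `Y` is a morphism. -/
noncomputable def slice : GSMod B := (Y.res (GSAlg.inclR C B)).shift (-e.1) e.2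

/-- The identity map from the slice of a supermodule. -/
noncomputable def unslice : (slice Y e).carrier →ₗ[F] Y.carrier :=
  resι (GSAlg.inclR C B) Y ∘ₗ (shiftEquiv (Y.res (GSAlg.inclR C B)) (-e.1) e.2).symm.toLinearMap

theorem unslice_bijective : Function.Bijective (unslice Y e) :=
  Function.Bijective.comp ⟨resι_injective (GSAlg.inclR C B) Y, fun y =>
    ⟨resMk (GSAlg.inclR C B) Y y (one_smul _ y), rfl⟩⟩
    (shiftEquiv (Y.res (GSAlg.inclR C B)) (-e.1) e.2).symm.bijective

theorem unslice_smul {i : Deg} {b : B.carrier} (hb : b ∈ B.gr i) (n : (slice Y e).carrier) :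
    unslice Y e (b • n) = ksign e.2 i.2 • Y.rightAct b (unslice Y e n) :=
  (congrArg (resι _ Y) (symm_shiftEquiv_smul_of_mem (Y.res (GSAlg.inclR C B)) (-e.1) e.2 hb n)).trans
    (map_zsmul (resι (GSAlg.inclR C B) Y) _ _)

theorem unslice_mem {j : Deg} {n : (slice Y e).carrier} :
    unslice Y e n ∈ Y.gr (e + j) ↔ n ∈ (slice Y e).gr j := by
  have h : (unslice Y e n ∈ Y.gr (j - (-e.1, e.2))) ↔ n ∈ (slice Y e).gr j := Iff.rfl
  rw [← h, deg_sub_shift, add_comm]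

/-- The identity map from a supermodule to its slice. -/
noncomputable def sliceEquiv : Y.carrier ≃ₗ[F] (slice Y e).carrier :=
  (LinearEquiv.ofBijective (unslice Y e) (unslice_bijective Y e)).symm

theorem unslice_sliceEquiv (y : Y.carrier) : unslice Y e (sliceEquiv Y e y) = y :=
  LinearEquiv.apply_symm_apply (LinearEquiv.ofBijective (unslice Y e) (unslice_bijective Y e)) y

theorem sliceEquiv_mem {j : Deg} {y : Y.carrier} :
    sliceEquiv Y e y ∈ (slice Y e).gr j ↔ y ∈ Y.gr (e + j) := by
  rw [← unslice_mem, unslice_sliceEquiv]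

theorem smul_sliceEquiv {i : Deg} {b : B.carrier} (hb : b ∈ B.gr i) (y : Y.carrier) :
    b • sliceEquiv Y e y = ksign e.2 i.2 • sliceEquiv Y e (Y.rightAct b y) :=
  (unslice_bijective Y e).1 (by
    rw [unslice_smul Y e hb, unslice_sliceEquiv, map_zsmul, unslice_sliceEquiv])

theorem sliceEquiv_rightAct {i : Deg} {b : B.carrier} (hb : b ∈ B.gr i) (y : Y.carrier) :
    sliceEquiv Y e (Y.rightAct b y) = ksign e.2 i.2 • b • sliceEquiv Y e y := by
  rw [smul_sliceEquiv Y e hb, ksign_smul_ksign_smul]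

variable {Y e}

/-- The morphism to a slice given by a homomorphism of degree `e`. -/
noncomputable def toSlice {X : GSMod B} (f : X.carrier →ₗ[F] Y.carrier)
    (hf : f ∈ homPiece X Y.gr Y.rightAct e) : X ⟶ slice Y e :=
  homOfF ((sliceEquiv Y e).toLinearMap ∘ₗ f)
    (fun d _ hm => (sliceEquiv_mem Y e).2 (hf.1 d _ hm)) (fun i _ b m hb _ => by
      rw [LinearMap.comp_apply, LinearMap.comp_apply, hf.2 i b m hb, LinearEquiv.coe_coe, map_zsmul,
        sliceEquiv_rightAct Y e hb, ksign_smul_ksign_smul])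

theorem toSlice_lin {X : GSMod B} (f : X.carrier →ₗ[F] Y.carrier)
    (hf : f ∈ homPiece X Y.gr Y.rightAct e) (x : X.carrier) :
    (toSlice f hf).lin x = sliceEquiv Y e (f x) := rfl

/-- The homomorphism of degree `e` given by a morphism to a slice. -/
noncomputable def ofSlice {X : GSMod B} (g : X ⟶ slice Y e) : X.carrier →ₗ[F] Y.carrier :=
  (sliceEquiv Y e).symm.toLinearMap ∘ₗ Hom.linF g

theorem sliceEquiv_ofSlice {X : GSMod B} (g : X ⟶ slice Y e) (x : X.carrier) :
    sliceEquiv Y e (ofSlice g x) = g.lin x := LinearEquiv.apply_symm_apply _ _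

theorem ofSlice_mem {X : GSMod B} (g : X ⟶ slice Y e) :
    ofSlice g ∈ homPiece X Y.gr Y.rightAct e := by
  refine ⟨fun j m hm => ?_, fun i b m hb => (sliceEquiv Y e).injective ?_⟩
  · rw [← sliceEquiv_mem, sliceEquiv_ofSlice]
    exact g.map_mem hm
  · rw [sliceEquiv_ofSlice, map_smul, map_zsmul, sliceEquiv_rightAct Y e hb, sliceEquiv_ofSlice,
      ksign_smul_ksign_smul]

end Slice

section IndSlice

variable (C) (ψ : GSAlg.Hom B A)

/-- The extension of `ψ : B → A` to `C ⊗ B → C ⊗ A`. -/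
noncomputable abbrev extHomR : GSAlg.Hom (C.tensor B) (C.tensor A) := (GSAlg.Hom.id C).tensor ψ

variable {C} (Y : GSMod (C.tensor B)) (e : Deg)

theorem indUnit_rightAct (b : B.carrier) (y : Y.carrier) :
    indUnit (extHomR C ψ) Y (Y.rightAct b y) =
      (Y.ind (extHomR C ψ)).rightAct (ψ.lin b) (indUnit (extHomR C ψ) Y y) :=
  indUnit_smul (extHomR C ψ) Y _ y

/-- The comparison of the induction of a slice with the slice of an induction. -/
noncomputable def sliceInd : (slice Y e).ind ψ ⟶ slice (Y.ind (extHomR C ψ)) e :=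
  indLift ψ ((sliceEquiv (Y.ind (extHomR C ψ)) e).toLinearMap ∘ₗ indUnit (extHomR C ψ) Y ∘ₗ
      (sliceEquiv Y e).symm.toLinearMap)
    (fun d n hn => by
      obtain ⟨y, rfl⟩ := (sliceEquiv Y e).surjective n
      rw [sliceEquiv_mem] at hn
      rw [LinearMap.comp_apply, LinearMap.comp_apply, LinearEquiv.coe_coe, LinearEquiv.coe_coe,
        LinearEquiv.symm_apply_apply, sliceEquiv_mem]
      exact indUnit_mem _ Y hn)
    (fun i _ b n hb _ => by
      obtain ⟨y, rfl⟩ := (sliceEquiv Y e).surjective n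
      simp only [LinearMap.comp_apply, LinearEquiv.coe_coe, smul_sliceEquiv Y e hb, map_zsmul,
        LinearEquiv.symm_apply_apply, indUnit_rightAct]
      rw [smul_sliceEquiv _ e (ψ.map_mem hb)])

theorem sliceInd_mk {i : Deg} {a : A.carrier} (ha : a ∈ A.gr i) (y : Y.carrier) :
    (sliceInd ψ Y e).lin (imk ψ (slice Y e) (a ⊗ₜ sliceEquiv Y e y)) = ksign e.2 i.2 •
      sliceEquiv (Y.ind (extHomR C ψ)) e (imk (extHomR C ψ) Y (GSAlg.tmul 1 a ⊗ₜ y)) := by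
  rw [imk_eq, map_smul, sliceInd, indLift_unit, LinearMap.comp_apply, LinearMap.comp_apply,
    LinearEquiv.coe_coe, LinearEquiv.coe_coe, LinearEquiv.symm_apply_apply,
    smul_sliceEquiv _ e ha, imk_eq, rightAct_apply]

/-- The inverse of `sliceInd`. -/
noncomputable def sliceIndInv : (Y.ind (extHomR C ψ)).carrier →ₗ[F] ((slice Y e).ind ψ).carrier :=
  indLiftT (GSAlg.Hom.id C) ψ (tensorLift (signed C.internal A.internal (LinearMap.mk₂ F
      (fun c a => imk ψ (slice Y e) ∘ₗ
        TensorProduct.mk F A.carrier (slice Y e).carrier (ptwist A.internal e.2 a) ∘ₗ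
        (sliceEquiv Y e).toLinearMap ∘ₗ Y.leftAct c)
      (fun c c' a => by ext; simp [TensorProduct.tmul_add]) (fun r c a => by ext; simp)
      (fun c a a' => by ext; simp) (fun r c a => by ext; simp))))
    (fun i j k l m c₁ a₁ c₂ b₂ y h₁ h₂ g₁ g₂ hy => by
      rw [tensorLift_tmul, tensorLift_tmul, GSAlg.Hom.id_lin,
        signed_apply _ _ _ (C.mul_mem h₁ g₁) (A.mul_mem h₂ (ψ.map_mem g₂)),
        signed_apply _ _ _ h₁ h₂]
      simp only [LinearMap.smul_apply, LinearMap.mk₂_apply, LinearMap.comp_apply,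
        TensorProduct.mk_apply, LinearEquiv.coe_coe]
      rw [ptwist_of_mem _ _ (A.mul_mem h₂ (ψ.map_mem g₂)), ptwist_of_mem _ _ h₂,
        ← TensorProduct.smul_tmul', ← TensorProduct.smul_tmul', map_zsmul, map_zsmul, imk_mul,
        smul_sliceEquiv Y e g₂, tmul_smul_eq, ← leftAct_mul,
        leftAct_rightAct Y (C.mul_mem h₁ g₁) g₂]
      simp only [map_zsmul, TensorProduct.tmul_smul, smul_smul]
      congr 1
      simp only [Prod.snd_add]
      generalize i.2 = i, j.2 = j, k.2 = k, l.2 = l, e.2 = e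
      revert i j k l e
      decide)

theorem sliceIndInv_mk {i j : Deg} {c : C.carrier} {a : A.carrier} (hc : c ∈ C.gr i)
    (ha : a ∈ A.gr j) (y : Y.carrier) :
    sliceIndInv ψ Y e (imk (extHomR C ψ) Y (GSAlg.tmul c a ⊗ₜ y)) = (ksign i.2 j.2 * ksign e.2 j.2) •
      imk ψ (slice Y e) (a ⊗ₜ sliceEquiv Y e (Y.leftAct c y)) := by
  rw [sliceIndInv, indLiftT_mk, tensorLift_tmul, signed_apply _ _ _ hc ha]
  simp only [LinearMap.smul_apply, LinearMap.mk₂_apply, LinearMap.comp_apply,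
    TensorProduct.mk_apply, LinearEquiv.coe_coe]
  rw [ptwist_of_mem _ _ ha, ← TensorProduct.smul_tmul', map_zsmul, smul_smul]

theorem imk_leftAct {i j : Deg} {c : C.carrier} {a : A.carrier} (hc : c ∈ C.gr i)
    (ha : a ∈ A.gr j) (y : Y.carrier) :
    ksign i.2 j.2 • imk (extHomR C ψ) Y (GSAlg.tmul 1 a ⊗ₜ Y.leftAct c y) =
      imk (extHomR C ψ) Y (GSAlg.tmul c a ⊗ₜ y) := by
  rw [leftAct_apply, ← imk_mul, ← imk_mul_one (extHomR C ψ) Y (GSAlg.tmul c a),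
    GSAlg.tensor_one, GSAlg.Hom.tensor_tmul, GSAlg.Hom.tensor_tmul, GSAlg.Hom.id_lin,
    GSAlg.Hom.id_lin, GSAlg.tmul_mul_tmul _ _ ha hc, GSAlg.tmul_mul_tmul _ _ ha C.one_mem, one_mul,
    mul_one, ← TensorProduct.smul_tmul', map_zsmul, smul_smul, ksign_comm, ksign_self]
  simp

theorem sliceInd_unit (y : Y.carrier) : (sliceInd ψ Y e).lin (indUnit ψ _ (sliceEquiv Y e y)) =
    sliceEquiv _ e (indUnit (extHomR C ψ) Y y) := by
  rw [sliceInd, indLift_unit, LinearMap.comp_apply, LinearMap.comp_apply, LinearEquiv.coe_coe,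
    LinearEquiv.coe_coe, LinearEquiv.symm_apply_apply]

theorem sliceInd_bijective : Function.Bijective (sliceInd ψ Y e).lin := by
  refine bij_of_inverse (fun x => sliceIndInv ψ Y e ((sliceEquiv _ e).symm x)) (fun x => ?_)
    (fun x => ?_)
  · refine ind_induction ψ (p := fun x => sliceIndInv ψ Y e ((sliceEquiv _ e).symm
      ((sliceInd ψ Y e).lin x)) = x) (fun i j a n ha hn => ?_)
      (fun x y hx hy => by simp only [map_add, hx, hy]) x
    obtain ⟨y, rfl⟩ := (sliceEquiv Y e).surjective n
    rw [sliceInd_mk ψ Y e ha, map_zsmul, LinearEquiv.symm_apply_apply, map_zsmul,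
      sliceIndInv_mk ψ Y e C.one_mem ha, leftAct_one, smul_smul]
    simp [ksign_self]
  · obtain ⟨x, rfl⟩ := (sliceEquiv _ e).surjective x
    simp only [LinearEquiv.symm_apply_apply]
    refine ind_tensor_induction (GSAlg.Hom.id C) ψ (p := fun x => (sliceInd ψ Y e).lin
      (sliceIndInv ψ Y e x) = sliceEquiv _ e x) (fun i j k c a y hc ha hy => ?_)
      (fun x y hx hy => by simp only [map_add, hx, hy]) x
    rw [sliceIndInv_mk ψ Y e hc ha, map_zsmul, sliceInd_mk ψ Y e ha, smul_smul, mul_assoc,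
      ksign_self, mul_one, ← map_zsmul]
    congr 1
    exact imk_leftAct ψ Y hc ha y

end IndSlice

section Adjoint

variable (ψ : GSAlg.Hom B A)

/-- The unit of induction as a morphism. -/
noncomputable def resUnit (N : GSMod B) : N ⟶ (N.ind ψ).res ψ :=
  resLift ψ (indUnit ψ N) (fun _ _ hn => indUnit_mem ψ N hn)
    (fun _ _ b n _ _ => indUnit_smul ψ N b n) (fun _ n _ => one_smul_indUnit ψ N n)

variable {L : GSMod A ⥤ GSMod B} (adj : L ⊣ indFunctor ψ) (P : GSMod A)

/-- The unit of an adjunction with induction. -/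
noncomputable def adjUnit : P ⟶ (L.obj P).ind ψ := adj.unit.app P

theorem adj_bijective (X : GSMod B) :
    Function.Bijective fun g : L.obj P ⟶ X => adjUnit ψ adj P ≫ indMap ψ g := by
  have : (fun g : L.obj P ⟶ X => adjUnit ψ adj P ≫ indMap ψ g) = adj.homEquiv P X :=
    funext fun g => (adj.homEquiv_unit P X g).symm
  rw [this]
  exact (adj.homEquiv P X).bijective

variable (Y : GSMod (C.tensor B))

/-- The comparison `HOM_B(L P, Y) → HOM_A(P, ind Y)` for a left adjoint `L` of induction. -/
noncomputable def adjHomHom : hom (L.obj P) Y ⟶ hom P (Y.ind (extHomR C ψ)) :=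
  homMap (L.obj P) (resUnit (extHomR C ψ) Y) ≫
    (isoOfBij (homIndHom ψ (L.obj P) (Y.ind (extHomR C ψ))) (homIndHom_bijective _ _ _)).inv ≫
    homPre (adjUnit ψ adj P) (Y.ind (extHomR C ψ))

theorem isoOfBij_inv_lin {M N : GSMod B} (f : M ⟶ N) (hf : Function.Bijective f.lin) {m : M.carrier}
    {n : N.carrier} (h : f.lin m = n) : (isoOfBij f hf).inv.lin n = m := by
  rw [← h]
  exact congrArg (fun g : M ⟶ M => g.lin m) (isoOfBij f hf).hom_inv_id

/-- The comparison map in terms of morphisms to slices. -/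
theorem adjHomHom_lin {e : Deg} {f : (hom (L.obj P) Y).carrier} (hf : f ∈ (hom (L.obj P) Y).gr e)
    (p : P.carrier) : sliceEquiv _ e (homι P _ ((adjHomHom ψ adj P Y).lin f) p) =
      (sliceInd ψ Y e).lin ((adjUnit ψ adj P ≫ indMap ψ (toSlice _ (homι_mem.2 hf))).lin p) := by
  have h : (isoOfBij (homIndHom ψ (L.obj P) (Y.ind (extHomR C ψ)))
      (homIndHom_bijective _ _ _)).inv.lin ((homMap (L.obj P) (resUnit (extHomR C ψ) Y)).lin f) =
      homMk _ (ofSlice_mem (indMap ψ (toSlice _ (homι_mem.2 hf)) ≫ sliceInd ψ Y e)) := by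
    refine isoOfBij_inv_lin _ _ (homι_injective (LinearMap.ext fun x => resι_injective _ _ ?_))
    refine (resι_homIndHom ψ (L.obj P) (Y.ind (extHomR C ψ)) _ x).trans ?_
    rw [homι_homMk]
    refine (sliceEquiv _ e).injective ((sliceEquiv_ofSlice _ _).trans ?_)
    rw [comp_lin, indMap_lin_unit, toSlice_lin, sliceInd_unit]
    rfl
  rw [adjHomHom, comp_lin, comp_lin, h]
  exact sliceEquiv_ofSlice (indMap ψ (toSlice _ (homι_mem.2 hf)) ≫ sliceInd ψ Y e) _

theorem lin_isoOfBij_inv {M N : GSMod B} (f : M ⟶ N) (hf : Function.Bijective f.lin)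
    (n : N.carrier) : f.lin ((isoOfBij f hf).inv.lin n) = n :=
  congrArg (fun g : N ⟶ N => g.lin n) (isoOfBij f hf).inv_hom_id

theorem adjHomHom_bijective : Function.Bijective (adjHomHom ψ adj P Y).lin := by
  refine hom_bijective_of_pieces (Hom.linF (adjHomHom ψ adj P Y)) (fun _ _ h => Hom.map_mem _ h)
    (fun e f hf h0 => ?_) (fun e g hg => ?_)
  · have hz : (0 : (hom (L.obj P) Y).carrier) ∈ (hom (L.obj P) Y).gr e := zero_mem _
    have h : toSlice _ (homι_mem.2 hf) = toSlice _ (homι_mem.2 hz) := by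
      refine (adj_bijective ψ adj P (slice Y e)).1 (hom_ext fun p =>
        (sliceInd_bijective ψ Y e).1 ?_)
      refine ((adjHomHom_lin ψ adj P Y hf p).symm.trans ?_).trans (adjHomHom_lin ψ adj P Y hz p)
      rw [show (adjHomHom ψ adj P Y).lin f = 0 from h0, map_zero, map_zero, map_zero]
    refine homι_injective (LinearMap.ext fun x => (sliceEquiv Y e).injective ?_)
    exact congrArg (fun k : L.obj P ⟶ slice Y e => k.lin x) h
  · obtain ⟨f, hf⟩ := (adj_bijective ψ adj P (slice Y e)).2 (toSlice _ (homι_mem.2 hg) ≫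
      (isoOfBij (sliceInd ψ Y e) (sliceInd_bijective ψ Y e)).inv)
    refine ⟨homMk _ (ofSlice_mem f), homι_injective (LinearMap.ext fun p =>
      (sliceEquiv _ e).injective ?_)⟩
    have hm := homMk_mem _ (ofSlice_mem f)
    have h : toSlice _ (homι_mem.2 hm) = f := hom_ext fun x => sliceEquiv_ofSlice f x
    refine (adjHomHom_lin ψ adj P Y hm p).trans ?_
    rw [h, show adjUnit ψ adj P ≫ indMap ψ f = _ from hf, comp_lin, lin_isoOfBij_inv, toSlice_lin]

theorem adjHomHom_natural {Y' : GSMod (C.tensor B)} (g : Y ⟶ Y') :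
    homMap (L.obj P) g ≫ adjHomHom ψ adj P Y' =
      adjHomHom ψ adj P Y ≫ homMap P (indMap (extHomR C ψ) g) := by
  have h := (homInd ψ (L.obj P) C).inv.naturality (indMap (extHomR C ψ) g)
  exact (congrArg (fun k => homMap (L.obj P) (resUnit (extHomR C ψ) Y) ≫ k ≫
    homPre (adjUnit ψ adj P) (Y'.ind (extHomR C ψ))) h)

/-- Homomorphisms from a left adjoint of induction. -/
noncomputable def adjHom (C : GSAlg F) :
    homFunctor (L.obj P) C ≅ indFunctor (extHomR C ψ) ⋙ homFunctor P C :=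
  natIsoOfBij' (G := homFunctor (L.obj P) C) (H := indFunctor (extHomR C ψ) ⋙ homFunctor P C)
    (adjHomHom ψ adj P) (adjHomHom_bijective ψ adj P) (fun {Y _} g => adjHomHom_natural ψ adj P Y g)

end Adjoint

end GSMod

end SuperTower

namespace SuperTower

variable {F : Type u} [Field F]

namespace GSMod

variable {A B C D : GSAlg F}

/-- Precomposition of a finite sum of functors. -/
noncomputable def compPi {ι : Type} [Finite ι] {𝒞 : Type*} [Category* 𝒞] {𝒟 : Type v}
    [Category.{w} 𝒟] (H : 𝒟 ⥤ 𝒞) (G : ι → 𝒞 ⥤ GSMod B) :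
    H ⋙ piFunctor G ≅ piFunctor fun i => H ⋙ G i :=
  Iso.refl _

/-- Shifts by equal degrees agree. -/
noncomputable def shiftCongr {n n' : ℤ} {σ σ' : ZMod 2} (h : n = n') (h' : σ = σ') :
    shiftFunctor B n σ ≅ shiftFunctor B n' σ' :=
  eqToIso (by rw [h, h'])

end GSMod

section Rearrangement

variable {C₁ C₂ C₃ C₄ C₅ C₆ C₇ C₈ : Type*} [Category* C₁] [Category* C₂] [Category* C₃]
  [Category* C₄] [Category* C₅] [Category* C₆] [Category* C₇] [Category* C₈]

/-- A rearrangement of a composition of functors. -/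
def compSwapInd {I : C₁ ⥤ C₃} {I₂ : C₁ ⥤ C₂} {I₁ : C₂ ⥤ C₃} {H : C₃ ⥤ C₄} {H₁ : C₂ ⥤ C₅}
    {I₃ : C₅ ⥤ C₄} {H₂ : C₁ ⥤ C₅} (e : I ≅ I₂ ⋙ I₁) (b : I₁ ⋙ H ≅ H₁ ⋙ I₃)
    (a : I₂ ⋙ H₁ ≅ H₂) : I ⋙ H ≅ H₂ ⋙ I₃ :=
  Functor.isoWhiskerRight e H ≪≫ Functor.isoWhiskerLeft I₂ b ≪≫ Functor.isoWhiskerRight a I₃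

/-- A rearrangement of a composition of functors. -/
def compSwapShift {S : C₁ ⥤ C₁} {H H' : C₁ ⥤ C₂} {S₀ S₁ S₂ : C₂ ⥤ C₂} (j : H ≅ H' ⋙ S₀)
    (s : S ⋙ H' ≅ H' ⋙ S₁) (c : S₁ ⋙ S₀ ≅ S₂) : S ⋙ H ≅ H' ⋙ S₂ :=
  Functor.isoWhiskerLeft S j ≪≫ Functor.isoWhiskerRight s S₀ ≪≫ Functor.isoWhiskerLeft H' c

/-- A rearrangement of a composition of functors. -/
def compSwapCross {O : C₁ ⥤ C₂} {R : C₂ ⥤ C₃} {R' : C₁ ⥤ C₄} {O' : C₄ ⥤ C₃} {S : C₃ ⥤ C₃}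
    {W : C₃ ⥤ C₅} {S₁ : C₅ ⥤ C₅} {I : C₅ ⥤ C₆} {H : C₆ ⥤ C₇} {H₁ H₂ : C₅ ⥤ C₈} {I₁ : C₈ ⥤ C₇}
    {S₂ : C₈ ⥤ C₈} (o : O ⋙ R ≅ R' ⋙ O') (s : S ⋙ W ≅ W ⋙ S₁) (i : I ⋙ H ≅ H₁ ⋙ I₁)
    (h : S₁ ⋙ H₁ ≅ H₂ ⋙ S₂) :
    O ⋙ (R ⋙ S ⋙ W ⋙ I) ⋙ H ≅ R' ⋙ O' ⋙ W ⋙ H₂ ⋙ S₂ ⋙ I₁ :=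
  Functor.isoWhiskerRight o (S ⋙ W ⋙ I ⋙ H) ≪≫ Functor.isoWhiskerLeft (R' ⋙ O')
    (Functor.isoWhiskerLeft (S ⋙ W) i ≪≫ Functor.isoWhiskerRight s (H₁ ⋙ I₁) ≪≫
      Functor.isoWhiskerLeft W (Functor.isoWhiskerRight h I₁))

/-- A rearrangement of a composition of functors. -/
def compSwapRes {S : C₁ ⥤ C₁} {R₁ : C₁ ⥤ C₂} {S₁ : C₂ ⥤ C₂} {R₂ : C₂ ⥤ C₃} {S₂ S₃ S₄ : C₃ ⥤ C₃}
    {R₃ : C₃ ⥤ C₄} {S₅ : C₄ ⥤ C₄} (a : S ⋙ R₁ ≅ R₁ ⋙ S₁) (b : S₁ ⋙ R₂ ≅ R₂ ⋙ S₂)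
    (c : S₂ ⋙ S₃ ≅ S₄) (d : S₄ ⋙ R₃ ≅ R₃ ⋙ S₅) :
    S ⋙ R₁ ⋙ R₂ ⋙ S₃ ⋙ R₃ ≅ (R₁ ⋙ R₂ ⋙ R₃) ⋙ S₅ :=
  Functor.isoWhiskerRight a (R₂ ⋙ S₃ ⋙ R₃) ≪≫ Functor.isoWhiskerLeft R₁
    (Functor.isoWhiskerRight b (S₃ ⋙ R₃) ≪≫ Functor.isoWhiskerLeft R₂
      (Functor.isoWhiskerRight c R₃ ≪≫ d))

/-- A rearrangement of a composition of functors. -/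
def compSwapOuter {O : C₁ ⥤ C₂} {I : C₂ ⥤ C₃} {R : C₃ ⥤ C₄} {H : C₄ ⥤ C₅} {M : C₂ ⥤ C₄}
    {M' : C₂ ⥤ C₅} (e : I ⋙ R ≅ M) (f : M ⋙ H ≅ M') : (O ⋙ I) ⋙ R ⋙ H ≅ O ⋙ M' :=
  Functor.isoWhiskerLeft O (Functor.isoWhiskerRight e H ≪≫ f)

end Rearrangement

namespace GSMod

variable {A₁ A₂ B₁ B₂ X Y Z W : GSAlg F}

/-- Homomorphisms from a left adjoint of induction that is a shift of the restriction. -/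
noncomputable def homOfShift {C B : GSAlg F} {P R : GSMod B} {n : ℤ} {σ : ZMod 2}
    (e : R.shift (-n) σ ≅ P) : homFunctor P C ≅ homFunctor R C ⋙ shiftFunctor C n σ :=
  homFunctorIso e C ≪≫ shiftHom R C (-n) σ ≪≫
    Functor.isoWhiskerLeft (homFunctor R C) (shiftCongr (neg_neg n) rfl)

/-- Induction along a tensor product of homomorphisms, one factor at a time. -/
noncomputable def indTensor (φ : GSAlg.Hom X Z) (ψ : GSAlg.Hom Y W) :
    indFunctor (φ.tensor ψ) ≅ indFunctor (extHomR X ψ) ⋙ indFunctor (extHom φ W) :=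
  eqToIso (congrArg indFunctor (GSAlg.Hom.ext_tmul fun _ _ => rfl :
    φ.tensor ψ = (extHom φ W).comp (extHomR X ψ))) ≪≫ indComp (extHom φ W) (extHomR X ψ)

/-- The summand of the composite of a restriction functor and an induction functor. -/
noncomputable def crossSummand
    (ρl₁ : GSAlg.Hom (A₁.tensor A₂) X) (ρl₂ : GSAlg.Hom (B₁.tensor B₂) Y)
    (ρm₁ : GSAlg.Hom (A₁.tensor B₁) Z) (ρm₂ : GSAlg.Hom (A₂.tensor B₂) W)
    {L : GSMod W ⥤ GSMod (A₂.tensor B₂)} (adj : L ⊣ indFunctor ρm₂)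
    (M : GSMod X) {P : GSMod W} (hP : P.IsProjective) {n n' m : ℤ} {σ σ' τ : ZMod 2}
    (e : (P.res ρm₂).shift (-n) σ ≅ L.obj P) (h : n' + n = m) (h' : σ' + σ = τ) :
    outerFunctor M Y ⋙ (resFunctor (ρl₁.tensor ρl₂) ⋙ shiftFunctor _ n' σ' ⋙
        swapFunctor A₁ A₂ B₁ B₂ ⋙ indFunctor (ρm₁.tensor ρm₂)) ⋙ homFunctor P Z ≅
      resFunctor ρl₂ ⋙ outerFunctor (M.res ρl₁) (B₁.tensor B₂) ⋙ swapFunctor A₁ A₂ B₁ B₂ ⋙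
        homFunctor (P.res ρm₂) (A₁.tensor B₁) ⋙ shiftFunctor _ m τ ⋙ indFunctor ρm₁ :=
  compSwapCross (outerRes ρl₁ ρl₂ M).symm (resShift (GSAlg.swap23 A₁ A₂ B₁ B₂) n' σ')
    (compSwapInd (indTensor ρm₁ ρm₂) (indHom ρm₁ P hP).symm
      (adjHom ρm₂ adj P (A₁.tensor B₁)).symm)
    (compSwapShift (homOfShift e) (homShift (P.res ρm₂) _ n' σ').symm
      (shiftShift _ n' n σ' σ ≪≫ shiftCongr h h'))

end GSMod

namespace Tower.Strong

variable {Λ : Type} [AddCommMonoid Λ] [Finset.HasAntidiagonal Λ] {T : Tower F Λ} (S : T.Strong)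

/-- The left adjoint of induction in terms of the conjugate restriction. -/
noncomputable def leftAdjointIso {l m n : Λ} (h : l + m = n) :
    GSMod.shiftFunctor (T.A n) (-S.δ n) (-S.σ n) ⋙ GSMod.resFunctor (S.ψ n).inv ⋙
      GSMod.resFunctor (T.ρ h) ⋙ GSMod.shiftFunctor _ (S.δ l + S.δ m) (S.σ l + S.σ m) ⋙
      GSMod.resFunctor ((S.ψ l).hom.tensor (S.ψ m).hom) ≅
    (GSMod.resFunctor (S.ψ n).inv ⋙ GSMod.resFunctor (T.ρ h) ⋙
      GSMod.resFunctor ((S.ψ l).hom.tensor (S.ψ m).hom)) ⋙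
      GSMod.shiftFunctor _ (-(S.d * S.κ l m)) (S.ε * (S.κ l m : ZMod 2)) :=
  compSwapRes (GSMod.resShift (S.ψ n).inv _ _) (GSMod.resShift (T.ρ h) _ _)
    (GSMod.shiftShift _ _ _ _ _ ≪≫ GSMod.shiftCongr
      (by subst h; linarith [S.δ_add l m])
      (by
        subst h
        have h := S.σ_add l m
        rw [← deg_neg (S.ε * _), ← h]
        ring))
    (GSMod.resShift _ _ _)

theorem nonempty_ind_comp_res {l₁ l₂ m₁ m₂ n : Λ} (hl : l₁ + l₂ = n) (hm : m₁ + m₂ = n)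
    (M : GSMod (T.A l₁)) (P : GSMod (T.A m₂)) (hP : P.IsProjective)
    (hconj : ∀ {l m : Λ} (h : l + m = m₂), Nonempty ((S.conjRes h).obj P ≅ P.res (T.ρ h))) :
    Nonempty (T.Ind hl M ⋙ T.Res hm P ≅ S.cross M P) := by
  obtain ⟨e⟩ := S.mackey hl hm
  refine ⟨compSwapOuter e (GSMod.homPi P _) ≪≫ GSMod.compPi _ _ ≪≫ GSMod.piIso fun s =>
    GSMod.crossSummand (T.ρ s.hl₁) (T.ρ s.hl₂) (T.ρ s.hm₁) (T.ρ s.hm₂) (S.adj s.hm₂).some M hP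
      ((GSMod.shiftFunctor _ _ _).mapIso (hconj s.hm₂).some.symm ≪≫
        (S.leftAdjointIso s.hm₂).symm.app P) (by ring) (by ring)⟩

end Tower.Strong

end SuperTower

namespace SuperTower

variable {F : Type u} [Field F]

namespace GSMod

variable {A B C A' B' : GSAlg F}

section Coefficients

/-- A functor whose values decompose naturally into finitely many copies of the argument is
exact. -/
theorem isExact_of_coefficients {Φ : GSMod A ⥤ GSMod B} {ι : Type*} [Fintype ι]
    (a : ι → ∀ X : GSMod A, X.carrier →ₗ[F] (Φ.obj X).carrier)
    (t : ι → ∀ X : GSMod A, (Φ.obj X).carrier →ₗ[F] X.carrier)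
    (ha : ∀ i {X Y : GSMod A} (f : X ⟶ Y) x, (Φ.map f).lin (a i X x) = a i Y (f.lin x))
    (ht : ∀ i {X Y : GSMod A} (f : X ⟶ Y) x, t i Y ((Φ.map f).lin x) = f.lin (t i X x))
    (h : ∀ X x, ∑ i, a i X (t i X x) = x) : IsExact Φ := by
  rintro X Y Z f g ⟨hi, he, hs⟩
  refine ⟨(injective_iff_map_eq_zero _).2 fun x hx => ?_, fun y => ⟨fun hy => ?_, ?_⟩, fun z => ?_⟩
  · rw [← h X x]
    refine Finset.sum_eq_zero fun i _ => ?_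
    have : f.lin (t i X x) = f.lin 0 := by rw [← ht, hx, map_zero, map_zero]
    rw [hi this, map_zero]
  · have : ∀ i, ∃ x, f.lin x = t i Y y := fun i => (he _).1 (by rw [← ht, hy, map_zero])
    choose x hx using this
    refine ⟨∑ i, a i X (x i), ?_⟩
    rw [map_sum]
    conv_rhs => rw [← h Y y]
    exact Finset.sum_congr rfl fun i _ => by rw [ha, hx]
  · rintro ⟨x, rfl⟩
    rw [← h X x, map_sum, map_sum]
    exact Finset.sum_eq_zero fun i _ => by rw [ha, ha, he.apply_apply_eq_zero, map_zero]
  · have : ∀ i, ∃ y, g.lin y = t i Z z := fun i => hs _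
    choose y hy using this
    refine ⟨∑ i, a i Y (y i), ?_⟩
    rw [map_sum]
    conv_rhs => rw [← h Z z]
    exact Finset.sum_congr rfl fun i _ => by rw [ha, hy]

theorem projective_of_dualBasis {R P ι : Type*} [Ring R] [AddCommGroup P] [Module R P] [Fintype ι]
    (x : ι → P) (t : ι → (P →ₗ[R] R)) (h : ∀ p, ∑ i, t i p • x i = p) : Module.Projective R P :=
  projective_of_sum (M := fun _ => R) (fun _ => inferInstance) t
    (fun i => LinearMap.toSpanSingleton R P (x i)) h

end Coefficients

section Outer

variable (M : GSMod A) (N : GSMod B)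

/-- Contraction of the left factor of an outer tensor product with a linear form. -/
noncomputable def outerContract (φ : M.carrier →ₗ[F] F) : (M.outer N).carrier →ₗ[F] N.carrier :=
  outerLiftF (LinearMap.lsmul F N.carrier ∘ₗ φ)

theorem outerContract_otm (φ : M.carrier →ₗ[F] F) (m : M.carrier) (n : N.carrier) :
    outerContract M N φ (otm M N m n) = φ m • n := rfl

/-- Contraction of the right factor of an outer tensor product with a linear form. -/
noncomputable def outerContractRight (φ : N.carrier →ₗ[F] F) :
    (M.outer N).carrier →ₗ[F] M.carrier :=
  outerLiftF (LinearMap.lsmul F M.carrier ∘ₗ φ).flip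

theorem outerContractRight_otm (φ : N.carrier →ₗ[F] F) (m : M.carrier) (n : N.carrier) :
    outerContractRight M N φ (otm M N m n) = φ n • m := rfl

variable {M N} in
theorem outerContract_map {M' : GSMod A} {N' : GSMod B} (φ : M'.carrier →ₗ[F] F) (f : M ⟶ M')
    (g : N ⟶ N') (x : (M.outer N).carrier) : outerContract M' N' φ ((outerMap f g).lin x) =
      g.lin (outerContract M N (φ ∘ₗ Hom.linF f) x) := by
  refine outer_induction (p := fun x => outerContract M' N' φ ((outerMap f g).lin x) =
    g.lin (outerContract M N (φ ∘ₗ Hom.linF f) x)) (fun _ _ m n _ _ => ?_)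
    (fun x y hx hy => by simp only [map_add, hx, hy]) x
  rw [outerMap_otm, outerContract_otm, outerContract_otm]
  exact ((Hom.linF g).map_smul _ _).symm

variable {M N} in
theorem outerContractRight_map {M' : GSMod A} {N' : GSMod B} (φ : N'.carrier →ₗ[F] F) (f : M ⟶ M')
    (g : N ⟶ N') (x : (M.outer N).carrier) : outerContractRight M' N' φ ((outerMap f g).lin x) =
      f.lin (outerContractRight M N (φ ∘ₗ Hom.linF g) x) := by
  refine outer_induction (p := fun x => outerContractRight M' N' φ ((outerMap f g).lin x) =
    f.lin (outerContractRight M N (φ ∘ₗ Hom.linF g) x)) (fun _ _ m n _ _ => ?_)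
    (fun x y hx hy => by simp only [map_add, hx, hy]) x
  rw [outerMap_otm, outerContractRight_otm, outerContractRight_otm]
  exact ((Hom.linF f).map_smul _ _).symm

theorem sum_outerContract {ι : Type*} [Fintype ι] (b : Module.Basis ι F M.carrier)
    (x : (M.outer N).carrier) : ∑ i, otm M N (b i) (outerContract M N (b.coord i) x) = x := by
  refine outer_induction (p := fun x => ∑ i, otm M N (b i) (outerContract M N (b.coord i) x) = x)
    (fun _ _ m n _ _ => ?_)
    (fun x y hx hy => by simp only [map_add, Finset.sum_add_distrib, hx, hy]) x
  conv_rhs => rw [← b.sum_repr m, map_sum, LinearMap.sum_apply]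
  exact Finset.sum_congr rfl fun i _ => by
    rw [outerContract_otm, map_smul, map_smul, LinearMap.smul_apply, b.coord_apply]

theorem sum_outerContractRight {ι : Type*} [Fintype ι] (b : Module.Basis ι F N.carrier)
    (x : (M.outer N).carrier) : ∑ i, otm M N (outerContractRight M N (b.coord i) x) (b i) = x := by
  refine outer_induction (p := fun x => ∑ i, otm M N (outerContractRight M N (b.coord i) x) (b i) = x)
    (fun _ _ m n _ _ => ?_)
    (fun x y hx hy => by
      simp only [map_add, LinearMap.add_apply, Finset.sum_add_distrib, hx, hy]) x
  conv_rhs => rw [← b.sum_repr n, map_sum]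
  exact Finset.sum_congr rfl fun i _ => by
    rw [outerContractRight_otm, map_smul, map_smul, LinearMap.smul_apply, b.coord_apply]

theorem outerFunctor_exact : IsExact (outerFunctor M B) :=
  isExact_of_coefficients (Φ := outerFunctor M B)
    (fun i N => otm M N (Module.finBasis F M.carrier i))
    (fun i N => outerContract M N ((Module.finBasis F M.carrier).coord i))
    (fun _ {_ _} _ _ => rfl) (fun _ {_ _} f x => outerContract_map _ (𝟙 M) f x)
    (fun N x => sum_outerContract M N _ x)

/-- The functor `- ⊠ N`. -/
noncomputable def outerFunctorRight (N : GSMod B) (A : GSAlg F) : GSMod A ⥤ GSMod (A.tensor B) where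
  obj M := M.outer N
  map f := outerMap f (𝟙 N)
  map_id _ := outer_hom_ext fun _ _ _ _ _ _ => rfl
  map_comp _ _ := outer_hom_ext fun _ _ _ _ _ _ => rfl

theorem outerFunctorRight_exact : IsExact (outerFunctorRight N A) :=
  isExact_of_coefficients (Φ := outerFunctorRight N A)
    (fun i M => (otm M N).flip (Module.finBasis F N.carrier i))
    (fun i M => outerContractRight M N ((Module.finBasis F N.carrier).coord i))
    (fun _ {_ _} _ _ => rfl) (fun _ {_ _} f x => outerContractRight_map _ f (𝟙 N) x)
    (fun M x => sum_outerContractRight M N _ x)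

variable {M N}

/-- The product of two homogeneous linear forms, as a linear map over the ground field. -/
noncomputable def outerFormF (t : M.carrier →ₗ[A.carrier] A.carrier)
    (s : N.carrier →ₗ[B.carrier] B.carrier) (d : Deg) :
    (M.outer N).carrier →ₗ[F] (A.tensor B).carrier :=
  outerLiftF ((GSAlg.tmulLin A B).compl₁₂ (t.restrictScalars F)
    (ptwist B.internal d.2 ∘ₗ s.restrictScalars F))

theorem outerFormF_otm (t : M.carrier →ₗ[A.carrier] A.carrier)
    (s : N.carrier →ₗ[B.carrier] B.carrier) (d : Deg) (m : M.carrier) (n : N.carrier) :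
    outerFormF t s d (otm M N m n) = GSAlg.tmul (t m) (ptwist B.internal d.2 (s n)) := rfl

theorem outerFormF_smul (t : M.carrier →ₗ[A.carrier] A.carrier)
    (s : N.carrier →ₗ[B.carrier] B.carrier) (d : Deg)
    (ht : ∀ j p, p ∈ M.gr j → t p ∈ A.gr (j - d)) (x : (A.tensor B).carrier)
    (y : (M.outer N).carrier) : outerFormF t s d (x • y) = x * outerFormF t s d y := by
  refine GSAlg.tensor_induction (p := fun x => outerFormF t s d (x • y) = x * outerFormF t s d y)
    (fun i j a b ha hb => ?_) (fun x y hx hy => by simp only [add_smul, map_add, hx, hy, add_mul]) x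
  refine outer_induction (p := fun y => outerFormF t s d (GSAlg.tmul a b • y) =
    GSAlg.tmul a b * outerFormF t s d y) (fun k l m n hm hn => ?_)
    (fun x y hx hy => by simp only [smul_add, map_add, hx, hy, mul_add]) y
  rw [smul_otm a hb hm, map_zsmul, outerFormF_otm, outerFormF_otm, map_smul, map_smul, smul_eq_mul,
    smul_eq_mul, B.ptwist_mul, ptwist_of_mem _ _ hb, smul_mul_assoc, GSAlg.tmul_zsmul, smul_smul,
    GSAlg.tmul_mul_tmul _ _ hb (ht _ _ hm)]
  congr 1
  change ksign j.2 k.2 * ksign d.2 j.2 = ksign j.2 (k.2 - d.2)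
  generalize j.2 = a, k.2 = b, d.2 = c
  revert a b c; decide

/-- The product of two homogeneous linear forms. -/
noncomputable def outerForm (t : M.carrier →ₗ[A.carrier] A.carrier)
    (s : N.carrier →ₗ[B.carrier] B.carrier) (d : Deg)
    (ht : ∀ j p, p ∈ M.gr j → t p ∈ A.gr (j - d)) :
    (M.outer N).carrier →ₗ[(A.tensor B).carrier] (A.tensor B).carrier where
  toFun := outerFormF t s d
  map_add' := map_add _
  map_smul' := outerFormF_smul t s d ht

theorem outerForm_otm (t : M.carrier →ₗ[A.carrier] A.carrier)
    (s : N.carrier →ₗ[B.carrier] B.carrier) (d : Deg)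
    (ht : ∀ j p, p ∈ M.gr j → t p ∈ A.gr (j - d)) (m : M.carrier) (n : N.carrier) :
    outerForm t s d ht (otm M N m n) = GSAlg.tmul (t m) (ptwist B.internal d.2 (s n)) := rfl

theorem IsProjective.outer (hM : M.IsProjective) (hN : N.IsProjective) :
    (M.outer N).IsProjective := by
  obtain ⟨ι, hι, d, x, t, hx, ht, h⟩ := hM.exists_homogeneous_dualBasis
  obtain ⟨κ, hκ, e, y, s, hy, hs, h'⟩ := hN.exists_homogeneous_dualBasis
  refine projective_of_dualBasis (ι := ι × κ) (fun k => otm M N (x k.1) (y k.2))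
    (fun k => outerForm (t k.1) (s k.2) (d k.1) (ht k.1)) fun p => ?_
  refine outer_induction (p := fun p => ∑ k : ι × κ, outerForm (t k.1) (s k.2) (d k.1) (ht k.1) p •
    otm M N (x k.1) (y k.2) = p) (fun i j m n hm hn => ?_)
    (fun x y hx hy => by simp only [map_add, add_smul, Finset.sum_add_distrib, hx, hy]) p
  have key : ∀ k : ι × κ, outerForm (t k.1) (s k.2) (d k.1) (ht k.1) (otm M N m n) •
      otm M N (x k.1) (y k.2) = otm M N (t k.1 m • x k.1) (s k.2 n • y k.2) := fun k => by
    rw [outerForm_otm, smul_otm _ (ptwist_mem _ _ (hs k.2 _ _ hn)) (hx k.1),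
      ptwist_of_mem _ _ (hs k.2 _ _ hn), smul_assoc, map_zsmul, smul_smul, ksign_comm, ksign_self,
      one_smul]
  rw [Finset.sum_congr rfl fun k _ => key k, Fintype.sum_prod_type]
  simp only [← map_sum, h', ← LinearMap.sum_apply, h]

end Outer

section Ind

variable (φ : GSAlg.Hom B A)

/-- An element of `A φ(1)`. -/
def rightMk (a : A.carrier) : RightCarrier φ :=
  ⟨a * φ.lin 1, by
    change a * φ.lin 1 * φ.lin 1 = a * φ.lin 1
    rw [mul_assoc, ← φ.map_mul, one_mul]⟩

theorem rightMk_coe (a : RightCarrier φ) : rightMk φ a.1 = a := Subtype.ext a.2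

theorem op_smul_rightMk (b : B.carrier) (a : A.carrier) :
    MulOpposite.op b • rightMk φ a = rightMk φ (a * φ.lin b) := Subtype.ext (by
  change a * φ.lin 1 * φ.lin b = a * φ.lin b * φ.lin 1
  rw [mul_assoc, mul_assoc, ← φ.map_mul, ← φ.map_mul, one_mul, mul_one])

/-- The linear map `A → B` given by a linear form on `A φ(1)`. -/
def rightForm (t : RightCarrier φ →ₗ[B.carrierᵐᵒᵖ] B.carrierᵐᵒᵖ) : A.carrier →ₗ[F] B.carrier where
  toFun a := (t (rightMk φ a)).unop
  map_add' a a' := by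
    rw [show rightMk φ (a + a') = rightMk φ a + rightMk φ a' from Subtype.ext (add_mul _ _ _),
      map_add]
    rfl
  map_smul' c a := by
    have : rightMk φ (c • a) = MulOpposite.op (algebraMap F B.carrier c) • rightMk φ a := by
      rw [op_smul_rightMk, Algebra.algebraMap_eq_smul_one, map_smul]
      refine Subtype.ext ?_
      change c • a * φ.lin 1 = a * c • φ.lin 1 * φ.lin 1
      rw [mul_assoc, smul_mul_assoc c (φ.lin 1), ← φ.map_mul, one_mul, smul_mul_assoc,
        mul_smul_comm]
    rw [this, map_smul, smul_eq_mul, MulOpposite.unop_mul, MulOpposite.unop_op,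
      ← Algebra.commutes, ← Algebra.smul_def]
    rfl

theorem rightForm_mul (t : RightCarrier φ →ₗ[B.carrierᵐᵒᵖ] B.carrierᵐᵒᵖ) (a : A.carrier)
    (b : B.carrier) : rightForm φ t (a * φ.lin b) = rightForm φ t a * b := by
  change (t (rightMk φ (a * φ.lin b))).unop = _
  rw [← op_smul_rightMk, map_smul]
  rfl

/-- The map `a ⊗ n ↦ t(a) n` for a linear form `t` on `A φ(1)`. -/
noncomputable def indContract (t : RightCarrier φ →ₗ[B.carrierᵐᵒᵖ] B.carrierᵐᵒᵖ) (N : GSMod B) :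
    (N.ind φ).carrier →ₗ[F] N.carrier :=
  indLiftF φ (TensorProduct.lift (N.act ∘ₗ rightForm φ t)) (fun _ _ _ a b n _ _ _ => by
    rw [TensorProduct.lift.tmul, TensorProduct.lift.tmul, LinearMap.comp_apply,
      LinearMap.comp_apply, rightForm_mul, act_apply, act_apply, mul_smul])

theorem indContract_mk (t : RightCarrier φ →ₗ[B.carrierᵐᵒᵖ] B.carrierᵐᵒᵖ) (N : GSMod B)
    (a : A.carrier) (n : N.carrier) :
    indContract φ t N (imk φ N (a ⊗ₜ n)) = rightForm φ t a • n := rfl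

theorem indContract_map (t : RightCarrier φ →ₗ[B.carrierᵐᵒᵖ] B.carrierᵐᵒᵖ) {N N' : GSMod B}
    (f : N ⟶ N') (x : (N.ind φ).carrier) :
    indContract φ t N' ((indMap φ f).lin x) = f.lin (indContract φ t N x) := by
  refine ind_induction φ (N := N) (p := fun x => indContract φ t N' ((indMap φ f).lin x) =
    f.lin (indContract φ t N x)) (fun _ _ a n _ _ => ?_)
    (fun x y hx hy => by simp only [map_add, hx, hy]) x
  rw [indContract_mk, map_smul]
  rfl

/-- The map `n ↦ a ⊗ n`. -/
noncomputable def indInsert (a : A.carrier) (N : GSMod B) : N.carrier →ₗ[F] (N.ind φ).carrier :=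
  imk φ N ∘ₗ TensorProduct.mk F A.carrier N.carrier a

theorem indInsert_apply (a : A.carrier) (N : GSMod B) (n : N.carrier) :
    indInsert φ a N n = imk φ N (a ⊗ₜ n) := rfl

theorem sum_indContract {ι : Type*} [Fintype ι] (a : ι → A.carrier)
    (t : ι → (RightCarrier φ →ₗ[B.carrierᵐᵒᵖ] B.carrierᵐᵒᵖ))
    (h : ∀ x, ∑ i, a i * φ.lin (rightForm φ (t i) x) = x * φ.lin 1) (N : GSMod B)
    (x : (N.ind φ).carrier) : ∑ i, indInsert φ (a i) N (indContract φ (t i) N x) = x := by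
  refine ind_induction φ (N := N) (p := fun x => ∑ i, indInsert φ (a i) N
    (indContract φ (t i) N x) = x) (fun _ _ b n _ _ => ?_)
    (fun x y hx hy => by simp only [map_add, Finset.sum_add_distrib, hx, hy]) x
  simp only [indContract_mk, indInsert_apply, ← imk_mul]
  rw [← map_sum, ← TensorProduct.sum_tmul, h, imk_mul_one]

theorem rightCarrier_finite : Module.Finite B.carrierᵐᵒᵖ (RightCarrier φ) := by
  obtain ⟨S, hS⟩ := (inferInstance : Module.Finite F (RightCarrier φ)).fg_top
  refine ⟨S, eq_top_iff.2 fun x _ => ?_⟩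
  have hx : x ∈ Submodule.span F (S : Set (RightCarrier φ)) := hS ▸ trivial
  induction hx using Submodule.span_induction with
  | mem x hx => exact Submodule.subset_span hx
  | zero => exact zero_mem _
  | add x y _ _ hx hy => exact add_mem (hx trivial) (hy trivial)
  | smul c x _ hx =>
    have : c • x = MulOpposite.op (algebraMap F B.carrier c) • x := by
      rw [← rightMk_coe φ x, op_smul_rightMk, Algebra.algebraMap_eq_smul_one, map_smul]
      refine Subtype.ext ?_
      change c • (x.1 * φ.lin 1) = x.1 * c • φ.lin 1 * φ.lin 1
      rw [mul_assoc, smul_mul_assoc c (φ.lin 1), ← φ.map_mul, one_mul, mul_smul_comm]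
    rw [this]
    exact Submodule.smul_mem _ _ (hx trivial)

theorem exists_right_dualBasis (hφ : Module.Projective B.carrierᵐᵒᵖ (RightCarrier φ)) :
    ∃ (n : ℕ) (a : Fin n → A.carrier)
      (t : Fin n → (RightCarrier φ →ₗ[B.carrierᵐᵒᵖ] B.carrierᵐᵒᵖ)),
      ∀ x, ∑ i, a i * φ.lin (rightForm φ (t i) x) = x * φ.lin 1 := by
  have := rightCarrier_finite φ
  obtain ⟨n, f, g, _, _, hfg⟩ :=
    Module.Finite.exists_comp_eq_id_of_projective B.carrierᵐᵒᵖ (RightCarrier φ)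
  refine ⟨n, fun i => (f (Pi.single i 1)).1, fun i => LinearMap.proj i ∘ₗ g, fun x => ?_⟩
  refine Eq.trans ?_ (congrArg Subtype.val (LinearMap.congr_fun hfg (rightMk φ x)))
  rw [LinearMap.comp_apply, ← Finset.univ_sum_single (g (rightMk φ x)), map_sum,
    AddSubmonoidClass.coe_finsetSum]
  refine Finset.sum_congr rfl fun i _ => ?_
  have : (Pi.single i (g (rightMk φ x) i) : Fin n → B.carrierᵐᵒᵖ) =
      g (rightMk φ x) i • Pi.single i 1 := by
    rw [← Pi.single_smul, smul_eq_mul, mul_one]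
  rw [this, map_smul]
  rfl

theorem indFunctor_exact (hφ : Module.Projective B.carrierᵐᵒᵖ (RightCarrier φ)) :
    IsExact (indFunctor φ) := by
  obtain ⟨n, a, t, h⟩ := exists_right_dualBasis φ hφ
  exact isExact_of_coefficients (Φ := indFunctor φ) (fun i N => indInsert φ (a i) N)
    (fun i N => indContract φ (t i) N) (fun _ {_ _} _ _ => rfl)
    (fun i {_ _} f x => indContract_map φ (t i) f x) (fun N x => sum_indContract φ a t h N x)

/-- The linear map `a ⊗ n ↦ a φ(t(n))`. -/
noncomputable def indFormF {N : GSMod B} (t : N.carrier →ₗ[B.carrier] B.carrier) :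
    (N.ind φ).carrier →ₗ[F] A.carrier :=
  indLiftF φ (TensorProduct.lift ((LinearMap.mul F A.carrier).compl₂
    (φ.lin ∘ₗ t.restrictScalars F))) (fun _ _ _ a b n _ _ _ => by
      rw [TensorProduct.lift.tmul, TensorProduct.lift.tmul]
      simp only [LinearMap.compl₂_apply, LinearMap.mul_apply', LinearMap.comp_apply,
        LinearMap.restrictScalars_apply, map_smul, smul_eq_mul, φ.map_mul, mul_assoc])

theorem indFormF_mk {N : GSMod B} (t : N.carrier →ₗ[B.carrier] B.carrier) (a : A.carrier)
    (n : N.carrier) : indFormF φ t (imk φ N (a ⊗ₜ n)) = a * φ.lin (t n) := rfl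

/-- The linear form `a ⊗ n ↦ a φ(t(n))`. -/
noncomputable def indForm {N : GSMod B} (t : N.carrier →ₗ[B.carrier] B.carrier) :
    (N.ind φ).carrier →ₗ[A.carrier] A.carrier where
  toFun := indFormF φ t
  map_add' := map_add _
  map_smul' a x := ind_induction φ (N := N)
    (p := fun x => indFormF φ t (a • x) = a * indFormF φ t x)
    (fun _ _ a' n _ _ => by rw [smul_imk, indFormF_mk, indFormF_mk, mul_assoc])
    (fun x y hx hy => by rw [smul_add, map_add, map_add, mul_add, hx, hy]) x

theorem indForm_mk {N : GSMod B} (t : N.carrier →ₗ[B.carrier] B.carrier) (a : A.carrier)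
    (n : N.carrier) : indForm φ t (imk φ N (a ⊗ₜ n)) = a * φ.lin (t n) := rfl

theorem IsProjective.ind {N : GSMod B} (hN : N.IsProjective) : (N.ind φ).IsProjective := by
  obtain ⟨ι, hι, d, x, t, hx, ht, h⟩ := hN.exists_homogeneous_dualBasis
  refine projective_of_dualBasis (fun i => indUnit φ N (x i)) (fun i => indForm φ (t i)) fun y => ?_
  refine ind_induction φ (p := fun y => ∑ i, indForm φ (t i) y • indUnit φ N (x i) = y)
    (fun i j a n ha hn => ?_)
    (fun x y hx hy => by simp only [map_add, add_smul, Finset.sum_add_distrib, hx, hy]) y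
  simp only [indForm_mk, mul_smul, ← indUnit_smul]
  rw [← Finset.smul_sum, ← map_sum, h, ← imk_eq]

end Ind

section Res

variable (φ : GSAlg.Hom B A)

/-- A linear map as a map of restrictions. -/
def resLin {M N : GSMod A} (f : M.carrier →ₗ[A.carrier] N.carrier) :
    (M.res φ).carrier →ₗ[B.carrier] (N.res φ).carrier where
  toFun m := resMk φ N (f (resι φ M m)) (by rw [← map_smul, one_smul_resι])
  map_add' m m' := resι_injective φ N (map_add f _ _)
  map_smul' b m := resι_injective φ N (map_smul f _ _)

theorem IsProjective.res {M : GSMod A} (hM : M.IsProjective)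
    (hφ : ((regular A).res φ).IsProjective) : (M.res φ).IsProjective := by
  obtain ⟨ι, hι, d, x, t, hx, ht, h⟩ := hM.exists_homogeneous_dualBasis
  refine projective_of_sum (M := fun _ : ι => ((regular A).res φ).carrier) (fun _ => hφ)
    (fun i => resLin φ (N := regular A) (t i))
    (fun i => resLin φ (M := regular A) (LinearMap.toSpanSingleton A.carrier M.carrier (x i)))
    fun p => resι_injective φ M ?_
  rw [map_sum]
  exact h (resι φ M p)

end Res

section Hom

/-- The homomorphism `c ↦ c ⊗ 1`. -/
noncomputable def _root_.SuperTower.GSAlg.inclL (C B : GSAlg F) : GSAlg.Hom C (C.tensor B) where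
  lin := (GSAlg.tmulLin C B).flip 1
  map_mul c c' := by
    change GSAlg.tmul (c * c') (1 : B.carrier) = GSAlg.tmul c 1 * GSAlg.tmul c' 1
    rw [GSAlg.tmul_mul_one]
  map_mem hc := by
    have := GSAlg.tmul_mem hc B.one_mem
    rwa [add_zero] at this

theorem _root_.SuperTower.GSAlg.inclL_lin (c : C.carrier) :
    (GSAlg.inclL C B).lin c = GSAlg.tmul c 1 := rfl

/-- The linear form `c ⊗ b ↦ φ(b) c`. -/
noncomputable def inclForm (φ : B.carrier →ₗ[F] F) : (C.tensor B).carrier →ₗ[F] C.carrier :=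
  tensorLift (LinearMap.lsmul F C.carrier ∘ₗ φ).flip

theorem inclForm_tmul (φ : B.carrier →ₗ[F] F) (c : C.carrier) (b : B.carrier) :
    inclForm φ (GSAlg.tmul c b) = φ b • c := rfl

theorem inclForm_mul (φ : B.carrier →ₗ[F] F) (c : C.carrier) (x : (C.tensor B).carrier) :
    inclForm φ ((GSAlg.inclL C B).lin c * x) = c * inclForm φ x :=
  GSAlg.tensor_induction (p := fun x => inclForm φ ((GSAlg.inclL C B).lin c * x) = c * inclForm φ x)
    (fun _ _ a b _ _ => by
      rw [GSAlg.inclL_lin, GSAlg.tmul_mul_one, inclForm_tmul, inclForm_tmul, mul_smul_comm])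
    (fun x y hx hy => by simp only [mul_add, map_add, hx, hy]) x

theorem regular_res_inclL_isProjective :
    ((regular (C.tensor B)).res (GSAlg.inclL C B)).IsProjective := by
  let b := Module.finBasis F B.carrier
  have h1 : ∀ x : (C.tensor B).carrier, (GSAlg.inclL C B).lin 1 • x = x := fun x => one_smul _ x
  refine projective_of_dualBasis
    (fun i => resMk (GSAlg.inclL C B) (regular (C.tensor B)) (GSAlg.tmul 1 (b i)) (h1 _))
    (fun i =>
      { toFun := fun x => inclForm (b.coord i) (resι (GSAlg.inclL C B) (regular (C.tensor B)) x)
        map_add' := fun x y => by rw [map_add]; exact map_add _ _ _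
        map_smul' := fun c x => inclForm_mul (b.coord i) c _ }) fun x =>
    resι_injective (GSAlg.inclL C B) (regular (C.tensor B)) ?_
  rw [map_sum]
  change ∑ i, (GSAlg.tmul (inclForm (b.coord i) (resι _ (regular (C.tensor B)) x)) 1 : (C.tensor B).carrier) *
    GSAlg.tmul 1 (b i) = resι _ (regular (C.tensor B)) x
  generalize resι (GSAlg.inclL C B) (regular (C.tensor B)) x = y
  refine GSAlg.tensor_induction (p := fun y => ∑ i, (GSAlg.tmul (inclForm (b.coord i) y) 1 :
    (C.tensor B).carrier) * GSAlg.tmul 1 (b i) = y) (fun _ _ c z _ _ => ?_)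
    (fun x y hx hy => ?_) y
  · simp only [GSAlg.tmul_mul_one, mul_one, inclForm_tmul]
    conv_rhs => rw [← b.sum_repr z, ← GSAlg.tmulLin_apply, map_sum]
    exact Finset.sum_congr rfl fun i _ => by
      rw [← GSAlg.tmulLin_apply, map_smul, LinearMap.smul_apply, map_smul, b.coord_apply]
  · simp only [map_add, ← GSAlg.tmulLin_apply, LinearMap.add_apply, add_mul,
      Finset.sum_add_distrib] at hx hy ⊢
    rw [hx, hy]

/-- Evaluation at an element. -/
noncomputable def homEval (P : GSMod B) (Y : GSMod (C.tensor B)) (p : P.carrier) :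
    (hom P Y).carrier →ₗ[F] Y.carrier := LinearMap.applyₗ p ∘ₗ homι P Y

theorem formHom_map {P : GSMod B} {Y Y' : GSMod (C.tensor B)} (g : Y ⟶ Y')
    (t : P.carrier →ₗ[B.carrier] B.carrier) (d : Deg)
    (ht : ∀ j p, p ∈ P.gr j → t p ∈ B.gr (j - d)) (y : Y.carrier) :
    (homMap P g).lin (formHom Y t d ht y) = formHom Y' t d ht (g.lin y) := by
  refine hom_induction Y.internal (p := fun y => (homMap P g).lin
    (formHom Y t d ht y) = formHom Y' t d ht (g.lin y)) (fun k y hy => homι_injective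
    (LinearMap.ext fun p => ?_)) (fun x y hx hy => by
      simp only [map_add, hx, hy]) y
  refine (homι_map g (formHom Y t d ht y) p).trans ?_
  rw [homι_formHom, homι_formHom, formSmul_apply _ _ _ hy,
    formSmul_apply _ _ _ (g.map_mem hy), rightAct_apply, rightAct_apply, map_smul]

theorem homFunctor_exact {P : GSMod B} (hP : P.IsProjective) (C : GSAlg F) :
    IsExact (homFunctor P C) := by
  obtain ⟨ι, hι, d, x, t, hx, ht, h⟩ := hP.exists_homogeneous_dualBasis
  exact isExact_of_coefficients (Φ := homFunctor P C)
    (fun i Y => formHom Y (t i) (d i) (ht i)) (fun i Y => homEval P Y (x i))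
    (fun i {_ _} f y => formHom_map f _ _ _ y) (fun _ {_ _} _ _ => rfl)
    (fun Y f => sum_formHom Y hx ht h f)

theorem IsProjective.hom {P : GSMod B} (hP : P.IsProjective) {Y : GSMod (C.tensor B)}
    (hY : Y.IsProjective) : (GSMod.hom P Y).IsProjective := by
  obtain ⟨ι, hι, d, x, t, hx, ht, h⟩ := hP.exists_homogeneous_dualBasis
  refine projective_of_sum (M := fun _ : ι => (Y.res (GSAlg.inclL C B)).carrier)
    (fun _ => hY.res _ regular_res_inclL_isProjective)
    (fun i =>
      { toFun := fun f => resMk _ Y (homι P Y f (x i)) (one_smul _ _)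
        map_add' := fun _ _ => rfl
        map_smul' := fun _ _ => rfl })
    (fun i =>
      { toFun := fun y => formHom Y (t i) (d i) (ht i) (resι _ Y y)
        map_add' := fun _ _ => by rw [map_add, map_add]
        map_smul' := fun c y => formHom_leftAct Y (t i) (d i) (ht i) c (resι _ Y y) })
    fun f => sum_formHom Y hx ht h f

end Hom

end GSMod

namespace Tower

variable {Λ : Type} [AddCommMonoid Λ] (T : Tower F Λ) {l m n : Λ} (h : l + m = n)

theorem Ind_exact (M : GSMod (T.A l)) : GSMod.IsExact (T.Ind h M) :=
  GSMod.IsExact.comp (GSMod.outerFunctor_exact M) (GSMod.indFunctor_exact (T.ρ h) (T.projective h).2)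

theorem Res_exact (P : GSMod (T.A m)) (hP : P.IsProjective) : GSMod.IsExact (T.Res h P) :=
  GSMod.IsExact.comp (GSMod.resFunctor_exact (T.ρ h)) (GSMod.homFunctor_exact hP _)

theorem nabla_isProjective {P : GSMod (T.A l)} {Q : GSMod (T.A m)} (hP : P.IsProjective)
    (hQ : Q.IsProjective) : (T.nabla h P Q).IsProjective := (hP.outer hQ).ind _

theorem res_isProjective {R : GSMod (T.A n)} (hR : R.IsProjective) :
    (R.res (T.ρ h)).IsProjective := hR.res _ (T.projective h).1

theorem Res_isProjective {P : GSMod (T.A m)} {R : GSMod (T.A n)} (hP : P.IsProjective)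
    (hR : R.IsProjective) : ((T.Res h P).obj R).IsProjective :=
  hP.hom (T.res_isProjective h hR)

end Tower

end SuperTower

namespace SuperTower

variable {F : Type u} [Field F]

section Dimension

variable {B C : GSAlg F}

theorem GSMod.finite_support_finrank (M : GSMod B) :
    (Function.support fun d => (Module.finrank F (M.gr d) : ℤ)).Finite := by
  refine (WellFoundedGT.finite_ne_bot_of_iSupIndep M.internal.submodule_iSupIndep).subset
    fun d hd h => hd ?_
  simp [h]

theorem finsum_qmon_coeff (f : Deg → ℤ) (hf : (Function.support f).Finite) (d : Deg) :
    (∑ᶠ e : Deg, f e • qmon e.1 e.2 : Zqπ).coeff d = f d := by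
  classical
  rw [finsum_eq_sum_of_support_subset (s := hf.toFinset) _ fun e he => by
    rw [Set.Finite.coe_toFinset]
    exact fun h => he (by change f e • _ = _; rw [h, zero_smul])]
  rw [AddMonoidAlgebra.coeff_sum, Finsupp.finsetSum_apply]
  simp only [AddMonoidAlgebra.coeff_smul_apply, qmon, Prod.mk.eta, AddMonoidAlgebra.coeff_single,
    Finsupp.single_apply, smul_eq_mul, mul_ite, mul_one, mul_zero, Finset.sum_ite_eq']
  split_ifs with h
  · rfl
  · exact (by simpa using h : f d = 0).symm

theorem grdim_coeff (M : GSMod B) (d : Deg) : (grdim M).coeff d = Module.finrank F (M.gr d) :=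
  finsum_qmon_coeff _ M.finite_support_finrank d

theorem zqπ_ext {x y : Zqπ} (h : ∀ d, x.coeff d = y.coeff d) : x = y :=
  AddMonoidAlgebra.coeff_injective (Finsupp.ext h)

namespace GSMod

theorem finrank_piece_of_shortExact {X Y Z : GSMod B} {f : X ⟶ Y} {g : Y ⟶ Z} (h : ShortExact f g)
    (d : Deg) : Module.finrank F (Y.gr d) =
      Module.finrank F (X.gr d) + Module.finrank F (Z.gr d) := by
  obtain ⟨hi, he, hs⟩ := h
  let f' : X.gr d →ₗ[F] Y.gr d := (Hom.linF f).restrict fun _ hx => f.map_mem hx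
  let g' : Y.gr d →ₗ[F] Z.gr d := (Hom.linF g).restrict fun _ hx => g.map_mem hx
  have hf' : Function.Injective f' := fun x y hxy => Subtype.ext (hi (congrArg Subtype.val hxy))
  have hg' : LinearMap.range g' = ⊤ := LinearMap.range_eq_top.2 fun z => by
    obtain ⟨y, hy, hz⟩ := exists_mem_of_surjective Y.internal Z.internal (Hom.linF g)
      (fun _ _ h => g.map_mem h) hs z.2
    exact ⟨⟨y, hy⟩, Subtype.ext hz⟩
  have hk : LinearMap.ker g' = LinearMap.range f' := by
    ext y
    constructor
    · intro hy
      obtain ⟨x, hx⟩ := (he y.1).1 (congrArg Subtype.val hy)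
      exact ⟨⟨x, mem_of_map_mem X.internal Y.internal (Hom.linF f) (fun _ _ h => f.map_mem h) hi
        (hx ▸ y.2)⟩, Subtype.ext hx⟩
    · rintro ⟨x, rfl⟩
      exact Subtype.ext (he.apply_apply_eq_zero x.1)
  rw [← LinearMap.finrank_range_add_finrank_ker g', hg', finrank_top, hk,
    LinearMap.finrank_range_of_inj hf', add_comm]

theorem grdim_of_shortExact {X Y Z : GSMod B} {f : X ⟶ Y} {g : Y ⟶ Z} (h : ShortExact f g) :
    grdim Y = grdim X + grdim Z := zqπ_ext fun d => by
  rw [AddMonoidAlgebra.coeff_add, Finsupp.add_apply, grdim_coeff, grdim_coeff, grdim_coeff,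
    finrank_piece_of_shortExact h, Nat.cast_add]

theorem finrank_piece_congr {M : GSMod B} {N : GSMod C} (f : M.carrier →ₗ[F] N.carrier)
    (hf : Function.Bijective f) {d d' : Deg} (h : ∀ m, m ∈ M.gr d ↔ f m ∈ N.gr d') :
    Module.finrank F (M.gr d) = Module.finrank F (N.gr d') :=
  (LinearEquiv.ofBijective (f.restrict fun m hm => (h m).1 hm)
    ⟨fun x y hxy => Subtype.ext (hf.1 (congrArg Subtype.val hxy)), fun y => by
      obtain ⟨x, hx⟩ := hf.2 y.1
      exact ⟨⟨x, (h x).2 (hx ▸ y.2)⟩, Subtype.ext hx⟩⟩).finrank_eq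

theorem grdim_of_iso {M N : GSMod B} (e : M ≅ N) : grdim M = grdim N := zqπ_ext fun d => by
  rw [grdim_coeff, grdim_coeff, finrank_piece_congr (Hom.linF e.hom) (iso_bijective e)
    fun m => ⟨fun h => e.hom.map_mem h, fun h => mem_of_map_mem M.internal N.internal _
      (fun _ _ h => e.hom.map_mem h) (iso_bijective e).1 h⟩]

theorem grdim_shift (M : GSMod B) (n : ℤ) (ε : ZMod 2) :
    grdim (M.shift n ε) = qmon n ε * grdim M := zqπ_ext fun d => by
  rw [qmon, AddMonoidAlgebra.coeff_single_mul_apply, one_mul, grdim_coeff, grdim_coeff,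
    neg_add_eq_sub]
  rfl

end GSMod

end Dimension

/-- The ground field as a graded superalgebra. -/
def GSAlg.unit (F : Type u) [Field F] : GSAlg F where
  carrier := F
  gr d := if d = 0 then ⊤ else ⊥
  internal := by
    refine isInternal_of_proj (fun d => if d = 0 then LinearMap.id else 0) ?_ ?_ ?_
    · intro d x hx
      split_ifs with h
      · rfl
      · rw [if_neg h] at hx; exact (Submodule.mem_bot F).1 hx ▸ rfl
    · intro d e x hx hd
      by_cases h : e = 0
      · rw [if_neg fun h' => hd (h.trans h'.symm)]; rfl
      · rw [if_neg h] at hx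
        rw [(Submodule.mem_bot F).1 hx, map_zero]
    · intro x
      exact Submodule.mem_iSup_of_mem 0 (by simp)
  nonneg d hd := if_neg fun h => by simp [h] at hd
  one_mem := by simp
  mul_mem {i j a b} ha hb := by
    by_cases hi : i = 0
    · by_cases hj : j = 0
      · simp [hi, hj]
      · rw [if_neg hj] at hb
        rw [(Submodule.mem_bot F).1 hb, mul_zero]; exact zero_mem _
    · rw [if_neg hi] at ha
      rw [(Submodule.mem_bot F).1 ha, zero_mul]; exact zero_mem _

namespace GSMod

variable {A B C : GSAlg F}

/-- The isomorphism `F ⊗ B → B` as a linear map. -/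
noncomputable def lidLin (B : GSAlg F) : ((GSAlg.unit F).tensor B).carrier →ₗ[F] B.carrier :=
  TensorProduct.lift (LinearMap.lsmul F B.carrier)

theorem lidLin_tmul (a : (GSAlg.unit F).carrier) (b : B.carrier) :
    lidLin B (GSAlg.tmul a b) = (show F from a) • b := rfl

/-- The isomorphism `F ⊗ B → B`. -/
noncomputable def lid (B : GSAlg F) : GSAlg.Hom ((GSAlg.unit F).tensor B) B where
  lin := lidLin B
  map_mul x y := by
    refine GSAlg.tensor_induction (p := fun x => lidLin B (x * y) = lidLin B x * lidLin B y)
      (fun i j a b ha hb => ?_) (fun x y hx hy => by simp only [add_mul, map_add, hx, hy]) x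
    refine GSAlg.tensor_induction (p := fun y => lidLin B (GSAlg.tmul a b * y) =
      lidLin B (GSAlg.tmul a b) * lidLin B y) (fun k l c d hc hd => ?_)
      (fun x y hx hy => by simp only [mul_add, map_add, hx, hy]) y
    rw [GSAlg.tmul_mul_tmul _ _ hb hc, map_zsmul, lidLin_tmul, lidLin_tmul, lidLin_tmul,
      smul_mul_smul_comm]
    by_cases hk : k = 0
    · rw [hk, Prod.snd_zero, ksign_zero_right, one_smul]; rfl
    · have hc' : c ∈ (if k = 0 then ⊤ else ⊥ : Submodule F F) := hc
      rw [if_neg hk] at hc'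
      have h0 : (show F from c) = 0 := (Submodule.mem_bot F).1 hc'
      have h1 : (show F from a * c) = (show F from a) * (show F from c) := rfl
      rw [h1, h0, mul_zero, zero_smul, smul_zero]
  map_mem {d x} hx := by
    refine map_tensorGr_of_tmul (lidLin B) (B.gr d) (fun i j a b ha hb hd => ?_) hx
    change (show F from a) • b ∈ _
    by_cases hi : i = 0
    · rw [← hd, hi, zero_add]; exact Submodule.smul_mem _ _ hb
    · have ha' : a ∈ (if i = 0 then ⊤ else ⊥ : Submodule F F) := ha
      rw [if_neg hi] at ha'
      have h0 : (show F from a) = 0 := (Submodule.mem_bot F).1 ha'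
      rw [h0, zero_smul]; exact zero_mem _

theorem lid_tmul_one (b : B.carrier) : (lid B).lin (GSAlg.tmul 1 b) = b := one_smul F b

theorem finrank_hom_piece (P : GSMod B) (N : GSMod (C.tensor B)) (d : Deg) :
    Module.finrank F ((hom P N).gr d) = Module.finrank F (homPiece P N.gr N.rightAct d) :=
  (Submodule.comapSubtypeEquivOfLe (homPiece_le P N d)).finrank_eq

theorem finrank_hom_res (P M : GSMod B) (θ : GSAlg.Hom (C.tensor B) B)
    (hθ : ∀ b, θ.lin (GSAlg.tmul 1 b) = b) (d : Deg) :
    Module.finrank F ((hom P (M.res θ)).gr d) = Module.finrank F (HOM P M d) := by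
  have h1 : ∀ m : M.carrier, θ.lin 1 • m = m := fun m => by
    rw [GSAlg.tensor_one, hθ, one_smul]
  have hr : ∀ (b : B.carrier) m, resι θ M ((M.res θ).rightAct b m) = M.act b (resι θ M m) :=
    fun b m => congrArg (· • resι θ M m) (hθ b)
  rw [finrank_hom_piece]
  refine finrank_homPiece_eq (LinearMap.compRight F (resι θ M))
    (fun f hf => ⟨hf.1, fun i b m hb => ?_⟩) (fun f _ h => ?_) (fun g hg => ?_)
  · rw [LinearMap.compRight_apply, LinearMap.comp_apply, LinearMap.comp_apply, hf.2 i b m hb,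
      map_zsmul, hr]
  · exact LinearMap.ext fun p => resι_injective _ M (LinearMap.congr_fun h p)
  · refine ⟨g.codRestrict (ResCarrier θ M) fun p => h1 _, ⟨hg.1, fun i b m hb => ?_⟩, rfl⟩
    refine resι_injective θ M ?_
    rw [map_zsmul, hr]
    exact hg.2 i b m hb

theorem grdimHom_eq_grdim (P M : GSMod B) (θ : GSAlg.Hom (C.tensor B) B)
    (hθ : ∀ b, θ.lin (GSAlg.tmul 1 b) = b) : grdimHom P M = grdim (hom P (M.res θ)) := by
  rw [grdimHom, grdim]
  exact finsum_congr fun d => by rw [finrank_hom_res P M θ hθ]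

theorem grdimHom_eq_grdim_lid (P M : GSMod B) : grdimHom P M = grdim (hom P (M.res (lid B))) :=
  grdimHom_eq_grdim P M (lid B) lid_tmul_one

theorem grdimHom_coeff (P M : GSMod B) (d : Deg) :
    (grdimHom P M).coeff d = Module.finrank F (HOM P M d) := by
  rw [grdimHom_eq_grdim_lid, grdim_coeff, finrank_hom_res P M (lid B) lid_tmul_one]

theorem grdimHom_of_shortExact {P : GSMod B} (hP : P.IsProjective) {X Y Z : GSMod B} {f : X ⟶ Y}
    {g : Y ⟶ Z} (h : ShortExact f g) : grdimHom P Y = grdimHom P X + grdimHom P Z := by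
  rw [grdimHom_eq_grdim_lid, grdimHom_eq_grdim_lid, grdimHom_eq_grdim_lid]
  exact grdim_of_shortExact (homFunctor_exact hP _ _ _ (resFunctor_exact (lid B) f g h))

theorem grdimHom_shift (P M : GSMod B) (n : ℤ) (ε : ZMod 2) :
    grdimHom P (M.shift n ε) = qmon n ε * grdimHom P M := by
  rw [grdimHom_eq_grdim_lid, grdimHom_eq_grdim_lid, ← grdim_shift]
  refine grdim_of_iso (((homFunctor P _).mapIso ((resShift (lid B) n ε).app M)).trans ?_)
  exact ((homShift P _ n ε).app (M.res (lid B))).symm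

theorem grdimHom_shift_left (P M : GSMod B) (n : ℤ) (ε : ZMod 2) :
    grdimHom (P.shift n ε) M = qmon (-n) ε * grdimHom P M := by
  rw [grdimHom_eq_grdim_lid, grdimHom_eq_grdim_lid, ← grdim_shift]
  exact grdim_of_iso ((shiftHom P _ n ε).app (M.res (lid B)))

theorem grdimHom_of_iso_left {P P' : GSMod B} (e : P ≅ P') (M : GSMod B) :
    grdimHom P M = grdimHom P' M := by
  rw [grdimHom_eq_grdim_lid, grdimHom_eq_grdim_lid]
  exact grdim_of_iso ((homFunctorIso e _).app (M.res (lid B))).symm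

theorem homPre_shortExact {X Y Z : GSMod B} {f : X ⟶ Y} {g : Y ⟶ Z} (h : ShortExact f g)
    (hZ : Z.IsProjective) (N : GSMod (C.tensor B)) : ShortExact (homPre g N) (homPre f N) := by
  obtain ⟨hi, he, hs⟩ := h
  obtain ⟨k, hk⟩ := hZ.exists_lift g hs (𝟙 Z)
  have hk' : ∀ z, g.lin (k.lin z) = z := fun z => congrArg (fun f : Z ⟶ Z => f.lin z) hk
  have hp : ∀ y, ∃ x, f.lin x = y - k.lin (g.lin y) := fun y => (he _).1 (by
    rw [map_sub, hk', sub_self])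
  choose p hp using hp
  let r : Y ⟶ X := homOfF
    { toFun := p
      map_add' := fun y y' => hi (by
        rw [hp, (map_add f.lin _ _ : f.lin (p y + p y') = _), hp, hp, map_add, map_add]; abel)
      map_smul' := fun c y => hi (by
        change f.lin (p (c • y)) = Hom.linF f (c • p y)
        rw [hp, map_smul (Hom.linF f), linF_apply, hp, smul_sub]
        change _ - Hom.linF k (Hom.linF g (c • y)) = c • y - c • Hom.linF k (Hom.linF g y)
        rw [map_smul, map_smul]) }
    (fun d y hy => mem_of_map_mem X.internal Y.internal (Hom.linF f) (fun _ _ h => f.map_mem h) hi (by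
      change f.lin (p y) ∈ _
      rw [hp]; exact sub_mem hy (k.map_mem (g.map_mem hy))))
    (fun i j b y _ _ => hi (by
      change f.lin (p (b • y)) = f.lin (b • p y)
      rw [hp, (map_smul f.lin b (p y) : f.lin (b • p y) = _), hp, map_smul, map_smul, smul_sub]))
  have hr : ∀ x, r.lin (f.lin x) = x := fun x => hi (by
    change f.lin (p (f.lin x)) = _
    rw [hp, he.apply_apply_eq_zero, map_zero, sub_zero])
  refine ⟨fun φ ψ h => homι_injective (LinearMap.ext fun z => ?_), fun φ => ⟨fun h => ?_, ?_⟩,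
    fun φ => ⟨(homPre r N).lin φ, homι_injective (LinearMap.ext fun x => ?_)⟩⟩
  · have := LinearMap.congr_fun (congrArg (homι Y N) h) (k.lin z)
    change homι Z N φ (g.lin (k.lin z)) = homι Z N ψ (g.lin (k.lin z)) at this
    rwa [hk'] at this
  · refine ⟨(homPre k N).lin φ, homι_injective (LinearMap.ext fun y => ?_)⟩
    have h0 : ∀ x, homι Y N φ (f.lin x) = 0 := fun x => LinearMap.congr_fun (congrArg (homι X N) h) x
    have := h0 (p y)
    rw [hp, map_sub, sub_eq_zero] at this
    exact this.symm
  · rintro ⟨ψ, rfl⟩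
    refine homι_injective (LinearMap.ext fun x => ?_)
    change homι Z N ψ (g.lin (f.lin x)) = 0
    rw [he.apply_apply_eq_zero, map_zero]
  · change homι X N φ (r.lin (f.lin x)) = _
    rw [hr]

theorem grdimHom_of_shortExact_left {X Y Z : GSMod B} {f : X ⟶ Y} {g : Y ⟶ Z} (h : ShortExact f g)
    (hZ : Z.IsProjective) (M : GSMod B) : grdimHom Y M = grdimHom X M + grdimHom Z M := by
  rw [grdimHom_eq_grdim_lid, grdimHom_eq_grdim_lid, grdimHom_eq_grdim_lid,
    grdim_of_shortExact (homPre_shortExact h hZ (M.res (lid B))), add_comm]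

end GSMod

end SuperTower

namespace SuperTower

variable {F : Type u} [Field F]

namespace GSMod

variable {A B : GSAlg F}

/-- Outer tensor products commute with shifts of the left factor. -/
theorem nonempty_outer_shift_left (M : GSMod A) (N : GSMod B) (n : ℤ) (σ : ZMod 2) :
    Nonempty ((M.shift n σ).outer N ≅ (M.outer N).shift n σ) := by
  let f : (M.shift n σ).outer N ⟶ (M.outer N).shift n σ := outerLift
    ((otm M N).compr₂ (shiftEquiv (M.outer N) n σ).toLinearMap ∘ₗ (shiftEquiv M n σ).symm.toLinearMap)
    (fun i j m x hm hx => by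
      have := shiftEquiv_mem_add (M.outer N) n σ (otm_mem ((symm_shiftEquiv_mem M n σ).2 hm) hx)
      rwa [sub_add_eq_add_sub, sub_add_cancel] at this)
    (fun i j p l a b m x ha hb hm hx => by
      obtain ⟨m, rfl⟩ := (shiftEquiv M n σ).surjective m
      have hm' := (shiftEquiv_mem M n σ).1 hm
      change _ • shiftEquiv (M.outer N) n σ (otm M N ((shiftEquiv M n σ).symm _) _) =
        _ • shiftEquiv (M.outer N) n σ (otm M N ((shiftEquiv M n σ).symm _) _)
      rw [smul_shiftEquiv_of_mem (M.outer N) n σ (b := GSAlg.tmul a b) (tmul_mem_tensorGr ha hb), symm_shiftEquiv_smul_of_mem M n σ ha,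
        LinearEquiv.symm_apply_apply, smul_otm a hb hm', map_zsmul, map_zsmul, LinearMap.smul_apply,
        map_zsmul, smul_smul, smul_smul]
      congr 1
      rw [Prod.snd_add, Prod.snd_sub]
      change _ = _ * ksign _ (_ - σ)
      generalize i.2 = i; generalize j.2 = j; generalize p.2 = p; clear * -; revert i j p σ; decide)
  have hf : ∀ m x, f.lin (otm _ N (shiftEquiv M n σ m) x) = shiftEquiv _ n σ (otm M N m x) :=
    fun _ _ => outerLift_otm _ _ _ _ _
  let g : (M.outer N).carrier →ₗ[F] ((M.shift n σ).outer N).carrier :=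
    outerLiftF (otm (M.shift n σ) N ∘ₗ (shiftEquiv M n σ).toLinearMap)
  have h₁ : ∀ y, g ((shiftEquiv _ n σ).symm (f.lin y)) = y := fun y =>
    outer_induction (p := fun y => g ((shiftEquiv _ n σ).symm (f.lin y)) = y) (fun i j m x hm hx => by
      obtain ⟨m, rfl⟩ := (shiftEquiv M n σ).surjective m
      rw [hf, LinearEquiv.symm_apply_apply, outerLiftF_otm]; rfl)
      (fun x y hx hy => by simp only [map_add, hx, hy]) y
  have h₂ : ∀ y, f.lin (g y) = shiftEquiv _ n σ y := fun y =>
    outer_induction (p := fun y => f.lin (g y) = shiftEquiv _ n σ y) (fun i j m x hm hx => by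
      rw [outerLiftF_otm]; exact hf m x)
      (fun x y hx hy => by simp only [map_add, hx, hy]) y
  exact ⟨isoOfBij f (bij_of_inverse (fun y => g ((shiftEquiv _ n σ).symm y)) h₁
    fun y => (h₂ _).trans ((shiftEquiv (M.outer N) n σ).apply_symm_apply y))⟩

/-- Outer tensor products commute with shifts of the right factor. -/
theorem nonempty_outer_shift_right (M : GSMod A) (N : GSMod B) (n : ℤ) (σ : ZMod 2) :
    Nonempty (M.outer (N.shift n σ) ≅ (M.outer N).shift n σ) := by
  have hp : ∀ {d : Deg} {m}, m ∈ M.gr d → ptwist M.internal σ m = ksign σ d.2 • m :=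
    fun h => ptwist_of_mem M.internal σ h
  let f : M.outer (N.shift n σ) ⟶ (M.outer N).shift n σ := outerLift
    (((otm M N).compl₁₂ (ptwist M.internal σ) (shiftEquiv N n σ).symm.toLinearMap).compr₂
      (shiftEquiv (M.outer N) n σ).toLinearMap)
    (fun i j m x hm hx => by
      have := shiftEquiv_mem_add (M.outer N) n σ (otm_mem (ptwist_mem M.internal σ hm)
        ((symm_shiftEquiv_mem N n σ).2 hx))
      rwa [add_assoc, sub_add_cancel] at this)
    (fun i j p l a b m x ha hb hm hx => by
      obtain ⟨x, rfl⟩ := (shiftEquiv N n σ).surjective x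
      change _ • shiftEquiv (M.outer N) n σ (otm M N (ptwist M.internal σ _)
        ((shiftEquiv N n σ).symm _)) = _ • shiftEquiv (M.outer N) n σ (otm M N (ptwist M.internal σ _)
          ((shiftEquiv N n σ).symm _))
      rw [smul_shiftEquiv_of_mem (M.outer N) n σ (b := GSAlg.tmul a b) (tmul_mem_tensorGr ha hb), symm_shiftEquiv_smul_of_mem N n σ hb,
        LinearEquiv.symm_apply_apply, hp hm, hp (M.smul_mem ha hm)]
      simp only [map_zsmul, LinearMap.smul_apply]
      rw [smul_comm (GSAlg.tmul a b), smul_otm a hb hm]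
      simp only [map_zsmul, smul_smul]
      congr 1
      rw [Prod.snd_add, Prod.snd_add]
      generalize i.2 = i; generalize j.2 = j; generalize p.2 = p; clear * -; revert i j p σ; decide)
  have hf : ∀ m x, f.lin (otm M _ m (shiftEquiv N n σ x)) =
      shiftEquiv _ n σ (otm M N (ptwist M.internal σ m) x) := fun _ _ => outerLift_otm _ _ _ _ _
  let g : (M.outer N).carrier →ₗ[F] (M.outer (N.shift n σ)).carrier :=
    outerLiftF ((otm M (N.shift n σ)).compl₁₂ (ptwist M.internal σ) (shiftEquiv N n σ).toLinearMap)
  have hg : ∀ m x, g (otm M N m x) = otm M _ (ptwist M.internal σ m) (shiftEquiv N n σ x) :=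
    fun _ _ => outerLiftF_otm _ _ _
  have h₁ : ∀ y, g ((shiftEquiv _ n σ).symm (f.lin y)) = y := fun y =>
    outer_induction (p := fun y => g ((shiftEquiv _ n σ).symm (f.lin y)) = y) (fun i j m x hm hx => by
      obtain ⟨x, rfl⟩ := (shiftEquiv N n σ).surjective x
      rw [hf, LinearEquiv.symm_apply_apply, hg, ptwist_ptwist])
      (fun x y hx hy => by simp only [map_add, hx, hy]) y
  have h₂ : ∀ y, f.lin (g y) = shiftEquiv _ n σ y := fun y =>
    outer_induction (p := fun y => f.lin (g y) = shiftEquiv _ n σ y) (fun i j m x hm hx => by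
      rw [hg, hf, ptwist_ptwist])
      (fun x y hx hy => by simp only [map_add, hx, hy]) y
  exact ⟨isoOfBij f (bij_of_inverse (fun y => g ((shiftEquiv _ n σ).symm y)) h₁
    fun y => (h₂ _).trans ((shiftEquiv (M.outer N) n σ).apply_symm_apply y))⟩

/-- Induction commutes with shifts. -/
theorem nonempty_ind_shift (φ : GSAlg.Hom B A) (X : GSMod B) (n : ℤ) (σ : ZMod 2) :
    Nonempty ((X.shift n σ).ind φ ≅ (X.ind φ).shift n σ) := by
  have hp : ∀ {d : Deg} {a}, a ∈ A.gr d → ptwist A.internal σ a = ksign σ d.2 • a :=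
    fun h => ptwist_of_mem A.internal σ h
  let f : (X.shift n σ).ind φ ⟶ (X.ind φ).shift n σ := indLift φ
    ((shiftEquiv (X.ind φ) n σ).toLinearMap ∘ₗ indUnit φ X ∘ₗ (shiftEquiv X n σ).symm.toLinearMap)
    (fun d x hx => by
      have := shiftEquiv_mem_add (X.ind φ) n σ (indUnit_mem φ X ((symm_shiftEquiv_mem X n σ).2 hx))
      rwa [sub_add_cancel] at this)
    (fun i j b x hb hx => by
      change shiftEquiv (X.ind φ) n σ (indUnit φ X ((shiftEquiv X n σ).symm _)) =
        _ • shiftEquiv (X.ind φ) n σ (indUnit φ X ((shiftEquiv X n σ).symm _))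
      rw [symm_shiftEquiv_smul_of_mem X n σ hb, smul_shiftEquiv_of_mem _ n σ (φ.map_mem hb), map_zsmul,
        map_zsmul, indUnit_smul])
  have hf : ∀ {i : Deg} {a} x, a ∈ A.gr i → f.lin (imk φ _ (a ⊗ₜ shiftEquiv X n σ x)) =
      ksign σ i.2 • shiftEquiv _ n σ (imk φ X (a ⊗ₜ x)) := fun {i a} x ha => by
    have : f.lin (imk φ _ (a ⊗ₜ shiftEquiv X n σ x)) =
      a • shiftEquiv (X.ind φ) n σ (indUnit φ X x) := indLift_mk φ _ _ _ _ _
    rw [this, smul_shiftEquiv_of_mem _ n σ ha, ← imk_eq]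
  let g : (X.ind φ).carrier →ₗ[F] ((X.shift n σ).ind φ).carrier := indLiftF φ
    (imk φ (X.shift n σ) ∘ₗ TensorProduct.map (ptwist A.internal σ) (shiftEquiv X n σ).toLinearMap)
    (fun i j k a b x ha hb hx => by
      change imk φ _ (ptwist A.internal σ (a * φ.lin b) ⊗ₜ[F] shiftEquiv X n σ x) =
        imk φ _ (ptwist A.internal σ a ⊗ₜ[F] shiftEquiv X n σ (b • x))
      rw [hp (A.mul_mem ha (φ.map_mem hb)), hp ha, shiftEquiv_smul_of_mem X n σ hb,
        ← TensorProduct.smul_tmul', ← TensorProduct.smul_tmul', TensorProduct.tmul_smul, map_zsmul,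
        map_zsmul, map_zsmul, imk_mul, smul_smul, Prod.snd_add, ksign_add_right])
  have hg : ∀ {i : Deg} {a} x, a ∈ A.gr i → g (imk φ X (a ⊗ₜ x)) =
      ksign σ i.2 • imk φ _ (a ⊗ₜ shiftEquiv X n σ x) := fun {i a} x ha => by
    change imk φ _ (ptwist A.internal σ a ⊗ₜ[F] shiftEquiv X n σ x) = _
    rw [hp ha, ← TensorProduct.smul_tmul', map_zsmul]
  refine ⟨isoOfBij f (bij_of_inverse (fun y => g ((shiftEquiv _ n σ).symm y)) (fun y => ?_)
    fun y => ?_)⟩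
  · refine ind_induction φ (p := fun y => g ((shiftEquiv _ n σ).symm (f.lin y)) = y)
      (fun i j a x ha hx => ?_) (fun x y hx hy => by simp only [map_add, hx, hy]) y
    obtain ⟨x, rfl⟩ := (shiftEquiv X n σ).surjective x
    rw [hf x ha, map_zsmul, LinearEquiv.symm_apply_apply, map_zsmul, hg x ha, smul_smul, ksign_self,
      one_smul]
  · obtain ⟨y, rfl⟩ := (shiftEquiv _ n σ).surjective y
    change f.lin (g ((shiftEquiv _ n σ).symm (shiftEquiv _ n σ y))) = _
    rw [LinearEquiv.symm_apply_apply]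
    refine ind_induction φ (p := fun y => f.lin (g y) = shiftEquiv _ n σ y)
      (fun i j a x ha hx => ?_) (fun x y hx hy => by simp only [map_add, hx, hy]) y
    rw [hg x ha, map_zsmul, hf x ha, smul_smul, ksign_self, one_smul]

end GSMod

end SuperTower

namespace SuperTower

variable {F : Type u} [Field F]

/-- There is a short exact sequence `0 → X → Y → Z → 0`. -/
def GSMod.IsExtension {B : GSAlg F} (X Y Z : GSMod B) : Prop :=
  ∃ (f : X ⟶ Y) (g : Y ⟶ Z), GSMod.ShortExact f g

/-- Maps to `X` that are additive for the relation `E` and compatible with the shifts `s` extend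
linearly along the family `x`. -/
def Extends (k : Type) [CommRing k] [Algebra Zqπ k] {I : Type*} {W : Type*} [AddCommGroup W]
    [Module k W] (x : I → W) (E : I → I → I → Prop) (s : ℤ → ZMod 2 → I → I) (X : Type*)
    [AddCommGroup X] [Module k X] : Prop :=
  ∀ v : I → X, (∀ a b c, E a b c → v b = v a + v c) →
    (∀ n ε a, v (s n ε a) = algebraMap Zqπ k (qmon n ε) • v a) → ∃ f : W →ₗ[k] X, ∀ i, f (x i) = v i

section Groth

variable {B : GSAlg F}

theorem Groth.map_monHom {S : GSMod B → Prop} (hS : Groth.ShiftStable S) (s : Deg →+ Deg)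
    {X : Type*} [AddCommGroup X] [Module Zqπ X] (L : Groth B S →+ X)
    (h : ∀ n ε M, L (Groth.shiftEnd hS (s (n, ε)) (Groth.cls M)) = qmon n ε • L (Groth.cls M))
    (r : Zqπ) (y : Groth B S) : L (Groth.monHom hS s r y) = r • L y := by
  induction r using AddMonoidAlgebra.induction_linear with
  | zero => rw [map_zero, LinearMap.zero_apply, map_zero, zero_smul]
  | add a b ha hb => rw [map_add, LinearMap.add_apply, map_add, ha, hb, add_smul]
  | single d z =>
    have hd : (AddMonoidAlgebra.single d z : Zqπ) = z • qmon d.1 d.2 := by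
      rw [qmon, AddMonoidAlgebra.smul_single, smul_eq_mul, mul_one]
    rw [hd, map_zsmul, LinearMap.smul_apply, map_zsmul, Groth.monHom_qmon, smul_assoc]
    congr 1
    exact DFunLike.congr_fun (Groth.addHom_ext (f := L.comp (Groth.shiftEnd hS (s d)).toAddMonoidHom)
      (g := (DistribSMul.toAddMonoidHom X (qmon d.1 d.2)).comp L) fun M => h d.1 d.2 M) y

variable (k : Type) [CommRing k] [Algebra Zqπ k]

theorem extendsG {X : Type*} [AddCommGroup X] [Module k X] :
    Extends k (clsG k (B := B)) GSMod.IsExtension (fun n ε M => M.shift n ε) X := by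
  intro v hv hs
  let : Module Zqπ X := Module.compHom X (algebraMap Zqπ k)
  have : IsScalarTower Zqπ k X := IsScalarTower.of_algebraMap_smul fun _ _ => rfl
  have h0 : ∀ (X Y Z : {_M : GSMod B // True}) (f : X.1 ⟶ Y.1) (g : Y.1 ⟶ Z.1),
      GSMod.ShortExact f g → v X.1 - v Y.1 + v Z.1 = 0 :=
    fun X Y Z f g h => by rw [hv X.1 Y.1 Z.1 ⟨f, g, h⟩]; abel
  let L : GPrime B →+ X := Groth.lift (fun M => v M.1) h0
  have hL : ∀ M, L (gcls M) = v M := fun M => Groth.lift_cls (fun M => v M.1) h0 ⟨M, trivial⟩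
  let L' : GPrime B →ₗ[Zqπ] X :=
    { toFun := L
      map_add' := map_add L
      map_smul' := fun r y => Groth.map_monHom (shiftStable_true B) (AddMonoidHom.id Deg) L
        (fun n ε M => by
          refine (congrArg L (Groth.shiftEnd_cls (shiftStable_true B) (n, ε) M)).trans ?_
          refine (hL _).trans ((hs n ε M.1).trans ?_)
          exact congrArg (fun x : X => qmon n ε • x) (hL M.1).symm) r y }
  refine ⟨L'.liftBaseChange k, fun M => ?_⟩
  exact (LinearMap.liftBaseChange_tmul k L' _ _).trans ((one_smul k _).trans (hL M))

theorem extendsK {X : Type*} [AddCommGroup X] [Module k X] :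
    Extends k (clsK k (B := B)) (fun P Q R => GSMod.IsExtension P.1 Q.1 R.1)
      (fun n ε P => ⟨P.1.shift (-n) ε, P.2.shift (-n) ε⟩) X := by
  intro v hv hs
  let : Module Zqπ X := Module.compHom X (algebraMap Zqπ k)
  have : IsScalarTower Zqπ k X := IsScalarTower.of_algebraMap_smul fun _ _ => rfl
  have h0 : ∀ (X Y Z : {P : GSMod B // P.IsProjective}) (f : X.1 ⟶ Y.1) (g : Y.1 ⟶ Z.1),
      GSMod.ShortExact f g → v X - v Y + v Z = 0 :=
    fun X Y Z f g h => by rw [hv X Y Z ⟨f, g, h⟩]; abel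
  let L : KPrime B →+ X := Groth.lift v h0
  have hL : ∀ M, L (kcls M) = v M := fun M => Groth.lift_cls v h0 M
  let L' : KPrime B →ₗ[Zqπ] X :=
    { toFun := L
      map_add' := map_add L
      map_smul' := fun r y => Groth.map_monHom (shiftStable_isProjective B) negDeg L
        (fun n ε M => by
          refine (congrArg L (Groth.shiftEnd_cls (shiftStable_isProjective B) (-n, ε) M)).trans ?_
          refine (hL _).trans ((hs n ε M).trans ?_)
          exact congrArg (fun x : X => qmon n ε • x) (hL M).symm) r y }
  refine ⟨L'.liftBaseChange k, fun M => ?_⟩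
  exact (LinearMap.liftBaseChange_tmul k L' _ _).trans ((one_smul k _).trans (hL M))

theorem clsG_span : Submodule.span k (Set.range (clsG k (B := B))) = ⊤ := by
  refine eq_top_iff.2 fun x _ => ?_
  let V := Submodule.span k (Set.range (clsG k (B := B)))
  have h1 : ∀ y : GPrime B, (1 ⊗ₜ[Zqπ] y : k ⊗[Zqπ] GPrime B) ∈ V := fun y => by
    have := Groth.addHom_ext (S := fun _ : GSMod B => True)
      (f := (QuotientAddGroup.mk' V.toAddSubgroup).comp (TensorProduct.mk Zqπ k (GPrime B) 1).toAddMonoidHom)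
      (g := 0) fun M => (QuotientAddGroup.eq_zero_iff _).2 (Submodule.subset_span ⟨M.1, rfl⟩)
    exact (QuotientAddGroup.eq_zero_iff _).1 (DFunLike.congr_fun this y)
  exact TensorProduct.induction_on (motive := fun x => x ∈ V) x (zero_mem _)
    (fun a y => by
      have h : a • (1 ⊗ₜ[Zqπ] y : k ⊗[Zqπ] GPrime B) = a ⊗ₜ y := by
        rw [TensorProduct.smul_tmul', smul_eq_mul, mul_one]
      exact (congrArg (· ∈ V) h).mp (V.smul_mem a (h1 y)))
    fun _ _ => add_mem

theorem clsK_span : Submodule.span k (Set.range (clsK k (B := B))) = ⊤ := by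
  refine eq_top_iff.2 fun x _ => ?_
  let V := Submodule.span k (Set.range (clsK k (B := B)))
  have h1 : ∀ y : KPrime B, (1 ⊗ₜ[Zqπ] y : k ⊗[Zqπ] KPrime B) ∈ V := fun y => by
    have := Groth.addHom_ext (S := fun P : GSMod B => P.IsProjective)
      (f := (QuotientAddGroup.mk' V.toAddSubgroup).comp (TensorProduct.mk Zqπ k (KPrime B) 1).toAddMonoidHom)
      (g := 0) fun M => (QuotientAddGroup.eq_zero_iff _).2 (Submodule.subset_span ⟨M, rfl⟩)
    exact (QuotientAddGroup.eq_zero_iff _).1 (DFunLike.congr_fun this y)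
  exact TensorProduct.induction_on (motive := fun x => x ∈ V) x (zero_mem _)
    (fun a y => by
      have h : a • (1 ⊗ₜ[Zqπ] y : k ⊗[Zqπ] KPrime B) = a ⊗ₜ y := by
        rw [TensorProduct.smul_tmul', smul_eq_mul, mul_one]
      exact (congrArg (· ∈ V) h).mp (V.smul_mem a (h1 y)))
    fun _ _ => add_mem

theorem clsG_of_iso {M N : GSMod B} (e : M ≅ N) : clsG k M = clsG k N :=
  congrArg (fun x => (1 ⊗ₜ[Zqπ] x : k ⊗[Zqπ] GPrime B)) (Groth.cls_iso (S := fun _ => True)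
    (M := ⟨M, trivial⟩) (N := ⟨N, trivial⟩) trivial e)

theorem clsG_shift (M : GSMod B) (n : ℤ) (ε : ZMod 2) :
    clsG k (M.shift n ε) = algebraMap Zqπ k (qmon n ε) • clsG k M := by
  refine (congrArg (fun x => (1 ⊗ₜ[Zqπ] x : k ⊗[Zqπ] GPrime B)) (qmon_smul_gcls n ε M).symm).trans ?_
  exact (TensorProduct.tmul_smul _ _ _).trans
    (algebraMap_smul k (qmon n ε) (1 ⊗ₜ[Zqπ] gcls M : k ⊗[Zqπ] GPrime B)).symm

theorem clsG_extension {X Y Z : GSMod B} (h : GSMod.IsExtension X Y Z) :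
    clsG k Y = clsG k X + clsG k Z := by
  obtain ⟨f, g, h⟩ := h
  have : gcls X - gcls Y + gcls Z = 0 := Groth.cls_exact (S := fun _ => True) (X := ⟨X, trivial⟩)
    (Y := ⟨Y, trivial⟩) (Z := ⟨Z, trivial⟩) h
  rw [sub_add_eq_add_sub, sub_eq_zero] at this
  exact (congrArg (fun x => (1 ⊗ₜ[Zqπ] x : k ⊗[Zqπ] GPrime B)) this.symm).trans
    (TensorProduct.tmul_add _ _ _)

theorem clsKOf_eq {P : GSMod B} (hP : P.IsProjective) : clsKOf k P = clsK k ⟨P, hP⟩ :=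
  dif_pos hP

theorem clsKOf_of_iso {P Q : GSMod B} (hP : P.IsProjective) (hQ : Q.IsProjective) (e : P ≅ Q) :
    clsKOf k P = clsKOf k Q := by
  rw [clsKOf_eq k hP, clsKOf_eq k hQ]
  exact congrArg (fun x => (1 ⊗ₜ[Zqπ] x : k ⊗[Zqπ] KPrime B))
    (Groth.cls_iso (S := fun P => P.IsProjective) GSMod.IsProjective.zeroMod e)

theorem clsKOf_shift {P : GSMod B} (hP : P.IsProjective) (n : ℤ) (ε : ZMod 2) :
    clsKOf k (P.shift (-n) ε) = algebraMap Zqπ k (qmon n ε) • clsKOf k P := by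
  rw [clsKOf_eq k hP, clsKOf_eq k (hP.shift (-n) ε)]
  refine (congrArg (fun x => (1 ⊗ₜ[Zqπ] x : k ⊗[Zqπ] KPrime B))
    (qmon_smul_kcls n ε ⟨P, hP⟩).symm).trans ?_
  exact (TensorProduct.tmul_smul _ _ _).trans
    (algebraMap_smul k (qmon n ε) (1 ⊗ₜ[Zqπ] kcls ⟨P, hP⟩ : k ⊗[Zqπ] KPrime B)).symm

theorem clsKOf_extension {X Y Z : GSMod B} (hX : X.IsProjective) (hY : Y.IsProjective)
    (hZ : Z.IsProjective) (h : GSMod.IsExtension X Y Z) :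
    clsKOf k Y = clsKOf k X + clsKOf k Z := by
  obtain ⟨f, g, h⟩ := h
  rw [clsKOf_eq k hX, clsKOf_eq k hY, clsKOf_eq k hZ]
  have : kcls ⟨X, hX⟩ - kcls ⟨Y, hY⟩ + kcls ⟨Z, hZ⟩ = 0 :=
    Groth.cls_exact (S := fun P => P.IsProjective) (X := ⟨X, hX⟩) (Y := ⟨Y, hY⟩) (Z := ⟨Z, hZ⟩) h
  rw [sub_add_eq_add_sub, sub_eq_zero] at this
  exact (congrArg (fun x => (1 ⊗ₜ[Zqπ] x : k ⊗[Zqπ] KPrime B)) this.symm).trans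
    (TensorProduct.tmul_add _ _ _)

theorem extendsKOf {X : Type*} [AddCommGroup X] [Module k X] :
    Extends k (fun P : {P : GSMod B // P.IsProjective} => clsKOf k P.1)
      (fun P Q R => GSMod.IsExtension P.1 Q.1 R.1)
      (fun n ε P => ⟨P.1.shift (-n) ε, P.2.shift (-n) ε⟩) X := by
  rw [show (fun P : {P : GSMod B // P.IsProjective} => clsKOf k P.1) = clsK k from
    funext fun P => clsKOf_eq k P.2]
  exact extendsK k

theorem clsKOf_span : Submodule.span k (Set.range
    fun P : {P : GSMod B // P.IsProjective} => clsKOf k P.1) = ⊤ := by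
  rw [show (fun P : {P : GSMod B // P.IsProjective} => clsKOf k P.1) = clsK k from
    funext fun P => clsKOf_eq k P.2]
  exact clsK_span k

/-- Maps of two variables that are additive and compatible with shifts extend bilinearly. -/
theorem bilinOf_extends {I J X Y Z : Type*} [AddCommGroup X] [Module k X] [AddCommGroup Y]
    [Module k Y] [AddCommGroup Z] [Module k Z] {x : I → X} {y : J → Y} {E : I → I → I → Prop}
    {E' : J → J → J → Prop} {s : ℤ → ZMod 2 → I → I} {s' : ℤ → ZMod 2 → J → J}
    (hx : Extends k x E s (Y →ₗ[k] Z)) (hy : Extends k y E' s' Z)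
    (hspan : Submodule.span k (Set.range y) = ⊤) (v : I → J → Z)
    (h₁ : ∀ a b c j, E a b c → v b j = v a j + v c j)
    (h₂ : ∀ n ε a j, v (s n ε a) j = algebraMap Zqπ k (qmon n ε) • v a j)
    (h₃ : ∀ i a b c, E' a b c → v i b = v i a + v i c)
    (h₄ : ∀ n ε i a, v i (s' n ε a) = algebraMap Zqπ k (qmon n ε) • v i a) (i : I) (j : J) :
    bilinOf (k := k) x y v (x i) (y j) = v i j := by
  have hex : ∃ f : X →ₗ[k] Y →ₗ[k] Z, ∀ i j, f (x i) (y j) = v i j := by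
    choose g hg using fun i => hy (v i) (fun a b c h => h₃ i a b c h) (fun n ε a => h₄ n ε i a)
    have hext : ∀ {f f' : Y →ₗ[k] Z}, (∀ j, f (y j) = f' (y j)) → f = f' := fun h =>
      LinearMap.ext_on_range hspan h
    obtain ⟨f, hf⟩ := hx g
      (fun a b c h => hext fun j => by rw [LinearMap.add_apply, hg, hg, hg, h₁ a b c j h])
      (fun n ε a => hext fun j => by rw [LinearMap.smul_apply, hg, hg, h₂])
    exact ⟨f, fun i j => by rw [hf, hg]⟩
  rw [bilinOf, dif_pos hex]
  exact hex.choose_spec i j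

end Groth

section Products

variable (k : Type) [CommRing k] [Algebra Zqπ k] {A B C : GSAlg F}

open GSMod

theorem pairing_cls {P : GSMod B} (hP : P.IsProjective) (M : GSMod B) :
    pairing k B (clsKOf k P) (clsG k M) = algebraMap Zqπ k (grdimHom P M) := by
  rw [clsKOf_eq k hP]
  exact bilinOf_extends k (extendsK k) (extendsG k) (clsG_span k)
    (fun P M => algebraMap Zqπ k (grdimHom P.1 M))
    (fun X Y Z M ⟨f, g, h⟩ => by
      rw [grdimHom_of_shortExact_left h Z.2, map_add])
    (fun n ε P M => by rw [grdimHom_shift_left, neg_neg, map_mul, smul_eq_mul])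
    (fun P X Y Z ⟨f, g, h⟩ => by rw [grdimHom_of_shortExact P.2 h, map_add])
    (fun n ε P M => by rw [grdimHom_shift, map_mul, smul_eq_mul]) ⟨P, hP⟩ M

theorem bilinOf_clsG (Φ : GSMod (A.tensor B) ⥤ GSMod C) (hΦ : IsExact Φ)
    (hs : ∀ X n ε, Nonempty (Φ.obj (X.shift n ε) ≅ (Φ.obj X).shift n ε)) (M : GSMod A)
    (N : GSMod B) : bilinOf (k := k) (clsG k) (clsG k) (fun M N => clsG k (Φ.obj (M.outer N)))
      (clsG k M) (clsG k N) = clsG k (Φ.obj (M.outer N)) :=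
  bilinOf_extends k (extendsG k) (extendsG k) (clsG_span k)
    (fun M N => clsG k (Φ.obj (outer M N)))
    (fun _ _ _ N ⟨f, g, h⟩ => clsG_extension k ⟨_, _, hΦ _ _ (outerFunctorRight_exact N f g h)⟩)
    (fun n ε M N => (clsG_of_iso k (Φ.mapIso (nonempty_outer_shift_left M N n ε).some ≪≫
      (hs _ n ε).some)).trans (clsG_shift k _ n ε))
    (fun M _ _ _ ⟨f, g, h⟩ => clsG_extension k ⟨_, _, hΦ _ _ (outerFunctor_exact M f g h)⟩)
    (fun n ε M N => (clsG_of_iso k (Φ.mapIso (nonempty_outer_shift_right M N n ε).some ≪≫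
      (hs _ n ε).some)).trans (clsG_shift k _ n ε)) M N

theorem bilinOf_clsKOf (Φ : GSMod (A.tensor B) ⥤ GSMod C) (hΦ : IsExact Φ)
    (hs : ∀ X n ε, Nonempty (Φ.obj (X.shift n ε) ≅ (Φ.obj X).shift n ε))
    (hp : ∀ X, X.IsProjective → (Φ.obj X).IsProjective) {P : GSMod A}
    {Q : GSMod B} (hP : P.IsProjective) (hQ : Q.IsProjective) :
    bilinOf (k := k) (fun P : {P : GSMod A // P.IsProjective} => clsKOf k P.1)
      (fun Q : {Q : GSMod B // Q.IsProjective} => clsKOf k Q.1)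
      (fun P Q => clsKOf k (Φ.obj (P.1.outer Q.1))) (clsKOf k P) (clsKOf k Q) =
        clsKOf k (Φ.obj (P.outer Q)) := by
  have hp' : ∀ (P : {P : GSMod A // P.IsProjective}) (Q : {Q : GSMod B // Q.IsProjective}),
      (Φ.obj (outer P.1 Q.1)).IsProjective := fun P Q => hp _ (P.2.outer Q.2)
  have hsh : ∀ {X : GSMod (A.tensor B)} {Y} (n : ℤ) (ε : ZMod 2), X.IsProjective →
      Y.IsProjective → (Y ≅ X.shift (-n) ε) →
      clsKOf k (Φ.obj Y) = algebraMap Zqπ k (qmon n ε) • clsKOf k (Φ.obj X) :=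
    fun {X Y} n ε hX hY e => (clsKOf_of_iso k (hp _ hY) ((hp _ hX).shift (-n) ε)
      (Φ.mapIso e ≪≫ (hs X (-n) ε).some)).trans (clsKOf_shift k (hp _ hX) n ε)
  exact bilinOf_extends k (extendsKOf k) (extendsKOf k) (clsKOf_span k)
    (fun P Q => clsKOf k (Φ.obj (outer P.1 Q.1)))
    (fun X Y Z Q ⟨f, g, h⟩ => clsKOf_extension k (hp' X Q) (hp' Y Q) (hp' Z Q)
      ⟨_, _, hΦ _ _ (outerFunctorRight_exact Q.1 f g h)⟩)
    (fun n ε P Q => hsh n ε (P.2.outer Q.2) ((P.2.shift (-n) ε).outer Q.2)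
      (nonempty_outer_shift_left P.1 Q.1 (-n) ε).some)
    (fun P X Y Z ⟨f, g, h⟩ => clsKOf_extension k (hp' P X) (hp' P Y) (hp' P Z)
      ⟨_, _, hΦ _ _ (outerFunctor_exact P.1 f g h)⟩)
    (fun n ε P Q => hsh n ε (P.2.outer Q.2) (P.2.outer (Q.2.shift (-n) ε))
      (nonempty_outer_shift_right P.1 Q.1 (-n) ε).some) ⟨P, hP⟩ ⟨Q, hQ⟩

end Products

namespace Tower

variable {Λ : Type} [AddCommMonoid Λ] (T : Tower F Λ)

theorem mulG_G {l m n : Λ} (h : l + m = n) (M : GSMod (T.A l)) (N : GSMod (T.A m)) :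
    T.mulG h (T.G M) (T.G N) = T.G (T.nabla h M N) :=
  bilinOf_clsG T.kk (GSMod.indFunctor (T.ρ h)) (GSMod.indFunctor_exact _ (T.projective h).2)
    (fun X n ε => GSMod.nonempty_ind_shift _ X n ε) M N

theorem boxG_G {l m : Λ} (M : GSMod (T.A l)) (N : GSMod (T.A m)) :
    T.boxG l m (T.G M ⊗ₜ[T.kk] T.G N) = clsG T.kk (M.outer N) :=
  bilinOf_clsG T.kk (𝟭 _) (fun _ _ h => h) (fun _ _ _ => ⟨Iso.refl _⟩) M N

theorem mulK_K {l m n : Λ} (h : l + m = n) {P : GSMod (T.A l)} {Q : GSMod (T.A m)}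
    (hP : P.IsProjective) (hQ : Q.IsProjective) :
    T.mulK h (T.K P) (T.K Q) = T.K (T.nabla h P Q) :=
  bilinOf_clsKOf T.kk (GSMod.indFunctor (T.ρ h)) (GSMod.indFunctor_exact _ (T.projective h).2)
    (fun X n ε => GSMod.nonempty_ind_shift _ X n ε) (fun _ hX => hX.ind _) hP hQ

theorem boxK_K {l m : Λ} {P : GSMod (T.A l)} {Q : GSMod (T.A m)} (hP : P.IsProjective)
    (hQ : Q.IsProjective) : T.boxK l m (T.K P ⊗ₜ[T.kk] T.K Q) = clsKOf T.kk (P.outer Q) :=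
  bilinOf_clsKOf T.kk (𝟭 _) (fun _ _ h => h) (fun _ _ _ => ⟨Iso.refl _⟩) (fun _ h => h) hP hQ

end Tower

end SuperTower

namespace SuperTower

variable {F : Type u} [Field F]

namespace GSMod

variable {A B C D : GSAlg F}

section HomOuter

/-- The action of `B ⊗ D` on the outer tensor product of an `A ⊗ B`-supermodule and a
`C ⊗ D`-supermodule. -/
noncomputable def swapAct (M : GSMod (A.tensor B)) (N : GSMod (C.tensor D)) :
    (B.tensor D).carrier →ₗ[F] (M.outer N).carrier →ₗ[F] (M.outer N).carrier :=
  (M.outer N).act ∘ₗ (GSAlg.swap23 A B C D).lin ∘ₗ GSAlg.tmulLin (A.tensor C) (B.tensor D) 1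

theorem swap23_four (a : A.carrier) {i j : Deg} {c : C.carrier} {b : B.carrier} (d : D.carrier)
    (hc : c ∈ C.gr i) (hb : b ∈ B.gr j) :
    (GSAlg.swap23 A B C D).lin (GSAlg.tmul (GSAlg.tmul a c) (GSAlg.tmul b d)) =
      ksign i.2 j.2 • GSAlg.tmul (GSAlg.tmul a b) (GSAlg.tmul c d) := GSAlg.swapLin_four a hc hb d

theorem swap23_one : (GSAlg.swap23 A B C D).lin 1 = 1 := by
  rw [GSAlg.tensor_one, GSAlg.tensor_one, GSAlg.tensor_one, swap23_four _ _ C.one_mem B.one_mem,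
    Prod.snd_zero, ksign_zero_left, one_smul, GSAlg.tensor_one, GSAlg.tensor_one, GSAlg.tensor_one]

variable {M : GSMod (A.tensor B)} {N : GSMod (C.tensor D)} {P : GSMod B} {Q : GSMod D}

theorem swapAct_otm {i j k : Deg} {b : B.carrier} {d : D.carrier} (hb : b ∈ B.gr i)
    (hd : d ∈ D.gr j) {m : M.carrier} (hm : m ∈ M.gr k) (n : N.carrier) :
    swapAct M N (GSAlg.tmul b d) (otm M N m n) =
      ksign j.2 k.2 • otm M N (M.rightAct b m) (N.rightAct d n) := by
  change (GSAlg.swap23 A B C D).lin (GSAlg.tmul 1 (GSAlg.tmul b d)) • otm M N m n = _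
  rw [GSAlg.tensor_one, swap23_four _ _ C.one_mem hb, Prod.snd_zero, ksign_zero_left, one_smul,
    smul_otm _ (GSAlg.tmul_mem C.one_mem hd) hm, zero_add]
  rfl

theorem swapLeft_otm {j k : Deg} (a : A.carrier) {c : C.carrier}
    (hc : c ∈ C.gr j) {m : M.carrier} (hm : m ∈ M.gr k) (n : N.carrier) :
    (GSAlg.swap23 A B C D).lin (GSAlg.tmul (GSAlg.tmul a c) 1) • otm M N m n =
      ksign j.2 k.2 • otm M N (M.leftAct a m) (N.leftAct c n) := by
  rw [GSAlg.tensor_one, swap23_four _ _ hc B.one_mem, Prod.snd_zero, ksign_zero_right, one_smul,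
    smul_otm _ (GSAlg.tmul_mem hc D.one_mem) hm, add_zero]
  rfl

/-- The map `f ⊗ g ↦ (p ⊗ q ↦ (-1)^{ḡ p̄} f(p) ⊗ g(q))`. -/
noncomputable def homOuterF (P : GSMod B) (Q : GSMod D) (M : GSMod (A.tensor B))
    (N : GSMod (C.tensor D)) : (hom P M).carrier →ₗ[F] (hom Q N).carrier →ₗ[F]
      ((P.outer Q).carrier →ₗ[F] (M.outer N).carrier) :=
  LinearMap.mk₂ F (fun f g => ∑ ε : ZMod 2, outerLiftF ((otm M N).compl₁₂
      (homι P M f ∘ₗ ptwist P.internal ε) (homι Q N (parityPart (hom Q N).internal ε g))))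
    (fun f f' g => outer_lin_ext fun _ _ p q _ _ => by
      simp [LinearMap.sum_apply, outerLiftF_otm, Finset.sum_add_distrib])
    (fun c f g => outer_lin_ext fun _ _ p q _ _ => by
      simp [LinearMap.sum_apply, outerLiftF_otm, Finset.smul_sum])
    (fun f g g' => outer_lin_ext fun _ _ p q _ _ => by
      simp [LinearMap.sum_apply, outerLiftF_otm, Finset.sum_add_distrib])
    (fun c f g => outer_lin_ext fun _ _ p q _ _ => by
      simp [LinearMap.sum_apply, outerLiftF_otm, Finset.smul_sum])

theorem homOuterF_otm (f : (hom P M).carrier) {e j : Deg} {g : (hom Q N).carrier}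
    (hg : g ∈ (hom Q N).gr e) {p : P.carrier} (hp : p ∈ P.gr j) (q : Q.carrier) :
    homOuterF P Q M N f g (otm P Q p q) =
      ksign e.2 j.2 • otm M N (homι P M f p) (homι Q N g q) := by
  change (∑ ε : ZMod 2, outerLiftF ((otm M N).compl₁₂ (homι P M f ∘ₗ ptwist P.internal ε)
    (homι Q N (parityPart (hom Q N).internal ε g)))) (otm P Q p q) = _
  rw [LinearMap.sum_apply, Finset.sum_eq_single e.2]
  · rw [outerLiftF_otm, LinearMap.compl₁₂_apply, LinearMap.comp_apply, ptwist_of_mem _ _ hp,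
      parityPart_of_mem _ _ hg, if_pos rfl, map_zsmul, map_zsmul, LinearMap.smul_apply]
  · intro ε _ hε
    rw [outerLiftF_otm, LinearMap.compl₁₂_apply, parityPart_of_mem _ _ hg, if_neg hε.symm, map_zero,
      LinearMap.zero_apply, map_zero]
  · exact fun h => absurd (Finset.mem_univ _) h

theorem homι_rightAct {i j : Deg} {f : (hom P M).carrier} (hf : f ∈ (hom P M).gr i) {b : B.carrier}
    (hb : b ∈ B.gr j) (p : P.carrier) :
    homι P M f (b • p) = ksign i.2 j.2 • M.rightAct b (homι P M f p) := hf.2 j b p hb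

theorem homι_apply_mem {i j : Deg} {f : (hom P M).carrier} (hf : f ∈ (hom P M).gr i) {p : P.carrier}
    (hp : p ∈ P.gr j) : homι P M f p ∈ M.gr (i + j) := hf.1 j p hp

theorem homOuterF_mem {i e : Deg} {f : (hom P M).carrier} {g : (hom Q N).carrier}
    (hf : f ∈ (hom P M).gr i) (hg : g ∈ (hom Q N).gr e) :
    homOuterF P Q M N f g ∈ homPiece (P.outer Q) (M.outer N).gr (swapAct M N) (i + e) := by
  refine ⟨fun j w hw => ?_, fun i' b w hb => ?_⟩
  · refine map_outer_mem (homOuterF P Q M N f g) _ (fun k l p q hp hq h => ?_) hw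
    rw [homOuterF_otm f hg hp, ← h, add_add_add_comm]
    exact zsmul_mem (otm_mem (hf.1 k p hp) (hg.1 l q hq)) _
  · have : homOuterF P Q M N f g ∘ₗ (P.outer Q).act b = ksign (i + e).2 i'.2 •
        (swapAct M N b ∘ₗ homOuterF P Q M N f g) := by
      refine outer_lin_ext fun k l p q hp hq => sub_eq_zero.1 ((Submodule.mem_bot F).1 ?_)
      refine GSAlg.map_mem_of_tmul (homOuterF P Q M N f g ∘ₗ (P.outer Q).act.flip (otm P Q p q) -
        ksign (i + e).2 i'.2 • (swapAct M N).flip (homOuterF P Q M N f g (otm P Q p q))) ⊥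
        (fun s t b d hb hd h => (Submodule.mem_bot F).2 ((LinearMap.sub_apply _ _ _).trans (sub_eq_zero.2 ?_))) hb
      change homOuterF P Q M N f g (GSAlg.tmul b d • otm P Q p q) =
        ksign (i + e).2 i'.2 • swapAct M N (GSAlg.tmul b d) (homOuterF P Q M N f g (otm P Q p q))
      rw [smul_otm b hd hp, map_zsmul, homOuterF_otm f hg (P.smul_mem hb hp), homOuterF_otm f hg hp,
        map_zsmul, swapAct_otm hb hd (homι_apply_mem hf hp), homι_rightAct hf hb, homι_rightAct hg hd,
        map_zsmul, map_zsmul, LinearMap.smul_apply, ← h]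
      simp only [smul_smul]
      congr 1
      simp only [Prod.snd_add]
      generalize i.2 = i, e.2 = e, s.2 = s, t.2 = t, k.2 = k
      clear * -
      revert i e s t k
      decide
    exact LinearMap.congr_fun this w

/-- The map `f ⊗ g ↦ (p ⊗ q ↦ (-1)^{ḡ p̄} f(p) ⊗ g(q))` to the space of homomorphisms. -/
noncomputable def homOuterLin (P : GSMod B) (Q : GSMod D) (M : GSMod (A.tensor B))
    (N : GSMod (C.tensor D)) : ((hom P M).outer (hom Q N)).carrier →ₗ[F]
      (hom (P.outer Q) ((M.outer N).res (GSAlg.swap23 A B C D))).carrier :=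
  (LinearMap.compRight F (resPr (GSAlg.swap23 A B C D) (M.outer N)) ∘ₗ
    outerLiftF (homOuterF P Q M N)).codRestrict (HomCarrier (P.outer Q) _) fun z =>
      outer_induction (p := fun z => LinearMap.compRight F
        (resPr (GSAlg.swap23 A B C D) (M.outer N)) (outerLiftF (homOuterF P Q M N) z) ∈
          HomCarrier (P.outer Q) ((M.outer N).res (GSAlg.swap23 A B C D)))
        (fun i j f g hf hg => homPiece_le _ _ (i + j) ((resι_comp_mem _ _ (ρ := swapAct M N)
          (fun _ _ => rfl)).1 (by
            rw [outerLiftF_otm, show resι (GSAlg.swap23 A B C D) (M.outer N) ∘ₗ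
              LinearMap.compRight F (resPr (GSAlg.swap23 A B C D) (M.outer N))
                (homOuterF P Q M N f g) = homOuterF P Q M N f g from LinearMap.ext fun w => by
                  refine (resι_resPr _ _ _).trans ?_; rw [swap23_one, one_smul]]
            exact homOuterF_mem hf hg)))
        (fun x y hx hy => by rw [map_add, map_add]; exact add_mem hx hy) z

theorem homι_homOuterLin (z : ((hom P M).outer (hom Q N)).carrier) (w : (P.outer Q).carrier) :
    resι _ _ (homι _ _ (homOuterLin P Q M N z) w) = outerLiftF (homOuterF P Q M N) z w := by
  refine (resι_resPr _ _ _).trans ?_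
  rw [swap23_one, one_smul]

theorem homOuterLin_mem {d : Deg} {z : ((hom P M).outer (hom Q N)).carrier}
    (hz : z ∈ ((hom P M).outer (hom Q N)).gr d) : homOuterLin P Q M N z ∈
      (hom (P.outer Q) ((M.outer N).res (GSAlg.swap23 A B C D))).gr d := by
  refine map_outer_mem (homOuterLin P Q M N) _ (fun i j f g hf hg h => ?_) hz
  refine homι_mem.1 ((resι_comp_mem _ _ (ρ := swapAct M N) (fun _ _ => rfl)).1 ?_)
  rw [show resι _ _ ∘ₗ homι _ _ (homOuterLin P Q M N (otm _ _ f g)) = homOuterF P Q M N f g from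
    LinearMap.ext fun w => (homι_homOuterLin _ w).trans (by rw [outerLiftF_otm]), ← h]
  exact homOuterF_mem hf hg

theorem homOuterLin_smul {j : Deg} (a : A.carrier) {c : C.carrier}
    (hc : c ∈ C.gr j) (z : ((hom P M).outer (hom Q N)).carrier) :
    homOuterLin P Q M N (GSAlg.tmul a c • z) = GSAlg.tmul a c • homOuterLin P Q M N z := by
  refine outer_induction (p := fun z => homOuterLin P Q M N (GSAlg.tmul a c • z) =
    GSAlg.tmul a c • homOuterLin P Q M N z) (fun k e f g hf hg => ?_)
    (fun x y hx hy => by simp only [map_add, smul_add, hx, hy]) z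
  refine homι_injective (lin_ext_hom (P.outer Q).internal fun d w hw => resι_injective _ _ ?_)
  refine outer_induction (p := fun w => resι _ _ (homι _ _ (homOuterLin P Q M N
    (GSAlg.tmul a c • otm _ _ f g)) w) = resι _ _ (homι _ _ (GSAlg.tmul a c •
      homOuterLin P Q M N (otm _ _ f g)) w)) (fun r l p q hp hq => ?_)
    (fun x y hx hy => by simp only [map_add, hx, hy]) w
  rw [homι_homOuterLin, homι_smul_apply, resι_smul, homι_homOuterLin, smul_otm a hc hf, map_zsmul,
    LinearMap.smul_apply, outerLiftF_otm, outerLiftF_otm,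
    homOuterF_otm _ ((hom Q N).smul_mem hc hg) hp, homOuterF_otm _ hg hp]
  refine Eq.trans ?_ (smul_comm _ _ _)
  rw [swapLeft_otm a hc (homι_apply_mem hf hp), homι_smul, homι_smul, LinearMap.comp_apply,
    LinearMap.comp_apply]
  simp only [smul_smul, Prod.snd_add, ksign_add_left, ksign_add_right]
  congr 1
  ring

/-- The map `f ⊗ g ↦ (p ⊗ q ↦ (-1)^{ḡ p̄} f(p) ⊗ g(q))` as a morphism of supermodules. -/
noncomputable def homOuter (P : GSMod B) (Q : GSMod D) (M : GSMod (A.tensor B))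
    (N : GSMod (C.tensor D)) :
    (hom P M).outer (hom Q N) ⟶ hom (P.outer Q) ((M.outer N).res (GSAlg.swap23 A B C D)) :=
  homOfF (homOuterLin P Q M N) (fun _ _ hz => homOuterLin_mem hz) (fun _ _ b z _ _ => by
    refine GSAlg.tensor_induction (p := fun b => homOuterLin P Q M N (b • z) =
      b • homOuterLin P Q M N z) (fun i j a c _ hc => homOuterLin_smul a hc z)
      (fun x y hx hy => by rw [add_smul, map_add, hx, hy, add_smul]) b)

section Inverse

variable (M N) {a b : Deg} {t : P.carrier →ₗ[B.carrier] B.carrier}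
  {s : Q.carrier →ₗ[D.carrier] D.carrier} (ht : ∀ j p, p ∈ P.gr j → t p ∈ B.gr (j - a))
  (hs : ∀ j q, q ∈ Q.gr j → s q ∈ D.gr (j - b))

/-- The map `m ⊗ n ↦ ± (p ↦ ± t(p) m) ⊗ (q ↦ ± s(q) n)`. -/
noncomputable def outerFormHom :
    (M.outer N).carrier →ₗ[F] ((hom P M).outer (hom Q N)).carrier :=
  ksign b.2 a.2 • outerLiftF ((otm (hom P M) (hom Q N)).compl₁₂ (formHom M t a ht)
    (formHom N s b hs ∘ₗ ptwist N.internal a.2))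

theorem outerFormHom_otm (m : M.carrier) {j : Deg} {n : N.carrier} (hn : n ∈ N.gr j) :
    outerFormHom M N ht hs (otm M N m n) =
      (ksign b.2 a.2 * ksign a.2 j.2) • otm _ _ (formHom M t a ht m) (formHom N s b hs n) := by
  rw [outerFormHom, LinearMap.smul_apply, outerLiftF_otm, LinearMap.compl₁₂_apply,
    LinearMap.comp_apply, ptwist_of_mem _ _ hn, map_zsmul, map_zsmul, smul_smul]

theorem homOuterF_outerFormHom {k r l : Deg} {w : (M.outer N).carrier} (hw : w ∈ (M.outer N).gr k)
    {p : P.carrier} (hp : p ∈ P.gr r) {q : Q.carrier} (hq : q ∈ Q.gr l) :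
    outerLiftF (homOuterF P Q M N) (outerFormHom M N ht hs w) (otm P Q p q) =
      (ksign (k.2 + a.2 + b.2) (r.2 + a.2 + l.2 + b.2) * ksign (l.2 + b.2) a.2) •
        swapAct M N (GSAlg.tmul (t p) (s q)) w := by
  refine sub_eq_zero.1 ((Submodule.mem_bot F).1 ?_)
  refine map_outer_mem ((outerLiftF (homOuterF P Q M N) ∘ₗ outerFormHom M N ht hs).flip (otm P Q p q) -
    (ksign (k.2 + a.2 + b.2) (r.2 + a.2 + l.2 + b.2) * ksign (l.2 + b.2) a.2) •
      swapAct M N (GSAlg.tmul (t p) (s q))) ⊥ (fun i j m n hm hn h => (Submodule.mem_bot F).2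
        ((LinearMap.sub_apply _ _ _).trans (sub_eq_zero.2 ?_))) hw
  change outerLiftF (homOuterF P Q M N) (outerFormHom M N ht hs (otm M N m n)) (otm P Q p q) =
    (ksign (k.2 + a.2 + b.2) (r.2 + a.2 + l.2 + b.2) * ksign (l.2 + b.2) a.2) •
      swapAct M N (GSAlg.tmul (t p) (s q)) (otm M N m n)
  rw [outerFormHom_otm M N ht hs m hn, map_zsmul, LinearMap.smul_apply, outerLiftF_otm,
    homOuterF_otm _ (formHom_mem N s b hs hn) hp, homι_formHom, homι_formHom,
    formSmul_apply M t a hm, formSmul_apply N s b hn, ptwist_of_mem _ _ (ht r p hp),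
    ptwist_of_mem _ _ (hs l q hq), swapAct_otm (ht r p hp) (hs l q hq) hm, map_zsmul, map_zsmul,
    LinearMap.smul_apply, LinearMap.smul_apply, map_zsmul, map_zsmul, LinearMap.smul_apply, ← h]
  simp only [smul_smul]
  congr 1
  simp only [Prod.snd_add, Prod.snd_sub]
  generalize a.2 = a, b.2 = b, i.2 = i, j.2 = j, r.2 = r, l.2 = l
  clear * -
  revert a b i j r l
  decide

end Inverse

theorem homOuter_bijective (hP : P.IsProjective) (hQ : Q.IsProjective) (M : GSMod (A.tensor B))
    (N : GSMod (C.tensor D)) : Function.Bijective (homOuter P Q M N).lin := by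
  obtain ⟨ι, _, a, x, t, hx, ht, h⟩ := hP.exists_homogeneous_dualBasis
  obtain ⟨κ, _, b, y, s, hy, hs, h'⟩ := hQ.exists_homogeneous_dualBasis
  refine bij_of_inverse (fun w => ∑ i, ∑ j, outerFormHom M N (ht i) (hs j)
    (resι _ _ (homι _ _ w (otm P Q (x i) (y j))))) (fun z => ?_) (fun w => ?_)
  · refine outer_induction (p := fun z => ∑ i, ∑ j, outerFormHom M N (ht i) (hs j)
      (resι _ _ (homι _ _ (homOuterLin P Q M N z) (otm P Q (x i) (y j)))) = z)
      (fun d e f g hf hg => ?_) (fun z z' hz hz' => by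
        simp only [map_add, LinearMap.add_apply, Finset.sum_add_distrib, hz, hz']) z
    have hij : ∀ i j, outerFormHom M N (ht i) (hs j) (resι _ _ (homι _ _ (homOuterLin P Q M N
        (otm _ _ f g)) (otm P Q (x i) (y j)))) = otm _ _ (formHom M (t i) (a i) (ht i)
          (homι P M f (x i))) (formHom N (s j) (b j) (hs j) (homι Q N g (y j))) := fun i j => by
      rw [homι_homOuterLin, outerLiftF_otm, homOuterF_otm f hg (hx i), map_zsmul,
        outerFormHom_otm M N _ _ _ (homι_apply_mem hg (hy j)), smul_smul]
      refine (congrArg (· • _) ?_).trans (one_smul ℤ _)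
      rw [Prod.snd_add]
      generalize (a i).2 = a, (b j).2 = b, e.2 = e
      clear * -
      revert a b e
      decide
    simp only [hij]
    refine Eq.trans ?_ (congrArg₂ (fun f g => otm _ _ f g) (sum_formHom M hx ht h f)
      (sum_formHom N hy hs h' g))
    rw [Finset.sum_comm]
    simp only [map_sum, LinearMap.sum_apply]
  · change homOuterLin P Q M N _ = w
    refine hom_induction (hom (P.outer Q) _).internal (p := fun w => homOuterLin P Q M N
      (∑ i, ∑ j, outerFormHom M N (ht i) (hs j) (resι _ _ (homι _ _ w (otm P Q (x i) (y j))))) = w)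
      (fun e w hw => ?_) (fun w w' hz hz' => by
        simp only [map_add, LinearMap.add_apply, Finset.sum_add_distrib] at hz hz' ⊢
        rw [hz, hz']) w
    have hw' := (resι_comp_mem _ _ (ρ := swapAct M N) (fun _ _ => rfl)).2 (homι_mem.2 hw)
    refine homι_injective (lin_ext_hom (P.outer Q).internal fun d z hz => resι_injective _ _ ?_)
    refine outer_induction (p := fun z => resι _ _ (homι _ _ (homOuterLin P Q M N
      (∑ i, ∑ j, outerFormHom M N (ht i) (hs j) (resι _ _ (homι _ _ w (otm P Q (x i) (y j)))))) z) =
        resι _ _ (homι _ _ w z)) (fun r l p q hp hq => ?_)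
      (fun x y hx hy => by simp only [map_add, hx, hy]) z
    rw [homι_homOuterLin]
    simp only [map_sum, LinearMap.sum_apply]
    conv_rhs => rw [← h p, ← h' q]
    simp only [map_sum, LinearMap.sum_apply]
    rw [Finset.sum_comm]
    refine Finset.sum_congr rfl fun j _ => Finset.sum_congr rfl fun i _ => ?_
    have hm : resι _ _ (homι _ _ w (otm P Q (x i) (y j))) ∈ (M.outer N).gr (e + (a i + b j)) :=
      hw'.1 _ _ (otm_mem (hx i) (hy j))
    have key : resι _ _ (homι _ _ w (GSAlg.tmul (t i p) (s j q) • otm P Q (x i) (y j))) =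
        ksign e.2 (r - a i + (l - b j)).2 • swapAct M N (GSAlg.tmul (t i p) (s j q))
          (resι _ _ (homι _ _ w (otm P Q (x i) (y j)))) :=
      hw'.2 _ _ (otm P Q (x i) (y j)) (GSAlg.tmul_mem (ht i r p hp) (hs j l q hq))
    rw [smul_otm _ (hs j l q hq) (hx i), map_zsmul, map_zsmul] at key
    rw [homOuterF_outerFormHom M N _ _ hm hp hq,
      ← ksign_smul_ksign_smul (l - b j).2 (a i).2 (resι _ _ (homι _ _ w (otm P Q (t i p • x i) _))),
      key, smul_smul]
    congr 1
    simp only [Prod.snd_add, Prod.snd_sub]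
    generalize (a i).2 = a, (b j).2 = b, e.2 = e, r.2 = r, l.2 = l
    clear * -
    revert a b e r l
    decide

end HomOuter

section GradedDimension

theorem grdim_eq_sum (M : GSMod B) {ι : Type} [Fintype ι] {d : ι → Deg} (b : Module.Basis ι F M.carrier)
    (hb : ∀ i, b i ∈ M.gr (d i)) : grdim M = ∑ i, qmon (d i).1 (d i).2 := zqπ_ext fun e => by
  classical
  rw [grdim_coeff, AddMonoidAlgebra.coeff_sum, Finsupp.finsetSum_apply]
  simp only [qmon, Prod.mk.eta, AddMonoidAlgebra.coeff_single, Finsupp.single_apply]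
  rw [Finset.sum_boole, ← Fintype.card_subtype]
  have hs : Submodule.span F (Set.range fun i : {i // d i = e} => b i.1) = M.gr e := by
    refine le_antisymm (Submodule.span_le.2 ?_) fun x hx => ?_
    · rintro _ ⟨i, rfl⟩
      have := hb i.1
      rwa [i.2] at this
    · rw [← prj_same M.internal hx, ← b.sum_repr x, map_sum]
      refine sum_mem fun i _ => ?_
      rw [map_smul]
      by_cases h : d i = e
      · rw [prj_same M.internal (h ▸ hb i)]
        exact Submodule.smul_mem _ _ (Submodule.subset_span ⟨⟨i, h⟩, rfl⟩)
      · rw [prj_ne M.internal (hb i) h, smul_zero]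
        exact zero_mem _
  rw [← hs]
  exact congrArg Nat.cast (finrank_span_eq_card
    (b.linearIndependent.comp (fun i : {i // d i = e} => i.1) Subtype.val_injective))

theorem grdim_outer (M : GSMod A) (N : GSMod B) : grdim (M.outer N) = grdim M * grdim N := by
  obtain ⟨ι, _, d, b, hb⟩ := exists_homBasis M.internal
  obtain ⟨κ, _, e, c, hc⟩ := exists_homBasis N.internal
  rw [grdim_eq_sum M b hb, grdim_eq_sum N c hc, Finset.sum_mul_sum, ← Finset.sum_product',
    grdim_eq_sum (M.outer N) (d := fun k : ι × κ => d k.1 + e k.2) (b.tensorProduct c) fun k =>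
      (congrArg (· ∈ (M.outer N).gr _) (Module.Basis.tensorProduct_apply' b c k)).mpr
        (otm_mem (hb k.1) (hc k.2))]
  refine Finset.sum_congr rfl fun k _ => ?_
  rw [qmon, qmon, qmon, AddMonoidAlgebra.single_mul_single, mul_one]

theorem grdimHom_outer_outer {P : GSMod A} {Q : GSMod B} (hP : P.IsProjective)
    (hQ : Q.IsProjective) (M : GSMod A) (N : GSMod B) :
    grdimHom (P.outer Q) (M.outer N) = grdimHom P M * grdimHom Q N := by
  rw [grdimHom_eq_grdim P M (lid A) lid_tmul_one, grdimHom_eq_grdim Q N (lid B) lid_tmul_one,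
    ← grdim_outer, grdim_of_iso (isoOfBij _ (homOuter_bijective hP hQ (M.res (lid A)) (N.res (lid B)))),
    grdimHom_eq_grdim (P.outer Q) (M.outer N) (((lid A).tensor (lid B)).comp
      (GSAlg.swap23 (GSAlg.unit F) A (GSAlg.unit F) B)) fun x => ?_]
  · refine grdim_of_iso ((homFunctor (P.outer Q) _).mapIso ?_)
    exact (resComp _ _).symm.app (M.outer N) ≪≫
      (resFunctor _).mapIso ((outerRes (lid A) (lid B) M).symm.app N)
  · refine GSAlg.tensor_induction (p := fun x => (((lid A).tensor (lid B)).comp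
      (GSAlg.swap23 (GSAlg.unit F) A (GSAlg.unit F) B)).lin (GSAlg.tmul 1 x) = x)
      (fun i j a b ha hb => ?_) (fun x y hx hy => by
        rw [← GSAlg.tmulLin_apply, map_add, map_add]; exact congrArg₂ (· + ·) hx hy) x
    rw [GSAlg.Hom.comp_lin, GSAlg.tensor_one, swap23_four _ _ (GSAlg.unit F).one_mem ha,
      Prod.snd_zero, ksign_zero_left, one_smul, GSAlg.Hom.tensor_tmul]
    exact congrArg₂ GSAlg.tmul (lid_tmul_one a) (lid_tmul_one b)

end GradedDimension

end GSMod

end SuperTower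

namespace SuperTower

variable {F : Type u} [Field F]

section Classes

variable (k : Type) [CommRing k] [Algebra Zqπ k] {A B C D : GSAlg F}

open GSMod

theorem clsG_zeroMod : clsG k (zeroMod B) = 0 :=
  (congrArg (fun x => (1 ⊗ₜ[Zqπ] x : k ⊗[Zqπ] GPrime B))
    (Groth.cls_zero (S := fun _ : GSMod B => True) trivial)).trans (TensorProduct.tmul_zero _ _)

/-- The inclusion of the direct sum of all but one of the summands. -/
def piSome {ι : Type} [Finite ι] (M : Option ι → GSMod B) : pi (fun i => M (some i)) ⟶ pi M where
  lin := LinearMap.pi fun o => match o with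
    | none => 0
    | some i => LinearMap.proj i
  map_mem hm o _ := match o with
    | none => zero_mem _
    | some i => hm i trivial

theorem clsG_pi {ι : Type} [Fintype ι] (M : ι → GSMod B) :
    clsG k (pi M) = ∑ i, clsG k (M i) := by
  have h : ∀ (ι : Type) [Finite ι] (M : ι → GSMod B), clsG k (pi M) = ∑ᶠ i, clsG k (M i) := by
    intro ι _
    refine Finite.induction_empty_option (P := fun ι => ∀ [Finite ι] (M : ι → GSMod B),
      clsG k (pi M) = ∑ᶠ i, clsG k (M i)) ?_ ?_ ?_ ι
    · intro α β e h _ M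
      have := Finite.of_equiv β e.symm
      rw [← finsum_comp_equiv e, ← h fun i => M (e i)]
      let f : pi M ⟶ pi fun i => M (e i) :=
        ⟨LinearMap.pi fun i => LinearMap.proj (e i), fun hm i _ => hm (e i) trivial⟩
      refine clsG_of_iso k (isoOfBij f ⟨fun x y hxy => funext fun j => ?_, fun y => ?_⟩)
      · obtain ⟨i, rfl⟩ := e.surjective j
        exact congrFun hxy i
      · exact ⟨(Equiv.piCongrLeft (fun j => (M j).carrier) e) y, funext fun i =>
          Equiv.piCongrLeft_apply_apply (fun j => (M j).carrier) e y i⟩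
    · intro _ M
      have : IsEmpty PEmpty := inferInstance
      rw [finsum_of_isEmpty, ← clsG_zeroMod]
      exact clsG_of_iso k (isoOfBij ⟨LinearMap.pi fun i : Empty => i.elim, fun _ i _ => i.elim⟩
        ⟨fun x y _ => funext fun i => i.elim, fun y => ⟨fun i => i.elim, Subsingleton.elim _ _⟩⟩)
    · intro α _ h _ M
      rw [clsG_extension k (X := pi fun i => M (some i)) (Z := M none) ⟨piSome M, piProj M none, ?_⟩,
        h, finsum_eq_sum_of_fintype, finsum_eq_sum_of_fintype, Fintype.sum_option, add_comm]
      refine ⟨fun x y hxy => funext fun i => congrFun hxy (some i), fun y => ⟨fun hy =>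
        ⟨fun i => y (some i), funext fun o => ?_⟩, ?_⟩, fun z => ⟨fun o => match o with
          | none => z
          | some _ => 0, rfl⟩⟩
      · cases o
        · exact hy.symm
        · rfl
      · rintro ⟨x, rfl⟩
        rfl
  rw [h, finsum_eq_sum_of_fintype]

/-- The map `[P] ↦ [Φ(HOM(P, X))]`. -/
theorem exists_clsK_hom (X : GSMod (C.tensor B)) (Φ : GSMod C ⥤ GSMod D) (hΦ : IsExact Φ)
    (hs : ∀ X n ε, Nonempty (Φ.obj (X.shift n ε) ≅ (Φ.obj X).shift n ε)) :
    ∃ f : K₀ k B →ₗ[k] G₀ k D, ∀ P : GSMod B, P.IsProjective →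
      f (clsKOf k P) = clsG k (Φ.obj (hom P X)) := by
  obtain ⟨f, hf⟩ := extendsKOf k (B := B) (fun P => clsG k (Φ.obj (hom P.1 X)))
    (fun P Q R ⟨f, g, h⟩ => (clsG_extension k
      ⟨_, _, hΦ _ _ (homPre_shortExact h R.2 X)⟩).trans (add_comm _ _))
    (fun n ε P => (clsG_of_iso k (Φ.mapIso ((shiftHom P.1 C (-n) ε).app X) ≪≫
      (hs _ _ ε).some)).trans ((clsG_shift k _ _ ε).trans (by rw [neg_neg]; rfl)))
  exact ⟨f, fun P hP => hf ⟨P, hP⟩⟩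

end Classes

theorem DualPair.pair_ext {k : Type} [CommRing k] {Λ : Type} [AddCommMonoid Λ]
    (D : DualPair.{w} k Λ) {l : Λ} {a b : D.pos.carrier l} (h : ∀ y, D.pair l y a = D.pair l y b) :
    a = b :=
  (D.pair l).flip.toPerfPair.injective (LinearMap.ext h)

/-- The linear dependence of `f(x, y) = m(R_x(a), R'_y(b))` on `a` and `b`. -/
theorem exists_lift_compl₁₂ {k : Type*} [CommRing k] {U V A B X Y Z : Type*} [AddCommGroup U]
    [Module k U] [AddCommGroup V] [Module k V] [AddCommGroup A] [Module k A] [AddCommGroup B]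
    [Module k B] [AddCommGroup X] [Module k X] [AddCommGroup Y] [Module k Y] [AddCommGroup Z]
    [Module k Z] (m : X →ₗ[k] Y →ₗ[k] Z) (R : U →ₗ[k] A →ₗ[k] X) (R' : V →ₗ[k] B →ₗ[k] Y) :
    ∃ L : A →ₗ[k] B →ₗ[k] (U ⊗[k] V →ₗ[k] Z), ∀ a b,
      L a b = TensorProduct.lift (m.compl₁₂ (R.flip a) (R'.flip b)) :=
  ⟨LinearMap.mk₂ k (fun a b => TensorProduct.lift (m.compl₁₂ (R.flip a) (R'.flip b)))
    (fun a a' b => TensorProduct.ext' fun x y => by simp)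
    (fun c a b => TensorProduct.ext' fun x y => by simp)
    (fun a b b' => TensorProduct.ext' fun x y => by simp)
    (fun c a b => TensorProduct.ext' fun x y => by simp), fun _ _ => rfl⟩

theorem trilin_ext {k : Type*} [CommRing k] {I J L X Y Z W : Type*} [AddCommGroup X]
    [Module k X] [AddCommGroup Y] [Module k Y] [AddCommGroup Z] [Module k Z] [AddCommGroup W]
    [Module k W] {x : I → X} {y : J → Y} {z : L → Z} (hx : Submodule.span k (Set.range x) = ⊤)
    (hy : Submodule.span k (Set.range y) = ⊤) (hz : Submodule.span k (Set.range z) = ⊤)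
    {f g : X →ₗ[k] Y →ₗ[k] Z →ₗ[k] W} (h : ∀ i j l, f (x i) (y j) (z l) = g (x i) (y j) (z l)) :
    f = g :=
  LinearMap.ext_on_range hx fun i => LinearMap.ext_on_range hy fun j =>
    LinearMap.ext_on_range hz fun l => h i j l

namespace Tower

open GSMod

variable {Λ : Type} [AddCommMonoid Λ] {T : Tower F Λ}

theorem unit_zpow (d : ℤ) (ε : ZMod 2) (e : ℤ) :
    ((T.unit d ε ^ e : T.kkˣ) : T.kk) = algebraMap Zqπ T.kk (qmon (d * e) (ε * (e : ZMod 2))) := by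
  have : qunit d ε ^ e = qunit (d * e) (ε * (e : ZMod 2)) := by
    rw [qunit, qunit, ← map_zpow, ← map_zpow, ← ofAdd_zsmul]
    congr 3
    refine Prod.ext ?_ ?_
    · change e • d = _
      rw [smul_eq_mul, mul_comm]
    · change e • ε = _
      rw [zsmul_eq_mul, mul_comm]
  rw [Tower.unit, ← map_zpow, this]
  rfl

variable [Finset.HasAntidiagonal Λ]

namespace Compatible

variable {d : ℤ} {ε : ZMod 2} {κ : Λ →+ Λ →+ ℤ} (C : T.Compatible d ε κ)

theorem rStar_cls {l m n : Λ} (h : l + m = n) {P : GSMod (T.A m)} (hP : P.IsProjective)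
    (N : GSMod (T.A n)) : C.dualPair.rStar h (T.K P) (T.G N) = T.G ((T.Res h P).obj N) := by
  refine C.dualPair.pair_ext fun y => (C.dualPair.pair_rStar h y (T.K P) (T.G N)).trans ?_
  have : (pairing T.kk (T.A n)).flip (T.G N) ∘ₗ (T.mulK h).flip (T.K P) =
      (pairing T.kk (T.A l)).flip (T.G ((T.Res h P).obj N)) :=
    LinearMap.ext_on_range (clsKOf_span T.kk) fun Q => by
      change pairing T.kk (T.A n) (T.mulK h (T.K Q.1) (T.K P)) (T.G N) =
        pairing T.kk (T.A l) (clsKOf T.kk Q.1) (T.G ((T.Res h P).obj N))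
      rw [T.mulK_K h Q.2 hP]
      refine (pairing_cls T.kk (T.nabla_isProjective h Q.2 hP) N).trans (Eq.trans ?_
        (pairing_cls T.kk Q.2 _).symm)
      rw [nabla, grdimHom_ind, grdimHom_outer]
      rfl
  exact LinearMap.congr_fun this y

end Compatible

namespace Strong

variable (S : T.Strong) (C : T.Compatible S.d S.ε S.κ)

theorem G_cross {l₁ l₂ m₁ m₂ : Λ} (M : GSMod (T.A l₁)) {P : GSMod (T.A m₂)}
    (hP : P.IsProjective) (N : GSMod (T.A l₂)) :
    T.G ((S.cross (m₁ := m₁) M P).obj N) = S.dagger C m₁ (T.K P) (T.G M) (T.G N) := by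
  refine (clsG_pi T.kk _).trans (Finset.sum_congr rfl fun s _ => ?_)
  let X := ((M.res (T.ρ s.hl₁)).outer (N.res (T.ρ s.hl₂))).res
    (GSAlg.swap23 (T.A s.a) (T.A s.b) (T.A s.c) (T.A s.d))
  obtain ⟨f, hf⟩ := exists_clsK_hom T.kk X (indFunctor (T.ρ s.hm₁))
    (indFunctor_exact _ (T.projective s.hm₁).2) (fun X n ε => nonempty_ind_shift _ X n ε)
  have key : f ∘ₗ T.boxK s.b s.d = TensorProduct.lift ((C.dualPair.pos.mul s.hm₁).compl₁₂
      ((C.dualPair.rStar s.hl₁).flip (T.G M)) ((C.dualPair.rStar s.hl₂).flip (T.G N))) := by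
    refine TensorProduct.ext (LinearMap.ext_on_range (clsKOf_span T.kk) fun P₁ =>
      LinearMap.ext_on_range (clsKOf_span T.kk) fun P₂ => ?_)
    change f (T.boxK s.b s.d (T.K P₁.1 ⊗ₜ[T.kk] T.K P₂.1)) = T.mulG s.hm₁
      (C.dualPair.rStar s.hl₁ (T.K P₁.1) (T.G M)) (C.dualPair.rStar s.hl₂ (T.K P₂.1) (T.G N))
    rw [T.boxK_K P₁.2 P₂.2, hf _ (P₁.2.outer P₂.2), C.rStar_cls _ P₁.2, C.rStar_cls _ P₂.2]
    refine Eq.trans ?_ (T.mulG_G s.hm₁ _ _).symm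
    exact clsG_of_iso T.kk ((indFunctor (T.ρ s.hm₁)).mapIso
      (isoOfBij _ (homOuter_bijective P₁.2 P₂.2 _ _)).symm)
  rw [← key, Units.smul_def, unit_zpow]
  change _ = algebraMap Zqπ T.kk _ • f (T.boxK s.b s.d (C.comulK s.hm₂ (T.K P)))
  rw [C.comulK_cls s.hm₂ P hP, hf _ (T.res_isProjective s.hm₂ hP), ← clsG_shift]
  refine (clsG_of_iso T.kk (nonempty_ind_shift (T.ρ s.hm₁) _ _ _).some).trans ?_
  rw [mul_add, mul_add, Int.cast_add, Int.cast_add, mul_add, mul_add]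
  rfl

theorem rStar_mulG (hconj : ∀ {l m n : Λ} (h : l + m = n) (P : GSMod (T.A n)), P.IsProjective →
      Nonempty ((S.conjRes h).obj P ≅ P.res (T.ρ h))) {l₁ l₂ m₁ m₂ n : Λ} (hl : l₁ + l₂ = n)
    (hm : m₁ + m₂ = n) (x : K₀ T.kk (T.A m₂)) (a : G₀ T.kk (T.A l₁)) (b : G₀ T.kk (T.A l₂)) :
    C.dualPair.rStar hm x (T.mulG hl a b) = S.dagger C m₁ x a b := by
  choose L hL using fun s : Quad l₁ l₂ m₁ m₂ => exists_lift_compl₁₂ (C.dualPair.pos.mul s.hm₁)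
    (C.dualPair.rStar s.hl₁) (C.dualPair.rStar s.hl₂)
  let g : C.dualPair.pos.carrier l₁ →ₗ[T.kk] C.dualPair.pos.carrier l₂ →ₗ[T.kk]
      C.dualPair.neg.carrier m₂ →ₗ[T.kk] C.dualPair.pos.carrier m₁ := ∑ s : Quad l₁ l₂ m₁ m₂,
    ((T.unit S.d S.ε ^ (S.κ s.b s.d + S.χ' s.b s.c + S.χ'' s.a s.d) : T.kkˣ) : T.kk) •
      (L s).compr₂ (LinearMap.lcomp T.kk _ (C.dualPair.neg.comul s.hm₂))
  have hg : ∀ (a : C.dualPair.pos.carrier l₁) (b : C.dualPair.pos.carrier l₂)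
      (x : C.dualPair.neg.carrier m₂), g a b x = S.dagger C m₁ x a b := fun a b x => by
    simp only [g, LinearMap.sum_apply, LinearMap.smul_apply, LinearMap.compr₂_apply,
      LinearMap.lcomp_apply, hL]
    rfl
  have : (C.dualPair.pos.mul hl).compr₂ (C.dualPair.rStar hm).flip = g :=
    trilin_ext (clsG_span T.kk) (clsG_span T.kk) (clsKOf_span T.kk) fun M N P =>
      Eq.trans ((congrArg (C.dualPair.rStar hm (T.K P.1)) (T.mulG_G hl M N)).trans
        ((C.rStar_cls hm P.2 _).trans ((clsG_of_iso T.kk ((S.nonempty_ind_comp_res hl hm M P.1 P.2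
          fun h => hconj h P.1 P.2).some.app N)).trans (S.G_cross C M P.2 N)))) (hg _ _ _).symm
  exact (LinearMap.congr_fun₂ (LinearMap.congr_fun this a) b x).trans (hg a b x)

end Strong

end Tower

end SuperTower

namespace SuperTower

variable {F : Type u} [Field F]

theorem exists_sum_prj {V : Type u} [AddCommGroup V] [Module F V] {gr : Deg → Submodule F V}
    (h : DirectSum.IsInternal gr) (x : V) : ∃ s : Finset Deg, ∑ d ∈ s, prj h d x = x := by
  classical
  suffices ∃ s : Finset Deg, ∀ t, s ⊆ t → ∑ d ∈ t, prj h d x = x from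
    this.imp fun s hs => hs s subset_rfl
  refine hom_induction h (p := fun x => ∃ s : Finset Deg, ∀ t, s ⊆ t → ∑ d ∈ t, prj h d x = x)
    (fun e x hx => ⟨{e}, fun t ht => ?_⟩) (fun x y ⟨s, hs⟩ ⟨s', hs'⟩ => ⟨s ∪ s', fun t ht => ?_⟩) x
  · rw [Finset.sum_eq_single_of_mem e (Finset.singleton_subset_iff.1 ht)
      fun d _ hd => prj_ne h hx (Ne.symm hd), prj_same h hx]
  · simp only [map_add, Finset.sum_add_distrib]
    rw [hs t (Finset.union_subset_left ht), hs' t (Finset.union_subset_right ht)]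

theorem comap_internal {V : Type u} [AddCommGroup V] [Module F V] {gr : Deg → Submodule F V}
    (h : DirectSum.IsInternal gr) (N : Submodule F V) (hN : ∀ d, ∀ x ∈ N, prj h d x ∈ N) :
    DirectSum.IsInternal fun d => (gr d).comap N.subtype :=
  isInternal_of_proj (fun d => (prj h d).restrict (hN d)) (fun d x hx => Subtype.ext (prj_same _ hx))
    (fun d e x hx hd => Subtype.ext (prj_ne _ hx hd)) fun x => by
      obtain ⟨s, hs⟩ := exists_sum_prj h x.1
      have hx : x = ∑ d ∈ s, (prj h d).restrict (hN d) x := Subtype.ext (by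
        rw [Submodule.coe_sum]
        exact hs.symm)
      rw [hx]
      exact sum_mem fun d _ => Submodule.mem_iSup_of_mem d (prj_mem h d x.1)

namespace GSMod

variable {B : GSAlg F}

/-- The graded subsupermodule given by a submodule that is stable under the projections. -/
def sub (M : GSMod B) (N : Submodule B.carrier M.carrier)
    (hN : ∀ d, ∀ x ∈ N, prj M.internal d x ∈ N) : GSMod B where
  carrier := N.restrictScalars F
  module := N.module
  tower := ⟨fun c b x => Subtype.ext (smul_assoc c b x.1)⟩
  fg :=
    letI : Module B.carrier (N.restrictScalars F) := N.module
    haveI : IsScalarTower F B.carrier (N.restrictScalars F) :=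
      ⟨fun c b x => Subtype.ext (smul_assoc c b x.1)⟩
    Module.Finite.of_restrictScalars_finite F B.carrier (N.restrictScalars F)
  gr d := (M.gr d).comap (N.restrictScalars F).subtype
  internal := comap_internal M.internal (N.restrictScalars F) hN
  smul_mem hb hm := M.smul_mem hb hm

variable {M : GSMod B} {N : Submodule B.carrier M.carrier}
  (hN : ∀ d, ∀ x ∈ N, prj M.internal d x ∈ N)

/-- The inclusion of a graded subsupermodule. -/
def subι : sub M N hN ⟶ M where
  lin := ⟨(N.restrictScalars F).subtype.toAddHom, fun _ _ => rfl⟩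
  map_mem h := h

theorem subι_injective : Function.Injective (subι hN).lin := Subtype.val_injective

theorem subι_mem (x : (sub M N hN).carrier) : (subι hN).lin x ∈ N := x.2

theorem exists_subι {x : M.carrier} (hx : x ∈ N) : ∃ y, (subι hN).lin y = x := ⟨⟨x, hx⟩, rfl⟩

theorem finrank_sub : Module.finrank F (sub M N hN).carrier =
    Module.finrank F (N.restrictScalars F) := rfl

theorem exists_factor_sub {X : GSMod B} (f : X ⟶ M) (hf : ∀ x, f.lin x ∈ N) :
    ∃ g : X ⟶ sub M N hN, ∀ x, (subι hN).lin (g.lin x) = f.lin x :=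
  ⟨homOfF (N := sub M N hN) ((Hom.linF f).codRestrict (N.restrictScalars F) hf)
    (fun _ _ h => f.map_mem h) fun _ _ b m _ _ => Subtype.ext (map_smul f.lin b m), fun _ => rfl⟩

theorem prj_lin {M N : GSMod B} (f : M ⟶ N) (d : Deg) (x : M.carrier) :
    prj N.internal d (f.lin x) = f.lin (prj M.internal d x) :=
  prj_map M.internal N.internal (Hom.linF f) (fun _ _ h => f.map_mem h) d x

theorem prj_mem_range {M N : GSMod B} (f : M ⟶ N) (d : Deg) :
    ∀ x ∈ LinearMap.range f.lin, prj N.internal d x ∈ LinearMap.range f.lin := by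
  rintro _ ⟨x, rfl⟩
  exact ⟨prj M.internal d x, (prj_lin f d x).symm⟩

theorem prj_mem_ker {M N : GSMod B} (f : M ⟶ N) (d : Deg) :
    ∀ x ∈ LinearMap.ker f.lin, prj M.internal d x ∈ LinearMap.ker f.lin := fun x hx => by
  rw [LinearMap.mem_ker, ← prj_lin, LinearMap.mem_ker.1 hx, map_zero]

theorem surjective_of_minimal {M N : GSMod B} (f : M ⟶ N)
    (h : Module.finrank F N.carrier ≤ Module.finrank F (sub N _ (prj_mem_range f)).carrier) :
    Function.Surjective f.lin := by
  have : (LinearMap.range f.lin).restrictScalars F = ⊤ := Submodule.eq_top_of_finrank_eq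
    ((Submodule.finrank_le _).antisymm (h.trans_eq (finrank_sub _)))
  exact fun y => (this ▸ Submodule.mem_top : y ∈ (LinearMap.range f.lin).restrictScalars F)

/-- An endomorphism of a projective cover over the covered supermodule is bijective. -/
theorem bijective_of_cover {Q L : GSMod B} (hQ : Q.IsProjective) (f : Q ⟶ L)
    (hf : Function.Surjective f.lin)
    (hmin : ∀ X : GSMod B, X.IsProjective → (∃ g : X ⟶ L, Function.Surjective g.lin) →
      Module.finrank F Q.carrier ≤ Module.finrank F X.carrier)
    (e : Q ⟶ Q) (he : ∀ x, f.lin (e.lin x) = f.lin x) : Function.Bijective e.lin := by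
  obtain ⟨n, hc, hn⟩ := ((LinearMap.eventually_isCompl_ker_pow_range_pow (Hom.linF e)).and
    (Filter.eventually_ge_atTop 1)).exists
  obtain ⟨n, rfl⟩ := Nat.exists_eq_add_of_le' hn
  have hpow : ∀ n x, (Hom.linF e ^ n) x = (e.lin ^ n : Module.End B.carrier Q.carrier) x := by
    intro n
    induction n with
    | zero => exact fun x => rfl
    | succ n ih => exact fun x => by rw [pow_succ, pow_succ]; exact ih (e.lin x)
  have hmem : ∀ n d x, x ∈ Q.gr d → (e.lin ^ n : Module.End B.carrier Q.carrier) x ∈ Q.gr d := by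
    intro n
    induction n with
    | zero => exact fun d x hx => hx
    | succ n ih => exact fun d x hx => by rw [pow_succ]; exact ih d _ (e.map_mem hx)
  have hfe : ∀ n x, f.lin ((e.lin ^ n : Module.End B.carrier Q.carrier) x) = f.lin x := by
    intro n
    induction n with
    | zero => exact fun x => rfl
    | succ n ih => exact fun x => by rw [pow_succ]; exact (ih (e.lin x)).trans (he x)
  let g : Q ⟶ Q := ⟨e.lin ^ (n + 1), fun hx => hmem (n + 1) _ _ hx⟩
  let I := sub Q _ (prj_mem_range g)
  obtain ⟨r, hr⟩ := exists_factor_sub (prj_mem_range g) g fun x => ⟨x, rfl⟩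
  let i : I ⟶ Q := subι (prj_mem_range g)
  have hi : Function.Injective i.lin := subι_injective _
  have hir : Function.Injective (Hom.linF (i ≫ r)) := by
    rw [injective_iff_map_eq_zero]
    intro x hx
    obtain ⟨y, hy⟩ := subι_mem _ x
    have h0 : i.lin x = 0 := by
      refine (Submodule.disjoint_def.1 hc.disjoint) _ ?_ ⟨y, (hpow _ _).trans hy⟩
      rw [LinearMap.mem_ker, hpow]
      exact (hr (i.lin x)).symm.trans ((congrArg i.lin hx).trans (map_zero _))
    exact hi (h0.trans (map_zero _).symm)
  let a := isoOfBij (i ≫ r) ⟨hir, LinearMap.injective_iff_surjective.1 hir⟩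
  have hI : I.IsProjective := by
    have : Module.Projective B.carrier Q.carrier := hQ
    refine Module.Projective.of_split i.lin (Hom.lin (r ≫ a.inv)) (LinearMap.ext fun x => ?_)
    exact congrArg (fun k : I ⟶ I => k.lin x) a.hom_inv_id
  have hge := hmin I hI ⟨i ≫ f, fun y => by
    obtain ⟨x, rfl⟩ := hf y
    exact ⟨r.lin x, (congrArg f.lin (hr x)).trans (hfe (n + 1) x)⟩⟩
  have hsurj : Function.Surjective (Hom.linF e) := fun y => by
    obtain ⟨x, hx⟩ := surjective_of_minimal g hge y
    refine ⟨(e.lin ^ n : Module.End B.carrier Q.carrier) x, ?_⟩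
    rw [← hx]
    change e.lin _ = (e.lin ^ (n + 1) : Module.End B.carrier Q.carrier) x
    rw [pow_succ']
    rfl
  exact ⟨LinearMap.injective_iff_surjective.2 hsurj, hsurj⟩

/-- A projective supermodule with a surjection to `L` splits off the projective cover of `L`. -/
theorem exists_split_cover {P Q L : GSMod B} (hP : P.IsProjective) (hQ : Q.IsProjective) (f : Q ⟶ L)
    (hf : Function.Surjective f.lin)
    (hmin : ∀ X : GSMod B, X.IsProjective → (∃ g : X ⟶ L, Function.Surjective g.lin) →
      Module.finrank F Q.carrier ≤ Module.finrank F X.carrier)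
    (p : P ⟶ L) (hp : Function.Surjective p.lin) :
    ∃ (s : Q ⟶ P) (v : P ⟶ Q), ∀ x, v.lin (s.lin x) = x := by
  obtain ⟨u, hu⟩ := hQ.exists_lift p hp f
  obtain ⟨v, hv⟩ := hP.exists_lift f hf p
  let a := isoOfBij (u ≫ v) (bijective_of_cover hQ f hf hmin (u ≫ v) fun x => by
    rw [← comp_lin, Category.assoc, hv, hu])
  exact ⟨a.inv ≫ u, v, fun x => congrArg (fun k : Q ⟶ Q => k.lin x) a.inv_hom_id⟩

section Split

variable {P Q : GSMod B} (s : Q ⟶ P) (v : P ⟶ Q)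

theorem shortExact_ker (h : ∀ x, v.lin (s.lin x) = x) :
    ShortExact (subι (prj_mem_ker v)) v :=
  ⟨subι_injective _, fun _ => ⟨fun hy => exists_subι _ hy, fun ⟨x, hx⟩ => hx ▸ subι_mem _ x⟩,
    fun x => ⟨_, h x⟩⟩

theorem exists_ker_retraction (h : ∀ x, v.lin (s.lin x) = x) :
    ∃ r : P ⟶ sub P _ (prj_mem_ker v), ∀ x,
      (subι (prj_mem_ker v)).lin (r.lin x) = x - s.lin (v.lin x) :=
  exists_factor_sub _ (⟨LinearMap.id - s.lin ∘ₗ v.lin,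
    fun hx => sub_mem hx (s.map_mem (v.map_mem hx))⟩ : P ⟶ P) fun x => by
      change v.lin (x - s.lin (v.lin x)) = 0
      rw [map_sub, h, sub_self]

theorem ker_isProjective (hP : P.IsProjective) (h : ∀ x, v.lin (s.lin x) = x) :
    (sub P _ (prj_mem_ker v)).IsProjective := by
  obtain ⟨r, hr⟩ := exists_ker_retraction s v h
  have : Module.Projective B.carrier P.carrier := hP
  refine Module.Projective.of_split (subι (prj_mem_ker v)).lin r.lin
    (LinearMap.ext fun x => subι_injective _ ((hr _).trans ?_))
  rw [show v.lin ((subι (prj_mem_ker v)).lin x) = 0 from subι_mem _ x, map_zero, sub_zero]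
  rfl

theorem nonempty_iso_of_split {P' : GSMod B} {s' : Q ⟶ P'} {v' : P' ⟶ Q}
    (h : ∀ x, v.lin (s.lin x) = x) (h' : ∀ x, v'.lin (s'.lin x) = x)
    (e : sub P _ (prj_mem_ker v) ≅ sub P' _ (prj_mem_ker v')) : Nonempty (P ≅ P') := by
  obtain ⟨r, hr⟩ := exists_ker_retraction s v h
  obtain ⟨r', hr'⟩ := exists_ker_retraction s' v' h'
  let i := subι (prj_mem_ker v)
  let i' := subι (prj_mem_ker v')
  have hi : ∀ k, v.lin (i.lin k) = 0 := fun k => subι_mem _ k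
  have hi' : ∀ k, v'.lin (i'.lin k) = 0 := fun k => subι_mem _ k
  let w : P ⟶ P' := ⟨s'.lin ∘ₗ v.lin + i'.lin ∘ₗ Hom.lin (r ≫ e.hom), fun hx =>
    add_mem (s'.map_mem (v.map_mem hx)) (i'.map_mem (Hom.map_mem (r ≫ e.hom) hx))⟩
  have hw : ∀ x, w.lin x = s'.lin (v.lin x) + i'.lin (e.hom.lin (r.lin x)) := fun _ => rfl
  have hvw : ∀ x, v'.lin (w.lin x) = v.lin x := fun x => by rw [hw, map_add, h', hi', add_zero]
  have hri : ∀ k, r.lin (i.lin k) = k := fun k => subι_injective _ ((hr _).trans (by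
    rw [show v.lin ((subι (prj_mem_ker v)).lin k) = 0 from hi k, map_zero, sub_zero]))
  refine ⟨isoOfBij w ⟨(injective_iff_map_eq_zero w.lin).2 fun x hx => ?_, fun y => ?_⟩⟩
  · have h1 : v.lin x = 0 := by rw [← hvw, hx, map_zero]
    have h2 : i.lin (r.lin x) = x := by rw [hr, h1, map_zero, sub_zero]
    rw [hw, h1, map_zero, zero_add] at hx
    have h3 : e.hom.lin (r.lin x) = 0 := subι_injective _ (hx.trans (map_zero _).symm)
    rw [← h2, (iso_bijective e).1 (h3.trans (map_zero _).symm), map_zero]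
  · obtain ⟨k, hk⟩ := (iso_bijective e).2 (r'.lin y)
    refine ⟨s.lin (v'.lin y) + i.lin k, ?_⟩
    have hrs : r.lin (s.lin (v'.lin y)) = 0 := subι_injective _ ((hr _).trans (by
      rw [h, sub_self, map_zero]))
    rw [hw, map_add v.lin, map_add r.lin, h, hi, add_zero, hri, hrs, zero_add, hk]
    exact (congrArg (s'.lin (v'.lin y) + ·) (hr' y)).trans (add_sub_cancel _ _)

end Split

/-- The morphism given by an element of degree `0` of `HOM(P, M)`. -/
def ofHOM {P M : GSMod B} (f : HOM P M 0) : P ⟶ M :=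
  homOfF f.1 (fun d m hm => by simpa using f.2.1 d m hm) fun i j b m hb _ => by
    simpa [ksign_zero_left] using f.2.2 i b m hb

theorem linF_mem_HOM {P M : GSMod B} (g : P ⟶ M) : Hom.linF g ∈ HOM P M 0 :=
  ⟨fun j m hm => by rw [zero_add]; exact g.map_mem hm, fun i b m _ => by
    rw [Prod.snd_zero, ksign_zero_left, one_smul]
    exact map_smul g.lin b m⟩

theorem exists_hom_ne_zero_iff (P M : GSMod B) :
    (∃ f : P ⟶ M, ∃ x, f.lin x ≠ 0) ↔ (grdimHom P M).coeff 0 ≠ 0 := by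
  rw [grdimHom_coeff, Nat.cast_ne_zero, ← Nat.pos_iff_ne_zero, Module.finrank_pos_iff,
    Submodule.nontrivial_iff_ne_bot, Submodule.ne_bot_iff]
  constructor
  · rintro ⟨f, x, hx⟩
    exact ⟨_, linF_mem_HOM f, fun h => hx (LinearMap.congr_fun h x)⟩
  · rintro ⟨f, hf, h0⟩
    by_contra! h
    exact h0 (LinearMap.ext fun x => h (ofHOM ⟨f, hf⟩) x)

/-- Projective supermodules are determined by the dimensions of the spaces of homomorphisms. -/
theorem nonempty_iso_of_grdimHom {P P' : GSMod B} (hP : P.IsProjective) (hP' : P'.IsProjective)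
    (h : ∀ M, grdimHom P M = grdimHom P' M) : Nonempty (P ≅ P') := by
  obtain ⟨n, hn⟩ : ∃ n, Module.finrank F P.carrier = n := ⟨_, rfl⟩
  induction n using Nat.strong_induction_on generalizing P P' with
  | _ n ih =>
  by_cases h0 : ∃ L : GSMod B, ∃ f : P ⟶ L, ∃ x, f.lin x ≠ 0
  · classical
    have hex : ∃ k, ∃ L : GSMod B, Module.finrank F L.carrier = k ∧
        ∃ f : P ⟶ L, ∃ x, f.lin x ≠ 0 := by
      obtain ⟨L, hL⟩ := h0
      exact ⟨_, L, rfl, hL⟩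
    obtain ⟨L, hLk, f, hf⟩ := Nat.find_spec hex
    have hsurj : ∀ {X : GSMod B}, (∀ M, (∃ f : X ⟶ M, ∃ x, f.lin x ≠ 0) →
        ∃ f : P ⟶ M, ∃ x, f.lin x ≠ 0) → ∀ g : X ⟶ L, (∃ x, g.lin x ≠ 0) →
        Function.Surjective g.lin := fun hX g ⟨x, hx⟩ => surjective_of_minimal g (by
      rw [hLk]
      obtain ⟨r, hr⟩ := exists_factor_sub (prj_mem_range g) g fun x => ⟨x, rfl⟩
      exact Nat.find_min' hex ⟨_, rfl, hX _ ⟨r, x, fun h0 => hx (by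
        rw [← hr, h0, map_zero])⟩⟩)
    obtain ⟨f', hf'⟩ := (exists_hom_ne_zero_iff P' L).2
      (h L ▸ (exists_hom_ne_zero_iff P L).1 ⟨f, hf⟩)
    have hfs := hsurj (fun _ h => h) f hf
    have hfs' := hsurj (fun M hM => (exists_hom_ne_zero_iff P M).2
      (h M ▸ (exists_hom_ne_zero_iff P' M).1 hM)) f' hf'
    have hexQ : ∃ k, ∃ X : GSMod B, Module.finrank F X.carrier = k ∧ X.IsProjective ∧
        ∃ g : X ⟶ L, Function.Surjective g.lin := ⟨_, P, rfl, hP, f, hfs⟩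
    obtain ⟨Q, hQk, hQ, g, hg⟩ := Nat.find_spec hexQ
    have hmin : ∀ X : GSMod B, X.IsProjective → (∃ g : X ⟶ L, Function.Surjective g.lin) →
        Module.finrank F Q.carrier ≤ Module.finrank F X.carrier := fun X hX hg => by
      rw [hQk]
      exact Nat.find_min' hexQ ⟨X, rfl, hX, hg⟩
    obtain ⟨s, v, hsv⟩ := exists_split_cover hP hQ g hg hmin f hfs
    obtain ⟨s', v', hsv'⟩ := exists_split_cover hP' hQ g hg hmin f' hfs'
    obtain ⟨e⟩ := ih _ (by
      rw [← hn]
      refine (finrank_sub _).trans_lt (Submodule.finrank_lt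
        (s := (LinearMap.ker v.lin).restrictScalars F) fun ht => ?_)
      obtain ⟨x, hx⟩ := hf
      obtain ⟨y, hy⟩ := hg (f.lin x)
      have : s.lin y ∈ (LinearMap.ker v.lin).restrictScalars F := ht ▸ Submodule.mem_top
      have hy0 : y = 0 := (hsv y).symm.trans this
      exact hx (by rw [← hy, hy0, map_zero]))
      (ker_isProjective s v hP hsv) (ker_isProjective s' v' hP' hsv') (fun M => by
        have h1 := grdimHom_of_shortExact_left (shortExact_ker s v hsv) hQ M
        have h2 := grdimHom_of_shortExact_left (shortExact_ker s' v' hsv') hQ M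
        rw [h, h2] at h1
        exact (add_right_cancel h1).symm) rfl
    exact nonempty_iso_of_split s v hsv hsv' e
  · have hz : ∀ x : P.carrier, x = 0 := fun x => by
      by_contra hx
      exact h0 ⟨P, 𝟙 P, x, hx⟩
    have hz' : ∀ x : P'.carrier, x = 0 := fun x => by
      by_contra hx
      exact h0 ⟨P', (exists_hom_ne_zero_iff P P').2
        ((h P').symm ▸ (exists_hom_ne_zero_iff P' P').1 ⟨𝟙 P', x, hx⟩)⟩
    exact ⟨isoOfBij ⟨0, fun _ => zero_mem _⟩
      ⟨fun x y _ => (hz x).trans (hz y).symm, fun y => ⟨0, (map_zero _).trans (hz' y).symm⟩⟩⟩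

end GSMod

end SuperTower

namespace SuperTower

variable {F : Type u} [Field F]

namespace GSMod

variable {A B : GSAlg F}

theorem grdimHom_of_iso_right (P : GSMod B) {M N : GSMod B} (e : M ≅ N) :
    grdimHom P M = grdimHom P N := by
  rw [grdimHom_eq_grdim_lid, grdimHom_eq_grdim_lid]
  exact grdim_of_iso ((homFunctor P _).mapIso ((resFunctor (lid B)).mapIso e))

theorem grdimHom_coeff_eq_shift (P M : GSMod B) (d : Deg) :
    (grdimHom P M).coeff d = (grdimHom P (M.shift (-d.1) d.2)).coeff 0 := by
  rw [grdimHom_shift, qmon, AddMonoidAlgebra.coeff_single_mul_apply, one_mul, add_zero]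
  congr 1
  exact Prod.ext (neg_neg _).symm (deg_neg _).symm

theorem grdimHom_adj (ψ : GSAlg.Hom B A) {L : GSMod A ⥤ GSMod B} (adj : L ⊣ indFunctor ψ)
    (P : GSMod A) (Y : GSMod B) : grdimHom (L.obj P) Y = grdimHom P (Y.ind ψ) := by
  have key : ∀ Y, (grdimHom (L.obj P) Y).coeff 0 = (grdimHom P (Y.ind ψ)).coeff 0 := by
    intro Y
    have hadd : ∀ (f g h : L.obj P ⟶ Y), (∀ x, h.lin x = f.lin x + g.lin x) → ∀ x,
        (indMap ψ h).lin x = (indMap ψ f).lin x + (indMap ψ g).lin x := fun f g h hx x =>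
      ind_induction ψ (p := fun x => (indMap ψ h).lin x = (indMap ψ f).lin x + (indMap ψ g).lin x)
        (fun i j a n _ _ => (congrArg (fun y => imk ψ Y (a ⊗ₜ y)) (hx n)).trans
          ((congrArg (imk ψ Y) (TensorProduct.tmul_add _ _ _)).trans (map_add _ _ _)))
        (fun x y hx hy => by rw [map_add, map_add, map_add, hx, hy]; abel) x
    have hsmul : ∀ (c : F) (f h : L.obj P ⟶ Y), (∀ x, h.lin x = c • f.lin x) → ∀ x,
        (indMap ψ h).lin x = c • (indMap ψ f).lin x := fun c f h hx x =>
      ind_induction ψ (p := fun x => (indMap ψ h).lin x = c • (indMap ψ f).lin x)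
        (fun i j a n _ _ => (congrArg (fun y => imk ψ Y (a ⊗ₜ y)) (hx n)).trans
          ((congrArg (imk ψ Y) (TensorProduct.tmul_smul _ _ _)).trans (map_smul _ _ _)))
        (fun x y hx hy => by rw [map_add, map_add, hx, hy, smul_add]) x
    let t : HOM (L.obj P) Y 0 →ₗ[F] HOM P (Y.ind ψ) 0 :=
      { toFun := fun f => ⟨_, linF_mem_HOM (adjUnit ψ adj P ≫ indMap ψ (ofHOM f))⟩
        map_add' := fun f g => Subtype.ext (LinearMap.ext fun p => hadd _ _ _ (fun _ => rfl) _)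
        map_smul' := fun c f => Subtype.ext (LinearMap.ext fun p => hsmul c _ _ (fun _ => rfl) _) }
    have ht : ∀ f p, (t f).1 p = (adjUnit ψ adj P ≫ indMap ψ (ofHOM f)).lin p := fun _ _ => rfl
    rw [grdimHom_coeff, grdimHom_coeff, (LinearEquiv.ofBijective t ⟨fun f g h => ?_, fun g => ?_⟩).finrank_eq]
    · have := (adj_bijective ψ adj P Y).1 (hom_ext (f := adjUnit ψ adj P ≫ indMap ψ (ofHOM f))
        (g := adjUnit ψ adj P ≫ indMap ψ (ofHOM g)) fun p => by rw [← ht, ← ht, h])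
      exact Subtype.ext (LinearMap.ext fun x => congrArg (fun k : L.obj P ⟶ Y => k.lin x) this)
    · obtain ⟨f, hf⟩ := (adj_bijective ψ adj P Y).2 (ofHOM g)
      refine ⟨⟨_, linF_mem_HOM f⟩, Subtype.ext (LinearMap.ext fun p => ?_)⟩
      exact congrArg (fun k : P ⟶ Y.ind ψ => k.lin p) hf
  refine zqπ_ext fun d => ?_
  rw [grdimHom_coeff_eq_shift, key, grdimHom_coeff_eq_shift P (Y.ind ψ),
    grdimHom_of_iso_right P (nonempty_ind_shift ψ Y (-d.1) d.2).some]

/-- Twists by automorphisms preserve projective supermodules. -/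
theorem IsProjective.res_aut {P : GSMod B} (hP : P.IsProjective) {ψ ψ' : GSAlg.Hom B B}
    (h : ∀ b, ψ.lin (ψ'.lin b) = b) (h' : ∀ b, ψ'.lin (ψ.lin b) = b) : (P.res ψ).IsProjective := by
  have h1 : ψ.lin 1 = 1 := by
    have := ψ.map_mul 1 (ψ'.lin 1)
    rwa [one_mul, h, mul_one, eq_comm] at this
  refine hP.res ψ ((regular_isProjective B).of_iso (isoOfBij (resLift ψ (N := regular B)
    (M := regular B) ψ.lin (fun _ _ hb => ψ.map_mem hb) (fun _ _ b n _ _ => ψ.map_mul b n)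
    (fun _ n _ => by rw [h1, one_smul])) ⟨fun x y hxy => ?_, fun y => ?_⟩))
  · have : ψ.lin x = ψ.lin y := congrArg (resι ψ (regular B)) hxy
    exact (h' x).symm.trans ((congrArg ψ'.lin this).trans (h' y))
  · exact ⟨ψ'.lin (resι ψ (regular B) y), resι_injective ψ (regular B) (h (resι ψ (regular B) y))⟩

end GSMod

section Classes

variable (k : Type) [CommRing k] [Algebra Zqπ k] {B C : GSAlg F}

open GSMod

/-- The map on Grothendieck groups of projective supermodules induced by an exact functor. -/
theorem exists_clsK_map (Φ : GSMod B ⥤ GSMod C) (hΦ : IsExact Φ)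
    (hs : ∀ X n ε, Nonempty (Φ.obj (X.shift n ε) ≅ (Φ.obj X).shift n ε))
    (hp : ∀ X, X.IsProjective → (Φ.obj X).IsProjective) :
    ∃ f : K₀ k B →ₗ[k] K₀ k C, ∀ P : GSMod B, P.IsProjective →
      f (clsKOf k P) = clsKOf k (Φ.obj P) := by
  obtain ⟨f, hf⟩ := extendsKOf k (B := B) (fun P => clsKOf k (Φ.obj P.1))
    (fun P Q R ⟨f, g, h⟩ => clsKOf_extension k (hp _ P.2) (hp _ Q.2) (hp _ R.2) ⟨_, _, hΦ f g h⟩)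
    (fun n ε P => (clsKOf_of_iso k (hp _ (P.2.shift (-n) ε)) ((hp _ P.2).shift (-n) ε)
      (hs P.1 (-n) ε).some).trans (clsKOf_shift k (hp _ P.2) n ε))
  exact ⟨f, fun P hP => hf ⟨P, hP⟩⟩

theorem tensorPairing_injective {k : Type} [CommRing k] {X Y A B : Type w} [AddCommGroup X]
    [Module k X] [AddCommGroup Y] [Module k Y] [AddCommGroup A] [Module k A] [AddCommGroup B]
    [Module k B] [Module.Free k A] [Module.Finite k A] [Module.Free k B] [Module.Finite k B]
    (p : X →ₗ[k] A →ₗ[k] k) (q : Y →ₗ[k] B →ₗ[k] k) [p.IsPerfPair] [q.IsPerfPair] :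
    Function.Injective (tensorPairing p q) := by
  have : tensorPairing p q = (TensorProduct.dualDistribEquiv k A B).toLinearMap ∘ₗ
      (TensorProduct.congr p.toPerfPair q.toPerfPair).toLinearMap :=
    TensorProduct.ext' fun x y => TensorProduct.ext' fun a b => rfl
  rw [this]
  exact (TensorProduct.dualDistribEquiv k A B).injective.comp (LinearEquiv.injective _)

theorem GroundRing.algebraMap_injective {Q : Prop} (hQ : ¬ Q) :
    Function.Injective (algebraMap Zqπ (GroundRing Q)) := by
  refine Function.LeftInverse.injective (g := Ideal.Quotient.lift (groundIdeal Q)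
    (Polynomial.evalRingHom (0 : Zqπ)) fun p hp => ?_) fun x => ?_
  · have : groundIdeal Q ≤ RingHom.ker (Polynomial.evalRingHom (0 : Zqπ)) := by
      refine Ideal.span_le.2 ?_
      rintro p (⟨_, rfl⟩ | ⟨h, _⟩ | ⟨h, _⟩)
      · exact Polynomial.eval_X
      · exact absurd h hQ
      · exact absurd h hQ
    exact this hp
  · exact Polynomial.eval_C

end Classes

namespace Tower

open GSMod

variable {Λ : Type} [AddCommMonoid Λ] {T : Tower F Λ}

theorem pairing_boxK_boxG {l m : Λ} (z : K₀ T.kk (T.A l) ⊗[T.kk] K₀ T.kk (T.A m))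
    (w : G₀ T.kk (T.A l) ⊗[T.kk] G₀ T.kk (T.A m)) :
    pairing T.kk ((T.A l).tensor (T.A m)) (T.boxK l m z) (T.boxG l m w) =
      tensorPairing (pairing T.kk (T.A l)) (pairing T.kk (T.A m)) z w := by
  have : (pairing T.kk ((T.A l).tensor (T.A m))).compl₁₂ (T.boxK l m) (T.boxG l m) =
      tensorPairing (pairing T.kk (T.A l)) (pairing T.kk (T.A m)) := by
    refine TensorProduct.ext (LinearMap.ext_on_range (clsKOf_span T.kk) fun P =>
      LinearMap.ext_on_range (clsKOf_span T.kk) fun Q => TensorProduct.ext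
        (LinearMap.ext_on_range (clsG_span T.kk) fun M =>
          LinearMap.ext_on_range (clsG_span T.kk) fun N => ?_))
    change pairing T.kk ((T.A l).tensor (T.A m)) (T.boxK l m (T.K P.1 ⊗ₜ T.K Q.1))
      (T.boxG l m (T.G M ⊗ₜ T.G N)) = pairing T.kk (T.A l) (clsKOf T.kk P.1) (clsG T.kk M) *
        pairing T.kk (T.A m) (clsKOf T.kk Q.1) (clsG T.kk N)
    rw [T.boxK_K P.2 Q.2, T.boxG_G, pairing_cls T.kk (P.2.outer Q.2), pairing_cls T.kk P.2,
      pairing_cls T.kk Q.2, grdimHom_outer_outer P.2 Q.2, map_mul]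
  exact LinearMap.congr_fun₂ this z w

namespace Strong

variable [Finset.HasAntidiagonal Λ] (S : T.Strong)

theorem res_ψ_tensor_isProjective {l m : Λ} {X : GSMod ((T.A l).tensor (T.A m))}
    (hX : X.IsProjective) : (X.res ((S.ψ l).hom.tensor (S.ψ m).hom)).IsProjective := by
  refine hX.res_aut (ψ' := (S.ψ l).inv.tensor (S.ψ m).inv) ?_ ?_
  · refine fun x => LinearMap.congr_fun (f := ((S.ψ l).hom.tensor (S.ψ m).hom).lin ∘ₗ
      ((S.ψ l).inv.tensor (S.ψ m).inv).lin) (g := LinearMap.id)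
      (TensorProduct.ext' fun a b => ?_) x
    exact congrArg₂ GSAlg.tmul ((S.ψ l).hom_inv a) ((S.ψ m).hom_inv b)
  · refine fun x => LinearMap.congr_fun (f := ((S.ψ l).inv.tensor (S.ψ m).inv).lin ∘ₗ
      ((S.ψ l).hom.tensor (S.ψ m).hom).lin) (g := LinearMap.id)
      (TensorProduct.ext' fun a b => ?_) x
    exact congrArg₂ GSAlg.tmul ((S.ψ l).inv_hom a) ((S.ψ m).inv_hom b)

theorem conjRes_isProjective {l m n : Λ} (h : l + m = n) {P : GSMod (T.A n)}
    (hP : P.IsProjective) : ((S.conjRes h).obj P).IsProjective :=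
  S.res_ψ_tensor_isProjective (X := (P.res (S.ψ n).inv).res (T.ρ h))
    (T.res_isProjective h (hP.res_aut (S.ψ n).inv_hom (S.ψ n).hom_inv))

theorem grdimHom_conjRes (C : T.Compatible S.d S.ε S.κ) {l m n : Λ} (h : l + m = n) {P : GSMod (T.A n)} (hP : P.IsProjective)
    (M : GSMod (T.A l)) (N : GSMod (T.A m)) :
    algebraMap Zqπ T.kk (grdimHom ((S.conjRes h).obj P) (M.outer N)) =
      tensorPairing (pairing T.kk (T.A l)) (pairing T.kk (T.A m)) (C.comulK h (T.K P))
        (T.G M ⊗ₜ T.G N) := by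
  have h1 : grdimHom P (T.nabla h M N) = qmon (S.d * S.κ l m) (S.ε * (S.κ l m : ZMod 2)) *
      grdimHom ((S.conjRes h).obj P) (M.outer N) := by
    refine (grdimHom_adj (T.ρ h) (S.adj h).some P (M.outer N)).symm.trans
      ((grdimHom_of_iso_left ((S.leftAdjointIso h).app P) _).trans
        ((grdimHom_shift_left ((S.conjRes h).obj P) (M.outer N) _ _).trans ?_))
    rw [neg_neg]
  have h2 : pairing T.kk (T.A n) (T.K P) (T.mulG h (T.G M) (T.G N)) =
      ((T.unit S.d S.ε ^ S.κ l m : T.kkˣ)) • tensorPairing (pairing T.kk (T.A l))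
        (pairing T.kk (T.A m)) (C.comulK h (T.K P)) (T.G M ⊗ₜ T.G N) :=
    C.isDualPairing.mul_right h (T.K P) (T.G M) (T.G N)
  rw [T.mulG_G] at h2
  have h3 := (pairing_cls T.kk hP (T.nabla h M N)).symm.trans h2
  rw [h1, map_mul, ← unit_zpow] at h3
  exact (Units.mul_right_inj _).1 h3

theorem clsKOf_conjRes (C : T.Compatible S.d S.ε S.κ) {l m n : Λ} (h : l + m = n) {P : GSMod (T.A n)} (hP : P.IsProjective) :
    clsKOf T.kk ((S.conjRes h).obj P) = clsKOf T.kk (P.res (T.ρ h)) := by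
  have hP' := hP.res_aut (S.ψ n).inv_hom (S.ψ n).hom_inv
  have ht : ∀ l, ∃ f : K₀ T.kk (T.A l) →ₗ[T.kk] K₀ T.kk (T.A l), ∀ P : GSMod (T.A l),
      P.IsProjective → f (clsKOf T.kk P) = clsKOf T.kk (P.res (S.ψ l).hom) := fun l =>
    exists_clsK_map T.kk (resFunctor (S.ψ l).hom) (resFunctor_exact _)
      (fun X n ε => ⟨(resShift (S.ψ l).hom n ε).app X⟩)
      (fun X hX => hX.res_aut (S.ψ l).hom_inv (S.ψ l).inv_hom)
  choose t ht using ht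
  obtain ⟨τ, hτ⟩ := exists_clsK_map T.kk (resFunctor ((S.ψ l).hom.tensor (S.ψ m).hom))
    (resFunctor_exact _) (fun X n ε => ⟨(resShift _ n ε).app X⟩) (fun X hX => S.res_ψ_tensor_isProjective hX)
  have hbox : τ ∘ₗ T.boxK l m = T.boxK l m ∘ₗ TensorProduct.map (t l) (t m) := by
    refine TensorProduct.ext (LinearMap.ext_on_range (clsKOf_span T.kk) fun P =>
      LinearMap.ext_on_range (clsKOf_span T.kk) fun Q => ?_)
    have hp := P.2.res_aut (S.ψ l).hom_inv (S.ψ l).inv_hom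
    have hq := Q.2.res_aut (S.ψ m).hom_inv (S.ψ m).inv_hom
    change τ (T.boxK l m (T.K P.1 ⊗ₜ T.K Q.1)) =
      T.boxK l m (t l (clsKOf T.kk P.1) ⊗ₜ t m (clsKOf T.kk Q.1))
    rw [T.boxK_K P.2 Q.2, hτ _ (P.2.outer Q.2), ht l _ P.2, ht m _ Q.2]
    exact (clsKOf_of_iso T.kk (S.res_ψ_tensor_isProjective (P.2.outer Q.2)) (hp.outer hq)
      ((outerRes (S.ψ l).hom (S.ψ m).hom P.1).symm.app Q.1)).trans (T.boxK_K hp hq).symm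
  have hz : T.boxK l m (TensorProduct.map (t l) (t m) (C.comulK h (T.K (P.res (S.ψ n).inv)))) =
      clsKOf T.kk ((S.conjRes h).obj P) := by
    refine (LinearMap.congr_fun hbox _).symm.trans ((congrArg τ (C.comulK_cls h _ hP')).trans ?_)
    exact hτ _ (T.res_isProjective h hP')
  have hG : ∀ l, Module.Free T.kk (G₀ T.kk (T.A l)) := C.isTwistedHopfG.free
  have hG' : ∀ l, Module.Finite T.kk (G₀ T.kk (T.A l)) := C.isTwistedHopfG.finite
  have hpf : ∀ l, (pairing T.kk (T.A l)).IsPerfPair := T.perfect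
  have key : TensorProduct.map (t l) (t m) (C.comulK h (T.K (P.res (S.ψ n).inv))) =
      C.comulK h (T.K P) := by
    refine tensorPairing_injective (pairing T.kk (T.A l)) (pairing T.kk (T.A m))
      (TensorProduct.ext (LinearMap.ext_on_range (clsG_span T.kk) fun M =>
        LinearMap.ext_on_range (clsG_span T.kk) fun N => ?_))
    refine (pairing_boxK_boxG _ (T.G M ⊗ₜ T.G N)).symm.trans (Eq.trans ?_
      (S.grdimHom_conjRes C h hP M N))
    rw [hz, T.boxG_G]
    exact pairing_cls T.kk (S.conjRes_isProjective h hP) _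
  rw [← hz, key, C.comulK_cls h P hP]

/-- The conjugate restriction of a projective supermodule is isomorphic to the restriction. -/
theorem nonempty_conjRes_iso (C : T.Compatible S.d S.ε S.κ) (hQ : ¬ ∃ l, (T.A l).HasTypeQ)
    {l m n : Λ} (h : l + m = n) {P : GSMod (T.A n)} (hP : P.IsProjective) :
    Nonempty ((S.conjRes h).obj P ≅ P.res (T.ρ h)) :=
  nonempty_iso_of_grdimHom (S.conjRes_isProjective h hP) (T.res_isProjective h hP) fun M =>
    GroundRing.algebraMap_injective hQ (((pairing_cls T.kk (S.conjRes_isProjective h hP) M).symm.trans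
      (congrArg (fun x => pairing T.kk _ x (clsG T.kk M)) (S.clsKOf_conjRes C h hP))).trans
      (pairing_cls T.kk (T.res_isProjective h hP) M))

end Strong

end Tower

end SuperTower

namespace SuperTower

section Hopf

variable {k : Type} [CommRing k]

theorem tensorPairing_comm {X₁ X₂ X₃ X₄ A₁ A₂ A₃ A₄ : Type w} [AddCommGroup X₁] [Module k X₁]
    [AddCommGroup X₂] [Module k X₂] [AddCommGroup X₃] [Module k X₃] [AddCommGroup X₄] [Module k X₄]
    [AddCommGroup A₁] [Module k A₁] [AddCommGroup A₂] [Module k A₂] [AddCommGroup A₃] [Module k A₃]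
    [AddCommGroup A₄] [Module k A₄] (p₁ : X₁ →ₗ[k] A₁ →ₗ[k] k) (p₂ : X₂ →ₗ[k] A₂ →ₗ[k] k)
    (p₃ : X₃ →ₗ[k] A₃ →ₗ[k] k) (p₄ : X₄ →ₗ[k] A₄ →ₗ[k] k) (x : X₁ ⊗[k] X₃) (y : X₂ ⊗[k] X₄)
    (u : A₁ ⊗[k] A₂) (v : A₃ ⊗[k] A₄) :
    tensorPairing (tensorPairing p₁ p₃) (tensorPairing p₂ p₄) (x ⊗ₜ y)
        (TensorProduct.tensorTensorTensorComm k A₁ A₂ A₃ A₄ (u ⊗ₜ v)) =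
      tensorPairing (tensorPairing p₁ p₂) (tensorPairing p₃ p₄)
        (TensorProduct.tensorTensorTensorComm k X₁ X₃ X₂ X₄ (x ⊗ₜ y)) (u ⊗ₜ v) := by
  induction x with
  | zero => simp
  | add x x' hx hx' => simp only [TensorProduct.add_tmul, map_add, LinearMap.add_apply, hx, hx']
  | tmul x₁ x₃ =>
  induction y with
  | zero => simp
  | add y y' hy hy' => simp only [TensorProduct.tmul_add, map_add, LinearMap.add_apply, hy, hy']
  | tmul x₂ x₄ =>
  induction u with
  | zero => simp
  | add u u' hu hu' => simp only [TensorProduct.add_tmul, map_add, hu, hu']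
  | tmul a₁ a₂ =>
  induction v with
  | zero => simp
  | add v v' hv hv' => simp only [TensorProduct.tmul_add, map_add, hv, hv']
  | tmul a₃ a₄ =>
  simp only [TensorProduct.tensorTensorTensorComm_tmul, tensorPairing_tmul]
  ring

variable {Λ : Type} [AddCommMonoid Λ]

namespace DualPair

variable {D : DualPair.{w} k Λ} {c : kˣ} {κ : Λ →+ Λ →+ ℤ}

theorem tensorPairing_mulTensor (hp : IsDualPairing c 0 κ D.pos D.neg D.pair) {l₁ l₂ m₁ m₂ : Λ}
    (s : Quad l₁ l₂ m₁ m₂) (y : D.neg.carrier m₁) (x : D.neg.carrier m₂)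
    (u : D.pos.carrier s.a ⊗[k] D.pos.carrier s.b) (v : D.pos.carrier s.c ⊗[k] D.pos.carrier s.d) :
    tensorPairing (D.pair m₁) (D.pair m₂) (y ⊗ₜ x) (D.pos.mulTensor s.hm₁ s.hm₂ (u ⊗ₜ v)) =
      (c ^ (κ s.a s.c + κ s.b s.d) : kˣ) •
        tensorPairing (tensorPairing (D.pair s.a) (D.pair s.c))
          (tensorPairing (D.pair s.b) (D.pair s.d))
          (D.neg.comul s.hm₁ y ⊗ₜ D.neg.comul s.hm₂ x)
          (TensorProduct.tensorTensorTensorComm k _ _ _ _ (u ⊗ₜ v)) := by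
  induction u with
  | zero => simp
  | add u u' hu hu' => simp only [TensorProduct.add_tmul, map_add, hu, hu', smul_add]
  | tmul a₁ a₂ =>
  induction v with
  | zero => simp
  | add v v' hv hv' => simp only [TensorProduct.tmul_add, map_add, hv, hv', smul_add]
  | tmul a₃ a₄ =>
  rw [HopfData.mulTensor, LinearMap.comp_apply, LinearEquiv.coe_coe,
    TensorProduct.tensorTensorTensorComm_tmul, TensorProduct.map_tmul, TensorProduct.lift.tmul,
    TensorProduct.lift.tmul, tensorPairing_tmul, tensorPairing_tmul, hp.mul_right, hp.mul_right,
    zpow_add, Units.smul_def, Units.smul_def, Units.smul_def, Units.val_mul, smul_eq_mul,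
    smul_eq_mul, smul_eq_mul]
  ring

theorem tensorPairing_comul (hp : IsDualPairing c 0 κ D.pos D.neg D.pair) {l₁ l₂ m₁ m₂ : Λ}
    (s : Quad l₁ l₂ m₁ m₂) (z : D.neg.carrier s.a ⊗[k] D.neg.carrier s.c)
    (x : D.neg.carrier s.b ⊗[k] D.neg.carrier s.d) (b : D.pos.carrier l₁) (w : D.pos.carrier l₂) :
    tensorPairing (tensorPairing (D.pair s.a) (D.pair s.b))
        (tensorPairing (D.pair s.c) (D.pair s.d))
        (TensorProduct.tensorTensorTensorComm k _ _ _ _ (z ⊗ₜ x))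
        (D.pos.comul s.hl₁ b ⊗ₜ D.pos.comul s.hl₂ w) =
      tensorPairing (D.pair s.a) (D.pair s.c) z
        (TensorProduct.map ((D.rStar s.hl₁).flip b) ((D.rStar s.hl₂).flip w) x) := by
  induction z with
  | zero => simp
  | add z z' hz hz' => simp only [TensorProduct.add_tmul, map_add, LinearMap.add_apply, hz, hz']
  | tmul y₁ y₂ =>
  induction x with
  | zero => simp
  | add x x' hx hx' => simp only [TensorProduct.tmul_add, map_add, LinearMap.add_apply, hx, hx']
  | tmul x₁ x₂ =>
  have h1 : ∀ {l m n : Λ} (h : l + m = n) (y : D.neg.carrier l) (x : D.neg.carrier m)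
      (b : D.pos.carrier n), tensorPairing (D.pair l) (D.pair m) (y ⊗ₜ x) (D.pos.comul h b) =
        D.pair l y (D.rStar h x b) := fun h y x b => by
    rw [D.pair_rStar, hp.mul_left]
    simp
  rw [TensorProduct.tensorTensorTensorComm_tmul, tensorPairing_tmul, h1, h1,
    TensorProduct.map_tmul, tensorPairing_tmul]
  rfl

variable [Finset.HasAntidiagonal Λ] {τ : Λ →+ Λ →+ ℤ}

/-- The action of `R_x^*` on products. -/
theorem rStar_mul_pos (hp : IsDualPairing c 0 κ D.pos D.neg D.pair)
    (hG : D.pos.IsTwistedHopf c 0 τ) {l₁ l₂ m₁ m₂ n : Λ} (hl : l₁ + l₂ = n) (hm : m₁ + m₂ = n)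
    (x : D.neg.carrier m₂) (b : D.pos.carrier l₁) (w : D.pos.carrier l₂) :
    D.rStar hm x (D.pos.mul hl b w) = ∑ s : Quad l₁ l₂ m₁ m₂, (c ^ (κ s.b s.d + τ s.a s.d) : kˣ) •
      TensorProduct.lift (D.pos.mul s.hm₁)
        (TensorProduct.map ((D.rStar s.hl₁).flip b) ((D.rStar s.hl₂).flip w)
          (D.neg.comul s.hm₂ x)) := by
  refine D.pair_ext fun y => ?_
  rw [D.pair_rStar, hp.mul_left, hG.comul_mul, map_sum, map_sum]
  simp only [AddMonoidHom.zero_apply, zpow_zero, one_smul, zero_add]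
  refine Finset.sum_congr rfl fun s _ => ?_
  have hmr : ∀ t : D.pos.carrier s.a ⊗[k] D.pos.carrier s.c,
      D.pair m₁ y (TensorProduct.lift (D.pos.mul s.hm₁) t) =
        (c ^ κ s.a s.c : kˣ) • tensorPairing (D.pair s.a) (D.pair s.c) (D.neg.comul s.hm₁ y) t := by
    intro t
    induction t with
    | zero => simp
    | add t t' ht ht' => rw [map_add, map_add, map_add, ht, ht', smul_add]
    | tmul a a' => rw [TensorProduct.lift.tmul, hp.mul_right]
  simp only [Units.smul_def, map_smul]
  simp only [← Units.smul_def]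
  rw [tensorPairing_mulTensor hp, tensorPairing_comm, tensorPairing_comul hp, hmr, smul_smul,
    smul_smul, ← zpow_add, ← zpow_add]
  congr 2
  ring

end DualPair

end Hopf

end SuperTower

namespace SuperTower

section Hopf

open Finset.HasAntidiagonal

variable {k : Type} [CommRing k] {Λ : Type} [AddCommMonoid Λ]

namespace DualPair

variable (D : DualPair.{w} k Λ)

theorem ofPos_sum {ι : Type*} (s : Finset ι) {l : Λ} (a : ι → D.pos.carrier l) [DecidableEq Λ] :
    D.ofPos (∑ i ∈ s, a i) = ∑ i ∈ s, D.ofPos (a i) := map_sum _ _ _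

theorem rStar_rStar [Finset.HasAntidiagonal Λ] {D : DualPair.{w} k Λ} {c : kˣ}
    {ξ' ξ'' : Λ →+ Λ →+ ℤ} (hK : D.neg.IsTwistedHopf c ξ' ξ'') {l m n p q : Λ} (h₁ : l + m = p)
    (h₂ : p + n = q) {s : Λ} (h₃ : m + n = s) (h₄ : l + s = q) (x : D.neg.carrier m)
    (y : D.neg.carrier n) (b : D.pos.carrier q) :
    D.rStar h₁ x (D.rStar h₂ y b) = D.rStar h₄ (D.neg.mul h₃ x y) b :=
  D.pair_ext fun z => by
    rw [D.pair_rStar, D.pair_rStar, D.pair_rStar, hK.mul_assoc h₁ h₂ h₃ h₄]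

variable [DecidableEq Λ]

theorem ofPos_units_smul (c : kˣ) {l : Λ} (a : D.pos.carrier l) :
    D.ofPos (c • a) = c • D.ofPos a := by
  rw [Units.smul_def, Units.smul_def]
  exact map_smul _ _ _

theorem ofPos_mul_congr {l m n : Λ} (h : l + m = n) (c : kˣ)
    (z : D.pos.carrier l ⊗[k] D.pos.carrier m) :
    D.ofPos (c • TensorProduct.lift (D.pos.mul h) z) =
      D.ofPos (c • TensorProduct.lift (D.pos.mul (rfl : l + m = l + m)) z) := by
  subst h
  rfl

theorem fock_hom_ext {X : Type*} [AddCommGroup X] [Module k X] {f g : D.Fock →ₗ[k] X}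
    (h : ∀ l (a : D.pos.carrier l), f (D.ofPos a) = g (D.ofPos a)) : f = g :=
  DirectSum.linearMap_ext k fun l => LinearMap.ext (h l)

/-- Left multiplication by a homogeneous element. -/
noncomputable def mulLeft {l : Λ} : D.pos.carrier l →ₗ[k] Module.End k D.Fock :=
  LinearMap.flip <| DirectSum.toModule k Λ _ fun n => LinearMap.flip <|
    (D.pos.mul rfl).compr₂ (DirectSum.lof k Λ D.pos.carrier (l + n))

theorem mulLeft_ofPos {l m n : Λ} (h : l + m = n) (a : D.pos.carrier l) (b : D.pos.carrier m) :
    D.mulLeft a (D.ofPos b) = D.ofPos (D.pos.mul h a b) := by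
  subst h
  rw [mulLeft, LinearMap.flip_apply, ofPos, DirectSum.toModule_lof]
  rfl

variable [Finset.HasAntidiagonal Λ]

/-- The operator `R_x^*` for a homogeneous element `x`. -/
noncomputable def lower {m : Λ} : D.neg.carrier m →ₗ[k] Module.End k D.Fock :=
  LinearMap.flip <| DirectSum.toModule k Λ _ fun n => LinearMap.flip <|
    ∑ t : antidiagonal n, if h : t.1.2 = m then
      (D.rStar (h ▸ mem_antidiagonal.1 t.2)).compr₂ (DirectSum.lof k Λ D.pos.carrier t.1.1) else 0

theorem lower_ofPos' {m n : Λ} (x : D.neg.carrier m) (b : D.pos.carrier n) :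
    D.lower x (D.ofPos b) = ∑ t : antidiagonal n, if h : t.1.2 = m then
      D.ofPos (D.rStar (h ▸ mem_antidiagonal.1 t.2) x b) else 0 := by
  rw [lower, LinearMap.flip_apply, ofPos, DirectSum.toModule_lof, LinearMap.flip_apply,
    LinearMap.sum_apply, LinearMap.sum_apply]
  refine Finset.sum_congr rfl fun t _ => ?_
  split_ifs <;> rfl

theorem lower_ofPos_of_not {m n : Λ} (h : ¬ ∃ l, l + m = n) (x : D.neg.carrier m)
    (b : D.pos.carrier n) : D.lower x (D.ofPos b) = 0 := by
  rw [lower_ofPos']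
  exact Finset.sum_eq_zero fun t _ => dif_neg fun ht : t.1.2 = m =>
    h ⟨t.1.1, (ht ▸ mem_antidiagonal.1 t.2 : t.1.1 + m = n)⟩

theorem lower_ofPos [IsCancelAdd Λ] {l m n : Λ} (h : l + m = n) (x : D.neg.carrier m)
    (b : D.pos.carrier n) : D.lower x (D.ofPos b) = D.ofPos (D.rStar h x b) := by
  rw [lower_ofPos', Finset.sum_eq_single_of_mem ⟨(l, m), mem_antidiagonal.2 h⟩ (Finset.mem_univ _)
    fun t _ ht => dif_neg fun h' : t.1.2 = m => ht (Subtype.ext (Prod.ext (add_right_cancel (b := m)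
      ((h' ▸ mem_antidiagonal.1 t.2 : t.1.1 + m = n).trans h.symm)) h'))]
  exact dif_pos rfl

theorem fock_sharp {l m : Λ} (a : D.pos.carrier l) (x : D.neg.carrier m) :
    D.fock (D.sharp a x) = D.mulLeft a ∘ₗ D.lower x := by
  refine D.fock_hom_ext fun n b => ?_
  rw [LinearMap.comp_apply, lower_ofPos', map_sum, sharp, fock, DirectSum.toModule_lof,
    LinearMap.flip_apply, ofPos, DirectSum.toModule_lof, LinearMap.flip_apply,
    TensorProduct.curry_apply, LinearMap.sum_apply]
  refine Finset.sum_congr rfl fun t _ => ?_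
  split_ifs with h
  · rw [mulLeft_ofPos D rfl]
    rfl
  · rw [map_zero]
    rfl

section

variable {D} {c : kˣ} {κ τ ξ' ξ'' : Λ →+ Λ →+ ℤ}

theorem mulLeft_comp (hG : D.pos.IsTwistedHopf c 0 τ) {l m n : Λ} (h : l + m = n)
    (a : D.pos.carrier l) (b : D.pos.carrier m) :
    D.mulLeft a ∘ₗ D.mulLeft b = D.mulLeft (D.pos.mul h a b) :=
  D.fock_hom_ext fun p w => by
    rw [LinearMap.comp_apply, mulLeft_ofPos D rfl, mulLeft_ofPos D (n := n + p)
      (by rw [← h, add_assoc]), mulLeft_ofPos D rfl]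
    exact congrArg D.ofPos (hG.mul_assoc _ _ _ _ a b w).symm

variable [IsCancelAdd Λ]

theorem lower_comp (hK : D.neg.IsTwistedHopf c ξ' ξ'') {m n p : Λ} (h : m + n = p)
    (x : D.neg.carrier m) (y : D.neg.carrier n) :
    D.lower x ∘ₗ D.lower y = D.lower (D.neg.mul h x y) := by
  refine D.fock_hom_ext fun q b => ?_
  rw [LinearMap.comp_apply]
  by_cases h1 : ∃ r, r + n = q
  · obtain ⟨r, h1⟩ := h1
    rw [D.lower_ofPos h1]
    by_cases h2 : ∃ l, l + m = r
    · obtain ⟨l, h2⟩ := h2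
      rw [D.lower_ofPos h2, D.lower_ofPos (l := l) (by rw [← h, ← h1, ← h2, add_assoc]),
        rStar_rStar hK h2 h1 h]
    · rw [D.lower_ofPos_of_not h2, D.lower_ofPos_of_not]
      rintro ⟨l, h3⟩
      exact h2 ⟨l, add_right_cancel (b := n) (by rw [h1, ← h3, ← h, add_assoc])⟩
  · rw [D.lower_ofPos_of_not h1, map_zero, D.lower_ofPos_of_not]
    rintro ⟨l, h3⟩
    exact h1 ⟨l + m, by rw [← h3, ← h, add_assoc]⟩

/-- The commutation relation between `R_x^*` and left multiplication by `b`. -/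
theorem lower_comp_mulLeft (hp : IsDualPairing c 0 κ D.pos D.neg D.pair)
    (hG : D.pos.IsTwistedHopf c 0 τ) {m n : Λ} (x : D.neg.carrier m) (b : D.pos.carrier n) :
    D.lower x ∘ₗ D.mulLeft b = ∑ s : antidiagonal m, ∑ t : antidiagonal n,
      if h : t.1.2 = s.1.1 then (c ^ (κ n s.1.2 + (τ - κ) t.1.1 s.1.2) : kˣ) •
        TensorProduct.lift ((LinearMap.mul k (Module.End k D.Fock)).compl₁₂
          (D.mulLeft ∘ₗ (D.rStar (h ▸ mem_antidiagonal.1 t.2)).flip b) D.lower)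
          (D.neg.comul (mem_antidiagonal.1 s.2) x)
      else 0 := by
  have hexp : ∀ (s : antidiagonal m) (t : antidiagonal n), t.1.2 = s.1.1 →
      κ n s.1.2 + (τ - κ) t.1.1 s.1.2 = κ s.1.1 s.1.2 + τ t.1.1 s.1.2 := fun s t h => by
    have hn : n = t.1.1 + s.1.1 := h ▸ (mem_antidiagonal.1 t.2).symm
    rw [congrArg κ hn, map_add, AddMonoidHom.add_apply, AddMonoidHom.sub_apply,
      AddMonoidHom.sub_apply]
    ring
  refine D.fock_hom_ext fun l w => ?_
  have key : ∀ {p r : Λ} (h₁ : p + r = n) {s : Λ} (z : D.neg.carrier r ⊗[k] D.neg.carrier s),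
      TensorProduct.lift ((LinearMap.mul k (Module.End k D.Fock)).compl₁₂
        (D.mulLeft ∘ₗ (D.rStar h₁).flip b) D.lower) z (D.ofPos w) =
      ∑ v : antidiagonal l, if h : v.1.2 = s then
        D.ofPos (TensorProduct.lift (D.pos.mul (n := p + v.1.1) rfl) (TensorProduct.map
          ((D.rStar h₁).flip b) ((D.rStar (h ▸ mem_antidiagonal.1 v.2)).flip w) z)) else 0 := by
    intro p r h₁ s z
    induction z with
    | zero => simp [ofPos]
    | add z z' hz hz' =>
      rw [map_add, LinearMap.add_apply, hz, hz', ← Finset.sum_add_distrib]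
      refine Finset.sum_congr rfl fun v _ => ?_
      split_ifs
      · rw [map_add, map_add]
        exact (map_add _ _ _).symm
      · rw [add_zero]
    | tmul x₁ x₂ =>
      change D.mulLeft _ (D.lower x₂ (D.ofPos w)) = _
      rw [lower_ofPos', map_sum]
      refine Finset.sum_congr rfl fun v _ => ?_
      split_ifs
      · exact mulLeft_ofPos D rfl _ _
      · exact map_zero _
  have hterm : ∀ (s : antidiagonal m) (t : antidiagonal n),
      (if h : t.1.2 = s.1.1 then (c ^ (κ n s.1.2 + (τ - κ) t.1.1 s.1.2) : kˣ) •
        TensorProduct.lift ((LinearMap.mul k (Module.End k D.Fock)).compl₁₂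
          (D.mulLeft ∘ₗ (D.rStar (h ▸ mem_antidiagonal.1 t.2)).flip b) D.lower)
          (D.neg.comul (mem_antidiagonal.1 s.2) x)
      else 0 : Module.End k D.Fock) (D.ofPos w) =
      ∑ v : antidiagonal l, if h : t.1.2 = s.1.1 ∧ v.1.2 = s.1.2 then
        D.ofPos ((c ^ (κ s.1.1 s.1.2 + τ t.1.1 s.1.2) : kˣ) •
          TensorProduct.lift (D.pos.mul (n := t.1.1 + v.1.1) rfl) (TensorProduct.map
            ((D.rStar (h.1 ▸ mem_antidiagonal.1 t.2)).flip b)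
            ((D.rStar (h.2 ▸ mem_antidiagonal.1 v.2)).flip w)
            (D.neg.comul (mem_antidiagonal.1 s.2) x))) else 0 := by
    intro s t
    by_cases h : t.1.2 = s.1.1
    · rw [dif_pos h, hexp s t h, Units.smul_def, LinearMap.smul_apply, key, Finset.smul_sum]
      refine Finset.sum_congr rfl fun v _ => ?_
      by_cases h' : v.1.2 = s.1.2
      · rw [dif_pos h', dif_pos ⟨h, h'⟩, ofPos_units_smul]
        rfl
      · rw [dif_neg h', dif_neg fun h'' => h' h''.2, smul_zero]
    · rw [dif_neg h]
      exact (Finset.sum_eq_zero fun v _ => dif_neg fun h' => h h'.1).symm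
  rw [LinearMap.comp_apply, mulLeft_ofPos D rfl, LinearMap.sum_apply]
  simp only [LinearMap.sum_apply, hterm]
  have hadd : ∀ (s : antidiagonal m) (t : antidiagonal n) (v : antidiagonal l),
      t.1.2 = s.1.1 ∧ v.1.2 = s.1.2 → t.1.1 + v.1.1 + m = n + l := fun s t v h => by
    rw [← mem_antidiagonal.1 s.2, ← h.1, ← h.2, add_add_add_comm, mem_antidiagonal.1 t.2,
      mem_antidiagonal.1 v.2]
  by_cases h1 : ∃ m₁, m₁ + m = n + l
  · obtain ⟨m₁, h1⟩ := h1
    rw [D.lower_ofPos h1, rStar_mul_pos hp hG, ofPos_sum]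
    simp only [← Fintype.sum_prod_type']
    refine Fintype.sum_of_injective (fun s : Quad n l m₁ m =>
      (⟨(s.b, s.d), mem_antidiagonal.2 s.hm₂⟩, ⟨(s.a, s.b), mem_antidiagonal.2 s.hl₁⟩,
        ⟨(s.c, s.d), mem_antidiagonal.2 s.hl₂⟩)) (fun s s' h => ?_) _ _ (fun i hi => ?_) fun s => ?_
    · simp only [Prod.mk.injEq, Subtype.mk.injEq] at h
      exact Quad.ext h.2.1.1 h.1.1 h.2.2.1 h.2.2.2
    · refine dif_neg fun h => hi ?_
      obtain ⟨⟨⟨p, q⟩, hs⟩, ⟨⟨a, b⟩, ht⟩, ⟨⟨c, d⟩, hv⟩⟩ := i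
      have h2 := hadd _ _ _ h
      obtain ⟨rfl, rfl⟩ : b = p ∧ d = q := h
      exact ⟨⟨a, b, c, d, mem_antidiagonal.1 ht, mem_antidiagonal.1 hv,
        add_right_cancel (h2.trans h1.symm), mem_antidiagonal.1 hs⟩, rfl⟩
    · rw [dif_pos ⟨rfl, rfl⟩]
      exact D.ofPos_mul_congr s.hm₁ _ _
  · rw [D.lower_ofPos_of_not h1]
    exact (Finset.sum_eq_zero fun s _ => Finset.sum_eq_zero fun t _ => Finset.sum_eq_zero
      fun v _ => dif_neg fun h => h1 ⟨_, hadd s t v h⟩).symm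

theorem fock_smashPiece (hG : D.pos.IsTwistedHopf c 0 τ) (hK : D.neg.IsTwistedHopf c ξ' ξ'')
    {l n p m₁ m₂ n₁ : Λ} (hn : n₁ + m₁ = n) (a : D.pos.carrier l) (b : D.pos.carrier n)
    (y : D.neg.carrier p) (z : D.neg.carrier m₁ ⊗[k] D.neg.carrier m₂) :
    D.fock (DirectSum.lof k (Λ × Λ) (fun i => D.pos.carrier i.1 ⊗[k] D.neg.carrier i.2)
        (l + n₁, m₂ + p) (TensorProduct.map
          (TensorProduct.lift (D.pos.mul rfl) ∘ₗ
            (TensorProduct.lift (D.rStar hn)).lTensor (D.pos.carrier l) ∘ₗ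
            (TensorProduct.assoc k _ _ _).toLinearMap) (TensorProduct.lift (D.neg.mul rfl))
          (TensorProduct.tensorTensorTensorComm k _ _ _ _
            ((TensorProduct.assoc k _ _ _).symm (a ⊗ₜ z) ⊗ₜ (b ⊗ₜ y))))) =
      D.mulLeft a ∘ₗ TensorProduct.lift ((LinearMap.mul k (Module.End k D.Fock)).compl₁₂
          (D.mulLeft ∘ₗ (D.rStar hn).flip b) D.lower) z ∘ₗ D.lower y := by
  induction z with
  | zero => simp
  | add z z' hz hz' =>
    rw [TensorProduct.tmul_add, map_add, TensorProduct.add_tmul, map_add, map_add, map_add, map_add,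
      hz, hz', map_add, LinearMap.add_comp, LinearMap.comp_add]
  | tmul x₁ x₂ =>
    refine (D.fock_sharp (D.pos.mul (rfl : l + n₁ = _) a (D.rStar hn x₁ b))
      (D.neg.mul (rfl : m₂ + p = _) x₂ y)).trans ?_
    rw [← mulLeft_comp hG, ← lower_comp hK]
    rfl

/-- The twisted Heisenberg double acts on the Fock space. -/
theorem fock_smash (hp : IsDualPairing c 0 κ D.pos D.neg D.pair) (hG : D.pos.IsTwistedHopf c 0 τ)
    (hK : D.neg.IsTwistedHopf c ξ' ξ'') (X Y : D.Double) (v : D.Fock) :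
    D.fock (D.smash c κ (τ - κ) X Y) v = D.fock X (D.fock Y v) := by
  have : (D.smash c κ (τ - κ)).compr₂ D.fock =
      (LinearMap.mul k (Module.End k D.Fock)).compl₁₂ D.fock D.fock := by
    refine DirectSum.linearMap_ext k fun i => TensorProduct.ext' fun a x =>
      DirectSum.linearMap_ext k fun j => TensorProduct.ext' fun b y => ?_
    change D.fock (D.smash c κ (τ - κ) (D.sharp a x) (D.sharp b y)) =
      D.fock (D.sharp a x) ∘ₗ D.fock (D.sharp b y)
    rw [D.fock_sharp, D.fock_sharp, LinearMap.comp_assoc, ← LinearMap.comp_assoc _ _ (D.lower x),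
      lower_comp_mulLeft hp hG, sharp, sharp, smash, DirectSum.toModule_lof, LinearMap.flip_apply,
      DirectSum.toModule_lof, LinearMap.flip_apply, TensorProduct.curry_apply, LinearMap.sum_apply,
      map_sum, ← Module.End.mul_eq_comp, ← Module.End.mul_eq_comp, Finset.sum_mul, Finset.mul_sum]
    refine Finset.sum_congr rfl fun s _ => ?_
    rw [LinearMap.sum_apply, map_sum, Finset.sum_mul, Finset.mul_sum]
    refine Finset.sum_congr rfl fun t _ => ?_
    split_ifs with h
    · rw [Units.smul_def, Units.smul_def, LinearMap.smul_apply, map_smul, smul_mul_assoc,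
        mul_smul_comm]
      exact congrArg _ (fock_smashPiece hG hK _ a b y _)
    · rw [LinearMap.zero_apply, map_zero, zero_mul, mul_zero]
  exact LinearMap.congr_fun (LinearMap.congr_fun₂ this X Y) v

theorem fock_one (hG : D.pos.IsTwistedHopf c 0 τ) (hK : D.neg.IsTwistedHopf c ξ' ξ'') (v : D.Fock) :
    D.fock (D.sharp D.pos.one D.neg.one) v = v := by
  rw [D.fock_sharp]
  refine LinearMap.congr_fun (g := LinearMap.id) (D.fock_hom_ext fun l a => ?_) v
  have : D.rStar (add_zero l) D.neg.one a = a := D.pair_ext fun y => by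
    rw [D.pair_rStar, hK.mul_one]
  rw [LinearMap.comp_apply, D.lower_ofPos (add_zero l), D.mulLeft_ofPos (zero_add l), hG.one_mul,
    this]
  rfl

end

end DualPair

end Hopf

end SuperTower

namespace SuperTower

section Hopf

open Finset.HasAntidiagonal

variable {k : Type} [CommRing k] {Λ : Type} [AddCommMonoid Λ]

theorem DualPair.smash_sharp_mem [DecidableEq Λ] [Finset.HasAntidiagonal Λ] {D : DualPair.{w} k Λ}
    {c : kˣ} {γ ξ : Λ →+ Λ →+ ℤ} {W : Submodule k D.Double} {l m n p : Λ} {a : D.pos.carrier l}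
    {x : D.neg.carrier m} {b : D.pos.carrier n} {y : D.neg.carrier p}
    (h : ∀ {n₁ m₁ m₂ : Λ} (hn : n₁ + m₁ = n) (x₁ : D.neg.carrier m₁) (x₂ : D.neg.carrier m₂),
      D.sharp (D.pos.mul rfl a (D.rStar hn x₁ b)) (D.neg.mul rfl x₂ y) ∈ W) :
    D.smash c γ ξ (D.sharp a x) (D.sharp b y) ∈ W := by
  rw [sharp, sharp, smash, DirectSum.toModule_lof, LinearMap.flip_apply, DirectSum.toModule_lof,
    LinearMap.flip_apply, TensorProduct.curry_apply, LinearMap.sum_apply]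
  refine sum_mem fun s _ => ?_
  rw [LinearMap.sum_apply]
  refine sum_mem fun t _ => ?_
  split_ifs with ht
  · rw [Units.smul_def, LinearMap.smul_apply]
    refine W.smul_mem _ ?_
    have hn : t.1.1 + s.1.1 = n := ht ▸ mem_antidiagonal.1 t.2
    have key : ∀ z : D.neg.carrier s.1.1 ⊗[k] D.neg.carrier s.1.2,
        DirectSum.lof k (Λ × Λ) (fun i => D.pos.carrier i.1 ⊗[k] D.neg.carrier i.2)
          (l + t.1.1, s.1.2 + p) (TensorProduct.map
            (TensorProduct.lift (D.pos.mul rfl) ∘ₗ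
              (TensorProduct.lift (D.rStar hn)).lTensor (D.pos.carrier l) ∘ₗ
              (TensorProduct.assoc k _ _ _).toLinearMap) (TensorProduct.lift (D.neg.mul rfl))
            (TensorProduct.tensorTensorTensorComm k _ _ _ _
              ((TensorProduct.assoc k _ _ _).symm (a ⊗ₜ z) ⊗ₜ (b ⊗ₜ y)))) ∈ W := by
      intro z
      induction z with
      | zero => simp
      | add z z' hz hz' =>
        rw [TensorProduct.tmul_add, map_add, TensorProduct.add_tmul, map_add, map_add, map_add]
        exact add_mem hz hz'
      | tmul x₁ x₂ => exact h hn x₁ x₂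
    exact key _
  · exact zero_mem _

end Hopf

variable {F : Type u} [Field F]

namespace Tower.Compatible

open GSMod

variable {Λ : Type} [AddCommMonoid Λ] [Finset.HasAntidiagonal Λ] {T : Tower F Λ}
  {d : ℤ} {ε : ZMod 2} {κ : Λ →+ Λ →+ ℤ} (C : T.Compatible d ε κ)

theorem mul_mem_Gpj {l m n : Λ} (h : l + m = n) {a : C.dualPair.pos.carrier l}
    {b : C.dualPair.pos.carrier m} (ha : a ∈ C.Gpj l) (hb : b ∈ C.Gpj m) :
    C.dualPair.pos.mul h a b ∈ C.Gpj n := by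
  have : C.Gpj l ≤ ((C.Gpj n).comap ((C.dualPair.pos.mul h).flip b)) := by
    refine Submodule.span_le.2 ?_
    rintro _ ⟨P, hP, rfl⟩
    have : C.Gpj m ≤ (C.Gpj n).comap (C.dualPair.pos.mul h (T.G P)) := by
      refine Submodule.span_le.2 ?_
      rintro _ ⟨Q, hQ, rfl⟩
      exact Submodule.subset_span ⟨_, T.nabla_isProjective h hP hQ, T.mulG_G h P Q⟩
    exact this hb
  exact this ha

theorem rStar_mem_Gpj {l m n : Λ} (h : l + m = n) (x : C.dualPair.neg.carrier m)
    {b : C.dualPair.pos.carrier n} (hb : b ∈ C.Gpj n) : C.dualPair.rStar h x b ∈ C.Gpj l := by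
  have : C.Gpj n ≤ (C.Gpj l).comap (C.dualPair.rStar h x) := by
    refine Submodule.span_le.2 ?_
    rintro _ ⟨Q, hQ, rfl⟩
    have : ⊤ ≤ (C.Gpj l).comap ((C.dualPair.rStar h).flip (T.G Q)) := by
      refine (clsKOf_span T.kk).symm.trans_le (Submodule.span_le.2 ?_)
      rintro _ ⟨P, rfl⟩
      exact Submodule.subset_span ⟨_, T.Res_isProjective h P.2 hQ, C.rStar_cls h P.2 Q⟩
    exact this (Submodule.mem_top (x := x))
  exact this hb

variable [DecidableEq Λ]

theorem sharp_mem_doublePj {l m : Λ} {a : C.dualPair.pos.carrier l} (ha : a ∈ C.Gpj l)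
    (x : C.dualPair.neg.carrier m) : C.dualPair.sharp a x ∈ C.doublePj :=
  Submodule.subset_span ⟨l, m, a, x, ha, rfl⟩

theorem one_mem_doublePj :
    C.dualPair.sharp C.dualPair.pos.one C.dualPair.neg.one ∈ C.doublePj :=
  C.sharp_mem_doublePj (Submodule.subset_span ⟨_, regular_isProjective (T.A 0), rfl⟩) _

theorem smash_mem_doublePj {X Y : C.dualPair.Double} (hX : X ∈ C.doublePj) (hY : Y ∈ C.doublePj) :
    C.smash X Y ∈ C.doublePj := by
  have : C.doublePj ≤ C.doublePj.comap (C.smash.flip Y) := by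
    refine Submodule.span_le.2 ?_
    rintro _ ⟨l, m, a, x, ha, rfl⟩
    have : C.doublePj ≤ C.doublePj.comap (C.smash (C.dualPair.sharp a x)) := by
      refine Submodule.span_le.2 ?_
      rintro _ ⟨n, p, b, y, hb, rfl⟩
      exact DualPair.smash_sharp_mem fun hn x₁ x₂ =>
        C.sharp_mem_doublePj (C.mul_mem_Gpj rfl ha (C.rStar_mem_Gpj hn x₁ hb)) _
    exact this hY
  exact this hX

theorem fock_mem_fockPj {X : C.dualPair.Double} {v : C.dualPair.Fock} (hX : X ∈ C.doublePj)
    (hv : v ∈ C.fockPj) : C.dualPair.fock X v ∈ C.fockPj := by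
  have : C.doublePj ≤ C.fockPj.comap (C.dualPair.fock.flip v) := by
    refine Submodule.span_le.2 ?_
    rintro _ ⟨l, m, a, x, ha, rfl⟩
    have : C.fockPj ≤ C.fockPj.comap (C.dualPair.fock (C.dualPair.sharp a x)) := by
      refine Submodule.span_le.2 ?_
      rintro _ ⟨n, b, hb, rfl⟩
      change C.dualPair.fock (C.dualPair.sharp a x) (C.dualPair.ofPos b) ∈ C.fockPj
      rw [DualPair.fock_sharp, LinearMap.comp_apply, DualPair.lower_ofPos', map_sum]
      refine sum_mem fun t _ => ?_
      split_ifs with h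
      · rw [DualPair.mulLeft_ofPos _ rfl]
        exact Submodule.subset_span ⟨_, _, C.mul_mem_Gpj rfl ha (C.rStar_mem_Gpj _ x hb), rfl⟩
      · rw [map_zero]
        exact zero_mem _
    exact this hv
  exact this hX

end Tower.Compatible

end SuperTower

theorem mainTheorem1 {F : Type u} [Field F] (hF : (2 : F) ≠ 0)
    {Λ : Type} [AddCommMonoid Λ] [DecidableEq Λ] [Finset.HasAntidiagonal Λ] {r : ℕ}
    (_e : Λ ≃+ (Fin r → ℕ)) (T : Tower F Λ) (S : T.Strong) (C : T.Compatible S.d S.ε S.κ)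
    (hQ : (∃ l, (T.A l).HasTypeQ) → ∀ {l m n : Λ} (h : l + m = n) (P : GSMod (T.A n)),
      P.IsProjective → Nonempty ((S.conjRes h).obj P ≅ P.res (T.ρ h))) :
    -- `Ind_M ∘ Ind_N ≅ Ind_{∇(M ⊠ N)}`
    (∀ {l m n p q s : Λ} (h₁ : m + n = p) (h₂ : l + p = q) (h₃ : l + m = s) (h₄ : s + n = q)
      (M : GSMod (T.A l)) (N : GSMod (T.A m)),
      Nonempty (T.Ind h₁ N ⋙ T.Ind h₂ M ≅ T.Ind h₄ (T.nabla h₃ M N))) ∧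
    -- `Res_P ∘ Res_Q ≅ Res_{∇(P ⊠ Q)}`
    (∀ {l m n p q s : Λ} (h₁ : p + n = q) (h₂ : l + m = p) (h₃ : m + n = s) (h₄ : l + s = q)
      (P : GSMod (T.A m)) (Q : GSMod (T.A n)), P.IsProjective → Q.IsProjective →
      (T.nabla h₃ P Q).IsProjective ∧
      Nonempty (T.Res h₁ Q ⋙ T.Res h₂ P ≅ T.Res h₄ (T.nabla h₃ P Q))) ∧
    -- `Res_P ∘ Ind_M ≅ ∇ Res†_{Δ(P)}(M ⊠ -)`
    (∀ {l₁ l₂ m₁ m₂ n : Λ} (hl : l₁ + l₂ = n) (hm : m₁ + m₂ = n)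
      (M : GSMod (T.A l₁)) (P : GSMod (T.A m₂)), P.IsProjective →
      Nonempty (T.Ind hl M ⋙ T.Res hm P ≅ S.cross M P)) ∧
    -- the functors are exact, and they preserve projective supermodules
    (∀ {l m n : Λ} (h : l + m = n) (M : GSMod (T.A l)), GSMod.IsExact (T.Ind h M)) ∧
    (∀ {l m n : Λ} (h : l + m = n) (P : GSMod (T.A m)), P.IsProjective →
      GSMod.IsExact (T.Res h P)) ∧
    (∀ {l m n : Λ} (h : l + m = n) (P : GSMod (T.A l)) (R : GSMod (T.A m)), P.IsProjective →
      R.IsProjective → ((T.Ind h P).obj R).IsProjective) ∧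
    (∀ {l m n : Λ} (h : l + m = n) (P : GSMod (T.A m)) (R : GSMod (T.A n)), P.IsProjective →
      R.IsProjective → ((T.Res h P).obj R).IsProjective) ∧
    -- they induce the multiplications and the left regular action on Grothendieck groups
    (∀ {l m n : Λ} (h : l + m = n) (M : GSMod (T.A l)) (N : GSMod (T.A m)),
      T.mulG h (T.G M) (T.G N) = T.G ((T.Ind h M).obj N)) ∧
    (∀ {l m n : Λ} (h : l + m = n) (P : GSMod (T.A l)) (Q : GSMod (T.A m)), P.IsProjective →
      Q.IsProjective → T.mulK h (T.K P) (T.K Q) = T.K (T.nabla h P Q)) ∧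
    (∀ {l m n : Λ} (h : l + m = n) (P : GSMod (T.A m)) (N : GSMod (T.A n)), P.IsProjective →
      C.dualPair.rStar h (T.K P) (T.G N) = T.G ((T.Res h P).obj N)) ∧
    -- the Fock space representation of `𝔥(A)`, and the functors that induce it
    (∀ v : C.dualPair.Fock,
      C.dualPair.fock (C.dualPair.sharp C.dualPair.pos.one C.dualPair.neg.one) v = v) ∧
    (∀ (X Y : C.dualPair.Double) (v : C.dualPair.Fock),
      C.dualPair.fock (C.smash X Y) v = C.dualPair.fock X (C.dualPair.fock Y v)) ∧
    (∀ {l m n p q : Λ} (h₁ : p + m = n) (h₂ : l + p = q) (M : GSMod (T.A l))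
      (P : GSMod (T.A m)) (N : GSMod (T.A n)), P.IsProjective →
      C.dualPair.fock (C.dualPair.sharp (T.G M) (T.K P)) (C.dualPair.ofPos (T.G N)) =
        C.dualPair.ofPos (l := q) (T.G ((T.Ind h₂ M).obj ((T.Res h₁ P).obj N)))) ∧
    (∀ {l m n : Λ}, (¬ ∃ p, p + m = n) → ∀ (M : GSMod (T.A l)) (P : GSMod (T.A m))
      (N : GSMod (T.A n)), P.IsProjective →
      C.dualPair.fock (C.dualPair.sharp (T.G M) (T.K P)) (C.dualPair.ofPos (T.G N)) = 0) ∧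
    -- the Fock space representation of `𝔥_pj(A)`
    C.dualPair.sharp C.dualPair.pos.one C.dualPair.neg.one ∈ C.doublePj ∧
    (∀ X ∈ C.doublePj, ∀ Y ∈ C.doublePj, C.smash X Y ∈ C.doublePj) ∧
    (∀ X ∈ C.doublePj, ∀ v ∈ C.fockPj, C.dualPair.fock X v ∈ C.fockPj) ∧
    -- the relation `R_x^* ∘ L_a = ∇(Δ(x)† (a ⊗ -))`, and the functor that induces its right side
    (∀ {l₁ l₂ m₁ m₂ n : Λ} (hl : l₁ + l₂ = n) (hm : m₁ + m₂ = n) (x : K₀ T.kk (T.A m₂))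
      (a : G₀ T.kk (T.A l₁)) (b : G₀ T.kk (T.A l₂)),
      C.dualPair.rStar hm x (T.mulG hl a b) = S.dagger C m₁ x a b) ∧
    (∀ {l₁ l₂ m₁ m₂ n : Λ}, l₁ + l₂ = n → m₁ + m₂ = n → ∀ (M : GSMod (T.A l₁))
      (P : GSMod (T.A m₂)) (N : GSMod (T.A l₂)), P.IsProjective →
      T.G ((S.cross (m₁ := m₁) M P).obj N) = S.dagger C m₁ (T.K P) (T.G M) (T.G N)) := by
  have hcan : IsCancelAdd Λ := Function.Injective.isCancelAdd _e _e.injective (map_add _e)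
  have hconj : ∀ {l m n : Λ} (h : l + m = n) (P : GSMod (T.A n)), P.IsProjective →
      Nonempty ((S.conjRes h).obj P ≅ P.res (T.ρ h)) := fun {l m n} h P hP => by
    by_cases hq : ∃ l, (T.A l).HasTypeQ
    · exact hQ hq h P hP
    · exact S.nonempty_conjRes_iso C hq h hP
  obtain ⟨ξ', ξ'', hK⟩ := C.isTwistedHopfK
  have hlow : ∀ {m n p : Λ} (h : p + m = n) {P : GSMod (T.A m)} (_ : P.IsProjective)
      (N : GSMod (T.A n)), C.dualPair.lower (T.K P) (C.dualPair.ofPos (T.G N)) =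
        C.dualPair.ofPos (l := p) (T.G ((T.Res h P).obj N)) := fun h P hP N =>
    (C.dualPair.lower_ofPos h _ _).trans (congrArg C.dualPair.ofPos (C.rStar_cls h hP N))
  refine ⟨T.ind_comp_ind, fun h₁ h₂ h₃ h₄ P Q hP hQ => ⟨T.nabla_isProjective h₃ hP hQ,
      T.res_comp_res h₁ h₂ h₃ h₄ P Q⟩,
    fun hl hm M P hP => S.nonempty_ind_comp_res hl hm M P hP fun h => hconj h P hP,
    T.Ind_exact, T.Res_exact, fun h P R hP hR => T.nabla_isProjective h hP hR,
    fun h P R hP hR => T.Res_isProjective h hP hR, T.mulG_G, fun h P Q hP hQ => T.mulK_K h hP hQ,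
    fun h P N hP => C.rStar_cls h hP N, DualPair.fock_one C.isTwistedHopfG hK,
    DualPair.fock_smash C.isDualPairing C.isTwistedHopfG hK, fun h₁ h₂ M P N hP => ?_,
    fun h M P N _ => ?_, C.one_mem_doublePj, fun X hX Y hY => C.smash_mem_doublePj hX hY,
    fun X hX v hv => C.fock_mem_fockPj hX hv, S.rStar_mulG C hconj,
    fun _ _ M P N hP => S.G_cross C M hP N⟩
  · refine (LinearMap.congr_fun (C.dualPair.fock_sharp _ _) _).trans
      ((congrArg _ (hlow h₁ hP N)).trans ((C.dualPair.mulLeft_ofPos h₂ _ _).trans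
        (congrArg C.dualPair.ofPos (T.mulG_G h₂ M _))))
  · exact (LinearMap.congr_fun (C.dualPair.fock_sharp _ _) _).trans
      ((congrArg (C.dualPair.mulLeft (T.G M)) (C.dualPair.lower_ofPos_of_not h _ _)).trans
        (map_zero (C.dualPair.mulLeft (T.G M))))
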